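/- **Setting.** Let $-\infty\le a<b\le\infty$, let $J\in\mathbb R^{2\times2}$ be invertible with $J^\top=-J$, and let $q,w$ be $2\times2$ matrices of real distributions of order $0$ on $(a,b)$ (equivalently, of set functions that are real measures on each compact subset of $(a,b)$), with $q$ symmetric and $w$ non-negative. Put $\Delta_q(x)=q(\{x\})$ and assume that $2J\pm\Delta_q(x)$ is invertible for every $x\in(a,b)$. A function $u:(a,b)\to\mathbb C^2$ of locally bounded variation, with right- and left-hand limits $u^+,u^-$, is *balanced* if $u=\frac12(u^++u^-)$. All solutions of $Ju'+qu=wf$ (an equation between distributions of order $0$) are understood to be balanced functions of locally bounded variation; the same applies on subintervals. Let $L^2(w)$ be the Hilbert space of (classes of) functions with $\int f^*wf<\infty$ and scalar product $\langle f,g\rangle=\int f^*wg$, and $$T_{\max}=\{([u],[f])\in L^2(w)\times L^2(w): u\text{ balanced},\ Ju'+qu=wf\}.$$ For $\lambda\in\mathbb C$ let $D_\lambda=\{([u],\lambda[u])\in T_{\max}\}$ and let $n_\pm=\dim D_{\pm i}$. The adjoint of a linear relation $T$ is $T^*=\{(v,g):\langle g,u\rangle=\langle v,f\rangle\text{ for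 all }(u,f)\in T\}$, and $T$ is self-adjoint if $T=T^*$. Assume the *definiteness condition*: if $Ju'+qu=0$ and $wu=0$ on $(a,b)$, then $u=0$. Hence for each $([u],[f])\in T_{\max}$ there is exactly one balanced representative $u$ with $Ju'+qu=wf$, and it is always the one used. For $(u,f),(v,g)\in T_{\max}$ the limits $(v^*Ju)^+(a)=\lim_{x\downarrow a}v^+(x)^*Ju^+(x)$ and $(v^*Ju)^-(b)=\lim_{x\uparrow b}v^-(x)^*Ju^-(x)$ exist. The endpoint $b$ is *limit-point* (respectively *limit-circle*) if for every $c\in(a,b)$ and every $\lambda\in\mathbb C\setminus\mathbb R$ the space of solutions $u$ of $Ju'+qu=\lambda wu$ on $(c,b)$ with $\int_{(c,b)}u^*wu<\infty$ is one-dimensional (respectively two-dimensional). The definitions for $a$ are analogous, with $(a,c)$ in place of $(c,b)$. **Theorem.** Each of the endpoints $a$, $b$ is limit-point or limit-circle, and the following statements hold. 1. $n_+=n_-=0$ if and only if both $a$ and $b$ are limit-point. In this situation $T_{\max}$ is self-adjoint. 2. $n_+=n_-=1$ if and only if one of $a$ and $b$ is limit-point and the other is limit-circle. In this situation the self-adjoint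 restrictions of $T_{\max}$ are given by posing a boundary condition at the limit-circle endpoint: if $a$ is limit-circle and $b$ is limit-point, then the self-adjoint restrictions of $T_{\max}$ are precisely the relations $$\{(u,f)\in T_{\max}:(g^*Ju)^+(a)=0\},$$ where $(v,g)$ is a nonzero element of $D_i\oplus D_{-i}$ with $\langle v,g\rangle=\langle g,v\rangle$ (note that then $(g,-v)\in T_{\max}$, so that $g$ denotes the representative with $Jg'+qg=-wv$). If $b$ is limit-circle and $a$ is limit-point, the same is true with the condition $(g^*Ju)^-(b)=0$. 3. $n_+=n_-=2$ if and only if both $a$ and $b$ are limit-circle. -/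

import Mathlib

open MeasureTheory Filter Topology Set
open scoped Matrix ComplexOrder

noncomputable section

/-- The open interval of all real `x` with `lo < x < hi`; the endpoints may be infinite. -/
def openInterval (lo hi : EReal) : Set ℝ := {x : ℝ | lo < (x : EReal) ∧ (x : EReal) < hi}

lemma isOpen_openInterval (lo hi : EReal) : IsOpen (openInterval lo hi) :=
  (isOpen_lt continuous_const continuous_coe_real_ereal).inter
    (isOpen_lt continuous_coe_real_ereal continuous_const)

lemma openInterval_Icc_subset {lo hi : EReal} {x y : ℝ} (hx : x ∈ openInterval lo hi)
    (hy : y ∈ openInterval lo hi) : Icc x y ⊆ openInterval lo hi := fun _ ht =>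
  ⟨lt_of_lt_of_le hx.1 (EReal.coe_le_coe_iff.2 ht.1),
    lt_of_le_of_lt (EReal.coe_le_coe_iff.2 ht.2) hy.2⟩

section BoundedVariation

variable {n : ℕ}

/-- `u` is of locally bounded variation on the interval `(lo, hi)` and balanced there: its value
at each point is the mean of the left-hand and the right-hand limit. -/
def IsBalancedBV (lo hi : EReal) (u : ℝ → Fin n → ℂ) : Prop :=
  LocallyBoundedVariationOn u (openInterval lo hi) ∧
    ∀ x ∈ openInterval lo hi,
      u x = (2⁻¹ : ℂ) • (Function.leftLim u x + Function.rightLim u x)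

lemma locallyBV_add {s : Set ℝ} {u v : ℝ → Fin n → ℂ} (hu : LocallyBoundedVariationOn u s)
    (hv : LocallyBoundedVariationOn v s) : LocallyBoundedVariationOn (u + v) s := by
  intro x y hx hy
  have h : eVariationOn (u + v) (s ∩ Icc x y) ≤
      eVariationOn u (s ∩ Icc x y) + eVariationOn v (s ∩ Icc x y) := by
    refine iSup_le fun p => ?_
    calc ∑ i ∈ Finset.range p.1, edist ((u + v) (p.2.1 (i + 1))) ((u + v) (p.2.1 i))
        ≤ ∑ i ∈ Finset.range p.1, (edist (u (p.2.1 (i + 1))) (u (p.2.1 i))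
            + edist (v (p.2.1 (i + 1))) (v (p.2.1 i))) :=
          Finset.sum_le_sum fun i _ => edist_add_add_le _ _ _ _
      _ = _ := Finset.sum_add_distrib
      _ ≤ _ := add_le_add
          (eVariationOn.sum_le (f := u) p.2.2.1 p.2.2.2)
          (eVariationOn.sum_le (f := v) p.2.2.1 p.2.2.2)
  exact ne_top_of_le_ne_top (ENNReal.add_ne_top.2 ⟨hu x y hx hy, hv x y hx hy⟩) h

lemma locallyBV_smul {s : Set ℝ} {u : ℝ → Fin n → ℂ} (c : ℂ)
    (hu : LocallyBoundedVariationOn u s) : LocallyBoundedVariationOn (c • u) s :=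
  (lipschitzWith_smul c).comp_locallyBoundedVariationOn hu

lemma locallyBV_zero {s : Set ℝ} : LocallyBoundedVariationOn (0 : ℝ → Fin n → ℂ) s := by
  intro x y _ _
  have : eVariationOn (0 : ℝ → Fin n → ℂ) (s ∩ Icc x y) = 0 :=
    eVariationOn.constant_on (by
      rintro _ ⟨a, _, rfl⟩ _ ⟨b, _, rfl⟩
      rfl)
  simp [BoundedVariationOn, this]

lemma locallyBV_tendsto {lo hi : EReal} {u : ℝ → Fin n → ℂ}
    (hu : LocallyBoundedVariationOn u (openInterval lo hi)) {x : ℝ}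
    (hx : x ∈ openInterval lo hi) :
    Tendsto u (𝓝[<] x) (𝓝 (Function.leftLim u x)) ∧
      Tendsto u (𝓝[>] x) (𝓝 (Function.rightLim u x)) := by
  obtain ⟨e, he, hball⟩ :=
    Metric.isOpen_iff.1 (isOpen_openInterval lo hi) x hx
  have hmem : ∀ t : ℝ, |t - x| < e → t ∈ openInterval lo hi := fun t ht =>
    hball (by simpa [Metric.mem_ball, Real.dist_eq] using ht)
  have h1 : x - e / 2 ∈ openInterval lo hi := hmem _ (by
    rw [show x - e / 2 - x = -(e / 2) by ring, abs_neg, abs_of_pos (by positivity)]; linarith)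
  have h2 : x + e / 2 ∈ openInterval lo hi := hmem _ (by
    rw [show x + e / 2 - x = e / 2 by ring, abs_of_pos (by positivity)]; linarith)
  have hbv := hu _ _ h1 h2
  rw [inter_eq_self_of_subset_right (openInterval_Icc_subset h1 h2)] at hbv
  have hn : Icc (x - e / 2) (x + e / 2) ∈ 𝓝 x :=
    Icc_mem_nhds (by linarith) (by linarith)
  constructor
  · obtain ⟨l, hl⟩ := hbv.exists_tendsto_left x
    rw [inter_comm, nhdsWithin_inter_of_mem' (mem_nhdsWithin_of_mem_nhds hn)] at hl
    rwa [leftLim_eq_of_tendsto hl]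
  · obtain ⟨l, hl⟩ := hbv.exists_tendsto_right x
    rw [inter_comm, nhdsWithin_inter_of_mem' (mem_nhdsWithin_of_mem_nhds hn)] at hl
    rwa [rightLim_eq_of_tendsto hl]

lemma leftLim_add_of_BV {lo hi : EReal} {u v : ℝ → Fin n → ℂ}
    (hu : LocallyBoundedVariationOn u (openInterval lo hi))
    (hv : LocallyBoundedVariationOn v (openInterval lo hi)) {x : ℝ}
    (hx : x ∈ openInterval lo hi) :
    Function.leftLim (u + v) x = Function.leftLim u x + Function.leftLim v x :=
  leftLim_eq_of_tendsto ((locallyBV_tendsto hu hx).1.add (locallyBV_tendsto hv hx).1)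

lemma rightLim_add_of_BV {lo hi : EReal} {u v : ℝ → Fin n → ℂ}
    (hu : LocallyBoundedVariationOn u (openInterval lo hi))
    (hv : LocallyBoundedVariationOn v (openInterval lo hi)) {x : ℝ}
    (hx : x ∈ openInterval lo hi) :
    Function.rightLim (u + v) x = Function.rightLim u x + Function.rightLim v x :=
  rightLim_eq_of_tendsto ((locallyBV_tendsto hu hx).2.add (locallyBV_tendsto hv hx).2)

lemma leftLim_smul_of_BV {lo hi : EReal} {u : ℝ → Fin n → ℂ} (c : ℂ)
    (hu : LocallyBoundedVariationOn u (openInterval lo hi)) {x : ℝ}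
    (hx : x ∈ openInterval lo hi) :
    Function.leftLim (c • u) x = c • Function.leftLim u x :=
  leftLim_eq_of_tendsto ((locallyBV_tendsto hu hx).1.const_smul c)

lemma rightLim_smul_of_BV {lo hi : EReal} {u : ℝ → Fin n → ℂ} (c : ℂ)
    (hu : LocallyBoundedVariationOn u (openInterval lo hi)) {x : ℝ}
    (hx : x ∈ openInterval lo hi) :
    Function.rightLim (c • u) x = c • Function.rightLim u x :=
  rightLim_eq_of_tendsto ((locallyBV_tendsto hu hx).2.const_smul c)

lemma leftLim_zero_fun (x : ℝ) : Function.leftLim (0 : ℝ → Fin n → ℂ) x = 0 :=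
  leftLim_eq_of_tendsto tendsto_const_nhds

lemma rightLim_zero_fun (x : ℝ) : Function.rightLim (0 : ℝ → Fin n → ℂ) x = 0 :=
  rightLim_eq_of_tendsto tendsto_const_nhds

lemma IsBalancedBV.add {lo hi : EReal} {u v : ℝ → Fin n → ℂ} (hu : IsBalancedBV lo hi u)
    (hv : IsBalancedBV lo hi v) : IsBalancedBV lo hi (u + v) := by
  refine ⟨locallyBV_add hu.1 hv.1, fun x hx => ?_⟩
  rw [leftLim_add_of_BV hu.1 hv.1 hx, rightLim_add_of_BV hu.1 hv.1 hx, Pi.add_apply,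
    hu.2 x hx, hv.2 x hx]
  module

lemma IsBalancedBV.smul {lo hi : EReal} {u : ℝ → Fin n → ℂ} (c : ℂ)
    (hu : IsBalancedBV lo hi u) : IsBalancedBV lo hi (c • u) := by
  refine ⟨locallyBV_smul c hu.1, fun x hx => ?_⟩
  rw [leftLim_smul_of_BV c hu.1 hx, rightLim_smul_of_BV c hu.1 hx, Pi.smul_apply, hu.2 x hx]
  module

lemma IsBalancedBV.zero {lo hi : EReal} : IsBalancedBV lo hi (0 : ℝ → Fin n → ℂ) :=
  ⟨locallyBV_zero, fun x _ => by rw [leftLim_zero_fun, rightLim_zero_fun]; simp⟩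

end BoundedVariation

/-- The data of the system `J u' + q u = w f` of size `n` on the interval `(a, b)`, whose
coefficients `q` and `w` are matrices of distributions of order `0`, that is, of set functions on
`(a, b)` which are complex measures on each compact subset of `(a, b)`.
The entries of `q` and `w` are given by their densities `Q j k` and `W j k` with respect to a
common positive measure `μ` on `(a, b)` that is finite on compact sets: `q = Q μ` and `w = W μ`.
(Any finite family of distributions of order `0` is of this form; one may take for `μ` the sum of
their total variations.) -/
structure FirstOrderSystem (n : ℕ) where
  /-- the left endpoint, possibly `-∞` -/
  a : EReal
  /-- the right endpoint, possibly `∞` -/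
  b : EReal
  a_lt_b : a < b
  /-- the constant matrix in front of the derivative -/
  J : Matrix (Fin n) (Fin n) ℂ
  J_skewHermitian : Jᴴ = -J
  J_invertible : IsUnit J
  /-- the reference measure -/
  μ : Measure ℝ
  μ_lt_top : ∀ K : Set ℝ, IsCompact K → K ⊆ openInterval a b → μ K < ⊤
  /-- the density of `q` -/
  Q : ℝ → Matrix (Fin n) (Fin n) ℂ
  /-- the density of `w` -/
  W : ℝ → Matrix (Fin n) (Fin n) ℂ
  Q_locallyIntegrable : ∀ j k, LocallyIntegrableOn (fun x => Q x j k) (openInterval a b) μ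
  W_locallyIntegrable : ∀ j k, LocallyIntegrableOn (fun x => W x j k) (openInterval a b) μ
  Q_hermitian : ∀ x ∈ openInterval a b, (Q x).IsHermitian
  W_nonneg : ∀ x ∈ openInterval a b, (W x).PosSemidef
  /-- `2 J ± Δ_q(x)` is invertible, where `Δ_q(x) = q({x})` is the jump of an antiderivative
  of `q` at `x` -/
  jump_invertible : ∀ x ∈ openInterval a b,
    IsUnit ((2 : ℂ) • J + ((μ {x}).toReal : ℂ) • Q x) ∧
      IsUnit ((2 : ℂ) • J - ((μ {x}).toReal : ℂ) • Q x)

namespace FirstOrderSystem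

variable {n : ℕ} (S : FirstOrderSystem n)

/-- The interval `(a, b)`. -/
def interval : Set ℝ := openInterval S.a S.b

/-- The coefficients `J`, `q` and `w` are real. -/
def IsReal : Prop :=
  (∀ j k, (S.J j k).im = 0) ∧
    ∀ x ∈ S.interval, ∀ j k, (S.Q x j k).im = 0 ∧ (S.W x j k).im = 0

/-- The measure `μ` on `(a, b)`. -/
def ν : Measure ℝ := S.μ.restrict S.interval

/-- `u` is a balanced solution of `J u' + q u = w f` on `(lo, hi)`, a subinterval of `(a, b)`.
The equation is one between distributions of order `0`, i.e. between set functions that are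
measures on compact sets: both sides agree on each compact interval `[x, y]` in `(lo, hi)`; the
measure `du` associated with `u'` has the value `u⁺(y) - u⁻(x)` on `[x, y]`. -/
structure Solves (lo hi : EReal) (u f : ℝ → Fin n → ℂ) : Prop where
  balanced : IsBalancedBV lo hi u
  qu_integrable : ∀ x ∈ openInterval lo hi, ∀ y ∈ openInterval lo hi,
    IntegrableOn (fun t => S.Q t *ᵥ u t) (Icc x y) S.μ
  wf_integrable : ∀ x ∈ openInterval lo hi, ∀ y ∈ openInterval lo hi,
    IntegrableOn (fun t => S.W t *ᵥ f t) (Icc x y) S.μ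
  equation : ∀ x ∈ openInterval lo hi, ∀ y ∈ openInterval lo hi, x ≤ y →
    S.J *ᵥ (Function.rightLim u y - Function.leftLim u x)
        + ∫ t in Icc x y, S.Q t *ᵥ u t ∂S.μ
      = ∫ t in Icc x y, S.W t *ᵥ f t ∂S.μ

lemma Solves.add {S : FirstOrderSystem n} {lo hi : EReal} {u f v g : ℝ → Fin n → ℂ}
    (h : S.Solves lo hi u f) (k : S.Solves lo hi v g) : S.Solves lo hi (u + v) (f + g) where
  balanced := h.balanced.add k.balanced
  qu_integrable x hx y hy := by
    simp only [Pi.add_apply, Matrix.mulVec_add]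
    exact (h.qu_integrable x hx y hy).add (k.qu_integrable x hx y hy)
  wf_integrable x hx y hy := by
    simp only [Pi.add_apply, Matrix.mulVec_add]
    exact (h.wf_integrable x hx y hy).add (k.wf_integrable x hx y hy)
  equation x hx y hy hxy := by
    have e1 := integral_add (h.qu_integrable x hx y hy) (k.qu_integrable x hx y hy)
    have e2 := integral_add (h.wf_integrable x hx y hy) (k.wf_integrable x hx y hy)
    simp only [Pi.add_apply, Matrix.mulVec_add] at e1 e2 ⊢
    rw [e1, e2, ← h.equation x hx y hy hxy, ← k.equation x hx y hy hxy,
      rightLim_add_of_BV h.balanced.1 k.balanced.1 hy,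
      leftLim_add_of_BV h.balanced.1 k.balanced.1 hx, add_sub_add_comm, Matrix.mulVec_add]
    abel

lemma Solves.smul {S : FirstOrderSystem n} {lo hi : EReal} {u f : ℝ → Fin n → ℂ} (c : ℂ)
    (h : S.Solves lo hi u f) : S.Solves lo hi (c • u) (c • f) where
  balanced := h.balanced.smul c
  qu_integrable x hx y hy := by
    simp only [Pi.smul_apply, Matrix.mulVec_smul]
    exact (h.qu_integrable x hx y hy).smul c
  wf_integrable x hx y hy := by
    simp only [Pi.smul_apply, Matrix.mulVec_smul]
    exact (h.wf_integrable x hx y hy).smul c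
  equation x hx y hy hxy := by
    simp only [Pi.smul_apply, Matrix.mulVec_smul]
    rw [integral_smul, integral_smul, ← h.equation x hx y hy hxy,
      rightLim_smul_of_BV c h.balanced.1 hy, leftLim_smul_of_BV c h.balanced.1 hx,
      ← smul_sub, Matrix.mulVec_smul, smul_add]

lemma Solves.zero {S : FirstOrderSystem n} {lo hi : EReal} : S.Solves lo hi 0 0 where
  balanced := IsBalancedBV.zero
  qu_integrable x _ y _ := by simp
  wf_integrable x _ y _ := by simp
  equation x _ y _ _ := by simp [leftLim_zero_fun, rightLim_zero_fun]

/-- The definiteness condition: a balanced solution `u` of `J u' + q u = 0` on `(a, b)` for which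
`w u` is the zero distribution vanishes identically. -/
def Definite : Prop :=
  ∀ u : ℝ → Fin n → ℂ, S.Solves S.a S.b u 0 → (∀ᵐ x ∂S.ν, S.W x *ᵥ u x = 0) →
    ∀ x ∈ S.interval, u x = 0

/-! ### The Hilbert space of square-integrable functions -/

/-- The integrand of the scalar product: `f* W g`. -/
def density (f g : ℝ → Fin n → ℂ) (x : ℝ) : ℂ := star (f x) ⬝ᵥ (S.W x *ᵥ g x)

lemma norm_form_le {M : Matrix (Fin n) (Fin n) ℂ} (hM : M.PosSemidef) (x y : Fin n → ℂ) :
    ‖star x ⬝ᵥ (M *ᵥ y)‖ ≤ ‖star x ⬝ᵥ (M *ᵥ x)‖ + ‖star y ⬝ᵥ (M *ᵥ y)‖ := by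
  obtain ⟨B, rfl⟩ : ∃ B : Matrix (Fin n) (Fin n) ℂ, M = Bᴴ * B := by
    open scoped MatrixOrder in
    exact CStarAlgebra.nonneg_iff_eq_star_mul_self.1 hM.nonneg
  have key : ∀ x y : Fin n → ℂ, star x ⬝ᵥ ((Bᴴ * B) *ᵥ y) =
      inner ℂ (WithLp.toLp 2 (B *ᵥ x)) (WithLp.toLp 2 (B *ᵥ y)) := fun x y => by
    rw [EuclideanSpace.inner_toLp_toLp, ← Matrix.mulVec_mulVec, Matrix.dotProduct_mulVec,
      ← Matrix.star_mulVec, dotProduct_comm]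
  rw [key, key, key]
  refine (norm_inner_le_norm _ _).trans ?_
  have h : ∀ z : EuclideanSpace ℂ (Fin n), ‖inner ℂ z z‖ = ‖z‖ ^ 2 := fun z => by
    rw [inner_self_eq_norm_sq_to_K]; simp
  rw [h, h]
  nlinarith [sq_nonneg (‖WithLp.toLp 2 (B *ᵥ x)‖ - ‖WithLp.toLp 2 (B *ᵥ y)‖),
    sq_nonneg ‖WithLp.toLp 2 (B *ᵥ x)‖, sq_nonneg ‖WithLp.toLp 2 (B *ᵥ y)‖]

lemma density_measurable {f g : ℝ → Fin n → ℂ} (hf : AEStronglyMeasurable f S.ν)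
    (hg : AEStronglyMeasurable g S.ν) : AEStronglyMeasurable (S.density f g) S.ν := by
  have hW : ∀ j k, AEStronglyMeasurable (fun x => S.W x j k) S.ν := fun j k =>
    (S.W_locallyIntegrable j k).aestronglyMeasurable
  have hf' : ∀ j, AEStronglyMeasurable (fun x => f x j) S.ν := fun j =>
    (continuous_apply j).comp_aestronglyMeasurable hf
  have hg' : ∀ j, AEStronglyMeasurable (fun x => g x j) S.ν := fun j =>
    (continuous_apply j).comp_aestronglyMeasurable hg
  unfold density
  simp only [dotProduct, Matrix.mulVec]
  refine Finset.aestronglyMeasurable_fun_sum _ fun j _ => ?_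
  refine AEStronglyMeasurable.mul (continuous_star.comp_aestronglyMeasurable (hf' j)) ?_
  exact Finset.aestronglyMeasurable_fun_sum _ fun k _ => (hW j k).mul (hg' k)

lemma ae_mem : ∀ᵐ x ∂S.ν, x ∈ S.interval :=
  ae_restrict_mem (isOpen_openInterval _ _).measurableSet

lemma density_integrable {f g : ℝ → Fin n → ℂ} (hf : AEStronglyMeasurable f S.ν)
    (hg : AEStronglyMeasurable g S.ν) (hff : Integrable (S.density f f) S.ν)
    (hgg : Integrable (S.density g g) S.ν) : Integrable (S.density f g) S.ν := by
  refine (hff.norm.add hgg.norm).mono' (S.density_measurable hf hg) ?_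
  filter_upwards [S.ae_mem] with x hx
  exact norm_form_le (S.W_nonneg x hx) (f x) (g x)

/-- The space of the (measurable) functions `f` with `∫ f* w f < ∞`. -/
def sqIntegrable : Submodule ℂ (ℝ → Fin n → ℂ) where
  carrier := {f | AEStronglyMeasurable f S.ν ∧ Integrable (S.density f f) S.ν}
  add_mem' := by
    rintro f g ⟨hf, hff⟩ ⟨hg, hgg⟩
    refine ⟨hf.add hg, ?_⟩
    have : S.density (f + g) (f + g) =
        S.density f f + S.density f g + (S.density g f + S.density g g) := by
      ext x
      simp only [density, Pi.add_apply, star_add, Matrix.mulVec_add, add_dotProduct,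
        dotProduct_add]
      ring
    rw [this]
    exact (hff.add (S.density_integrable hf hg hff hgg)).add
      ((S.density_integrable hg hf hgg hff).add hgg)
  zero_mem' := by
    refine ⟨aestronglyMeasurable_zero, ?_⟩
    have : S.density 0 0 = 0 := by
      ext x; simp [density]
    rw [this]
    exact integrable_zero _ _ _
  smul_mem' := by
    rintro c f ⟨hf, hff⟩
    refine ⟨hf.const_smul c, ?_⟩
    have : S.density (c • f) (c • f) = (star c * c) • S.density f f := by
      ext x
      simp only [density, Pi.smul_apply, star_smul, Matrix.mulVec_smul, smul_dotProduct,
        dotProduct_smul, smul_eq_mul]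
      ring
    rw [this]
    exact hff.smul _

/-- The space `𝓛²(w)` of representatives, to be equipped with its semi-scalar product. -/
def PreL2 : Type := ↥S.sqIntegrable

instance : AddCommGroup S.PreL2 := inferInstanceAs (AddCommGroup ↥S.sqIntegrable)

instance : Module ℂ S.PreL2 := inferInstanceAs (Module ℂ ↥S.sqIntegrable)

variable {S} in
/-- The function underlying an element of `𝓛²(w)`. -/
def PreL2.fn (f : S.PreL2) : ℝ → Fin n → ℂ := f.1

/-- The semi-scalar product `⟨f, g⟩ = ∫ f* w g` on `𝓛²(w)`, linear in the second entry. -/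
@[reducible] def preL2Core : PreInnerProductSpace.Core ℂ S.PreL2 where
  inner f g := ∫ x, S.density f.fn g.fn x ∂S.ν
  conj_inner_symm f g := by
    rw [← integral_conj]
    refine integral_congr_ae ?_
    filter_upwards [S.ae_mem] with x hx
    have hH : (S.W x)ᴴ = S.W x := (S.W_nonneg x hx).isHermitian
    change star (star (g.fn x) ⬝ᵥ (S.W x *ᵥ f.fn x)) = star (f.fn x) ⬝ᵥ (S.W x *ᵥ g.fn x)
    rw [Matrix.star_dotProduct, star_star, Matrix.star_mulVec, hH, Matrix.dotProduct_mulVec]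
  re_inner_nonneg f := by
    have h : Integrable (S.density f.fn f.fn) S.ν := f.2.2
    rw [← integral_re h]
    refine integral_nonneg_of_ae ?_
    filter_upwards [S.ae_mem] with x hx
    exact (S.W_nonneg x hx).re_dotProduct_nonneg (f.fn x)
  add_left f g h := by
    have h1 : Integrable (S.density f.fn h.fn) S.ν :=
      S.density_integrable f.2.1 h.2.1 f.2.2 h.2.2
    have h2 : Integrable (S.density g.fn h.fn) S.ν :=
      S.density_integrable g.2.1 h.2.1 g.2.2 h.2.2
    rw [← integral_add h1 h2]
    congr 1
    ext x
    change star (f.fn x + g.fn x) ⬝ᵥ (S.W x *ᵥ h.fn x) = _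
    rw [star_add, add_dotProduct]
    rfl
  smul_left f g c := by
    rw [← integral_const_mul]
    congr 1
    ext x
    change star (c • f.fn x) ⬝ᵥ (S.W x *ᵥ g.fn x) = _
    rw [star_smul, smul_dotProduct]
    rfl

instance : SeminormedAddCommGroup S.PreL2 :=
  @InnerProductSpace.Core.toSeminormedAddCommGroup ℂ _ _ _ _ S.preL2Core

instance : InnerProductSpace ℂ S.PreL2 := InnerProductSpace.ofCore S.preL2Core

lemma PreL2.inner_def (f g : S.PreL2) :
    inner ℂ f g = ∫ x, star (f.fn x) ⬝ᵥ (S.W x *ᵥ g.fn x) ∂S.ν := rfl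

/-- The space `L²(w)`: elements of `𝓛²(w)` at distance `0` from each other are identified. -/
abbrev L2 : Type := SeparationQuotient S.PreL2

/-- The linear map `(u, f) ↦ ([u], [f])`. -/
def classes : S.PreL2 × S.PreL2 →ₗ[ℂ] S.L2 × S.L2 :=
  LinearMap.prodMap (SeparationQuotient.mkCLM ℂ S.PreL2).toLinearMap
    (SeparationQuotient.mkCLM ℂ S.PreL2).toLinearMap

/-! ### The maximal relation and the deficiency indices -/

/-- The pairs `(u, f)` in `𝓛²(w) × 𝓛²(w)` for which `u` is a balanced function of locally bounded
variation with `J u' + q u = w f` on `(a, b)`. -/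
def maxPairs : Submodule ℂ (S.PreL2 × S.PreL2) where
  carrier := {p | S.Solves S.a S.b p.1.fn p.2.fn}
  add_mem' h k := Solves.add h k
  zero_mem' := Solves.zero
  smul_mem' c _ h := Solves.smul c h

/-- The maximal relation `T_max` in `L²(w) × L²(w)`. -/
def Tmax : Submodule ℂ (S.L2 × S.L2) := S.maxPairs.map S.classes

/-- The deficiency space `D_lam = {([u], lam [u]) ∈ T_max}`. -/
def deficiencySpace (lam : ℂ) : Submodule ℂ (S.L2 × S.L2) :=
  S.Tmax ⊓ LinearMap.graph (lam • (LinearMap.id : S.L2 →ₗ[ℂ] S.L2))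

/-- The deficiency index `n₊ = dim D_i`. -/
def nPlus : Cardinal := Module.rank ℂ (S.deficiencySpace Complex.I)

/-- The deficiency index `n₋ = dim D_{-i}`. -/
def nMinus : Cardinal := Module.rank ℂ (S.deficiencySpace (-Complex.I))

/-- `T` is a self-adjoint restriction of `T_max`. -/
def IsSelfAdjointRestriction (T : Submodule ℂ (S.L2 × S.L2)) : Prop :=
  T ≤ S.Tmax ∧ T.adjoint = T

/-! ### Limit-point and limit-circle endpoints -/

/-- The space of the balanced solutions `u` of `J u' + q u = lam w u` on the subinterval `(lo, hi)`
of `(a, b)` for which the integral of `u* w u` over `(lo, hi)` is finite. (A function on `(lo, hi)`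
is represented by its extension by zero.) -/
def sqSolutions (lo hi : EReal) (lam : ℂ) : Submodule ℂ (ℝ → Fin n → ℂ) where
  carrier := {u | (∀ x, x ∉ openInterval lo hi → u x = 0) ∧ S.Solves lo hi u (lam • u) ∧
    u ∈ S.sqIntegrable}
  add_mem' := by
    rintro u v ⟨h1, h2, h3⟩ ⟨k1, k2, k3⟩
    refine ⟨fun x hx => by simp [h1 x hx, k1 x hx], ?_, S.sqIntegrable.add_mem h3 k3⟩
    rw [smul_add]
    exact h2.add k2
  zero_mem' := by
    refine ⟨fun _ _ => rfl, ?_, S.sqIntegrable.zero_mem⟩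
    rw [smul_zero]
    exact Solves.zero
  smul_mem' := by
    rintro c u ⟨h1, h2, h3⟩
    refine ⟨fun x hx => by simp [h1 x hx], ?_, S.sqIntegrable.smul_mem c h3⟩
    rw [smul_comm]
    exact h2.smul c

/-- The limit-point case at `a`: for `c` in `(a, b)` and nonreal `lam` the space of the solutions
of `J u' + q u = lam w u` near `a` which are square-integrable on `(a, c)` is one-dimensional. -/
def LimitPointAtA : Prop :=
  ∀ c : ℝ, c ∈ S.interval → ∀ lam : ℂ, lam.im ≠ 0 →
    Module.rank ℂ (S.sqSolutions S.a c lam) = 1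

/-- The limit-circle case at `a`: that space is two-dimensional. -/
def LimitCircleAtA : Prop :=
  ∀ c : ℝ, c ∈ S.interval → ∀ lam : ℂ, lam.im ≠ 0 →
    Module.rank ℂ (S.sqSolutions S.a c lam) = 2

/-- The limit-point case at `b`. -/
def LimitPointAtB : Prop :=
  ∀ c : ℝ, c ∈ S.interval → ∀ lam : ℂ, lam.im ≠ 0 →
    Module.rank ℂ (S.sqSolutions c S.b lam) = 1

/-- The limit-circle case at `b`. -/
def LimitCircleAtB : Prop :=
  ∀ c : ℝ, c ∈ S.interval → ∀ lam : ℂ, lam.im ≠ 0 →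
    Module.rank ℂ (S.sqSolutions c S.b lam) = 2

/-! ### Boundary conditions -/

/-- The filter of real `x` tending to the (possibly infinite) endpoint `a` from the right. -/
def towardsA : Filter ℝ := comap (fun x : ℝ => (x : EReal)) (𝓝[>] S.a)

/-- The filter of real `x` tending to the (possibly infinite) endpoint `b` from the left. -/
def towardsB : Filter ℝ := comap (fun x : ℝ => (x : EReal)) (𝓝[<] S.b)

/-- `([v], [g])` is a nonzero element of `D_i ⊕ D_{-i}` with `⟨(v, g), (g, -v)⟩ = 0`, and `g` is the
balanced representative with `J g' + q g = - w v`. -/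
def IsBoundaryElement (v g : S.PreL2) : Prop :=
  S.classes (v, g) ∈ S.deficiencySpace Complex.I ⊔ S.deficiencySpace (-Complex.I) ∧
    S.classes (v, g) ≠ 0 ∧ inner ℂ v g + inner ℂ g (-v) = 0 ∧ (g, -v) ∈ S.maxPairs

/-- The elements `([u], [f])` of `T_max`, with `J u' + q u = w f`, which satisfy the boundary
condition `(g* J u)⁺(a) = 0` at `a`. -/
def restrictionAtA (g : S.PreL2) : Set (S.L2 × S.L2) :=
  S.classes '' {p | p ∈ S.maxPairs ∧
    Tendsto (fun x => star (Function.rightLim g.fn x) ⬝ᵥ (S.J *ᵥ Function.rightLim p.1.fn x))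
      S.towardsA (𝓝 0)}

/-- The elements `([u], [f])` of `T_max`, with `J u' + q u = w f`, which satisfy the boundary
condition `(g* J u)⁻(b) = 0` at `b`. -/
def restrictionAtB (g : S.PreL2) : Set (S.L2 × S.L2) :=
  S.classes '' {p | p ∈ S.maxPairs ∧
    Tendsto (fun x => star (Function.leftLim g.fn x) ⬝ᵥ (S.J *ᵥ Function.leftLim p.1.fn x))
      S.towardsB (𝓝 0)}

end FirstOrderSystem

end

/-! The engine is an energy. For nonreal λ and a solution u of Ju' + qu = λwu put h(u) = Im(u*Ju) /
(2 Im λ). By Green's identity (`Solves.green`, `Solves.height_sub`) the increment h(u⁺(y)) -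
h(u⁻(x)) is the integral of u*wu over [x, y]. So the energy increases, and u is square-integrable
near b exactly when its energy stays bounded above there (`Solves.sqOn_of_bounded`,
`Solves.bounded_of_sqOn`). Green's identity has no extra terms at atoms because the functions are
balanced (`BalPrim.mul`).

Atoms cause the main difficulty. At a point x one has u⁺ = (1 + X)u and u⁻ = (1 - X)u with X =
`halfJump`, half the mass of J⁻¹(λw - q). For λ = 0 the hypothesis on 2J ± Δ_q makes 1 ± X
invertible, but for nonreal λ this may fail, and then initial value problems are neither uniquely
nor always solvable. In a real system of size two X has trace zero, so at such a singular point X² =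
1: all left limits lie in the line ker(1 + X), whose nonzero vectors have negative energy, all right
limits in ker(1 - X), where the energy is positive, and a solution lying on one side may be
continued by zero on the other.

Near b there is always a nontrivial solution of nonpositive, hence bounded, energy
(`IsReal.exists_nonpos_solution`): by Weyl's nested compact sets, or by ending a solution at the
first singular point. Let `CircleB` say that for some nonreal λ, far enough to the right, there are
no singular points and all solutions are square-integrable. If it fails, square-integrable solutions
have nonpositive energy (`IsReal.height_nonpos`), which makes them proportional, and their energy
tends to 0 (`IsReal.exists_height_gt`). If it holds, comparing brackets with two reference solutions
shows the same for every nonreal λ (`IsReal.circle_all`), and the square-integrable solutions form a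
plane for every starting point. This is the limit-point/limit-circle alternative at b; reflection
gives it at a.

For the deficiency indices, a pair of square-integrable solutions on (a, c) and (c, b) fits together
when a linear map into ℂ² vanishes on it. Definiteness makes this map surjective
(`IsReal.gluingDefect_surjective`), so 2 + n equals the sum of the two dimensions
(`IsReal.rank_add_two`), and the indices can be read off.

For the self-adjoint restrictions, T_max* and T_max** are contained in T_max (`Definite.adjoint_le`,
`Definite.adjoint_adjoint_le`), because a pair orthogonal to all compactly supported elements of
T_max already solves the equation (`Definite.exists_solution_of_orthogonal`). Completeness of L²(w)
then gives von Neumann's decomposition T_max = T_max* + D_i + D_{-i}, and for indices one the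
self-adjoint restrictions are the orthogonality conditions ⟨v, u⟩ + ⟨g, f⟩ = 0 with ⟨v, g⟩ = ⟨g, v⟩
(`LinearRelation.adjoint_restriction`, `LinearRelation.exists_restriction_eq`). The form of any two
elements of T_max vanishes at a limit-point endpoint (`IsReal.vanishAtB`), so Green's identity turns
this condition into one on g*Ju at the other endpoint. -/

noncomputable section

set_option linter.unusedSectionVars false

/-! ### Balanced primitives of a density: one-sided limits and the product rule -/

section BalancedPrimitive

variable {E : Type*} [NormedAddCommGroup E] [NormedSpace ℝ E] [CompleteSpace E]

/-- The balanced Heaviside kernel: `1` for `s < x`, `1/2` for `s = x`, `0` for `s > x`. -/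
def balKernel (s x : ℝ) : ℝ := ((if s < x then 1 else 0) + (if s ≤ x then 1 else 0)) / 2

lemma balKernel_of_lt {s x : ℝ} (h : s < x) : balKernel s x = 1 := by
  simp [balKernel, h, h.le]

lemma balKernel_of_gt {s x : ℝ} (h : x < s) : balKernel s x = 0 := by
  simp [balKernel, not_lt.2 h.le, not_le.2 h]

lemma balKernel_self (x : ℝ) : balKernel x x = 1 / 2 := by simp [balKernel]

/-- The value 1/2 on the diagonal makes this true for s = t as well. It is the reason for working
with balanced functions: through it the product rule `BalPrim.mul` acquires no extra term at atoms.
-/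
lemma balKernel_add_swap (s t : ℝ) : balKernel s t + balKernel t s = 1 := by
  rcases lt_trichotomy s t with h | rfl | h
  · rw [balKernel_of_lt h, balKernel_of_gt h]; norm_num
  · rw [balKernel_self]; norm_num
  · rw [balKernel_of_gt h, balKernel_of_lt h]; norm_num

lemma abs_balKernel_le (s x : ℝ) : |balKernel s x| ≤ 1 := by
  rcases lt_trichotomy s x with h | rfl | h
  · simp [balKernel_of_lt h]
  · rw [balKernel_self]; norm_num [abs_of_pos]
  · simp [balKernel_of_gt h]

lemma balKernel_nonneg (s x : ℝ) : 0 ≤ balKernel s x := by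
  unfold balKernel; positivity

lemma measurable_balKernel_uncurry : Measurable fun p : ℝ × ℝ => balKernel p.1 p.2 := by
  unfold balKernel
  exact ((Measurable.ite (measurableSet_lt measurable_fst measurable_snd) measurable_const
    measurable_const).add (Measurable.ite (measurableSet_le measurable_fst measurable_snd)
      measurable_const measurable_const)).div_const 2

lemma measurable_balKernel (x : ℝ) : Measurable fun s => balKernel s x :=
  measurable_balKernel_uncurry.comp (measurable_id.prodMk measurable_const)

lemma integrableOn_balKernel_smul {μ : Measure ℝ} {K : Set ℝ} {G : ℝ → E}
    (hG : IntegrableOn G K μ) (x : ℝ) : IntegrableOn (fun s => balKernel s x • G s) K μ := by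
  refine Integrable.mono hG ((measurable_balKernel x).aestronglyMeasurable.smul hG.1) ?_
  refine Eventually.of_forall fun s => ?_
  rw [norm_smul, Real.norm_eq_abs]
  exact mul_le_of_le_one_left (norm_nonneg _) (abs_balKernel_le _ _)

lemma tendsto_balKernel_left {μ : Measure ℝ} {K : Set ℝ} {G : ℝ → E}
    (hG : IntegrableOn G K μ) (x : ℝ) :
    Tendsto (fun y => ∫ s in K, balKernel s y • G s ∂μ) (𝓝[<] x)
      (𝓝 (∫ s in K, (Iio x).indicator G s ∂μ)) := by
  refine tendsto_integral_filter_of_dominated_convergence (fun s => ‖G s‖) ?_ ?_ hG.norm ?_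
  · exact Eventually.of_forall fun y => (integrableOn_balKernel_smul hG y).1
  · refine Eventually.of_forall fun y => Eventually.of_forall fun s => ?_
    rw [norm_smul, Real.norm_eq_abs]
    exact mul_le_of_le_one_left (norm_nonneg _) (abs_balKernel_le _ _)
  · refine Eventually.of_forall fun s => ?_
    refine tendsto_const_nhds.congr' ?_
    rcases lt_or_ge s x with h | h
    · filter_upwards [Ioo_mem_nhdsLT h] with y hy
      simp [balKernel_of_lt hy.1, h]
    · filter_upwards [self_mem_nhdsWithin] with y hy
      simp [balKernel_of_gt (lt_of_lt_of_le hy h), not_lt.2 h]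

lemma tendsto_balKernel_right {μ : Measure ℝ} {K : Set ℝ} {G : ℝ → E}
    (hG : IntegrableOn G K μ) (x : ℝ) :
    Tendsto (fun y => ∫ s in K, balKernel s y • G s ∂μ) (𝓝[>] x)
      (𝓝 (∫ s in K, (Iic x).indicator G s ∂μ)) := by
  refine tendsto_integral_filter_of_dominated_convergence (fun s => ‖G s‖) ?_ ?_ hG.norm ?_
  · exact Eventually.of_forall fun y => (integrableOn_balKernel_smul hG y).1
  · refine Eventually.of_forall fun y => Eventually.of_forall fun s => ?_
    rw [norm_smul, Real.norm_eq_abs]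
    exact mul_le_of_le_one_left (norm_nonneg _) (abs_balKernel_le _ _)
  · refine Eventually.of_forall fun s => ?_
    refine tendsto_const_nhds.congr' ?_
    rcases lt_or_ge x s with h | h
    · filter_upwards [Ioo_mem_nhdsGT h] with y hy
      simp [balKernel_of_gt hy.2, h]
    · filter_upwards [self_mem_nhdsWithin] with y hy
      simp [balKernel_of_lt (lt_of_le_of_lt h hy), h]

/-- The difference of kernels vanishes off [x, y], so the domain may be enlarged to one fixed K on
which the two kernels can be integrated separately. -/
lemma integral_balKernel_diff_of_subset {μ : Measure ℝ} {K : Set ℝ} (hK : MeasurableSet K)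
    {x y : ℝ} (hxy : x ≤ y) (h : Icc x y ⊆ K) (G : ℝ → E) :
    ∫ s in Icc x y, (balKernel s y - balKernel s x) • G s ∂μ
      = ∫ s in K, (balKernel s y - balKernel s x) • G s ∂μ := by
  symm
  refine setIntegral_eq_of_subset_of_forall_sdiff_eq_zero hK h fun s hs => ?_
  have h2 : s < x ∨ y < s := by
    by_contra! h3
    exact hs.2 ⟨h3.1, h3.2⟩
  rcases h2 with h2 | h2
  · rw [balKernel_of_lt h2, balKernel_of_lt (h2.trans_le hxy)]; simp
  · rw [balKernel_of_gt h2, balKernel_of_gt (hxy.trans_lt h2)]; simp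

/-- `u` is a balanced primitive on `(lo, hi)` of the density `G` with respect to `μ`. -/
structure BalPrim (μ : Measure ℝ) (lo hi : EReal) (u G : ℝ → E) : Prop where
  int : ∀ x ∈ openInterval lo hi, ∀ y ∈ openInterval lo hi, IntegrableOn G (Icc x y) μ
  eq : ∀ x ∈ openInterval lo hi, ∀ y ∈ openInterval lo hi, x ≤ y →
    u y - u x = ∫ s in Icc x y, (balKernel s y - balKernel s x) • G s ∂μ

lemma exists_mem_openInterval_between {lo hi : EReal} {x : ℝ} (hx : x ∈ openInterval lo hi) :
    ∃ y z : ℝ, y < x ∧ x < z ∧ y ∈ openInterval lo hi ∧ z ∈ openInterval lo hi := by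
  obtain ⟨y, h1, h2⟩ := EReal.lt_iff_exists_real_btwn.1 hx.1
  obtain ⟨z, h3, h4⟩ := EReal.lt_iff_exists_real_btwn.1 hx.2
  exact ⟨y, z, EReal.coe_lt_coe_iff.1 h2, EReal.coe_lt_coe_iff.1 h3, ⟨h1, h2.trans hx.2⟩,
    ⟨hx.1.trans h3, h4⟩⟩

namespace BalPrim

variable {μ : Measure ℝ} {lo hi : EReal} {u G : ℝ → E}

lemma sub_eq (h : BalPrim μ lo hi u G) {K : Set ℝ} (hK : MeasurableSet K)
    (hGK : IntegrableOn G K μ) {x y : ℝ} (hx : x ∈ openInterval lo hi)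
    (hy : y ∈ openInterval lo hi) (hs : uIcc x y ⊆ K) :
    u y - u x = ∫ s in K, balKernel s y • G s ∂μ - ∫ s in K, balKernel s x • G s ∂μ := by
  rw [← integral_sub (integrableOn_balKernel_smul hGK y) (integrableOn_balKernel_smul hGK x)]
  simp only [← sub_smul]
  rcases le_total x y with hxy | hxy
  · rw [h.eq x hx y hy hxy]
    exact integral_balKernel_diff_of_subset hK hxy (by rwa [uIcc_of_le hxy] at hs) G
  · rw [← neg_sub, h.eq y hy x hx hxy,
      integral_balKernel_diff_of_subset hK hxy (by rwa [uIcc_of_ge hxy] at hs) G, ← integral_neg]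
    simp only [← neg_smul, neg_sub]

lemma of_mem (h : BalPrim μ lo hi u G) {lo' hi' : EReal}
    (hsub : openInterval lo' hi' ⊆ openInterval lo hi) : BalPrim μ lo' hi' u G :=
  ⟨fun x hx y hy => h.int x (hsub hx) y (hsub hy), fun x hx y hy => h.eq x (hsub hx) y (hsub hy)⟩

/-- The kernel and the indicator of (-∞, x) differ only at s = x, where the kernel carries half of
the atom. This half is the step from u⁻(x) to u(x). -/
lemma setIntegral_indicator_Iio {K : Set ℝ} {x : ℝ} (hG : IntegrableOn G K μ) (hx : x ∈ K) :
    ∫ s in K, (Iio x).indicator G s ∂μ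
      = ∫ s in K, balKernel s x • G s ∂μ - (2⁻¹ * μ.real {x}) • G x := by
  have h1 : (2⁻¹ * μ.real {x}) • G x = ∫ s in K, ({x} : Set ℝ).indicator (fun s => (2⁻¹ : ℝ) • G s) s ∂μ := by
    rw [setIntegral_indicator (measurableSet_singleton x),
      inter_eq_self_of_subset_right (singleton_subset_iff.2 hx), integral_singleton, smul_smul,
      mul_comm]
  have h2 : IntegrableOn (({x} : Set ℝ).indicator fun s => (2⁻¹ : ℝ) • G s) K μ :=
    (hG.integrable.smul (2⁻¹ : ℝ)).indicator (measurableSet_singleton x)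
  rw [h1, ← integral_sub (integrableOn_balKernel_smul hG x) h2]
  congr 1
  ext s
  rcases lt_trichotomy s x with h | rfl | h
  · simp [balKernel_of_lt h, h, h.ne]
  · simp [balKernel_self]
  · simp [balKernel_of_gt h, not_lt.2 h.le, h.ne']

lemma setIntegral_indicator_Iic {K : Set ℝ} {x : ℝ} (hG : IntegrableOn G K μ) (hx : x ∈ K) :
    ∫ s in K, (Iic x).indicator G s ∂μ
      = ∫ s in K, balKernel s x • G s ∂μ + (2⁻¹ * μ.real {x}) • G x := by
  have h1 : (2⁻¹ * μ.real {x}) • G x = ∫ s in K, ({x} : Set ℝ).indicator (fun s => (2⁻¹ : ℝ) • G s) s ∂μ := by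
    rw [setIntegral_indicator (measurableSet_singleton x),
      inter_eq_self_of_subset_right (singleton_subset_iff.2 hx), integral_singleton, smul_smul,
      mul_comm]
  have h2 : IntegrableOn (({x} : Set ℝ).indicator fun s => (2⁻¹ : ℝ) • G s) K μ :=
    (hG.integrable.smul (2⁻¹ : ℝ)).indicator (measurableSet_singleton x)
  rw [h1, ← integral_add (integrableOn_balKernel_smul hG x) h2]
  congr 1
  ext s
  rcases lt_trichotomy s x with h | rfl | h
  · simp [balKernel_of_lt h, h.le, h.ne]
  · rw [indicator_of_mem (mem_Iic.2 le_rfl), indicator_of_mem (mem_singleton s), balKernel_self,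
      ← add_smul]
    norm_num
  · simp [balKernel_of_gt h, not_le.2 h, h.ne']

/-- On a compact neighbourhood u differs from the kernel integral by a constant, so dominated
convergence gives the limit. -/
lemma tendsto_left (h : BalPrim μ lo hi u G) {x : ℝ} (hx : x ∈ openInterval lo hi) :
    Tendsto u (𝓝[<] x) (𝓝 (u x - (2⁻¹ * μ.real {x}) • G x)) := by
  obtain ⟨y, z, hyx, hxz, hy, hz⟩ := exists_mem_openInterval_between hx
  have hG := h.int y hy z hz
  have hxK : x ∈ Icc y z := ⟨hyx.le, hxz.le⟩
  have h1 := (tendsto_balKernel_left hG x).add_const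
    (u x - ∫ s in Icc y z, balKernel s x • G s ∂μ)
  rw [setIntegral_indicator_Iio hG hxK] at h1
  rw [show u x - (2⁻¹ * μ.real {x}) • G x = ∫ s in Icc y z, balKernel s x • G s ∂μ
    - (2⁻¹ * μ.real {x}) • G x + (u x - ∫ s in Icc y z, balKernel s x • G s ∂μ) by abel]
  refine h1.congr' ?_
  filter_upwards [Ioo_mem_nhdsLT hyx] with t ht
  have htK : t ∈ Icc y z := ⟨ht.1.le, (ht.2.trans hxz).le⟩
  have h2 := h.sub_eq measurableSet_Icc hG hx (openInterval_Icc_subset hy hz htK)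
    (uIcc_subset_Icc hxK htK)
  linear_combination (norm := module) (-1 : ℝ) • h2

lemma tendsto_right (h : BalPrim μ lo hi u G) {x : ℝ} (hx : x ∈ openInterval lo hi) :
    Tendsto u (𝓝[>] x) (𝓝 (u x + (2⁻¹ * μ.real {x}) • G x)) := by
  obtain ⟨y, z, hyx, hxz, hy, hz⟩ := exists_mem_openInterval_between hx
  have hG := h.int y hy z hz
  have hxK : x ∈ Icc y z := ⟨hyx.le, hxz.le⟩
  have h1 := (tendsto_balKernel_right hG x).add_const
    (u x - ∫ s in Icc y z, balKernel s x • G s ∂μ)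
  rw [setIntegral_indicator_Iic hG hxK] at h1
  rw [show u x + (2⁻¹ * μ.real {x}) • G x = ∫ s in Icc y z, balKernel s x • G s ∂μ
    + (2⁻¹ * μ.real {x}) • G x + (u x - ∫ s in Icc y z, balKernel s x • G s ∂μ) by abel]
  refine h1.congr' ?_
  filter_upwards [Ioo_mem_nhdsGT hxz] with t ht
  have htK : t ∈ Icc y z := ⟨(hyx.trans ht.1).le, ht.2.le⟩
  have h2 := h.sub_eq measurableSet_Icc hG hx (openInterval_Icc_subset hy hz htK)
    (uIcc_subset_Icc hxK htK)
  linear_combination (norm := module) (-1 : ℝ) • h2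

lemma leftLim_eq (h : BalPrim μ lo hi u G) {x : ℝ} (hx : x ∈ openInterval lo hi) :
    Function.leftLim u x = u x - (2⁻¹ * μ.real {x}) • G x :=
  leftLim_eq_of_tendsto (h.tendsto_left hx)

lemma rightLim_eq (h : BalPrim μ lo hi u G) {x : ℝ} (hx : x ∈ openInterval lo hi) :
    Function.rightLim u x = u x + (2⁻¹ * μ.real {x}) • G x :=
  rightLim_eq_of_tendsto (h.tendsto_right hx)

lemma rightLim_sub_leftLim (h : BalPrim μ lo hi u G) {x y : ℝ} (hx : x ∈ openInterval lo hi)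
    (hy : y ∈ openInterval lo hi) (hxy : x ≤ y) :
    Function.rightLim u y - Function.leftLim u x = ∫ s in Icc x y, G s ∂μ := by
  have hG := h.int x hx y hy
  have e1 := setIntegral_indicator_Iic hG (right_mem_Icc.2 hxy)
  have e2 := setIntegral_indicator_Iio hG (left_mem_Icc.2 hxy)
  have e3 := h.sub_eq measurableSet_Icc hG hx hy (by rw [uIcc_of_le hxy])
  have e4 : ∫ s in Icc x y, (Iic y).indicator G s ∂μ = ∫ s in Icc x y, G s ∂μ :=
    setIntegral_congr_fun measurableSet_Icc fun s hs => by simp [hs.2]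
  have e5 : ∫ s in Icc x y, (Iio x).indicator G s ∂μ = 0 := by
    rw [← integral_zero ℝ E (μ := μ.restrict (Icc x y))]
    exact setIntegral_congr_fun measurableSet_Icc fun s hs => by simp [hs.1]
  rw [e4] at e1
  rw [e5] at e2
  rw [h.rightLim_eq hy, h.leftLim_eq hx, e1]
  rw [eq_comm, sub_eq_zero] at e2
  rw [e2] at e3
  rw [← sub_eq_zero] at e3 ⊢
  rw [← e3]; abel

lemma norm_sub_le (h : BalPrim μ lo hi u G) {K : Set ℝ}
    (hGK : IntegrableOn G K μ) {x y : ℝ} (hx : x ∈ openInterval lo hi)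
    (hy : y ∈ openInterval lo hi) (hs : uIcc x y ⊆ K) :
    ‖u y - u x‖ ≤ ∫ s in K, ‖G s‖ ∂μ := by
  wlog hxy : x ≤ y generalizing x y
  · rw [norm_sub_rev]; exact this hy hx (by rwa [uIcc_comm]) (le_of_not_ge hxy)
  rw [uIcc_of_le hxy] at hs
  rw [h.eq x hx y hy hxy]
  refine (norm_integral_le_integral_norm _).trans ?_
  refine (integral_mono_of_nonneg (Eventually.of_forall fun _ => norm_nonneg _)
    (hGK.mono_set hs).norm (Eventually.of_forall fun s => ?_)).trans
    (setIntegral_mono_set hGK.norm (Eventually.of_forall fun _ => norm_nonneg _)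
      hs.eventuallyLE)
  change ‖_ • G s‖ ≤ ‖G s‖
  rw [norm_smul, Real.norm_eq_abs]
  refine mul_le_of_le_one_left (norm_nonneg _) ?_
  rw [abs_le]
  have := abs_le.1 (abs_balKernel_le s x)
  have := abs_le.1 (abs_balKernel_le s y)
  have := balKernel_nonneg s x
  have := balKernel_nonneg s y
  constructor <;> linarith

lemma congr (h : BalPrim μ lo hi u G) {v F : ℝ → E}
    (hu : ∀ x ∈ openInterval lo hi, v x = u x) (hG : ∀ x ∈ openInterval lo hi, F x = G x) :
    BalPrim μ lo hi v F := by
  refine ⟨fun x hx y hy => (h.int x hx y hy).congr_fun (fun s hs => ?_) measurableSet_Icc,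
    fun x hx y hy hxy => ?_⟩
  · exact (hG s (openInterval_Icc_subset hx hy hs)).symm
  · rw [hu x hx, hu y hy, h.eq x hx y hy hxy]
    refine setIntegral_congr_fun measurableSet_Icc fun s hs => ?_
    simp only [hG s (openInterval_Icc_subset hx hy hs)]

lemma clm {F : Type*} [NormedAddCommGroup F] [NormedSpace ℝ F] [CompleteSpace F]
    (L : E →L[ℝ] F) (h : BalPrim μ lo hi u G) :
    BalPrim μ lo hi (fun x => L (u x)) (fun x => L (G x)) := by
  refine ⟨fun x hx y hy => L.integrable_comp (h.int x hx y hy), fun x hx y hy hxy => ?_⟩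
  rw [← map_sub, h.eq x hx y hy hxy, ← ContinuousLinearMap.integral_comp_comm]
  · simp
  · simp only [sub_smul]
    exact (integrableOn_balKernel_smul (h.int x hx y hy) y).sub
      (integrableOn_balKernel_smul (h.int x hx y hy) x)

end BalPrim

lemma openInterval_mono {lo hi lo' hi' : EReal} (h1 : lo ≤ lo') (h2 : hi' ≤ hi) :
    openInterval lo' hi' ⊆ openInterval lo hi :=
  fun _ hx => ⟨h1.trans_lt hx.1, hx.2.trans_le h2⟩

/-- The increments of u are dominated by those of the monotone function M built from ‖G‖ with the
same kernel, and monotone functions have finite variation on compact intervals. -/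
lemma BalPrim.locallyBV {μ : Measure ℝ} {lo hi : EReal} {u G : ℝ → E}
    (h : BalPrim μ lo hi u G) : LocallyBoundedVariationOn u (openInterval lo hi) := by
  intro x y hx hy
  rcases le_or_gt x y with hxy | hxy
  swap
  · rw [Icc_eq_empty (not_le.2 hxy), inter_empty]
    exact BoundedVariationOn.of_subsingleton subsingleton_empty
  rw [inter_eq_self_of_subset_right (openInterval_Icc_subset hx hy)]
  have hG := h.int x hx y hy
  set M : ℝ → ℝ := fun t => ∫ s in Icc x y, balKernel s t • ‖G s‖ ∂μ with hM
  have key : ∀ s ∈ Icc x y, ∀ t ∈ Icc x y, s ≤ t → ‖u t - u s‖ ≤ M t - M s := by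
    intro s hs t ht hst
    rw [hM]
    dsimp only
    rw [← integral_sub (integrableOn_balKernel_smul hG.norm t)
      (integrableOn_balKernel_smul hG.norm s)]
    rw [h.eq s (openInterval_Icc_subset hx hy hs) t (openInterval_Icc_subset hx hy ht) hst,
      integral_balKernel_diff_of_subset measurableSet_Icc hst (Icc_subset_Icc hs.1 ht.2)]
    refine (norm_integral_le_integral_norm _).trans_eq ?_
    congr 1
    ext r
    rw [norm_smul, ← sub_smul, Real.norm_eq_abs, abs_of_nonneg, smul_eq_mul]
    unfold balKernel
    split_ifs <;> linarith
  have hMm : MonotoneOn M (Icc x y) := fun s hs t ht hst => by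
    have := (norm_nonneg _).trans (key s hs t ht hst)
    linarith
  have hMbv := hMm.locallyBoundedVariationOn x y (left_mem_Icc.2 hxy) (right_mem_Icc.2 hxy)
  rw [inter_self] at hMbv
  refine ne_top_of_le_ne_top hMbv ?_
  refine iSup_le fun p => le_trans (Finset.sum_le_sum fun i _ => ?_)
    (eVariationOn.sum_le (f := M) p.2.2.1 p.2.2.2)
  rw [edist_eq_enorm_sub, edist_dist, Real.dist_eq, ← ofReal_norm]
  have := key _ (p.2.2.2 i) _ (p.2.2.2 (i + 1)) (p.2.2.1 (Nat.le_succ i))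
  exact ENNReal.ofReal_le_ofReal (this.trans (le_abs_self _))

lemma BalPrim.isBalancedBV {n : ℕ} {μ : Measure ℝ} {lo hi : EReal} {u G : ℝ → Fin n → ℂ}
    (h : BalPrim μ lo hi u G) : IsBalancedBV lo hi u := by
  refine ⟨h.locallyBV, fun x hx => ?_⟩
  rw [h.leftLim_eq hx, h.rightLim_eq hx]
  module

/-- The case x = y of the hypothesis gives the jump μ{x} G(x). As u is balanced, u(x) lies half of
it away from either one-sided limit, which converts statements on limits into statements on values.
-/
lemma BalPrim.of_equation {n : ℕ} {μ : Measure ℝ} {lo hi : EReal} {u G : ℝ → Fin n → ℂ}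
    (hb : IsBalancedBV lo hi u)
    (hG : ∀ x ∈ openInterval lo hi, ∀ y ∈ openInterval lo hi, IntegrableOn G (Icc x y) μ)
    (h : ∀ x ∈ openInterval lo hi, ∀ y ∈ openInterval lo hi, x ≤ y →
      Function.rightLim u y - Function.leftLim u x = ∫ s in Icc x y, G s ∂μ) :
    BalPrim μ lo hi u G := by
  refine ⟨hG, fun x hx y hy hxy => ?_⟩
  have hGi := hG x hx y hy
  have e1 := BalPrim.setIntegral_indicator_Iic hGi (right_mem_Icc.2 hxy)
  have e2 := BalPrim.setIntegral_indicator_Iio hGi (left_mem_Icc.2 hxy)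
  have e4 : ∫ s in Icc x y, (Iic y).indicator G s ∂μ = ∫ s in Icc x y, G s ∂μ :=
    setIntegral_congr_fun measurableSet_Icc fun s hs => by simp [hs.2]
  have e5 : ∫ s in Icc x y, (Iio x).indicator G s ∂μ = 0 := by
    rw [← integral_zero ℝ (Fin n → ℂ) (μ := μ.restrict (Icc x y))]
    exact setIntegral_congr_fun measurableSet_Icc fun s hs => by simp [hs.1]
  have h1 := h x hx y hy hxy
  have hxx := h x hx x hx le_rfl
  have hyy := h y hy y hy le_rfl
  rw [Icc_self, integral_singleton] at hxx hyy
  rw [e4] at e1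
  rw [e5] at e2
  simp only [sub_smul]
  rw [integral_sub (integrableOn_balKernel_smul hGi y) (integrableOn_balKernel_smul hGi x)]
  have e6 : ∫ s in Icc x y, balKernel s x • G s ∂μ = (2⁻¹ * μ.real {x}) • G x := by
    rw [eq_comm, sub_eq_zero] at e2; exact e2
  have e7 : ∫ s in Icc x y, balKernel s y • G s ∂μ
      = ∫ s in Icc x y, G s ∂μ - (2⁻¹ * μ.real {y}) • G y := by rw [e1]; abel
  rw [e6, e7, mul_smul, mul_smul, ← hxx, ← hyy, ← h1, hb.2 x hx, hb.2 y hy]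
  module

/-- Integration by parts for balanced primitives. -/
lemma BalPrim.mul {μ : Measure ℝ} {lo hi : EReal} {φ ψ F G : ℝ → ℂ}
    (h : BalPrim μ lo hi φ F) (k : BalPrim μ lo hi ψ G) {x y : ℝ} (hx : x ∈ openInterval lo hi)
    (hy : y ∈ openInterval lo hi) (hxy : x ≤ y) (hμ : μ (Icc x y) < ⊤) :
    IntegrableOn (fun t => φ t * G t + F t * ψ t) (Icc x y) μ ∧
    Function.rightLim φ y * Function.rightLim ψ y - Function.leftLim φ x * Function.leftLim ψ x
      = ∫ t in Icc x y, (φ t * G t + F t * ψ t) ∂μ := by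
  have hF := h.int x hx y hy
  have hG := k.int x hx y hy
  have : IsFiniteMeasure (μ.restrict (Icc x y)) := ⟨by rwa [Measure.restrict_apply_univ]⟩
  set κ := μ.restrict (Icc x y) with hκ
  have rep : ∀ {ψ G : ℝ → ℂ}, BalPrim μ lo hi ψ G → ∀ t ∈ Icc x y,
      ψ t = Function.leftLim ψ x + ∫ s, balKernel s t • G s ∂κ := by
    intro ψ G k t ht
    have hG := k.int x hx y hy
    have e2 := BalPrim.setIntegral_indicator_Iio hG (left_mem_Icc.2 hxy)
    have e5 : ∫ s in Icc x y, (Iio x).indicator G s ∂μ = 0 := by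
      rw [← integral_zero ℝ ℂ (μ := μ.restrict (Icc x y))]
      exact setIntegral_congr_fun measurableSet_Icc fun s hs => by simp [hs.1]
    rw [e5, eq_comm, sub_eq_zero] at e2
    have e3 := k.sub_eq measurableSet_Icc hG hx (openInterval_Icc_subset hx hy ht)
      (uIcc_subset_Icc (left_mem_Icc.2 hxy) ht)
    rw [e2] at e3
    rw [k.leftLim_eq hx, hκ, ← sub_eq_zero]
    rw [← sub_eq_zero] at e3
    rw [← e3]; abel
  -- Fubini: the product of the total masses of F and G is split by the kernel and its transpose,
  -- whose sum is 1 by `balKernel_add_swap`. Integrated in one variable, each part becomes one of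
  -- the two terms of the product rule.
  have hFG : Integrable (fun p : ℝ × ℝ => F p.1 * G p.2) (κ.prod κ) := hF.mul_prod hG
  have hk1 : Integrable (fun p : ℝ × ℝ => balKernel p.1 p.2 • (F p.1 * G p.2)) (κ.prod κ) := by
    refine hFG.mono (measurable_balKernel_uncurry.aestronglyMeasurable.smul hFG.1)
      (Eventually.of_forall fun p => ?_)
    rw [norm_smul, Real.norm_eq_abs]
    exact mul_le_of_le_one_left (norm_nonneg _) (abs_balKernel_le _ _)
  have hk2 : Integrable (fun p : ℝ × ℝ => balKernel p.2 p.1 • (F p.1 * G p.2)) (κ.prod κ) := by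
    refine hFG.mono ((measurable_balKernel_uncurry.comp measurable_swap).aestronglyMeasurable.smul
      hFG.1) (Eventually.of_forall fun p => ?_)
    rw [norm_smul, Real.norm_eq_abs]
    exact mul_le_of_le_one_left (norm_nonneg _) (abs_balKernel_le _ _)
  have i1 : Integrable (fun t => Function.leftLim φ x * G t
      + ∫ s, balKernel s t • (F s * G t) ∂κ) κ :=
    (hG.const_mul _).add hk1.integral_prod_right
  have i2 : Integrable (fun t => F t * Function.leftLim ψ x
      + ∫ s, balKernel s t • (F t * G s) ∂κ) κ :=
    (hF.mul_const _).add hk2.integral_prod_left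
  have c1 : ∀ t ∈ Icc x y, φ t * G t = Function.leftLim φ x * G t
      + ∫ s, balKernel s t • (F s * G t) ∂κ := fun t ht => by
    conv_lhs => rw [rep h t ht, add_mul, ← integral_mul_const]
    simp only [smul_mul_assoc]
  have c2 : ∀ t ∈ Icc x y, F t * ψ t = F t * Function.leftLim ψ x
      + ∫ s, balKernel s t • (F t * G s) ∂κ := fun t ht => by
    conv_lhs => rw [rep k t ht, mul_add, ← integral_const_mul]
    simp only [mul_smul_comm]
  have j1 : Integrable (fun t => φ t * G t) κ :=
    i1.congr ((ae_restrict_iff' measurableSet_Icc).2 (Eventually.of_forall fun t ht =>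
      (c1 t ht).symm))
  have j2 : Integrable (fun t => F t * ψ t) κ :=
    i2.congr ((ae_restrict_iff' measurableSet_Icc).2 (Eventually.of_forall fun t ht =>
      (c2 t ht).symm))
  refine ⟨j1.add j2, ?_⟩
  rw [integral_add j1 j2, setIntegral_congr_fun measurableSet_Icc c1,
    setIntegral_congr_fun measurableSet_Icc c2, ← hκ,
    integral_add (hG.const_mul _) hk1.integral_prod_right,
    integral_add (hF.mul_const _) hk2.integral_prod_left]
  have s1 : ∫ t, ∫ s, balKernel s t • (F s * G t) ∂κ ∂κ
      = ∫ p, balKernel p.1 p.2 • (F p.1 * G p.2) ∂(κ.prod κ) := (integral_prod_symm _ hk1).symm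
  have s2 : ∫ t, ∫ s, balKernel s t • (F t * G s) ∂κ ∂κ
      = ∫ p, balKernel p.2 p.1 • (F p.1 * G p.2) ∂(κ.prod κ) := (integral_prod _ hk2).symm
  have s3 : ∫ p, balKernel p.1 p.2 • (F p.1 * G p.2) ∂(κ.prod κ)
      + ∫ p, balKernel p.2 p.1 • (F p.1 * G p.2) ∂(κ.prod κ) = (∫ t, F t ∂κ) * ∫ t, G t ∂κ := by
    rw [← integral_add hk1 hk2, ← integral_prod_mul]
    congr 1
    ext p
    rw [← add_smul, balKernel_add_swap, one_smul]
  rw [s1, s2, integral_const_mul, integral_mul_const]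
  have r1 := h.rightLim_sub_leftLim hx hy hxy
  have r2 := k.rightLim_sub_leftLim hx hy hxy
  rw [sub_eq_iff_eq_add] at r1 r2
  rw [r1, r2, ← hκ]
  linear_combination -s3

end BalancedPrimitive

/-! ### Bounds and measurability for matrices and vector-valued functions -/

section MatrixEstimates

variable {n : ℕ}

/-- The sum of the absolute values of the entries of a matrix. -/
def entrySum (A : Matrix (Fin n) (Fin n) ℂ) : ℝ := ∑ j, ∑ k, ‖A j k‖

lemma entrySum_nonneg (A : Matrix (Fin n) (Fin n) ℂ) : 0 ≤ entrySum A :=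
  Finset.sum_nonneg fun _ _ => Finset.sum_nonneg fun _ _ => norm_nonneg _

lemma norm_mulVec_le (A : Matrix (Fin n) (Fin n) ℂ) (x : Fin n → ℂ) :
    ‖A *ᵥ x‖ ≤ entrySum A * ‖x‖ := by
  refine (pi_norm_le_iff_of_nonneg (mul_nonneg (entrySum_nonneg A) (norm_nonneg x))).2 fun j => ?_
  calc ‖(A *ᵥ x) j‖ ≤ ∑ k, ‖A j k * x k‖ := norm_sum_le Finset.univ fun k => A j k * x k
    _ ≤ ∑ k, ‖A j k‖ * ‖x‖ := Finset.sum_le_sum fun k _ => by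
        rw [norm_mul]; gcongr; exact norm_le_pi_norm x k
    _ = (∑ k, ‖A j k‖) * ‖x‖ := (Finset.sum_mul ..).symm
    _ ≤ entrySum A * ‖x‖ := by
        gcongr
        exact Finset.single_le_sum (f := fun j => ∑ k, ‖A j k‖)
          (fun _ _ => Finset.sum_nonneg fun _ _ => norm_nonneg _) (Finset.mem_univ j)

lemma integrableOn_entrySum {μ : Measure ℝ} {K : Set ℝ} {A : ℝ → Matrix (Fin n) (Fin n) ℂ}
    (hA : ∀ j k, IntegrableOn (fun x => A x j k) K μ) :
    IntegrableOn (fun x => entrySum (A x)) K μ :=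
  integrable_finsetSum _ fun j _ => integrable_finsetSum _ fun k _ => (hA j k).norm

lemma aestronglyMeasurable_vec {μ : Measure ℝ} {f : ℝ → Fin n → ℂ}
    (h : ∀ j, AEStronglyMeasurable (fun x => f x j) μ) : AEStronglyMeasurable f μ :=
  (aemeasurable_pi_lambda _ fun j => (h j).aemeasurable).aestronglyMeasurable

lemma aestronglyMeasurable_mulVec {μ : Measure ℝ} {A : ℝ → Matrix (Fin n) (Fin n) ℂ}
    {u : ℝ → Fin n → ℂ} (hA : ∀ j k, AEStronglyMeasurable (fun x => A x j k) μ)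
    (hu : AEStronglyMeasurable u μ) : AEStronglyMeasurable (fun x => A x *ᵥ u x) μ := by
  refine aestronglyMeasurable_vec fun j => ?_
  simp only [Matrix.mulVec, dotProduct]
  exact Finset.aestronglyMeasurable_fun_sum _ fun k _ =>
    (hA j k).mul ((continuous_apply k).comp_aestronglyMeasurable hu)

lemma integrableOn_mulVec {μ : Measure ℝ} {K : Set ℝ} (hK : MeasurableSet K)
    {A : ℝ → Matrix (Fin n) (Fin n) ℂ} {u : ℝ → Fin n → ℂ} {C : ℝ}
    (hA : ∀ j k, IntegrableOn (fun x => A x j k) K μ)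
    (hu : AEStronglyMeasurable u (μ.restrict K)) (hC : ∀ x ∈ K, ‖u x‖ ≤ C) :
    IntegrableOn (fun x => A x *ᵥ u x) K μ := by
  refine Integrable.mono' ((integrableOn_entrySum hA).mul_const C)
    (aestronglyMeasurable_mulVec (fun j k => (hA j k).1) hu) ?_
  refine (ae_restrict_iff' hK).2 (Eventually.of_forall fun x hx => ?_)
  exact (norm_mulVec_le _ _).trans (mul_le_mul_of_nonneg_left (hC x hx) (entrySum_nonneg _))

lemma star_mulVec_of_im_eq_zero {A : Matrix (Fin n) (Fin n) ℂ} (hA : ∀ j k, (A j k).im = 0)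
    (x : Fin n → ℂ) : star (A *ᵥ x) = A *ᵥ star x := by
  ext j
  simp only [Matrix.mulVec, dotProduct, Pi.star_apply, star_sum, star_mul']
  refine Finset.sum_congr rfl fun k _ => ?_
  congr 1
  exact Complex.conj_eq_iff_im.2 (hA j k)

/-- Multiplication by a matrix, as a real-linear continuous map. -/
def mulVecCLM (A : Matrix (Fin n) (Fin n) ℂ) : (Fin n → ℂ) →L[ℝ] (Fin n → ℂ) :=
  (LinearMap.toContinuousLinearMap (Matrix.mulVecLin A)).restrictScalars ℝ

lemma mulVecCLM_apply (A : Matrix (Fin n) (Fin n) ℂ) (x : Fin n → ℂ) :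
    mulVecCLM A x = A *ᵥ x := rfl

/-- Entrywise complex conjugation. -/
def conjCLM : (Fin n → ℂ) →L[ℝ] (Fin n → ℂ) :=
  ContinuousLinearMap.pi fun j =>
    Complex.conjCLE.toContinuousLinearMap.comp (ContinuousLinearMap.proj j)

lemma conjCLM_apply (x : Fin n → ℂ) : conjCLM x = star x := rfl

lemma IsBalancedBV.exists_bound {lo hi : EReal} {u : ℝ → Fin n → ℂ} (h : IsBalancedBV lo hi u)
    {x y : ℝ} (hx : x ∈ openInterval lo hi) (hy : y ∈ openInterval lo hi) :
    ∃ C, ∀ t ∈ Icc x y, ‖u t‖ ≤ C := by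
  refine ⟨‖u x‖ + (eVariationOn u (openInterval lo hi ∩ Icc x y)).toReal, fun t ht => ?_⟩
  have h1 := (h.1 x y hx hy).dist_le ⟨openInterval_Icc_subset hx hy ht, ht⟩
    ⟨hx, left_mem_Icc.2 (ht.1.trans ht.2)⟩
  rw [dist_eq_norm] at h1
  have := norm_le_insert' (u t) (u x)
  linarith

/-- The real and imaginary parts of the components are differences of monotone functions. -/
lemma LocallyBoundedVariationOn.aestronglyMeasurable {u : ℝ → Fin n → ℂ} {s : Set ℝ}
    (hs : MeasurableSet s) (h : LocallyBoundedVariationOn u s) (μ : Measure ℝ) :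
    AEStronglyMeasurable u (μ.restrict s) := by
  have key : ∀ φ : ℝ → ℝ, LocallyBoundedVariationOn φ s → AEMeasurable φ (μ.restrict s) := by
    intro φ hφ
    obtain ⟨p, q, hp, hq, e⟩ := hφ.exists_monotoneOn_sub_monotoneOn
    rw [e]
    exact (aemeasurable_restrict_of_monotoneOn hs hp).sub
      (aemeasurable_restrict_of_monotoneOn hs hq)
  refine aestronglyMeasurable_vec fun j => AEMeasurable.aestronglyMeasurable ?_
  have hre : LocallyBoundedVariationOn (fun x => (u x j).re) s :=
    ((Complex.reCLM.comp ((ContinuousLinearMap.proj j :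
      (Fin n → ℂ) →L[ℂ] ℂ).restrictScalars ℝ)).lipschitz).comp_locallyBoundedVariationOn h
  have him : LocallyBoundedVariationOn (fun x => (u x j).im) s :=
    ((Complex.imCLM.comp ((ContinuousLinearMap.proj j :
      (Fin n → ℂ) →L[ℂ] ℂ).restrictScalars ℝ)).lipschitz).comp_locallyBoundedVariationOn h
  have h3 := ((Complex.measurable_ofReal.comp_aemeasurable (key _ hre))).add
    ((Complex.measurable_ofReal.comp_aemeasurable (key _ him)).mul_const Complex.I)
  refine h3.congr (Eventually.of_forall fun x => ?_)
  exact Complex.re_add_im (u x j)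

end MatrixEstimates

/-! ### The equation in terms of balanced primitives, and Green's identity -/

namespace FirstOrderSystem

variable {n : ℕ} (S : FirstOrderSystem n)

lemma measurableSet_interval : MeasurableSet S.interval :=
  (isOpen_openInterval _ _).measurableSet

lemma J_mul_inv : S.J * S.J⁻¹ = 1 :=
  Matrix.mul_nonsing_inv _ ((Matrix.isUnit_iff_isUnit_det _).1 S.J_invertible)

lemma inv_mul_J : S.J⁻¹ * S.J = 1 :=
  Matrix.nonsing_inv_mul _ ((Matrix.isUnit_iff_isUnit_det _).1 S.J_invertible)

lemma J_mulVec_inv (x : Fin n → ℂ) : S.J *ᵥ (S.J⁻¹ *ᵥ x) = x := by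
  rw [Matrix.mulVec_mulVec, J_mul_inv, Matrix.one_mulVec]

lemma inv_mulVec_J (x : Fin n → ℂ) : S.J⁻¹ *ᵥ (S.J *ᵥ x) = x := by
  rw [Matrix.mulVec_mulVec, inv_mul_J, Matrix.one_mulVec]

variable {S}

lemma measure_lt_top {K : Set ℝ} {x y : ℝ} (hx : x ∈ S.interval) (hy : y ∈ S.interval)
    (hK : K ⊆ Icc x y) : S.μ K < ⊤ :=
  (measure_mono hK).trans_lt (S.μ_lt_top _ isCompact_Icc (openInterval_Icc_subset hx hy))

lemma W_integrableOn {K : Set ℝ} {x y : ℝ} (hx : x ∈ S.interval) (hy : y ∈ S.interval)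
    (hK : K ⊆ Icc x y) (j k : Fin n) : IntegrableOn (fun t => S.W t j k) K S.μ :=
  ((S.W_locallyIntegrable j k).integrableOn_compact_subset
    (openInterval_Icc_subset hx hy) isCompact_Icc).mono_set hK

lemma Q_integrableOn {K : Set ℝ} {x y : ℝ} (hx : x ∈ S.interval) (hy : y ∈ S.interval)
    (hK : K ⊆ Icc x y) (j k : Fin n) : IntegrableOn (fun t => S.Q t j k) K S.μ :=
  ((S.Q_locallyIntegrable j k).integrableOn_compact_subset
    (openInterval_Icc_subset hx hy) isCompact_Icc).mono_set hK

/-- The equation is solved for the derivative with J⁻¹. With the converse `BalPrim.solves`, all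
questions about solutions become questions about primitives of an explicit density. -/
lemma Solves.balPrim {lo hi : EReal} {u f : ℝ → Fin n → ℂ} (h : S.Solves lo hi u f) :
    BalPrim S.μ lo hi u fun x => S.J⁻¹ *ᵥ (S.W x *ᵥ f x - S.Q x *ᵥ u x) := by
  refine BalPrim.of_equation h.balanced (fun x hx y hy => ?_) fun x hx y hy hxy => ?_
  · exact (mulVecCLM S.J⁻¹).integrable_comp
      ((h.wf_integrable x hx y hy).sub (h.qu_integrable x hx y hy))
  · have e := (mulVecCLM S.J⁻¹).integral_comp_comm
      ((h.wf_integrable x hx y hy).sub (h.qu_integrable x hx y hy))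
    simp only [mulVecCLM_apply, Pi.sub_apply] at e
    rw [e, integral_sub (h.wf_integrable x hx y hy) (h.qu_integrable x hx y hy),
      ← h.equation x hx y hy hxy, add_sub_cancel_right, inv_mulVec_J]

lemma _root_.BalPrim.solves {lo hi : EReal} (hsub : openInterval lo hi ⊆ S.interval)
    {u f G : ℝ → Fin n → ℂ} (h : BalPrim S.μ lo hi u G)
    (hG : ∀ x ∈ openInterval lo hi, S.J *ᵥ G x = S.W x *ᵥ f x - S.Q x *ᵥ u x) :
    S.Solves lo hi u f := by
  have hq : ∀ x ∈ openInterval lo hi, ∀ y ∈ openInterval lo hi,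
      IntegrableOn (fun t => S.Q t *ᵥ u t) (Icc x y) S.μ := fun x hx y hy => by
    obtain ⟨C, hC⟩ := h.isBalancedBV.exists_bound hx hy
    exact integrableOn_mulVec measurableSet_Icc
      (Q_integrableOn (hsub hx) (hsub hy) le_rfl)
      ((h.locallyBV.aestronglyMeasurable (isOpen_openInterval lo hi).measurableSet S.μ).mono_measure
        (Measure.restrict_mono (openInterval_Icc_subset hx hy) le_rfl)) hC
  have hJ : ∀ x ∈ openInterval lo hi, ∀ y ∈ openInterval lo hi,
      IntegrableOn (fun t => S.J *ᵥ G t) (Icc x y) S.μ := fun x hx y hy =>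
    (mulVecCLM S.J).integrable_comp (h.int x hx y hy)
  have e1 : ∀ x ∈ openInterval lo hi, S.W x *ᵥ f x = S.J *ᵥ G x + S.Q x *ᵥ u x :=
    fun x hx => by rw [hG x hx]; abel
  refine ⟨h.isBalancedBV, hq, fun x hx y hy => ?_, fun x hx y hy hxy => ?_⟩
  · exact ((hJ x hx y hy).add (hq x hx y hy)).congr_fun (fun t ht =>
      (e1 t (openInterval_Icc_subset hx hy ht)).symm) measurableSet_Icc
  · rw [setIntegral_congr_fun measurableSet_Icc
      fun t ht => e1 t (openInterval_Icc_subset hx hy ht),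
      integral_add (hJ x hx y hy) (hq x hx y hy), h.rightLim_sub_leftLim hx hy hxy]
    congr 1
    have := (mulVecCLM S.J).integral_comp_comm (h.int x hx y hy)
    simp only [mulVecCLM_apply] at this
    exact this.symm

lemma Solves.mono {lo hi lo' hi' : EReal} {u f : ℝ → Fin n → ℂ} (h : S.Solves lo hi u f)
    (hsub : openInterval lo' hi' ⊆ openInterval lo hi) : S.Solves lo' hi' u f :=
  ⟨⟨fun p q hp hq => (h.balanced.1 p q (hsub hp) (hsub hq)).mono
      (inter_subset_inter_left _ hsub), fun x hx => h.balanced.2 x (hsub hx)⟩,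
    fun x hx y hy => h.qu_integrable x (hsub hx) y (hsub hy),
    fun x hx y hy => h.wf_integrable x (hsub hx) y (hsub hy),
    fun x hx y hy => h.equation x (hsub hx) y (hsub hy)⟩

lemma Solves.congr {lo hi : EReal} (hsub : openInterval lo hi ⊆ S.interval)
    {u f v g : ℝ → Fin n → ℂ} (h : S.Solves lo hi u f)
    (hu : ∀ x ∈ openInterval lo hi, v x = u x)
    (hf : ∀ x ∈ openInterval lo hi, S.W x *ᵥ g x = S.W x *ᵥ f x) : S.Solves lo hi v g := by
  refine (h.balPrim.congr hu fun x hx => rfl).solves hsub fun x hx => ?_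
  rw [J_mulVec_inv, hf x hx, hu x hx]

/-- The right-hand side matters only almost everywhere. -/
lemma Solves.congr_ae {lo hi : EReal} {u f g : ℝ → Fin n → ℂ} (h : S.Solves lo hi u f)
    (hf : ∀ᵐ x ∂S.μ.restrict (openInterval lo hi), S.W x *ᵥ g x = S.W x *ᵥ f x) :
    S.Solves lo hi u g := by
  have key : ∀ x ∈ openInterval lo hi, ∀ y ∈ openInterval lo hi,
      ∀ᵐ t ∂S.μ.restrict (Icc x y), S.W t *ᵥ g t = S.W t *ᵥ f t := fun x hx y hy =>
    ae_mono (Measure.restrict_mono (openInterval_Icc_subset hx hy) le_rfl) hf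
  refine ⟨h.balanced, h.qu_integrable, fun x hx y hy => ?_, fun x hx y hy hxy => ?_⟩
  · exact (h.wf_integrable x hx y hy).congr ((key x hx y hy).mono fun t ht => ht.symm)
  · rw [h.equation x hx y hy hxy]
    exact integral_congr_ae ((key x hx y hy).mono fun t ht => ht.symm)

/-- The skew-Hermitian form `v* J u`. -/
def form (S : FirstOrderSystem n) (v u : Fin n → ℂ) : ℂ := star v ⬝ᵥ (S.J *ᵥ u)

lemma form_add_right (v u u' : Fin n → ℂ) : S.form v (u + u') = S.form v u + S.form v u' := by
  simp [form, Matrix.mulVec_add]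

lemma form_smul_right (c : ℂ) (v u : Fin n → ℂ) : S.form v (c • u) = c * S.form v u := by
  simp [form, Matrix.mulVec_smul]

lemma form_add_left (v v' u : Fin n → ℂ) : S.form (v + v') u = S.form v u + S.form v' u := by
  simp [form, star_add]

lemma form_smul_left (c : ℂ) (v u : Fin n → ℂ) : S.form (c • v) u = star c * S.form v u := by
  simp [form, star_smul]

lemma form_zero_left (u : Fin n → ℂ) : S.form 0 u = 0 := by simp [form]

lemma form_zero_right (u : Fin n → ℂ) : S.form u 0 = 0 := by simp [form]

lemma star_form (v u : Fin n → ℂ) : star (S.form v u) = -S.form u v := by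
  rw [form, form, Matrix.star_dotProduct, star_star, Matrix.star_mulVec, S.J_skewHermitian,
    Matrix.vecMul_neg, neg_dotProduct, Matrix.dotProduct_mulVec]

lemma continuous_form : Continuous fun p : (Fin n → ℂ) × (Fin n → ℂ) => S.form p.1 p.2 := by
  unfold form
  fun_prop

lemma form_eq_sum (v u : Fin n → ℂ) :
    S.form v u = ∑ j, ∑ k, S.J j k * (star (v j) * u k) := by
  simp only [form, dotProduct, Matrix.mulVec, Finset.mul_sum, Pi.star_apply]
  exact Finset.sum_congr rfl fun j _ => Finset.sum_congr rfl fun k _ => by ring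

/-- The terms with q cancel because Q is Hermitian and J skew-Hermitian. What remains is the
integrand of Green's identity, that is v*Ju' + (v')*Ju with densities in place of derivatives. -/
lemma form_mulVec_inv_add (x : ℝ) (hx : x ∈ S.interval) (v u f g : Fin n → ℂ) :
    S.form v (S.J⁻¹ *ᵥ (S.W x *ᵥ f - S.Q x *ᵥ u))
      + S.form (S.J⁻¹ *ᵥ (S.W x *ᵥ g - S.Q x *ᵥ v)) u
      = star v ⬝ᵥ (S.W x *ᵥ f) - star g ⬝ᵥ (S.W x *ᵥ u) := by
  rw [form, J_mulVec_inv]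
  have h1 : S.form (S.J⁻¹ *ᵥ (S.W x *ᵥ g - S.Q x *ᵥ v)) u
      = -(star (S.W x *ᵥ g - S.Q x *ᵥ v) ⬝ᵥ u) := by
    rw [← neg_eq_iff_eq_neg, ← star_form, form, J_mulVec_inv, Matrix.star_dotProduct, star_star]
  have hW : (S.W x)ᴴ = S.W x := (S.W_nonneg x hx).isHermitian
  have hQ : (S.Q x)ᴴ = S.Q x := S.Q_hermitian x hx
  rw [h1, star_sub, sub_dotProduct, Matrix.star_mulVec, Matrix.star_mulVec, hW, hQ,
    ← Matrix.dotProduct_mulVec, ← Matrix.dotProduct_mulVec, dotProduct_sub]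
  ring

/-- Green's identity (Lagrange's identity) on a compact interval. -/
lemma Solves.green {lo hi : EReal} (hsub : openInterval lo hi ⊆ S.interval)
    {u f v g : ℝ → Fin n → ℂ} (h : S.Solves lo hi u f) (k : S.Solves lo hi v g) {x y : ℝ}
    (hx : x ∈ openInterval lo hi) (hy : y ∈ openInterval lo hi) (hxy : x ≤ y) :
    IntegrableOn (fun t => S.density v f t - S.density g u t) (Icc x y) S.μ ∧
    S.form (Function.rightLim v y) (Function.rightLim u y)
        - S.form (Function.leftLim v x) (Function.leftLim u x)
      = ∫ t in Icc x y, (S.density v f t - S.density g u t) ∂S.μ := by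
  have bu := h.balPrim
  have bv' := k.balPrim
  set Gu := fun x => S.J⁻¹ *ᵥ (S.W x *ᵥ f x - S.Q x *ᵥ u x) with hGu
  set Gv := fun x => S.J⁻¹ *ᵥ (S.W x *ᵥ g x - S.Q x *ᵥ v x) with hGv
  have bv := bv'.clm conjCLM
  have pr : ∀ j : Fin n, ∀ {w : ℝ → Fin n → ℂ}, IsBalancedBV lo hi w → ∀ t ∈ openInterval lo hi,
      Function.leftLim (fun x => w x j) t = Function.leftLim w t j ∧
      Function.rightLim (fun x => w x j) t = Function.rightLim w t j := fun j w hw t ht =>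
    ⟨leftLim_eq_of_tendsto (((continuous_apply j).tendsto _).comp (locallyBV_tendsto hw.1 ht).1),
      rightLim_eq_of_tendsto (((continuous_apply j).tendsto _).comp (locallyBV_tendsto hw.1 ht).2)⟩
  have st : ∀ t ∈ openInterval lo hi,
      Function.leftLim (fun x => conjCLM (v x)) t = star (Function.leftLim v t) ∧
      Function.rightLim (fun x => conjCLM (v x)) t = star (Function.rightLim v t) := fun t ht =>
    ⟨leftLim_eq_of_tendsto ((conjCLM.continuous.tendsto _).comp
        (locallyBV_tendsto k.balanced.1 ht).1),
      rightLim_eq_of_tendsto ((conjCLM.continuous.tendsto _).comp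
        (locallyBV_tendsto k.balanced.1 ht).2)⟩
  -- The product rule for the conjugate of v_j and for u_l; the form is a linear combination of such
  -- products.
  have m := fun j l => BalPrim.mul (bv.clm ((ContinuousLinearMap.proj j :
      (Fin n → ℂ) →L[ℂ] ℂ).restrictScalars ℝ)) (bu.clm ((ContinuousLinearMap.proj l :
      (Fin n → ℂ) →L[ℂ] ℂ).restrictScalars ℝ)) hx hy hxy
      (measure_lt_top (hsub hx) (hsub hy) le_rfl)
  simp only [ContinuousLinearMap.coe_restrictScalars', ContinuousLinearMap.proj_apply] at m
  have e : ∀ t ∈ Icc x y, ∑ j, ∑ l, S.J j l *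
      (conjCLM (v t) j * Gu t l + conjCLM (Gv t) j * u t l)
      = S.density v f t - S.density g u t := by
    intro t ht
    rw [density, density, ← form_mulVec_inv_add t (hsub (openInterval_Icc_subset hx hy ht)),
      form_eq_sum, form_eq_sum, ← Finset.sum_add_distrib]
    refine Finset.sum_congr rfl fun j _ => ?_
    rw [← Finset.sum_add_distrib]
    exact Finset.sum_congr rfl fun l _ => mul_add _ _ _
  have hi1 : IntegrableOn (fun t => ∑ j, ∑ l, S.J j l *
      (conjCLM (v t) j * Gu t l + conjCLM (Gv t) j * u t l)) (Icc x y) S.μ :=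
    integrable_finsetSum _ fun j _ => integrable_finsetSum _ fun l _ => (m j l).1.const_mul _
  refine ⟨hi1.congr_fun e measurableSet_Icc, ?_⟩
  rw [← setIntegral_congr_fun measurableSet_Icc e,
    integral_finsetSum _ fun j _ => integrable_finsetSum _ fun l _ =>
      (m j l).1.const_mul (S.J j l),
    form_eq_sum, form_eq_sum, ← Finset.sum_sub_distrib]
  refine Finset.sum_congr rfl fun j _ => ?_
  rw [integral_finsetSum _ fun l _ => (m j l).1.const_mul (S.J j l), ← Finset.sum_sub_distrib]
  refine Finset.sum_congr rfl fun l _ => ?_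
  rw [integral_const_mul, ← (m j l).2, (pr j bv.isBalancedBV x hx).1,
    (pr j bv.isBalancedBV y hy).2, (pr l bu.isBalancedBV x hx).1, (pr l bu.isBalancedBV y hy).2,
    (st x hx).1, (st y hy).2]
  simp only [Pi.star_apply]
  ring

lemma IsReal.star_J (hS : S.IsReal) (x : Fin n → ℂ) : star (S.J *ᵥ x) = S.J *ᵥ star x :=
  star_mulVec_of_im_eq_zero hS.1 x

lemma IsReal.star_Q (hS : S.IsReal) {t : ℝ} (ht : t ∈ S.interval) (x : Fin n → ℂ) :
    star (S.Q t *ᵥ x) = S.Q t *ᵥ star x :=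
  star_mulVec_of_im_eq_zero (fun j k => (hS.2 t ht j k).1) x

lemma IsReal.star_W (hS : S.IsReal) {t : ℝ} (ht : t ∈ S.interval) (x : Fin n → ℂ) :
    star (S.W t *ᵥ x) = S.W t *ᵥ star x :=
  star_mulVec_of_im_eq_zero (fun j k => (hS.2 t ht j k).2) x

/-- The complex conjugate of a solution of a real system is a solution. -/
lemma Solves.conj (hS : S.IsReal) {lo hi : EReal} (hsub : openInterval lo hi ⊆ S.interval)
    {u f : ℝ → Fin n → ℂ} (h : S.Solves lo hi u f) :
    S.Solves lo hi (fun x => star (u x)) (fun x => star (f x)) := by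
  refine (h.balPrim.clm conjCLM).solves hsub fun x hx => ?_
  rw [conjCLM_apply, ← hS.star_J, J_mulVec_inv, star_sub, hS.star_W (hsub hx),
    hS.star_Q (hsub hx), conjCLM_apply]

end FirstOrderSystem

/-! ### Linear equations with measure coefficients: Picard iteration, limits at an endpoint, gluing
-/

section LinearEquation

lemma openInterval_coe (c d : ℝ) : openInterval (c : EReal) (d : EReal) = Ioo c d := by
  ext x
  simp [openInterval]

lemma mem_openInterval_coe_left {c x : ℝ} {hi : EReal} :
    x ∈ openInterval (c : EReal) hi ↔ c < x ∧ (x : EReal) < hi := by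
  simp [openInterval]

lemma mem_openInterval_coe_right {c x : ℝ} {lo : EReal} :
    x ∈ openInterval lo (c : EReal) ↔ lo < (x : EReal) ∧ x < c := by
  simp [openInterval]

/-- The intervals (c, r] shrink to the empty set as r decreases to c; an atom at c does no harm
because c is excluded. -/
lemma exists_small_right {μ : Measure ℝ} {a : ℝ → ℝ} {c d : ℝ} (hcd : c < d)
    (ha : IntegrableOn a (Ioc c d) μ) :
    ∃ r, c < r ∧ r ≤ d ∧ ∫ s in Ioc c r, a s ∂μ ≤ 1 / 2 := by
  have h1 : Tendsto (fun y => ∫ s in Ioc c y, a s ∂μ) (𝓝[>] c) (𝓝 0) := by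
    have h2 : Tendsto (fun y => ∫ s in Ioc c d, (Iic y).indicator a s ∂μ) (𝓝[>] c)
        (𝓝 (∫ s in Ioc c d, (0 : ℝ) ∂μ)) := by
      refine tendsto_integral_filter_of_dominated_convergence (fun s => ‖a s‖) ?_ ?_ ha.norm ?_
      · exact Eventually.of_forall fun y => (ha.indicator measurableSet_Iic).1
      · exact Eventually.of_forall fun y => Eventually.of_forall fun s =>
          norm_indicator_le_norm_self _ _
      · refine (ae_restrict_iff' measurableSet_Ioc).2 (Eventually.of_forall fun s hs => ?_)
        refine tendsto_const_nhds.congr' ?_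
        filter_upwards [Ioo_mem_nhdsGT hs.1] with y hy
        simp [hy.2]
    rw [integral_zero] at h2
    refine h2.congr' ?_
    filter_upwards [Ioo_mem_nhdsGT hcd] with y hy
    rw [setIntegral_indicator measurableSet_Iic, Ioc_inter_Iic, min_eq_right hy.2.le]
  obtain ⟨r, hr1, hr2⟩ := ((h1.eventually (ge_mem_nhds (show (0 : ℝ) < 1 / 2 by norm_num))).and
    (Ioo_mem_nhdsGT hcd)).exists
  exact ⟨r, hr2.1, hr2.2.le, hr1⟩

lemma exists_small_left {μ : Measure ℝ} {a : ℝ → ℝ} {c d : ℝ} (hcd : c < d)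
    (ha : IntegrableOn a (Ioo c d) μ) :
    ∃ r, c < r ∧ r < d ∧ ∫ s in Ioo r d, a s ∂μ ≤ 1 / 2 := by
  have h1 : Tendsto (fun y => ∫ s in Ioo y d, a s ∂μ) (𝓝[<] d) (𝓝 0) := by
    have h2 : Tendsto (fun y => ∫ s in Ioo c d, (Ioi y).indicator a s ∂μ) (𝓝[<] d)
        (𝓝 (∫ s in Ioo c d, (0 : ℝ) ∂μ)) := by
      refine tendsto_integral_filter_of_dominated_convergence (fun s => ‖a s‖) ?_ ?_ ha.norm ?_
      · exact Eventually.of_forall fun y => (ha.indicator measurableSet_Ioi).1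
      · exact Eventually.of_forall fun y => Eventually.of_forall fun s =>
          norm_indicator_le_norm_self _ _
      · refine (ae_restrict_iff' measurableSet_Ioo).2 (Eventually.of_forall fun s hs => ?_)
        refine tendsto_const_nhds.congr' ?_
        filter_upwards [Ioo_mem_nhdsLT hs.2] with y hy
        simp [hy.1.le]
    rw [integral_zero] at h2
    refine h2.congr' ?_
    filter_upwards [Ioo_mem_nhdsLT hcd] with y hy
    rw [setIntegral_indicator measurableSet_Ioi]
    congr 2
    ext s
    simp only [mem_inter_iff, mem_Ioo, mem_Ioi]
    constructor
    · rintro ⟨⟨_, h1⟩, h2⟩; exact ⟨h2, h1⟩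
    · rintro ⟨h1, h2⟩; exact ⟨⟨hy.1.trans h1, h2⟩, h1⟩
  obtain ⟨r, hr1, hr2⟩ := ((h1.eventually (ge_mem_nhds (show (0 : ℝ) < 1 / 2 by norm_num))).and
    (Ioo_mem_nhdsLT hcd)).exists
  exact ⟨r, hr2.1, hr2.2, hr1⟩

variable {E : Type*} [NormedAddCommGroup E] [NormedSpace ℝ E] [CompleteSpace E]

/-- The balanced primitive on `(c, d)` of an integrable density, with right-hand limit `ξ`
at `c`. -/
def balIntegral (μ : Measure ℝ) (c d : ℝ) (ξ : E) (G : ℝ → E) (x : ℝ) : E :=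
  ξ + ∫ s in Ioo c d, balKernel s x • G s ∂μ

lemma balPrim_balIntegral {μ : Measure ℝ} {c d : ℝ} {G : ℝ → E} (ξ : E)
    (hG : IntegrableOn G (Ioo c d) μ) : BalPrim μ c d (balIntegral μ c d ξ G) G := by
  constructor
  · intro x hx y hy
    rw [openInterval_coe] at hx hy
    exact hG.mono_set (Icc_subset_Ioo hx.1 hy.2)
  · intro x hx y hy hxy
    rw [openInterval_coe] at hx hy
    rw [integral_balKernel_diff_of_subset measurableSet_Ioo hxy (Icc_subset_Ioo hx.1 hy.2)]
    simp only [sub_smul, balIntegral]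
    rw [integral_sub (integrableOn_balKernel_smul hG y) (integrableOn_balKernel_smul hG x)]
    abel

lemma tendsto_balIntegral_left {μ : Measure ℝ} {c d : ℝ} {G : ℝ → E} (ξ : E)
    (hG : IntegrableOn G (Ioo c d) μ) :
    Tendsto (balIntegral μ c d ξ G) (𝓝[>] c) (𝓝 ξ) := by
  have h := (tendsto_balKernel_right hG c).const_add ξ
  have h0 : ∫ s in Ioo c d, (Iic c).indicator G s ∂μ = 0 := by
    rw [← integral_zero ℝ E (μ := μ.restrict (Ioo c d))]
    exact setIntegral_congr_fun measurableSet_Ioo fun s hs => by simp [hs.1]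
  rwa [h0, add_zero] at h

lemma norm_balIntegral_sub_le {μ : Measure ℝ} {c d : ℝ} {G F : ℝ → E} (ξ : E) {B : ℝ}
    (hG : IntegrableOn G (Ioo c d) μ) (hF : IntegrableOn F (Ioo c d) μ) {b : ℝ → ℝ}
    (hb : IntegrableOn b (Ioo c d) μ) (h : ∀ s ∈ Ioo c d, ‖G s - F s‖ ≤ b s)
    (hB : ∫ s in Ioo c d, b s ∂μ ≤ B) (x : ℝ) :
    ‖balIntegral μ c d ξ G x - balIntegral μ c d ξ F x‖ ≤ B := by
  rw [balIntegral, balIntegral, add_sub_add_left_eq_sub,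
    ← integral_sub (integrableOn_balKernel_smul hG x) (integrableOn_balKernel_smul hF x)]
  refine (norm_integral_le_of_norm_le hb ?_).trans hB
  refine (ae_restrict_iff' measurableSet_Ioo).2 (Eventually.of_forall fun s hs => ?_)
  rw [← smul_sub, norm_smul, Real.norm_eq_abs]
  exact (mul_le_of_le_one_left (norm_nonneg _) (abs_balKernel_le _ _)).trans (h s hs)

variable {n : ℕ}

/-- Picard iteration for the integral equation, a contraction by the factor 1/2 because of `hs` and
because the kernel is at most 1. The iterates converge at every point, so the limit satisfies the
equation everywhere and not only almost everywhere. -/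
lemma exists_local_solution {μ : Measure ℝ} {c d : ℝ} {M : ℝ → Matrix (Fin n) (Fin n) ℂ}
    {F : ℝ → Fin n → ℂ} (hM : ∀ j k, IntegrableOn (fun x => M x j k) (Ioo c d) μ)
    (hF : IntegrableOn F (Ioo c d) μ) (hs : ∫ s in Ioo c d, entrySum (M s) ∂μ ≤ 1 / 2)
    (ξ : Fin n → ℂ) :
    ∃ u : ℝ → Fin n → ℂ, IntegrableOn (fun x => M x *ᵥ u x + F x) (Ioo c d) μ ∧
      ∀ x, u x = balIntegral μ c d ξ (fun x => M x *ᵥ u x + F x) x := by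
  have hE := integrableOn_entrySum hM
  let Φ : (ℝ → Fin n → ℂ) → ℝ → Fin n → ℂ := fun u =>
    balIntegral μ c d ξ fun x => M x *ᵥ u x + F x
  let u : ℕ → ℝ → Fin n → ℂ := fun k => Φ^[k] 0
  have hu : ∀ k, u (k + 1) = Φ (u k) := fun k => Function.iterate_succ_apply' Φ k 0
  set C₀ := ∫ s in Ioo c d, ‖F s‖ ∂μ with hC₀
  -- The ball of radius 2C is invariant under the iteration: ‖ξ‖ + (2C)/2 + C₀ = 2C.
  set C := ‖ξ‖ + C₀ with hC
  have hC₀0 : 0 ≤ C₀ := integral_nonneg fun _ => norm_nonneg _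
  have hC0 : 0 ≤ C := by positivity
  have bound : ∀ (v : ℝ → Fin n → ℂ) (B : ℝ), 0 ≤ B → (∀ x, ‖v x‖ ≤ B) → ∀ s,
      ‖M s *ᵥ v s‖ ≤ entrySum (M s) * B := fun v B _ hv s =>
    (norm_mulVec_le _ _).trans (mul_le_mul_of_nonneg_left (hv s) (entrySum_nonneg _))
  have half : ∀ B : ℝ, 0 ≤ B → ∫ s in Ioo c d, entrySum (M s) * B ∂μ ≤ B / 2 := fun B hB => by
    rw [integral_mul_const]
    calc _ ≤ 1 / 2 * B := mul_le_mul_of_nonneg_right hs hB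
      _ = B / 2 := by ring
  have meas : ∀ v : ℝ → Fin n → ℂ, IntegrableOn (fun x => M x *ᵥ v x + F x) (Ioo c d) μ →
      AEStronglyMeasurable (Φ v) (μ.restrict (Ioo c d)) := fun v hv => by
    have := (balPrim_balIntegral ξ hv).locallyBV
    rw [openInterval_coe] at this
    exact this.aestronglyMeasurable measurableSet_Ioo μ
  have good : ∀ k, AEStronglyMeasurable (u k) (μ.restrict (Ioo c d)) ∧ (∀ x, ‖u k x‖ ≤ 2 * C) ∧
      IntegrableOn (fun x => M x *ᵥ u k x + F x) (Ioo c d) μ := by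
    intro k
    have aux : ∀ v : ℝ → Fin n → ℂ, AEStronglyMeasurable v (μ.restrict (Ioo c d)) →
        (∀ x, ‖v x‖ ≤ 2 * C) → IntegrableOn (fun x => M x *ᵥ v x + F x) (Ioo c d) μ :=
      fun v h1 h2 => (integrableOn_mulVec measurableSet_Ioo hM h1 fun x _ => h2 x).add hF
    induction k with
    | zero =>
      have h2 : ∀ x, ‖u 0 x‖ ≤ 2 * C := fun x => by
        change ‖(0 : Fin n → ℂ)‖ ≤ _; rw [norm_zero]; positivity
      exact ⟨aestronglyMeasurable_const, h2, aux _ aestronglyMeasurable_const h2⟩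
    | succ k ih =>
      have h2 : ∀ x, ‖u (k + 1) x‖ ≤ 2 * C := fun x => by
        rw [hu]
        have hb := norm_balIntegral_sub_le (F := fun _ => 0) ξ ih.2.2 (integrable_zero _ _ _)
          (((hE.mul_const (2 * C))).add hF.norm) (fun s _ => by
            rw [sub_zero]
            exact (norm_add_le _ _).trans (add_le_add (bound _ _ (by positivity) ih.2.1 s) le_rfl))
          (B := C + C₀) (by
            have e1 := integral_add (hE.mul_const (2 * C)) hF.norm
            simp only [Pi.add_apply]
            rw [e1]
            have := half (2 * C) (by positivity)
            linarith) x
        have e0 : balIntegral μ c d ξ (fun _ => (0 : Fin n → ℂ)) x = ξ := by simp [balIntegral]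
        rw [e0] at hb
        have := norm_le_insert' (Φ (u k) x) ξ
        linarith
      have h1 : AEStronglyMeasurable (u (k + 1)) (μ.restrict (Ioo c d)) := by
        rw [hu]; exact meas _ ih.2.2
      exact ⟨h1, h2, aux _ h1 h2⟩
  have step : ∀ k x, ‖u (k + 1) x - u k x‖ ≤ 4 * C / 2 ^ k := by
    intro k
    induction k with
    | zero =>
      intro x
      have h1 := (good 1).2.1 x
      have h2 := (good 0).2.1 x
      have h3 := norm_sub_le (u 1 x) (u 0 x)
      rw [pow_zero, div_one]
      exact h3.trans (by linarith)
    | succ k ih =>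
      intro x
      rw [hu (k + 1), show u (k + 1) x = Φ (u k) x by rw [hu]]
      refine norm_balIntegral_sub_le ξ (good (k + 1)).2.2 (good k).2.2
        (hE.mul_const (4 * C / 2 ^ k)) (fun s _ => ?_) ?_ x
      · rw [add_sub_add_right_eq_sub, ← Matrix.mulVec_sub]
        exact bound (fun s => u (k + 1) s - u k s) _ (by positivity) ih s
      · refine (half _ (by positivity)).trans (le_of_eq ?_)
        rw [pow_succ]; ring
  have cau : ∀ x, ∃ l, Tendsto (fun k => u k x) atTop (𝓝 l) := fun x =>
    -- The criterion wants the bound C/2/2^k, so differences of size 4C/2^k need the constant 8C.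
    cauchySeq_tendsto_of_complete (cauchySeq_of_le_geometric_two (C := 8 * C) fun k => by
      rw [dist_eq_norm, norm_sub_rev]
      refine (step k x).trans (le_of_eq ?_)
      ring)
  choose v hv using cau
  have hv1 : AEStronglyMeasurable v (μ.restrict (Ioo c d)) :=
    aestronglyMeasurable_of_tendsto_ae atTop (fun k => (good k).1)
      (Eventually.of_forall hv)
  have hv2 : ∀ x, ‖v x‖ ≤ 2 * C := fun x =>
    le_of_tendsto (hv x).norm (Eventually.of_forall fun k => (good k).2.1 x)
  refine ⟨v, (integrableOn_mulVec measurableSet_Ioo hM hv1 fun x _ => hv2 x).add hF, fun x => ?_⟩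
  refine tendsto_nhds_unique ((hv x).comp (tendsto_add_atTop_nat 1)) ?_
  have : ((fun k => u k x) ∘ fun k => k + 1) = fun k => Φ (u k) x := by
    ext1 k; simp only [Function.comp, hu]
  rw [this]
  refine Tendsto.const_add ξ ?_
  refine tendsto_integral_of_dominated_convergence
    (fun s => entrySum (M s) * (2 * C) + ‖F s‖) ?_ ((hE.mul_const _).add hF.norm) ?_ ?_
  · exact fun k => (integrableOn_balKernel_smul (good k).2.2 x).1
  · refine fun k => Eventually.of_forall fun s => ?_
    rw [norm_smul, Real.norm_eq_abs]
    refine (mul_le_of_le_one_left (norm_nonneg _) (abs_balKernel_le _ _)).trans ?_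
    exact (norm_add_le _ _).trans (add_le_add (bound _ _ (by positivity) (good k).2.1 s) le_rfl)
  · refine Eventually.of_forall fun s => ?_
    refine Tendsto.const_smul ?_ _
    refine Tendsto.add_const _ ?_
    exact ((mulVecCLM (M s)).continuous.tendsto _).comp (hv s)

/-- A balanced primitive whose density is bounded by `a ‖u‖ + b` with `a` and `b` integrable near
the left endpoint has a density that is integrable there. -/
lemma BalPrim.integrableOn_near_left {μ : Measure ℝ} {c : ℝ} {hi : EReal} {u G : ℝ → E}
    (h : BalPrim μ c hi u G) {y : ℝ} (hy : y ∈ openInterval (c : EReal) hi) {a b : ℝ → ℝ}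
    (ha : IntegrableOn a (Ioc c y) μ) (hb : IntegrableOn b (Ioc c y) μ)
    (ha0 : ∀ x, 0 ≤ a x) (hb0 : ∀ x, 0 ≤ b x)
    (hG : ∀ s ∈ Ioc c y, ‖G s‖ ≤ a s * ‖u s‖ + b s) : IntegrableOn G (Ioc c y) μ := by
  obtain ⟨hcy, hyhi⟩ := mem_openInterval_coe_left.1 hy
  obtain ⟨r, hcr, hry, hr⟩ := exists_small_right hcy ha
  have mem : ∀ x, c < x → x ≤ y → x ∈ openInterval (c : EReal) hi := fun x h1 h2 =>
    mem_openInterval_coe_left.2 ⟨h1, lt_of_le_of_lt (EReal.coe_le_coe_iff.2 h2) hyhi⟩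
  set B := ‖u r‖ + ∫ s in Ioc c y, b s ∂μ with hB
  have hB0 : 0 ≤ B := add_nonneg (norm_nonneg _) (integral_nonneg hb0)
  have key : ∀ x ∈ Ioc c r, ‖u x‖ ≤ 2 * B := by
    intro x hx
    have hxm := mem x hx.1 (hx.2.trans hry)
    have hrm := mem r hcr hry
    have hGi := h.int x hxm r hrm
    have hsub : Icc x r ⊆ Ioc c y := fun s hs => ⟨hx.1.trans_le hs.1, hs.2.trans hry⟩
    have hbdd : ∀ t ∈ Icc x r, ‖u t‖ ≤ ‖u r‖ + ∫ s in Icc x r, ‖G s‖ ∂μ := fun t ht => by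
      have h1 := h.norm_sub_le hGi hrm (mem t (hx.1.trans_le ht.1) (ht.2.trans hry))
        (by rw [uIcc_of_ge ht.2]; exact Icc_subset_Icc_left ht.1)
      have := norm_le_insert' (u t) (u r)
      linarith
    have hne : (Icc x r).Nonempty := ⟨x, left_mem_Icc.2 hx.2⟩
    -- Gronwall by absorption: the supremum σ over [x, r] is finite, so σ ≤ B + σ/2 may be solved
    -- for σ. The resulting bound 2B does not depend on x.
    set σ := sSup ((fun t => ‖u t‖) '' Icc x r) with hσ
    have hbd : BddAbove ((fun t => ‖u t‖) '' Icc x r) :=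
      ⟨_, by rintro _ ⟨t, ht, rfl⟩; exact hbdd t ht⟩
    have hle : ∀ t ∈ Icc x r, ‖u t‖ ≤ σ := fun t ht => le_csSup hbd (mem_image_of_mem _ ht)
    have hσ0 : 0 ≤ σ := (norm_nonneg _).trans (hle x (left_mem_Icc.2 hx.2))
    have h3 : ∫ s in Icc x r, ‖G s‖ ∂μ ≤ 1 / 2 * σ + ∫ s in Ioc c y, b s ∂μ := by
      have i1 : ∫ s in Icc x r, ‖G s‖ ∂μ ≤ ∫ s in Icc x r, (a s * σ + b s) ∂μ := by
        refine setIntegral_mono_on hGi.norm (((ha.mono_set hsub).mul_const _).add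
          (hb.mono_set hsub)) measurableSet_Icc fun s hs => ?_
        exact (hG s (hsub hs)).trans (by have := mul_le_mul_of_nonneg_left (hle s hs) (ha0 s); linarith)
      refine i1.trans ?_
      rw [integral_add ((ha.mono_set hsub).mul_const _) (hb.mono_set hsub), integral_mul_const]
      refine add_le_add (mul_le_mul_of_nonneg_right ?_ hσ0) ?_
      · refine le_trans ?_ hr
        exact setIntegral_mono_set (ha.mono_set (Ioc_subset_Ioc_right hry))
          (Eventually.of_forall ha0) (LE.le.eventuallyLE fun s hs =>
            ⟨hx.1.trans_le hs.1, hs.2⟩)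
      · exact setIntegral_mono_set hb (Eventually.of_forall hb0) (LE.le.eventuallyLE hsub)
    have h4 : σ ≤ B + 1 / 2 * σ := csSup_le (hne.image _) (by
      rintro _ ⟨t, ht, rfl⟩
      have := hbdd t ht
      simp only [hB]
      linarith)
    have := hle x (left_mem_Icc.2 hx.2)
    linarith
  have hsm : AEStronglyMeasurable G (μ.restrict (Ioc c r)) := by
    obtain ⟨w, -, hw1, hw2⟩ := exists_seq_strictAnti_tendsto' hcr
    have hU : Ioc c r ⊆ ⋃ k, Icc (w k) r := fun s hs => by
      obtain ⟨k, hk⟩ := (hw2.eventually (gt_mem_nhds hs.1)).exists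
      exact mem_iUnion.2 ⟨k, hk.le, hs.2⟩
    refine AEStronglyMeasurable.mono_set hU ?_
    rw [aestronglyMeasurable_iUnion_iff]
    exact fun k => (h.int _ (mem _ (hw1 k).1 ((hw1 k).2.le.trans hry)) _ (mem r hcr hry)).1
  have i1 : IntegrableOn G (Ioc c r) μ := by
    refine Integrable.mono' (((ha.mono_set (Ioc_subset_Ioc_right hry)).mul_const (2 * B)).add
      (hb.mono_set (Ioc_subset_Ioc_right hry))) hsm ?_
    refine (ae_restrict_iff' measurableSet_Ioc).2 (Eventually.of_forall fun s hs => ?_)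
    refine (hG s ⟨hs.1, hs.2.trans hry⟩).trans ?_
    exact add_le_add (mul_le_mul_of_nonneg_left (key s hs) (ha0 s)) le_rfl
  refine (i1.union (h.int r (mem r hcr hry) y hy)).mono_set fun s hs => ?_
  rcases le_or_gt s r with h1 | h1
  · exact Or.inl ⟨hs.1, h1⟩
  · exact Or.inr ⟨h1.le, hs.2⟩

/-- Existence of the limit at the left endpoint. -/
lemma BalPrim.exists_limit_left {μ : Measure ℝ} {c : ℝ} {hi : EReal} {u G : ℝ → E}
    (h : BalPrim μ c hi u G) {y : ℝ} (hy : y ∈ openInterval (c : EReal) hi)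
    (hG : IntegrableOn G (Ioc c y) μ) :
    ∃ ξ, Tendsto u (𝓝[>] c) (𝓝 ξ) ∧
      ∀ x ∈ Ioc c y, u x = ξ + ∫ s in Ioc c y, balKernel s x • G s ∂μ := by
  obtain ⟨hcy, hyhi⟩ := mem_openInterval_coe_left.1 hy
  have mem : ∀ x ∈ Ioc c y, x ∈ openInterval (c : EReal) hi := fun x h1 =>
    mem_openInterval_coe_left.2 ⟨h1.1, lt_of_le_of_lt (EReal.coe_le_coe_iff.2 h1.2) hyhi⟩
  set ξ := u y - ∫ s in Ioc c y, balKernel s y • G s ∂μ with hξ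
  have rep : ∀ x ∈ Ioc c y, u x = ξ + ∫ s in Ioc c y, balKernel s x • G s ∂μ := fun x hx => by
    have := h.sub_eq measurableSet_Ioc hG hy (mem x hx)
      (by rw [uIcc_of_ge hx.2]; exact fun s hs => ⟨hx.1.trans_le hs.1, hs.2⟩)
    rw [sub_eq_iff_eq_add] at this
    rw [this, hξ]; abel
  refine ⟨ξ, ?_, rep⟩
  have h0 : ∫ s in Ioc c y, (Iic c).indicator G s ∂μ = 0 := by
    rw [← integral_zero ℝ E (μ := μ.restrict (Ioc c y))]
    exact setIntegral_congr_fun measurableSet_Ioc fun s hs => by simp [hs.1]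
  have h1 := (tendsto_balKernel_right hG c).const_add ξ
  rw [h0, add_zero] at h1
  refine h1.congr' ?_
  filter_upwards [Ioo_mem_nhdsGT hcy] with x hx
  exact (rep x ⟨hx.1, hx.2.le⟩).symm

/-- A balanced primitive with limit `0` at the left endpoint whose density is bounded by `a ‖u‖`
vanishes near that endpoint. -/
lemma BalPrim.eq_zero_near_left {μ : Measure ℝ} {c : ℝ} {hi : EReal} {u G : ℝ → E}
    (h : BalPrim μ c hi u G) {y : ℝ} (hy : y ∈ openInterval (c : EReal) hi) {a : ℝ → ℝ}
    (ha : IntegrableOn a (Ioc c y) μ) (ha0 : ∀ x, 0 ≤ a x)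
    (hG : ∀ s ∈ Ioc c y, ‖G s‖ ≤ a s * ‖u s‖) (h0 : Tendsto u (𝓝[>] c) (𝓝 0)) :
    ∃ r, c < r ∧ r ≤ y ∧ ∀ x ∈ Ioc c r, u x = 0 := by
  obtain ⟨hcy, hyhi⟩ := mem_openInterval_coe_left.1 hy
  obtain ⟨r, hcr, hry, hr⟩ := exists_small_right hcy ha
  have hrm : r ∈ openInterval (c : EReal) hi := mem_openInterval_coe_left.2
    ⟨hcr, lt_of_le_of_lt (EReal.coe_le_coe_iff.2 hry) hyhi⟩
  have har := ha.mono_set (Ioc_subset_Ioc_right hry)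
  have hGr : ∀ s ∈ Ioc c r, ‖G s‖ ≤ a s * ‖u s‖ := fun s hs => hG s ⟨hs.1, hs.2.trans hry⟩
  have hGi : IntegrableOn G (Ioc c r) μ := h.integrableOn_near_left hrm har
    (integrable_zero _ _ _) ha0 (fun _ => le_rfl) fun s hs => by
      simpa using hGr s hs
  obtain ⟨ξ, hξ, rep⟩ := h.exists_limit_left hrm hGi
  obtain rfl := tendsto_nhds_unique hξ h0
  refine ⟨r, hcr, hry, ?_⟩
  have hbdd : ∀ t ∈ Ioc c r, ‖u t‖ ≤ ∫ s in Ioc c r, ‖G s‖ ∂μ := fun t ht => by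
    rw [rep t ht, zero_add]
    refine norm_integral_le_of_norm_le hGi.norm (Eventually.of_forall fun s => ?_)
    rw [norm_smul, Real.norm_eq_abs]
    exact mul_le_of_le_one_left (norm_nonneg _) (abs_balKernel_le _ _)
  have hne : (Ioc c r).Nonempty := ⟨r, right_mem_Ioc.2 hcr⟩
  set σ := sSup ((fun t => ‖u t‖) '' Ioc c r) with hσ
  have hbd : BddAbove ((fun t => ‖u t‖) '' Ioc c r) :=
    ⟨_, by rintro _ ⟨t, ht, rfl⟩; exact hbdd t ht⟩
  have hle : ∀ t ∈ Ioc c r, ‖u t‖ ≤ σ := fun t ht => le_csSup hbd (mem_image_of_mem _ ht)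
  have hσ0 : 0 ≤ σ := (norm_nonneg _).trans (hle r (right_mem_Ioc.2 hcr))
  have h3 : ∫ s in Ioc c r, ‖G s‖ ∂μ ≤ 1 / 2 * σ := by
    have i1 : ∫ s in Ioc c r, ‖G s‖ ∂μ ≤ ∫ s in Ioc c r, a s * σ ∂μ :=
      setIntegral_mono_on hGi.norm (har.mul_const _) measurableSet_Ioc fun s hs =>
        (hGr s hs).trans (mul_le_mul_of_nonneg_left (hle s hs) (ha0 s))
    refine i1.trans ?_
    rw [integral_mul_const]
    exact mul_le_mul_of_nonneg_right hr hσ0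
  have h4 : σ ≤ 1 / 2 * σ := csSup_le (hne.image _) (by
    rintro _ ⟨t, ht, rfl⟩
    exact (hbdd t ht).trans h3)
  intro x hx
  have := hle x hx
  have h5 : ‖u x‖ ≤ 0 := by linarith
  exact norm_le_zero_iff.1 h5

/-- Two pieces of a balanced primitive to the left and to the right of `c` fit together. -/
lemma BalPrim.glue {μ : Measure ℝ} {lo hi : EReal} {c : ℝ} {u G : ℝ → E} {p q : E}
    (h : BalPrim μ lo c u G) (k : BalPrim μ c hi u G)
    (hG : ∀ x ∈ openInterval lo c, ∀ y ∈ openInterval c hi, IntegrableOn G (Icc x y) μ)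
    (hlo : lo < c) (hhi : c < hi)
    (hp : Tendsto u (𝓝[<] c) (𝓝 p)) (hq : Tendsto u (𝓝[>] c) (𝓝 q))
    (hc : u c = (2⁻¹ : ℝ) • (p + q)) (hj : q - p = μ.real {c} • G c) : BalPrim μ lo hi u G := by
  obtain ⟨x₀, hx₀, hx₀c⟩ := EReal.lt_iff_exists_real_btwn.1 hlo
  obtain ⟨y₀, hcy₀, hy₀⟩ := EReal.lt_iff_exists_real_btwn.1 hhi
  have hx₀c' : x₀ < c := EReal.coe_lt_coe_iff.1 hx₀c
  have hcy₀' : c < y₀ := EReal.coe_lt_coe_iff.1 hcy₀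
  have hint : ∀ x ∈ openInterval lo hi, ∀ y ∈ openInterval lo hi, IntegrableOn G (Icc x y) μ := by
    intro x hx y hy
    have m1 : min x x₀ ∈ openInterval lo c := by
      refine ⟨?_, EReal.coe_lt_coe_iff.2 (min_lt_of_right_lt hx₀c')⟩
      rcases min_choice x x₀ with e | e <;> rw [e]
      exacts [hx.1, hx₀]
    have m2 : max y y₀ ∈ openInterval c hi := by
      refine ⟨EReal.coe_lt_coe_iff.2 (lt_max_of_lt_right hcy₀'), ?_⟩
      rcases max_choice y y₀ with e | e <;> rw [e]
      exacts [hy.2, hy₀]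
    exact (hG _ m1 _ m2).mono_set (Icc_subset_Icc (min_le_left _ _) (le_max_left _ _))
  -- Increments are measured from c. On either side the identity for points y ≠ c is passed to the
  -- limit y → c, and the half atom at c reconciles u(c) with p and q.
  have base : ∀ x ∈ openInterval lo hi, ∀ K : Set ℝ, MeasurableSet K → IntegrableOn G K μ →
      uIcc c x ⊆ K →
      u x - u c = ∫ s in K, balKernel s x • G s ∂μ - ∫ s in K, balKernel s c • G s ∂μ := by
    intro x hx K hK hGK hcK
    have hcK' : c ∈ K := hcK left_mem_uIcc
    rcases lt_trichotomy x c with hxc | rfl | hxc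
    · have e := (tendsto_balKernel_left hGK c).sub_const (∫ s in K, balKernel s x • G s ∂μ)
      have e' : Tendsto (fun y => u y - u x) (𝓝[<] c) (𝓝 (p - u x)) := hp.sub_const _
      have e'' := tendsto_nhds_unique (e.congr' ?_) e'
      · rw [BalPrim.setIntegral_indicator_Iio hGK hcK', mul_smul, ← hj] at e''
        rw [hc]
        linear_combination (norm := module) (1 : ℝ) • e''
      · filter_upwards [Ioo_mem_nhdsLT hxc] with y hy
        refine (h.sub_eq hK hGK ⟨hx.1, EReal.coe_lt_coe_iff.2 hxc⟩
          ⟨hx.1.trans (EReal.coe_lt_coe_iff.2 hy.1), EReal.coe_lt_coe_iff.2 hy.2⟩ ?_).symm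
        rw [uIcc_of_ge hxc.le] at hcK
        rw [uIcc_of_le hy.1.le]
        exact (Icc_subset_Icc_right hy.2.le).trans hcK
    · simp
    · have e := (tendsto_balKernel_right hGK c).sub_const (∫ s in K, balKernel s x • G s ∂μ)
      have e' : Tendsto (fun y => u y - u x) (𝓝[>] c) (𝓝 (q - u x)) := hq.sub_const _
      have e'' := tendsto_nhds_unique (e.congr' ?_) e'
      · rw [BalPrim.setIntegral_indicator_Iic hGK hcK', mul_smul, ← hj] at e''
        rw [hc]
        linear_combination (norm := module) (1 : ℝ) • e''
      · filter_upwards [Ioo_mem_nhdsGT hxc] with y hy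
        refine (k.sub_eq hK hGK ⟨EReal.coe_lt_coe_iff.2 hxc, hx.2⟩
          ⟨EReal.coe_lt_coe_iff.2 hy.1, (EReal.coe_lt_coe_iff.2 hy.2).trans hx.2⟩ ?_).symm
        rw [uIcc_of_le hxc.le] at hcK
        rw [uIcc_of_ge hy.2.le]
        exact (Icc_subset_Icc_left hy.1.le).trans hcK
  have hcm : c ∈ openInterval lo hi := ⟨hlo, hhi⟩
  refine ⟨hint, fun x hx y hy hxy => ?_⟩
  have m1 : min x c ∈ openInterval lo hi := by
    rcases min_choice x c with e | e <;> rw [e] <;> assumption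
  have m2 : max y c ∈ openInterval lo hi := by
    rcases max_choice y c with e | e <;> rw [e] <;> assumption
  have hK := hint _ m1 _ m2
  have hcK : c ∈ Icc (min x c) (max y c) := ⟨min_le_right _ _, le_max_right _ _⟩
  have hxK : x ∈ Icc (min x c) (max y c) := ⟨min_le_left _ _, hxy.trans (le_max_left _ _)⟩
  have hyK : y ∈ Icc (min x c) (max y c) := ⟨(min_le_left _ _).trans hxy, le_max_left _ _⟩
  have b1 := base x hx _ measurableSet_Icc hK (uIcc_subset_Icc hcK hxK)
  have b2 := base y hy _ measurableSet_Icc hK (uIcc_subset_Icc hcK hyK)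
  rw [integral_balKernel_diff_of_subset measurableSet_Icc hxy (Icc_subset_Icc hxK.1 hyK.2)]
  simp only [sub_smul]
  rw [integral_sub (integrableOn_balKernel_smul hK y) (integrableOn_balKernel_smul hK x)]
  linear_combination (norm := module) (1 : ℝ) • b2 - (1 : ℝ) • b1

end LinearEquation

/-! ### Reflection x ↦ -x, exchanging the two endpoints -/

section Reflection

lemma mem_openInterval_neg {lo hi : EReal} {x : ℝ} :
    x ∈ openInterval (-hi) (-lo) ↔ -x ∈ openInterval lo hi := by
  simp only [openInterval, mem_ofPred_eq, EReal.coe_neg]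
  rw [EReal.neg_lt_comm, EReal.lt_neg_comm, and_comm]

lemma balKernel_neg (s x : ℝ) : balKernel (-s) x = 1 - balKernel s (-x) := by
  rcases lt_trichotomy s (-x) with h | h | h
  · rw [balKernel_of_lt h, balKernel_of_gt (by linarith)]; norm_num
  · rw [h, neg_neg, balKernel_self, balKernel_self]; norm_num
  · rw [balKernel_of_gt h, balKernel_of_lt (by linarith)]; norm_num

lemma measurableEmbedding_neg_real : MeasurableEmbedding (Neg.neg : ℝ → ℝ) :=
  (Homeomorph.neg ℝ).measurableEmbedding

lemma map_neg_real_singleton (μ : Measure ℝ) (x : ℝ) :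
    (μ.map Neg.neg) {x} = μ {-x} := by
  rw [measurableEmbedding_neg_real.map_apply]
  congr 1
  ext s
  simp

lemma integrableOn_comp_neg_iff {E : Type*} [NormedAddCommGroup E] {μ : Measure ℝ} {f : ℝ → E}
    {x y : ℝ} :
    IntegrableOn (fun s => f (-s)) (Icc x y) (μ.map Neg.neg) ↔
      IntegrableOn f (Icc (-y) (-x)) μ := by
  rw [measurableEmbedding_neg_real.integrableOn_map_iff, neg_preimage, neg_Icc]
  simp [Function.comp_def]

variable {E : Type*} [NormedAddCommGroup E] [NormedSpace ℝ E] [CompleteSpace E]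

/-- The substitution replaces the kernel by one minus a kernel (`balKernel_neg`), so differences of
kernels change their sign, and the sign is absorbed in -G. -/
lemma BalPrim.reflect {μ : Measure ℝ} {lo hi : EReal} {u G : ℝ → E} (h : BalPrim μ lo hi u G) :
    BalPrim (μ.map Neg.neg) (-hi) (-lo) (fun x => u (-x)) (fun x => -G (-x)) := by
  refine ⟨fun x hx y hy => ?_, fun x hx y hy hxy => ?_⟩
  · rw [mem_openInterval_neg] at hx hy
    exact (integrableOn_comp_neg_iff.2 (h.int _ hy _ hx)).neg
  · rw [mem_openInterval_neg] at hx hy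
    rw [measurableEmbedding_neg_real.setIntegral_map, neg_preimage, neg_Icc, ← neg_sub,
      h.eq _ hy _ hx (neg_le_neg hxy), ← integral_neg]
    congr 1
    ext s
    rw [balKernel_neg, balKernel_neg, neg_neg, ← neg_smul, smul_neg, ← neg_smul]
    congr 1
    ring

lemma tendsto_comp_neg_right {α : Type*} {u : ℝ → α} {l : Filter α} {x : ℝ} :
    Tendsto (fun t => u (-t)) (𝓝[>] x) l ↔ Tendsto u (𝓝[<] (-x)) l := by
  constructor
  · intro h
    have := h.comp (tendsto_neg_nhdsLT (a := -x) |>.trans (by rw [neg_neg]))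
    simpa [Function.comp_def] using this
  · intro h
    exact h.comp tendsto_neg_nhdsGT

lemma tendsto_comp_neg_left {α : Type*} {u : ℝ → α} {l : Filter α} {x : ℝ} :
    Tendsto (fun t => u (-t)) (𝓝[<] x) l ↔ Tendsto u (𝓝[>] (-x)) l := by
  constructor
  · intro h
    have := h.comp (tendsto_neg_nhdsGT (a := -x) |>.trans (by rw [neg_neg]))
    simpa [Function.comp_def] using this
  · intro h
    exact h.comp tendsto_neg_nhdsLT

end Reflection

namespace FirstOrderSystem

variable {n : ℕ}

lemma locallyIntegrableOn_reflect {μ : Measure ℝ} {lo hi : EReal} {f : ℝ → ℂ}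
    (hf : LocallyIntegrableOn f (openInterval lo hi) μ) :
    LocallyIntegrableOn (fun x => f (-x)) (openInterval (-hi) (-lo)) (μ.map Neg.neg) := by
  rw [locallyIntegrableOn_iff (isOpen_openInterval _ _).isLocallyClosed] at hf ⊢
  intro K hK hKc
  rw [measurableEmbedding_neg_real.integrableOn_map_iff]
  have := hf (Neg.neg ⁻¹' K) (fun x hx => by
    have := mem_openInterval_neg.1 (hK hx)
    rwa [neg_neg] at this) ((Homeomorph.neg ℝ).isCompact_preimage.2 hKc)
  simpa [Function.comp_def] using this

/-- The system reflected at the origin. -/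
def reflect (S : FirstOrderSystem n) : FirstOrderSystem n where
  a := -S.b
  b := -S.a
  a_lt_b := EReal.neg_lt_neg_iff.2 S.a_lt_b
  -- The derivative changes its sign under reflection while q and w do not; hence J becomes -J, and
  -- the conditions on 2J + Δ_q and 2J - Δ_q are interchanged.
  J := -S.J
  J_skewHermitian := by rw [Matrix.conjTranspose_neg, S.J_skewHermitian]
  J_invertible := S.J_invertible.neg
  μ := S.μ.map Neg.neg
  μ_lt_top K hK hKs := by
    rw [measurableEmbedding_neg_real.map_apply]
    exact S.μ_lt_top _ ((Homeomorph.neg ℝ).isCompact_preimage.2 hK) fun x hx => by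
      have := mem_openInterval_neg.1 (hKs hx)
      rwa [neg_neg] at this
  Q x := S.Q (-x)
  W x := S.W (-x)
  Q_locallyIntegrable j k := locallyIntegrableOn_reflect (S.Q_locallyIntegrable j k)
  W_locallyIntegrable j k := locallyIntegrableOn_reflect (S.W_locallyIntegrable j k)
  Q_hermitian x hx := S.Q_hermitian _ (mem_openInterval_neg.1 hx)
  W_nonneg x hx := S.W_nonneg _ (mem_openInterval_neg.1 hx)
  jump_invertible x hx := by
    have h := S.jump_invertible _ (mem_openInterval_neg.1 hx)
    rw [map_neg_real_singleton]
    refine ⟨?_, ?_⟩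
    · convert h.2.neg using 1
      module
    · convert h.1.neg using 1
      module

lemma reflect_reflect (S : FirstOrderSystem n) : S.reflect.reflect = S := by
  have h : (S.μ.map Neg.neg).map Neg.neg = S.μ := by
    rw [Measure.map_map measurable_neg measurable_neg]
    simp
  cases S
  simp only [reflect, neg_neg] at h ⊢
  simp only [h]

variable {S : FirstOrderSystem n}

lemma mem_reflect_interval {x : ℝ} : x ∈ S.reflect.interval ↔ -x ∈ S.interval :=
  mem_openInterval_neg

lemma IsReal.reflect (hS : S.IsReal) : S.reflect.IsReal :=
  ⟨fun j k => by simp [FirstOrderSystem.reflect, hS.1 j k], fun x hx =>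
    hS.2 (-x) (mem_reflect_interval.1 hx)⟩

lemma reflect_subset {lo hi : EReal} (hsub : openInterval lo hi ⊆ S.interval) :
    openInterval (-hi) (-lo) ⊆ S.reflect.interval := fun _ hx =>
  mem_reflect_interval.2 (hsub (mem_openInterval_neg.1 hx))

lemma Solves.reflect {lo hi : EReal} (hsub : openInterval lo hi ⊆ S.interval)
    {u f : ℝ → Fin n → ℂ} (h : S.Solves lo hi u f) :
    S.reflect.Solves (-hi) (-lo) (fun x => u (-x)) (fun x => f (-x)) := by
  refine BalPrim.solves (S := S.reflect) (reflect_subset hsub) h.balPrim.reflect fun x hx => ?_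
  change -S.J *ᵥ -_ = _
  rw [Matrix.neg_mulVec_neg, J_mulVec_inv]
  rfl

lemma solves_reflect_iff {lo hi : EReal} (hsub : openInterval lo hi ⊆ S.interval)
    {u f : ℝ → Fin n → ℂ} :
    S.reflect.Solves (-hi) (-lo) (fun x => u (-x)) (fun x => f (-x)) ↔ S.Solves lo hi u f := by
  refine ⟨fun h => ?_, fun h => h.reflect hsub⟩
  have := h.reflect (reflect_subset hsub)
  simpa only [reflect_reflect, neg_neg] using this

lemma reflect_ν : S.reflect.ν = S.ν.map Neg.neg := by
  change (S.μ.map Neg.neg).restrict S.reflect.interval = (S.μ.restrict S.interval).map Neg.neg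
  rw [measurableEmbedding_neg_real.restrict_map]
  congr 2
  ext x
  rw [mem_preimage, mem_reflect_interval, neg_neg]

end FirstOrderSystem

/-! ### Initial value problems: jumps, uniqueness and existence -/

namespace FirstOrderSystem

variable {n : ℕ} (S : FirstOrderSystem n)

/-- The coefficient `J⁻¹ (lam W - Q)` of the equation solved for the derivative. -/
def coef (lam : ℂ) (x : ℝ) : Matrix (Fin n) (Fin n) ℂ := S.J⁻¹ * (lam • S.W x - S.Q x)

/-- The density of `u'` for a solution of `J u' + q u = w (lam u + f)`. -/
def rhs (lam : ℂ) (u f : ℝ → Fin n → ℂ) (x : ℝ) : Fin n → ℂ :=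
  S.coef lam x *ᵥ u x + S.J⁻¹ *ᵥ (S.W x *ᵥ f x)

/-- Half of the mass of `J⁻¹ (lam w - q)` at a point. -/
def halfJump (lam : ℂ) (x : ℝ) : Matrix (Fin n) (Fin n) ℂ :=
  (2⁻¹ * S.μ.real {x}) • S.coef lam x

/-- Solutions can be continued across `x`, in both directions. -/
def Regular (lam : ℂ) (x : ℝ) : Prop :=
  IsUnit (1 - S.halfJump lam x) ∧ IsUnit (1 + S.halfJump lam x)

/-- `w f` is a distribution of order `0` on `(a, b)`. -/
def LocInt (f : ℝ → Fin n → ℂ) : Prop :=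
  ∀ x ∈ S.interval, ∀ y ∈ S.interval, IntegrableOn (fun t => S.W t *ᵥ f t) (Icc x y) S.μ

variable {S}

lemma LocInt.zero : S.LocInt 0 := fun _ _ _ _ => by simp

lemma rhs_eq (lam : ℂ) (u f : ℝ → Fin n → ℂ) (x : ℝ) :
    S.rhs lam u f x = S.J⁻¹ *ᵥ (S.W x *ᵥ (lam • u + f) x - S.Q x *ᵥ u x) := by
  simp only [rhs, coef, ← Matrix.mulVec_mulVec, ← Matrix.mulVec_add, Pi.add_apply, Pi.smul_apply]
  congr 1
  rw [Matrix.sub_mulVec, Matrix.smul_mulVec, Matrix.mulVec_add, Matrix.mulVec_smul]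
  abel

lemma Solves.balPrim_rhs {lo hi : EReal} {lam : ℂ} {u f : ℝ → Fin n → ℂ}
    (h : S.Solves lo hi u (lam • u + f)) : BalPrim S.μ lo hi u (S.rhs lam u f) :=
  h.balPrim.congr (fun _ _ => rfl) fun x _ => rhs_eq lam u f x

lemma solves_of_balPrim_rhs {lo hi : EReal} (hsub : openInterval lo hi ⊆ S.interval) {lam : ℂ}
    {u f : ℝ → Fin n → ℂ} (h : BalPrim S.μ lo hi u (S.rhs lam u f)) :
    S.Solves lo hi u (lam • u + f) :=
  h.solves hsub fun x _ => by rw [rhs_eq, J_mulVec_inv]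

lemma coef_integrableOn (lam : ℂ) {K : Set ℝ} {x y : ℝ} (hx : x ∈ S.interval)
    (hy : y ∈ S.interval) (hK : K ⊆ Icc x y) (j k : Fin n) :
    IntegrableOn (fun t => S.coef lam t j k) K S.μ := by
  simp only [coef, Matrix.mul_apply, Matrix.sub_apply, Matrix.smul_apply]
  exact integrable_finsetSum _ fun l _ =>
    (((W_integrableOn hx hy hK l k).smul lam).sub (Q_integrableOn hx hy hK l k)).const_mul _

lemma LocInt.inv_integrableOn {f : ℝ → Fin n → ℂ} (hf : S.LocInt f) {K : Set ℝ} {x y : ℝ}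
    (hx : x ∈ S.interval) (hy : y ∈ S.interval) (hK : K ⊆ Icc x y) :
    IntegrableOn (fun t => S.J⁻¹ *ᵥ (S.W t *ᵥ f t)) K S.μ :=
  (mulVecCLM S.J⁻¹).integrable_comp ((hf x hx y hy).mono_set hK)

lemma openInterval_subset_right {c : ℝ} {hi : EReal} (hc : c ∈ S.interval) (hhi : hi ≤ S.b) :
    openInterval c hi ⊆ S.interval := openInterval_mono hc.1.le hhi

lemma openInterval_subset_left {c : ℝ} {lo : EReal} (hc : c ∈ S.interval) (hlo : S.a ≤ lo) :
    openInterval lo c ⊆ S.interval := openInterval_mono hlo hc.2.le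

/-! ### Reflection of the coefficients -/

lemma reflect_inv_J : S.reflect.J⁻¹ = -S.J⁻¹ := by
  change (-S.J)⁻¹ = -S.J⁻¹
  exact Matrix.inv_eq_left_inv (by rw [neg_mul_neg, inv_mul_J])

lemma reflect_coef (lam : ℂ) (x : ℝ) : S.reflect.coef lam x = -S.coef lam (-x) := by
  rw [coef, reflect_inv_J, neg_mul]; rfl

lemma reflect_measureReal (x : ℝ) : S.reflect.μ.real {x} = S.μ.real {-x} := by
  change (S.μ.map Neg.neg).real {x} = _
  rw [measureReal_def, map_neg_real_singleton]; rfl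

lemma reflect_halfJump (lam : ℂ) (x : ℝ) : S.reflect.halfJump lam x = -S.halfJump lam (-x) := by
  rw [halfJump, reflect_coef, smul_neg, reflect_measureReal]; rfl

lemma reflect_regular {lam : ℂ} {x : ℝ} : S.reflect.Regular lam x ↔ S.Regular lam (-x) := by
  rw [Regular, Regular, reflect_halfJump, sub_neg_eq_add, ← sub_eq_add_neg, and_comm]

lemma LocInt.reflect {f : ℝ → Fin n → ℂ} (hf : S.LocInt f) :
    S.reflect.LocInt fun x => f (-x) := fun _ hx _ hy =>
  integrableOn_comp_neg_iff.2 (hf _ (mem_reflect_interval.1 hy) _ (mem_reflect_interval.1 hx))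

/-- For λ = 0 one has 1 ∓ X = ½ J⁻¹(2J ± Δ_q), invertible by assumption. For nonreal λ nothing of
the kind is assumed. -/
lemma regular_zero {x : ℝ} (hx : x ∈ S.interval) : S.Regular 0 x := by
  have h := S.jump_invertible x hx
  have hJ : IsUnit S.J⁻¹ := (Matrix.isUnit_nonsing_inv_iff).2 S.J_invertible
  have e : ∀ A : Matrix (Fin n) (Fin n) ℂ, IsUnit A → IsUnit ((2⁻¹ : ℂ) • (S.J⁻¹ * A)) :=
    fun A hA => (hJ.mul hA).smul (Units.mk0 (2⁻¹ : ℂ) (by norm_num))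
  have c : S.halfJump 0 x = (2⁻¹ : ℂ) • (S.J⁻¹ * -(((S.μ {x}).toReal : ℂ) • S.Q x)) := by
    rw [halfJump, coef, zero_smul, zero_sub, mul_neg, mul_neg, mul_smul_comm, mul_smul,
      smul_neg, smul_neg, smul_neg]
    ext j k
    simp [measureReal_def]
  have i : (1 : Matrix (Fin n) (Fin n) ℂ) = (2⁻¹ : ℂ) • (S.J⁻¹ * ((2 : ℂ) • S.J)) := by
    rw [mul_smul_comm, inv_mul_J, smul_smul]; norm_num
  refine ⟨?_, ?_⟩
  · rw [c, i, ← smul_sub, ← mul_sub, sub_neg_eq_add]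
    exact e _ h.1
  · rw [c, i, ← smul_add, ← mul_add, ← sub_eq_add_neg]
    exact e _ h.2

/-! ### Limits at an endpoint inside `(a, b)` -/

lemma norm_rhs_le (lam : ℂ) (u f : ℝ → Fin n → ℂ) (x : ℝ) :
    ‖S.rhs lam u f x‖ ≤ entrySum (S.coef lam x) * ‖u x‖ + ‖S.J⁻¹ *ᵥ (S.W x *ᵥ f x)‖ :=
  (norm_add_le _ _).trans (add_le_add (norm_mulVec_le _ _) le_rfl)

/-- The point c is interior to (a, b), so the coefficients are integrable up to c. Hence so is the
density of u', and u has a limit at c although it solves the equation only to the right of c. -/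
lemma Solves.right_limit {c : ℝ} {hi : EReal} (hc : c ∈ S.interval) (hchi : (c : EReal) < hi)
    (hhi : hi ≤ S.b) {lam : ℂ} {u f : ℝ → Fin n → ℂ} (hf : S.LocInt f)
    (h : S.Solves c hi u (lam • u + f)) :
    Tendsto u (𝓝[>] c) (𝓝 (Function.rightLim u c)) ∧
      ∀ y ∈ openInterval (c : EReal) hi, IntegrableOn (S.rhs lam u f) (Ioc c y) S.μ := by
  have hsub := openInterval_subset_right hc hhi
  have key : ∀ y ∈ openInterval (c : EReal) hi, IntegrableOn (S.rhs lam u f) (Ioc c y) S.μ :=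
    fun y hy => h.balPrim_rhs.integrableOn_near_left hy
      (integrableOn_entrySum fun j k => coef_integrableOn lam hc (hsub hy) Ioc_subset_Icc_self j k)
      (hf.inv_integrableOn hc (hsub hy) Ioc_subset_Icc_self).norm
      (fun _ => entrySum_nonneg _) (fun _ => norm_nonneg _) fun s _ => norm_rhs_le lam u f s
  obtain ⟨y, hcy, hyhi⟩ := EReal.lt_iff_exists_real_btwn.1 hchi
  obtain ⟨ξ, hξ, -⟩ := h.balPrim_rhs.exists_limit_left ⟨hcy, hyhi⟩ (key y ⟨hcy, hyhi⟩)
  exact ⟨by rwa [rightLim_eq_of_tendsto hξ], key⟩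

lemma Solves.left_limit {c : ℝ} {lo : EReal} (hc : c ∈ S.interval) (hclo : lo < (c : EReal))
    (hlo : S.a ≤ lo) {lam : ℂ} {u f : ℝ → Fin n → ℂ} (hf : S.LocInt f)
    (h : S.Solves lo c u (lam • u + f)) :
    Tendsto u (𝓝[<] c) (𝓝 (Function.leftLim u c)) ∧
      ∀ y ∈ openInterval lo (c : EReal), IntegrableOn (S.rhs lam u f) (Ico y c) S.μ := by
  have h' := h.reflect (openInterval_subset_left hc hlo)
  have hc' : -c ∈ S.reflect.interval := mem_reflect_interval.2 (by rwa [neg_neg])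
  obtain ⟨h1, h2⟩ := Solves.right_limit (S := S.reflect) (c := -c) (hi := -lo) hc'
    (by rw [EReal.coe_neg]; exact EReal.neg_lt_neg_iff.2 hclo) (EReal.neg_le_neg_iff.2 hlo)
    hf.reflect (lam := lam) (u := fun x => u (-x)) (by rw [EReal.coe_neg]; exact h')
  rw [tendsto_comp_neg_right, neg_neg] at h1
  refine ⟨by rwa [leftLim_eq_of_tendsto h1], fun y hy => ?_⟩
  have h3 := h2 (-y) (by rw [EReal.coe_neg, mem_openInterval_neg, neg_neg]; exact hy)
  change IntegrableOn _ _ (S.μ.map Neg.neg) at h3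
  rw [measurableEmbedding_neg_real.integrableOn_map_iff, neg_preimage, neg_Ioc, neg_neg,
    neg_neg] at h3
  refine h3.neg.congr (Eventually.of_forall fun x => ?_)
  simp only [Function.comp, rhs, reflect_coef, neg_neg, Pi.neg_apply, reflect_inv_J]
  simp only [Matrix.neg_mulVec, FirstOrderSystem.reflect, neg_neg, neg_add]

/-! ### Gluing -/

/-- The function which is `u` to the left of `c`, `v` to the right of `c`, and balanced at `c`. -/
def glueFun (u v : ℝ → Fin n → ℂ) (c : ℝ) (x : ℝ) : Fin n → ℂ :=
  if x < c then u x else if c < x then v x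
  else (2⁻¹ : ℝ) • (Function.leftLim u c + Function.rightLim v c)

lemma glueFun_of_lt (u v : ℝ → Fin n → ℂ) {c x : ℝ} (h : x < c) : glueFun u v c x = u x := by
  simp [glueFun, h]

lemma glueFun_of_gt (u v : ℝ → Fin n → ℂ) {c x : ℝ} (h : c < x) : glueFun u v c x = v x := by
  simp [glueFun, h, not_lt.2 h.le]

lemma glueFun_self (u v : ℝ → Fin n → ℂ) (c : ℝ) :
    glueFun u v c c = (2⁻¹ : ℝ) • (Function.leftLim u c + Function.rightLim v c) := by
  simp [glueFun]

/-- At the single point c the equation says that the jump is the atom of the density, evaluated at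
the balanced value; this is `hj`. Besides that only integrability up to c is needed, and the
one-sided limit lemmas supply it. -/
lemma Solves.glue {lo hi : EReal} {c : ℝ} (hlo : S.a ≤ lo) (hloc : lo < (c : EReal))
    (hchi : (c : EReal) < hi) (hhi : hi ≤ S.b) {lam : ℂ} {u v f : ℝ → Fin n → ℂ}
    (hf : S.LocInt f) (h : S.Solves lo c u (lam • u + f)) (k : S.Solves c hi v (lam • v + f))
    (hj : Function.rightLim v c - Function.leftLim u c
      = S.μ.real {c} • S.rhs lam (glueFun u v c) f c) :
    S.Solves lo hi (glueFun u v c) (lam • glueFun u v c + f) := by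
  have hc : c ∈ S.interval := ⟨hlo.trans_lt hloc, hchi.trans_le hhi⟩
  obtain ⟨lu, iu⟩ := h.left_limit hc hloc hlo hf
  obtain ⟨lv, iv⟩ := k.right_limit hc hchi hhi hf
  have e1 : ∀ x, x < c → S.rhs lam (glueFun u v c) f x = S.rhs lam u f x := fun x hx => by
    rw [rhs, rhs, glueFun_of_lt u v hx]
  have e2 : ∀ x, c < x → S.rhs lam (glueFun u v c) f x = S.rhs lam v f x := fun x hx => by
    rw [rhs, rhs, glueFun_of_gt u v hx]
  refine solves_of_balPrim_rhs (openInterval_mono hlo hhi) ?_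
  refine BalPrim.glue (c := c) (p := Function.leftLim u c) (q := Function.rightLim v c)
    (h.balPrim_rhs.congr (fun x hx => glueFun_of_lt u v (EReal.coe_lt_coe_iff.1 hx.2))
      fun x hx => e1 x (EReal.coe_lt_coe_iff.1 hx.2))
    (k.balPrim_rhs.congr (fun x hx => glueFun_of_gt u v (EReal.coe_lt_coe_iff.1 hx.1))
      fun x hx => e2 x (EReal.coe_lt_coe_iff.1 hx.1)) ?_ hloc hchi ?_ ?_ (glueFun_self u v c) hj
  · intro x hx y hy
    have i1 : IntegrableOn (S.rhs lam (glueFun u v c) f) (Ico x c) S.μ :=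
      (iu x hx).congr_fun (fun t ht => (e1 t ht.2).symm) measurableSet_Ico
    have i2 : IntegrableOn (S.rhs lam (glueFun u v c) f) (Ioc c y) S.μ :=
      (iv y hy).congr_fun (fun t ht => (e2 t ht.1).symm) measurableSet_Ioc
    have i3 : IntegrableOn (S.rhs lam (glueFun u v c) f) {c} S.μ :=
      integrableOn_singleton (hx := measure_lt_top hc hc (by simp))
    refine ((i1.union i3).union i2).mono_set fun t ht => ?_
    rcases lt_trichotomy t c with h1 | h1 | h1
    · exact Or.inl (Or.inl ⟨ht.1, h1⟩)
    · exact Or.inl (Or.inr h1)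
    · exact Or.inr ⟨h1, ht.2⟩
  · refine lu.congr' ?_
    filter_upwards [self_mem_nhdsWithin] with x hx
    exact (glueFun_of_lt u v hx).symm
  · refine lv.congr' ?_
    filter_upwards [self_mem_nhdsWithin] with x hx
    exact (glueFun_of_gt u v hx).symm

/-! ### Uniqueness -/

/-- Half of the jump at x is Xu(x), so u⁻ = (1 - X)u and u⁺ = (1 + X)u. Crossing x from left to
right means inverting 1 - X, from right to left 1 + X. -/
lemma Solves.leftLim_eq_sub {lo hi : EReal} {lam : ℂ} {u : ℝ → Fin n → ℂ}
    (h : S.Solves lo hi u (lam • u)) {x : ℝ} (hx : x ∈ openInterval lo hi) :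
    Function.leftLim u x = (1 - S.halfJump lam x) *ᵥ u x := by
  have h' : S.Solves lo hi u (lam • u + 0) := by rwa [add_zero]
  rw [h'.balPrim_rhs.leftLim_eq hx, Matrix.sub_mulVec, Matrix.one_mulVec, halfJump,
    Matrix.smul_mulVec]
  simp [rhs]

lemma Solves.rightLim_eq_add {lo hi : EReal} {lam : ℂ} {u : ℝ → Fin n → ℂ}
    (h : S.Solves lo hi u (lam • u)) {x : ℝ} (hx : x ∈ openInterval lo hi) :
    Function.rightLim u x = (1 + S.halfJump lam x) *ᵥ u x := by
  have h' : S.Solves lo hi u (lam • u + 0) := by rwa [add_zero]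
  rw [h'.balPrim_rhs.rightLim_eq hx, Matrix.add_mulVec, Matrix.one_mulVec, halfJump,
    Matrix.smul_mulVec]
  simp [rhs]

lemma eq_zero_of_isUnit_mulVec {A : Matrix (Fin n) (Fin n) ℂ} (hA : IsUnit A) {x : Fin n → ℂ}
    (h : A *ᵥ x = 0) : x = 0 :=
  (Matrix.mulVec_injective_iff_isUnit.2 hA) (by rw [h, Matrix.mulVec_zero])

/-- Continuous induction: if u vanishes on (c, x), then u⁻(x) = 0; inverting 1 - X gives u(x) = 0
and thus u⁺(x) = 0, and `BalPrim.eq_zero_near_left` leads a little beyond x. -/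
lemma Solves.eq_zero_right {c : ℝ} {hi : EReal} (hc : c ∈ S.interval)
    (hhi : hi ≤ S.b) {lam : ℂ} {u : ℝ → Fin n → ℂ} (h : S.Solves c hi u (lam • u))
    (hreg : ∀ x ∈ openInterval (c : EReal) hi, S.Regular lam x)
    (h0 : Tendsto u (𝓝[>] c) (𝓝 0)) : ∀ x ∈ openInterval (c : EReal) hi, u x = 0 := by
  have h' : S.Solves c hi u (lam • u + 0) := by rwa [add_zero]
  have hsub := openInterval_subset_right hc hhi
  have hG : ∀ s, ‖S.rhs lam u 0 s‖ ≤ entrySum (S.coef lam s) * ‖u s‖ := fun s => by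
    simpa using norm_rhs_le lam u 0 s
  have hI : ∀ x y : ℝ, x ∈ S.interval → y ∈ S.interval →
      IntegrableOn (fun s => entrySum (S.coef lam s)) (Ioc x y) S.μ := fun x y hx hy =>
    integrableOn_entrySum fun j k => coef_integrableOn lam hx hy Ioc_subset_Icc_self j k
  intro d hd
  obtain ⟨d', hdd', hd'⟩ := EReal.lt_iff_exists_real_btwn.1 hd.2
  have hcd : c < d := EReal.coe_lt_coe_iff.1 hd.1
  have hdd'' : d < d' := EReal.coe_lt_coe_iff.1 hdd'
  -- A point x > c is in s when u vanishes on (c, x). As an intersection of half-lines s is closed,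
  -- which settles the limit step of the induction.
  set s : Set ℝ := ⋂ t ∈ {t : ℝ | c < t ∧ u t ≠ 0}, Iic t with hs
  have hsmem : ∀ x, x ∈ s ↔ ∀ t, c < t → u t ≠ 0 → x ≤ t := by
    intro x; simp [hs]
  have hclosed : IsClosed s := isClosed_biInter fun _ _ => isClosed_Iic
  have hcs : c ∈ s := (hsmem c).2 fun t ht _ => ht.le
  have hsub2 := IsClosed.Icc_subset_of_forall_exists_gt (a := c) (b := d') (s := s)
    (hclosed.inter isClosed_Icc) hcs ?_
  · by_contra hne
    exact absurd ((hsmem d').1 (hsub2 ⟨(hcd.trans hdd'').le, le_rfl⟩) d hcd hne) (not_le.2 hdd'')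
  · intro x hx y hy
    have hxs := (hsmem x).1 hx.1
    have hxhi : (x : EReal) < hi := (EReal.coe_lt_coe_iff.2 hx.2.2).trans hd'
    have hz : Tendsto u (𝓝[>] x) (𝓝 0) := by
      rcases hx.2.1.eq_or_lt with rfl | hcx
      · exact h0
      · have hxm : x ∈ openInterval (c : EReal) hi := ⟨EReal.coe_lt_coe_iff.2 hcx, hxhi⟩
        have hl : Function.leftLim u x = 0 := by
          refine leftLim_eq_of_tendsto (tendsto_const_nhds.congr' ?_)
          filter_upwards [Ioo_mem_nhdsLT hcx] with t ht
          by_contra hne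
          exact absurd (hxs t ht.1 (Ne.symm hne)) (not_le.2 ht.2)
        rw [h.leftLim_eq_sub hxm] at hl
        have h1 := eq_zero_of_isUnit_mulVec (hreg x hxm).1 hl
        have h2 := h.rightLim_eq_add hxm
        rw [h1, Matrix.mulVec_zero] at h2
        have h3 := (locallyBV_tendsto h.balanced.1 hxm).2
        rwa [h2] at h3
    have hxI : x ∈ S.interval := by
      rcases hx.2.1.eq_or_lt with rfl | hcx
      · exact hc
      · exact hsub ⟨EReal.coe_lt_coe_iff.2 hcx, hxhi⟩
    set y' := min y d' with hy'
    have hxy' : x < y' := lt_min hy hx.2.2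
    have hy'm : y' ∈ openInterval (x : EReal) hi := ⟨EReal.coe_lt_coe_iff.2 hxy',
      (EReal.coe_le_coe_iff.2 (min_le_right _ _)).trans_lt hd'⟩
    obtain ⟨r, hxr, hry, hr⟩ := BalPrim.eq_zero_near_left
      (h'.balPrim_rhs.of_mem (openInterval_mono (EReal.coe_le_coe_iff.2 hx.2.1) le_rfl))
      hy'm (hI x y' hxI (openInterval_subset_right hxI hhi hy'm)) (fun _ => entrySum_nonneg _)
      (fun s _ => hG s) hz
    refine ⟨r, (hsmem r).2 fun t ht hne => ?_, hxr, hry.trans (min_le_left _ _)⟩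
    by_contra! htr
    rcases lt_or_ge x t with hxt | hxt
    · exact hne (hr t ⟨hxt, htr.le⟩)
    · have hxt' := hxs t ht hne
      have hxe : t = x := le_antisymm hxt hxt'
      subst hxe
      have hxm : t ∈ openInterval (c : EReal) hi := ⟨EReal.coe_lt_coe_iff.2 ht, hxhi⟩
      have h2 := rightLim_eq_of_tendsto hz
      rw [h.rightLim_eq_add hxm] at h2
      exact hne (eq_zero_of_isUnit_mulVec (hreg t hxm).2 h2)

/-! ### Existence -/

lemma exists_solution_small {r r' : ℝ} (hr : r ∈ S.interval) (hr' : r' ∈ S.interval) {lam : ℂ}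
    {f : ℝ → Fin n → ℂ} (hf : S.LocInt f)
    (hs : ∫ s in Ioo r r', entrySum (S.coef lam s) ∂S.μ ≤ 1 / 2) (ξ : Fin n → ℂ) :
    ∃ u, S.Solves r r' u (lam • u + f) ∧ Tendsto u (𝓝[>] r) (𝓝 ξ) := by
  obtain ⟨u, hu, e⟩ := exists_local_solution
    (fun j k => coef_integrableOn lam hr hr' Ioo_subset_Icc_self j k)
    (hf.inv_integrableOn hr hr' Ioo_subset_Icc_self) hs ξ
  have e' : u = balIntegral S.μ r r' ξ fun x => S.coef lam x *ᵥ u x + S.J⁻¹ *ᵥ (S.W x *ᵥ f x) :=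
    funext e
  refine ⟨u, solves_of_balPrim_rhs (openInterval_mono hr.1.le hr'.2.le) ?_, ?_⟩
  · exact (balPrim_balIntegral ξ hu).congr (fun x _ => e x) fun _ _ => rfl
  · rw [e']
    exact tendsto_balIntegral_left ξ hu

lemma Solves.exists_extension {lo : EReal} {r r' : ℝ} (hlo : S.a ≤ lo) (hlor : lo < (r : EReal))
    (hrr' : r < r') (hr' : r' ∈ S.interval) {lam : ℂ} {f u : ℝ → Fin n → ℂ} (hf : S.LocInt f)
    (hs : ∫ s in Ioo r r', entrySum (S.coef lam s) ∂S.μ ≤ 1 / 2) (hreg : S.Regular lam r)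
    (h : S.Solves lo r u (lam • u + f)) :
    ∃ v, S.Solves lo r' v (lam • v + f) ∧ ∀ x, x < r → v x = u x := by
  have hr : r ∈ S.interval := ⟨hlo.trans_lt hlor, (EReal.coe_lt_coe_iff.2 hrr').trans hr'.2⟩
  set p := Function.leftLim u r with hp
  set m := S.μ.real {r} with hm
  set g := S.J⁻¹ *ᵥ (S.W r *ᵥ f r) with hg
  -- The value z at r must satisfy (1 - X)z = u⁻ plus half the atom of the inhomogeneity; the
  -- balanced continuation then starts with the right-hand limit 2z - u⁻.
  obtain ⟨z, hz⟩ := (Matrix.mulVec_surjective_iff_isUnit.2 hreg.1) (p + (2⁻¹ * m) • g)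
  obtain ⟨v, hv, lv⟩ := exists_solution_small hr hr' hf hs ((2 : ℝ) • z - p)
  refine ⟨glueFun u v r, Solves.glue hlo hlor (EReal.coe_lt_coe_iff.2 hrr') hr'.2.le hf h hv ?_,
    fun x hx => glueFun_of_lt u v hx⟩
  have e1 : Function.rightLim v r = (2 : ℝ) • z - p := rightLim_eq_of_tendsto lv
  have e2 : glueFun u v r r = z := by
    rw [glueFun_self, e1, ← hp]
    module
  rw [e1, rhs, e2, ← hg, ← hm]
  rw [Matrix.sub_mulVec, Matrix.one_mulVec, halfJump, Matrix.smul_mulVec] at hz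
  linear_combination (norm := module) (2 : ℝ) • hz

/-- The set A of reachable right endpoints is pushed up to d: a short interval to the left of sup A,
with coefficient mass at most 1/2, shows that the supremum is attained, and one to the right of it
that the supremum is d. -/
lemma exists_solution_right_real {c d : ℝ} (hc : c ∈ S.interval) (hcd : c < d)
    (hd : d ∈ S.interval) {lam : ℂ} {f : ℝ → Fin n → ℂ} (hf : S.LocInt f)
    (hreg : ∀ x ∈ Ioo c d, S.Regular lam x) (ξ : Fin n → ℂ) :
    ∃ u, S.Solves c d u (lam • u + f) ∧ Tendsto u (𝓝[>] c) (𝓝 ξ) := by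
  have hI : ∀ x y : ℝ, x ∈ S.interval → y ∈ S.interval →
      IntegrableOn (fun s => entrySum (S.coef lam s)) (Icc x y) S.μ := fun x y hx hy =>
    integrableOn_entrySum fun j k => coef_integrableOn lam hx hy le_rfl j k
  have hmem : ∀ x, c ≤ x → x ≤ d → x ∈ S.interval := fun x h1 h2 =>
    openInterval_Icc_subset hc hd ⟨h1, h2⟩
  have small : ∀ x y : ℝ, x ∈ S.interval → y ∈ S.interval → ∀ z, z ≤ y →
      ∫ s in Ioc x z, entrySum (S.coef lam s) ∂S.μ ≤ 1 / 2 →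
      ∫ s in Ioo x z, entrySum (S.coef lam s) ∂S.μ ≤ 1 / 2 := fun x y hx hy z hz h =>
    (setIntegral_mono_set ((hI x y hx hy).mono_set (Ioc_subset_Icc_self.trans
      (Icc_subset_Icc_right hz))) (Eventually.of_forall fun _ => entrySum_nonneg _)
      (LE.le.eventuallyLE Ioo_subset_Ioc_self)).trans h
  set A : Set ℝ := {r | c < r ∧ r ≤ d ∧
    ∃ u, S.Solves c r u (lam • u + f) ∧ Tendsto u (𝓝[>] c) (𝓝 ξ)} with hA
  have step : ∀ r ∈ A, ∀ r', r < r' → r' ≤ d →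
      ∫ s in Ioo r r', entrySum (S.coef lam s) ∂S.μ ≤ 1 / 2 → r' ∈ A := by
    rintro r ⟨hcr, hrd, u, hu, lu⟩ r' hrr' hr'd hs
    obtain ⟨v, hv, e⟩ := hu.exists_extension hc.1.le (EReal.coe_lt_coe_iff.2 hcr) hrr'
      (hmem r' (hcr.trans hrr').le hr'd) hf hs (hreg r ⟨hcr, hrr'.trans_le hr'd⟩)
    refine ⟨hcr.trans hrr', hr'd, v, hv, lu.congr' ?_⟩
    filter_upwards [Ioo_mem_nhdsGT hcr] with x hx
    exact (e x hx.2).symm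
  have hne : A.Nonempty := by
    obtain ⟨r, hcr, hrd, hs⟩ := exists_small_right hcd
      ((hI c d hc hd).mono_set Ioc_subset_Icc_self)
    obtain ⟨u, hu, lu⟩ := exists_solution_small hc (hmem r hcr.le hrd) hf
      (small c d hc hd r hrd hs) ξ
    exact ⟨r, hcr, hrd, u, hu, lu⟩
  have hbdd : BddAbove A := ⟨d, fun r hr => hr.2.1⟩
  set s := sSup A with hs
  obtain ⟨r₁, hr₁⟩ := hne
  have hcs : c < s := hr₁.1.trans_le (le_csSup hbdd hr₁)
  have hsd : s ≤ d := csSup_le ⟨r₁, hr₁⟩ fun r hr => hr.2.1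
  have hsI := hmem s hcs.le hsd
  have hsA : s ∈ A := by
    obtain ⟨r₀, hcr₀, hr₀s, hs₀⟩ := exists_small_left hcs
      ((hI c s hc hsI).mono_set Ioo_subset_Icc_self)
    obtain ⟨r, hrA, hr⟩ := exists_lt_of_lt_csSup ⟨r₁, hr₁⟩ hr₀s
    rcases (le_csSup hbdd hrA).eq_or_lt with e | hrs
    · exact (show r = s from e) ▸ hrA
    · refine step r hrA s hrs hsd (le_trans ?_ hs₀)
      exact setIntegral_mono_set ((hI r₀ s (hmem _ hcr₀.le (hr₀s.le.trans hsd)) hsI).mono_set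
        Ioo_subset_Icc_self) (Eventually.of_forall fun _ => entrySum_nonneg _)
        (LE.le.eventuallyLE (Ioo_subset_Ioo_left hr.le))
  rcases hsd.eq_or_lt with e | hsd'
  · rw [e] at hsA
    exact hsA.2.2
  · obtain ⟨r, hsr, hrd, hs'⟩ := exists_small_right hsd'
      ((hI s d hsI hd).mono_set Ioc_subset_Icc_self)
    have := step s hsA r hsr hrd (small s d hsI hd r hrd hs')
    exact absurd (le_csSup hbdd this) (not_le.2 hsr)

lemma Solves.sub {lo hi : EReal} {lam : ℂ} {u v f : ℝ → Fin n → ℂ}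
    (h : S.Solves lo hi u (lam • u + f)) (k : S.Solves lo hi v (lam • v + f)) :
    S.Solves lo hi (u - v) (lam • (u - v)) := by
  have := h.add (k.smul (-1))
  convert this using 1
  · module
  · module

/-- By uniqueness the solutions on (c, d) for various d agree where both are defined, and together
they form a solution on (c, hi), where hi may be the endpoint b. -/
lemma exists_solution_right {c : ℝ} {hi : EReal} (hc : c ∈ S.interval) (hchi : (c : EReal) < hi)
    (hhi : hi ≤ S.b) {lam : ℂ} {f : ℝ → Fin n → ℂ} (hf : S.LocInt f)
    (hreg : ∀ x ∈ openInterval (c : EReal) hi, S.Regular lam x) (ξ : Fin n → ℂ) :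
    ∃ u, S.Solves c hi u (lam • u + f) ∧ Tendsto u (𝓝[>] c) (𝓝 ξ) := by
  have hsub := openInterval_subset_right hc hhi
  have ex : ∀ d : ℝ, d ∈ openInterval (c : EReal) hi →
      ∃ u, S.Solves c d u (lam • u + f) ∧ Tendsto u (𝓝[>] c) (𝓝 ξ) := fun d hd =>
    exists_solution_right_real hc (EReal.coe_lt_coe_iff.1 hd.1) (hsub hd) hf
      (fun x hx => hreg x ⟨EReal.coe_lt_coe_iff.2 hx.1, (EReal.coe_lt_coe_iff.2 hx.2).trans hd.2⟩) ξ
  choose! U hU lU using ex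
  have agree : ∀ d ∈ openInterval (c : EReal) hi, ∀ e ∈ openInterval (c : EReal) hi, d ≤ e →
      ∀ x, c < x → x < d → U d x = U e x := by
    intro d hd e he hde x hcx hxd
    have hsol : S.Solves c d (U d - U e) (lam • (U d - U e)) :=
      (hU d hd).sub ((hU e he).mono (openInterval_mono le_rfl (EReal.coe_le_coe_iff.2 hde)))
    have := hsol.eq_zero_right hc (hd.2.le.trans hhi)
      (fun y hy => hreg y ⟨hy.1, hy.2.trans hd.2⟩)
      (by have := (lU d hd).sub (lU e he); rwa [sub_self] at this) x
      ⟨EReal.coe_lt_coe_iff.2 hcx, EReal.coe_lt_coe_iff.2 hxd⟩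
    exact sub_eq_zero.1 this
  have hbt : ∀ x ∈ openInterval (c : EReal) hi, ∃ d : ℝ, x < d ∧ d ∈ openInterval (c : EReal) hi :=
    fun x hx => by
      obtain ⟨d, h1, h2⟩ := EReal.lt_iff_exists_real_btwn.1 hx.2
      exact ⟨d, EReal.coe_lt_coe_iff.1 h1, hx.1.trans h1, h2⟩
  choose! D hD1 hD2 using hbt
  have eqU : ∀ d ∈ openInterval (c : EReal) hi, ∀ x, c < x → x < d → U (D x) x = U d x := by
    intro d hd x hcx hxd
    have hx : x ∈ openInterval (c : EReal) hi :=
      ⟨EReal.coe_lt_coe_iff.2 hcx, (EReal.coe_lt_coe_iff.2 hxd).trans hd.2⟩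
    rcases le_total (D x) d with h | h
    · exact agree _ (hD2 x hx) _ hd h x hcx (hD1 x hx)
    · exact (agree _ hd _ (hD2 x hx) h x hcx hxd).symm
  refine ⟨fun x => U (D x) x, solves_of_balPrim_rhs hsub ⟨fun x hx y hy => ?_,
    fun x hx y hy hxy => ?_⟩, ?_⟩
  · rcases le_or_gt x y with hxy | hxy
    swap
    · rw [Icc_eq_empty (not_le.2 hxy)]; exact integrableOn_empty
    obtain ⟨d, hyd, hd⟩ : ∃ d, y < d ∧ d ∈ openInterval (c : EReal) hi :=
      ⟨D y, hD1 y hy, hD2 y hy⟩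
    refine ((hU d hd).balPrim_rhs.int x ⟨hx.1, EReal.coe_lt_coe_iff.2 (hxy.trans_lt hyd)⟩ y
      ⟨hy.1, EReal.coe_lt_coe_iff.2 hyd⟩).congr_fun (fun t ht => ?_) measurableSet_Icc
    rw [rhs, rhs, eqU d hd t ((EReal.coe_lt_coe_iff.1 hx.1).trans_le ht.1) (ht.2.trans_lt hyd)]
  · have hd := hD2 y hy
    have hyd := hD1 y hy
    have := (hU _ hd).balPrim_rhs.eq x ⟨hx.1, EReal.coe_lt_coe_iff.2 (hxy.trans_lt hyd)⟩ y
      ⟨hy.1, EReal.coe_lt_coe_iff.2 hyd⟩ hxy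
    rw [eqU _ hd x (EReal.coe_lt_coe_iff.1 hx.1) (hxy.trans_lt hyd), this]
    refine setIntegral_congr_fun measurableSet_Icc fun t ht => ?_
    rw [rhs, rhs, eqU _ hd t ((EReal.coe_lt_coe_iff.1 hx.1).trans_le ht.1) (ht.2.trans_lt hyd)]
  · obtain ⟨d, hcd, hd⟩ := EReal.lt_iff_exists_real_btwn.1 hchi
    refine (lU d ⟨hcd, hd⟩).congr' ?_
    filter_upwards [Ioo_mem_nhdsGT (EReal.coe_lt_coe_iff.1 hcd)] with x hx
    exact (eqU d ⟨hcd, hd⟩ x hx.1 hx.2).symm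

lemma exists_solution_left {c : ℝ} {lo : EReal} (hc : c ∈ S.interval) (hclo : lo < (c : EReal))
    (hlo : S.a ≤ lo) {lam : ℂ} {f : ℝ → Fin n → ℂ} (hf : S.LocInt f)
    (hreg : ∀ x ∈ openInterval lo (c : EReal), S.Regular lam x) (ξ : Fin n → ℂ) :
    ∃ u, S.Solves lo c u (lam • u + f) ∧ Tendsto u (𝓝[<] c) (𝓝 ξ) := by
  have hc' : -c ∈ S.reflect.interval := mem_reflect_interval.2 (by rwa [neg_neg])
  obtain ⟨u, hu, lu⟩ := exists_solution_right (S := S.reflect) (c := -c) (hi := -lo) hc'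
    (by rw [EReal.coe_neg]; exact EReal.neg_lt_neg_iff.2 hclo) (EReal.neg_le_neg_iff.2 hlo)
    hf.reflect (lam := lam) (fun x hx => by
      rw [EReal.coe_neg, mem_openInterval_neg] at hx
      exact reflect_regular.2 (hreg _ hx)) ξ
  refine ⟨fun x => u (-x), ?_, ?_⟩
  · rw [← solves_reflect_iff (openInterval_subset_left hc hlo)]
    rw [EReal.coe_neg] at hu
    simpa only [neg_neg, Pi.add_apply, Pi.smul_apply, Pi.add_def, Pi.smul_def] using hu
  · rwa [tendsto_comp_neg_left]

lemma Solves.eq_zero_left {c : ℝ} {lo : EReal} (hc : c ∈ S.interval)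
    (hlo : S.a ≤ lo) {lam : ℂ} {u : ℝ → Fin n → ℂ} (h : S.Solves lo c u (lam • u))
    (hreg : ∀ x ∈ openInterval lo (c : EReal), S.Regular lam x)
    (h0 : Tendsto u (𝓝[<] c) (𝓝 0)) : ∀ x ∈ openInterval lo (c : EReal), u x = 0 := by
  have hc' : -c ∈ S.reflect.interval := mem_reflect_interval.2 (by rwa [neg_neg])
  have h' := h.reflect (openInterval_subset_left hc hlo)
  intro x hx
  have := Solves.eq_zero_right (S := S.reflect) (c := -c) (hi := -lo) hc'
    (EReal.neg_le_neg_iff.2 hlo)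
    (lam := lam) (u := fun x => u (-x)) (by rw [EReal.coe_neg]; exact h') (fun x hx => by
      rw [EReal.coe_neg, mem_openInterval_neg] at hx
      exact reflect_regular.2 (hreg _ hx)) (by rwa [tendsto_comp_neg_right, neg_neg]) (-x)
      (by rw [EReal.coe_neg, mem_openInterval_neg, neg_neg]; exact hx)
  simpa using this

end FirstOrderSystem

/-! ### The energy of solutions and the singular points -/

namespace FirstOrderSystem

section General

variable {n : ℕ} {S : FirstOrderSystem n}

lemma form_self (z : Fin n → ℂ) : S.form z z = ((S.form z z).im : ℂ) * Complex.I := by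
  have h := S.star_form z z
  apply Complex.ext
  · have := congrArg Complex.re h
    simp at this ⊢
    linarith
  · simp

/-- The energy of `z`; along a solution of `J u' + q u = lam w u` it increases by `∫ u* w u`. -/
def height (S : FirstOrderSystem n) (lam : ℂ) (z : Fin n → ℂ) : ℝ :=
  (S.form z z).im / (2 * lam.im)

lemma continuous_height (lam : ℂ) : Continuous (S.height lam) :=
  (Complex.continuous_im.comp (S.continuous_form.comp (continuous_id.prodMk continuous_id))).div_const _

lemma height_zero (lam : ℂ) : S.height lam 0 = 0 := by simp [height, form]

lemma height_smul (lam c : ℂ) (z : Fin n → ℂ) :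
    S.height lam (c • z) = ‖c‖ ^ 2 * S.height lam z := by
  rw [height, height, form_smul_left, form_smul_right, ← mul_assoc]
  have : star c * c = ((‖c‖ ^ 2 : ℝ) : ℂ) := by
    rw [Complex.star_def, Complex.conj_mul']; push_cast; rfl
  rw [this, Complex.im_ofReal_mul, mul_div_assoc]

lemma form_self_eq_height {lam : ℂ} (hl : lam.im ≠ 0) (z : Fin n → ℂ) :
    S.form z z = ((2 * lam.im * S.height lam z : ℝ) : ℂ) * Complex.I := by
  rw [height, mul_div_cancel₀ _ (by simpa using hl)]
  exact form_self z

lemma density_smul_right (c : ℂ) (u v : ℝ → Fin n → ℂ) (x : ℝ) :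
    S.density v (c • u) x = c * S.density v u x := by
  simp [density, Matrix.mulVec_smul]

lemma density_smul_left (c : ℂ) (u v : ℝ → Fin n → ℂ) (x : ℝ) :
    S.density (c • v) u x = star c * S.density v u x := by
  simp [density, star_smul]

lemma density_self_nonneg (u : ℝ → Fin n → ℂ) {x : ℝ} (hx : x ∈ S.interval) :
    0 ≤ S.density u u x := (S.W_nonneg x hx).dotProduct_mulVec_nonneg (u x)

lemma density_self_re (u : ℝ → Fin n → ℂ) {x : ℝ} (hx : x ∈ S.interval) :
    S.density u u x = ((S.density u u x).re : ℂ) := by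
  have := density_self_nonneg u hx
  rw [Complex.le_def] at this
  exact Complex.ext rfl (by simpa using this.2.symm)

lemma density_self_re_nonneg (u : ℝ → Fin n → ℂ) {x : ℝ} (hx : x ∈ S.interval) :
    0 ≤ (S.density u u x).re := by
  have := density_self_nonneg u hx
  rw [Complex.le_def] at this
  exact this.1

lemma mulVec_eq_zero_of_density {u : ℝ → Fin n → ℂ} {x : ℝ} (hx : x ∈ S.interval)
    (h : S.density u u x = 0) : S.W x *ᵥ u x = 0 :=
  ((S.W_nonneg x hx).dotProduct_mulVec_zero_iff (u x)).1 h

/-- The increment of the energy along a solution. -/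
lemma Solves.height_sub {lo hi : EReal} (hsub : openInterval lo hi ⊆ S.interval) {lam : ℂ}
    (hl : lam.im ≠ 0) {u : ℝ → Fin n → ℂ} (h : S.Solves lo hi u (lam • u)) {x y : ℝ}
    (hx : x ∈ openInterval lo hi) (hy : y ∈ openInterval lo hi) (hxy : x ≤ y) :
    IntegrableOn (fun t => (S.density u u t).re) (Icc x y) S.μ ∧
    S.height lam (Function.rightLim u y) - S.height lam (Function.leftLim u x)
      = ∫ t in Icc x y, (S.density u u t).re ∂S.μ := by
  obtain ⟨hi', e⟩ := Solves.green hsub h h hx hy hxy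
  have e1 : ∀ t ∈ Icc x y, S.density u (lam • u) t - S.density (lam • u) u t
      = ((2 * lam.im * (S.density u u t).re : ℝ) : ℂ) * Complex.I := fun t ht => by
    rw [density_smul_right, density_smul_left,
      density_self_re u (hsub (openInterval_Icc_subset hx hy ht))]
    apply Complex.ext <;> simp
    ring
  have hint : IntegrableOn (fun t => ((2 * lam.im * (S.density u u t).re : ℝ) : ℂ) * Complex.I)
      (Icc x y) S.μ := hi'.congr_fun e1 measurableSet_Icc
  have hre : IntegrableOn (fun t => 2 * lam.im * (S.density u u t).re) (Icc x y) S.μ := by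
    have h2 : IntegrableOn (fun t => (((2 * lam.im * (S.density u u t).re : ℝ) : ℂ)
        * Complex.I).im) (Icc x y) S.μ := hint.im
    refine h2.congr_fun (fun t _ => ?_) measurableSet_Icc
    simp only [Complex.im_ofReal_mul, Complex.I_im, mul_one]
  rw [setIntegral_congr_fun measurableSet_Icc e1, integral_mul_const, integral_complex_ofReal,
    integral_const_mul, form_self_eq_height hl, form_self_eq_height hl] at e
  have hl2 : 2 * lam.im ≠ 0 := by simpa using hl
  refine ⟨?_, ?_⟩
  · refine IntegrableOn.congr_fun (hre.const_mul (2 * lam.im)⁻¹) (fun t _ => ?_) measurableSet_Icc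
    exact inv_mul_cancel_left₀ hl2 _
  · have e2 := congrArg Complex.im e
    simp only [Complex.sub_im, Complex.mul_im, Complex.ofReal_re, Complex.I_im, mul_one,
      Complex.ofReal_im, Complex.I_re, mul_zero, add_zero] at e2
    rw [← mul_sub] at e2
    exact mul_left_cancel₀ hl2 e2

section Monotone

variable {lo hi : EReal} {lam : ℂ} {u : ℝ → Fin n → ℂ} {x y : ℝ}

lemma integral_density_nonneg (hx : x ∈ S.interval) (hy : y ∈ S.interval) :
    0 ≤ ∫ t in Icc x y, (S.density u u t).re ∂S.μ :=
  setIntegral_nonneg measurableSet_Icc fun _ ht =>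
    density_self_re_nonneg u (openInterval_Icc_subset hx hy ht)

lemma Solves.height_left_le_right (hsub : openInterval lo hi ⊆ S.interval) (hl : lam.im ≠ 0)
    (h : S.Solves lo hi u (lam • u)) (hx : x ∈ openInterval lo hi) (hy : y ∈ openInterval lo hi)
    (hxy : x ≤ y) :
    S.height lam (Function.leftLim u x) ≤ S.height lam (Function.rightLim u y) := by
  have := (h.height_sub hsub hl hx hy hxy).2
  have := integral_density_nonneg (u := u) (hsub hx) (hsub hy)
  linarith

lemma Solves.height_right_mono (hsub : openInterval lo hi ⊆ S.interval) (hl : lam.im ≠ 0)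
    (h : S.Solves lo hi u (lam • u)) (hx : x ∈ openInterval lo hi) (hy : y ∈ openInterval lo hi)
    (hxy : x ≤ y) :
    S.height lam (Function.rightLim u x) ≤ S.height lam (Function.rightLim u y) := by
  have e1 := h.height_sub hsub hl hx hy hxy
  have e2 := h.height_sub hsub hl hx hx le_rfl
  have : ∫ t in Icc x x, (S.density u u t).re ∂S.μ ≤ ∫ t in Icc x y, (S.density u u t).re ∂S.μ :=
    setIntegral_mono_set e1.1 ((ae_restrict_iff' measurableSet_Icc).2 (Eventually.of_forall
      fun t ht => density_self_re_nonneg u (hsub (openInterval_Icc_subset hx hy ht))))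
      (LE.le.eventuallyLE (Icc_subset_Icc_right hxy))
  linarith [e1.2, e2.2]

lemma Solves.height_left_mono (hsub : openInterval lo hi ⊆ S.interval) (hl : lam.im ≠ 0)
    (h : S.Solves lo hi u (lam • u)) (hx : x ∈ openInterval lo hi) (hy : y ∈ openInterval lo hi)
    (hxy : x ≤ y) :
    S.height lam (Function.leftLim u x) ≤ S.height lam (Function.leftLim u y) := by
  have e1 := h.height_sub hsub hl hx hy hxy
  have e2 := h.height_sub hsub hl hy hy le_rfl
  have : ∫ t in Icc y y, (S.density u u t).re ∂S.μ ≤ ∫ t in Icc x y, (S.density u u t).re ∂S.μ :=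
    setIntegral_mono_set e1.1 ((ae_restrict_iff' measurableSet_Icc).2 (Eventually.of_forall
      fun t ht => density_self_re_nonneg u (hsub (openInterval_Icc_subset hx hy ht))))
      (LE.le.eventuallyLE (Icc_subset_Icc_left hxy))
  linarith [e1.2, e2.2]

end Monotone

/-- The product rule for u*Ju at one point: q and the real part of λ drop out, and λ minus its
conjugate, 2i Im λ, remains in front of w. -/
lemma form_inv_smul_sub {x : ℝ} (hx : x ∈ S.interval) (lam : ℂ) (z : Fin n → ℂ) :
    S.form z (S.coef lam x *ᵥ z) + S.form (S.coef lam x *ᵥ z) z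
      = (2 * lam.im * (star z ⬝ᵥ (S.W x *ᵥ z)).re : ℝ) * Complex.I := by
  have e : S.coef lam x *ᵥ z = S.J⁻¹ *ᵥ (S.W x *ᵥ (lam • z) - S.Q x *ᵥ z) := by
    rw [coef, ← Matrix.mulVec_mulVec, Matrix.sub_mulVec, Matrix.smul_mulVec, Matrix.mulVec_smul]
  have hr : star z ⬝ᵥ (S.W x *ᵥ z) = ((star z ⬝ᵥ (S.W x *ᵥ z)).re : ℂ) :=
    density_self_re (fun _ => z) hx
  rw [e, form_mulVec_inv_add x hx, Matrix.mulVec_smul, dotProduct_smul, star_smul, smul_dotProduct,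
    smul_eq_mul, smul_eq_mul, hr]
  apply Complex.ext <;> simp
  ring

/-- The jump of the energy at an atom. -/
lemma height_jump {x : ℝ} (hx : x ∈ S.interval) {lam : ℂ} (hl : lam.im ≠ 0) (z : Fin n → ℂ) :
    S.height lam ((1 + S.halfJump lam x) *ᵥ z) - S.height lam ((1 - S.halfJump lam x) *ᵥ z)
      = S.μ.real {x} * (star z ⬝ᵥ (S.W x *ᵥ z)).re := by
  have h := form_inv_smul_sub hx lam z
  set y := S.coef lam x *ᵥ z
  set r : ℝ := 2⁻¹ * S.μ.real {x} with hr
  have e : S.halfJump lam x *ᵥ z = (r : ℂ) • y := by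
    rw [halfJump, Matrix.smul_mulVec, Complex.coe_smul]
  have e2 : S.form (z + (r : ℂ) • y) (z + (r : ℂ) • y) - S.form (z - (r : ℂ) • y) (z - (r : ℂ) • y)
      = 2 * r * (S.form z y + S.form y z) := by
    simp only [sub_eq_add_neg, ← neg_smul, form_add_left, form_add_right, form_smul_left,
      form_smul_right, star_neg, Complex.star_def, Complex.conj_ofReal]
    ring
  rw [Matrix.add_mulVec, Matrix.sub_mulVec, Matrix.one_mulVec, e, height, height, ← sub_div,
    ← Complex.sub_im, e2, h]
  have hl2 : 2 * lam.im ≠ 0 := by simpa using hl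
  rw [div_eq_iff hl2]
  simp [hr]
  ring

/-- If the atom of w vanishes on k, then λ does not enter Xk, so k would be an eigenvector to the
eigenvalue 1 or -1 for λ = 0 too. This contradicts `regular_zero` unless k = 0. -/
lemma eq_zero_of_halfJump {x : ℝ} (hx : x ∈ S.interval) {lam : ℂ} {k : Fin n → ℂ} {ε : ℂ}
    (hk : S.halfJump lam x *ᵥ k = ε • k) (hε : ε = 1 ∨ ε = -1)
    (h : S.μ.real {x} * (star k ⬝ᵥ (S.W x *ᵥ k)).re = 0) : k = 0 := by
  have hW : S.μ.real {x} • (S.W x *ᵥ k) = 0 := by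
    rcases mul_eq_zero.1 h with h | h
    · rw [h, zero_smul]
    · rw [mulVec_eq_zero_of_density (u := fun _ => k) hx, smul_zero]
      rw [density_self_re (fun _ => k) hx, density, h, Complex.ofReal_zero]
  have key : ∀ c : ℂ, S.halfJump c x *ᵥ k = -(2⁻¹ * S.μ.real {x}) • (S.J⁻¹ *ᵥ (S.Q x *ᵥ k)) := by
    intro c
    have e1 : (2⁻¹ * S.μ.real {x}) • (S.J⁻¹ *ᵥ (c • S.W x *ᵥ k)) = 0 := by
      rw [mul_smul, ← Matrix.mulVec_smul, smul_comm (S.μ.real {x}) c, hW]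
      simp
    rw [halfJump, Matrix.smul_mulVec, coef, ← Matrix.mulVec_mulVec, Matrix.sub_mulVec,
      Matrix.mulVec_sub, smul_sub, Matrix.smul_mulVec, e1]
    module
  have e : S.halfJump 0 x *ᵥ k = ε • k := by rw [← hk, key, key]
  rcases hε with rfl | rfl
  · refine eq_zero_of_isUnit_mulVec (regular_zero hx).1 ?_
    rw [Matrix.sub_mulVec, Matrix.one_mulVec, e, one_smul, sub_self]
  · refine eq_zero_of_isUnit_mulVec (regular_zero hx).2 ?_
    rw [Matrix.add_mulVec, Matrix.one_mulVec, e]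
    module

/-- Here 1 + X annihilates k and 1 - X doubles it, so the jump formula at k reads h(0) - h(2k) =
μ{x} k*Wk ≥ 0. Equality is excluded by `eq_zero_of_halfJump`. -/
lemma height_neg_of_halfJump {x : ℝ} (hx : x ∈ S.interval) {lam : ℂ} (hl : lam.im ≠ 0)
    {k : Fin n → ℂ} (hk : S.halfJump lam x *ᵥ k = -k) (h0 : k ≠ 0) : S.height lam k < 0 := by
  have h := height_jump hx hl k
  have e1 : (1 + S.halfJump lam x) *ᵥ k = 0 := by
    rw [Matrix.add_mulVec, Matrix.one_mulVec, hk, add_neg_cancel]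
  have e2 : (1 - S.halfJump lam x) *ᵥ k = (2 : ℂ) • k := by
    rw [Matrix.sub_mulVec, Matrix.one_mulVec, hk]; module
  rw [e1, e2, height_zero, height_smul] at h
  norm_num at h
  have hnn : 0 ≤ S.μ.real {x} * (star k ⬝ᵥ (S.W x *ᵥ k)).re :=
    mul_nonneg measureReal_nonneg (density_self_re_nonneg (fun _ => k) hx)
  refine lt_of_le_of_ne (by linarith) fun hne => h0 ?_
  refine eq_zero_of_halfJump hx (ε := -1) (by rw [hk, neg_one_smul]) (Or.inr rfl) ?_
  rw [← h, hne]; simp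

lemma height_pos_of_halfJump {x : ℝ} (hx : x ∈ S.interval) {lam : ℂ} (hl : lam.im ≠ 0)
    {k : Fin n → ℂ} (hk : S.halfJump lam x *ᵥ k = k) (h0 : k ≠ 0) : 0 < S.height lam k := by
  have h := height_jump hx hl k
  have e1 : (1 - S.halfJump lam x) *ᵥ k = 0 := by
    rw [Matrix.sub_mulVec, Matrix.one_mulVec, hk, sub_self]
  have e2 : (1 + S.halfJump lam x) *ᵥ k = (2 : ℂ) • k := by
    rw [Matrix.add_mulVec, Matrix.one_mulVec, hk]; module
  rw [e1, e2, height_zero, height_smul] at h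
  norm_num at h
  have hnn : 0 ≤ S.μ.real {x} * (star k ⬝ᵥ (S.W x *ᵥ k)).re :=
    mul_nonneg measureReal_nonneg (density_self_re_nonneg (fun _ => k) hx)
  refine lt_of_le_of_ne (by linarith) fun hne => h0 ?_
  refine eq_zero_of_halfJump hx (ε := 1) (by rw [hk, one_smul]) (Or.inl rfl) ?_
  rw [← h, ← hne]; simp

/-! ### Limits at interior endpoints -/

lemma exists_hom_right {c : ℝ} {hi : EReal} (hc : c ∈ S.interval) (hchi : (c : EReal) < hi)
    (hhi : hi ≤ S.b) {lam : ℂ} (hreg : ∀ x ∈ openInterval (c : EReal) hi, S.Regular lam x)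
    (ξ : Fin n → ℂ) : ∃ u, S.Solves c hi u (lam • u) ∧ Function.rightLim u c = ξ := by
  obtain ⟨u, hu, lu⟩ := exists_solution_right hc hchi hhi LocInt.zero hreg ξ
  rw [add_zero] at hu
  exact ⟨u, hu, rightLim_eq_of_tendsto lu⟩

lemma exists_hom_left {c : ℝ} {lo : EReal} (hc : c ∈ S.interval) (hclo : lo < (c : EReal))
    (hlo : S.a ≤ lo) {lam : ℂ} (hreg : ∀ x ∈ openInterval lo (c : EReal), S.Regular lam x)
    (ξ : Fin n → ℂ) : ∃ u, S.Solves lo c u (lam • u) ∧ Function.leftLim u c = ξ := by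
  obtain ⟨u, hu, lu⟩ := exists_solution_left hc hclo hlo LocInt.zero hreg ξ
  rw [add_zero] at hu
  exact ⟨u, hu, leftLim_eq_of_tendsto lu⟩

lemma Solves.tendsto_right {c : ℝ} {hi : EReal} (hc : c ∈ S.interval) (hchi : (c : EReal) < hi)
    (hhi : hi ≤ S.b) {lam : ℂ} {u : ℝ → Fin n → ℂ} (h : S.Solves c hi u (lam • u)) :
    Tendsto u (𝓝[>] c) (𝓝 (Function.rightLim u c)) :=
  (Solves.right_limit hc hchi hhi LocInt.zero (f := 0) (by rwa [add_zero])).1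

lemma Solves.tendsto_left {c : ℝ} {lo : EReal} (hc : c ∈ S.interval) (hclo : lo < (c : EReal))
    (hlo : S.a ≤ lo) {lam : ℂ} {u : ℝ → Fin n → ℂ} (h : S.Solves lo c u (lam • u)) :
    Tendsto u (𝓝[<] c) (𝓝 (Function.leftLim u c)) :=
  (Solves.left_limit hc hclo hlo LocInt.zero (f := 0) (by rwa [add_zero])).1

/-- If `u` tends to `ξ` at `c` from the right, then so do its one-sided limits. -/
lemma tendsto_sided_of_tendsto_right {lo hi : EReal} {u : ℝ → Fin n → ℂ}
    (hu : LocallyBoundedVariationOn u (openInterval lo hi)) {c : ℝ} (hlo : lo ≤ c)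
    (hhi : (c : EReal) < hi) {ξ : Fin n → ℂ}
    (h : Tendsto u (𝓝[>] c) (𝓝 ξ)) :
    Tendsto (Function.leftLim u) (𝓝[>] c) (𝓝 ξ) ∧ Tendsto (Function.rightLim u) (𝓝[>] c) (𝓝 ξ) := by
  obtain ⟨d, hd1, hd2⟩ := EReal.lt_iff_exists_real_btwn.1 hhi
  have hcd : c < d := EReal.coe_lt_coe_iff.1 hd1
  have hm : ∀ x ∈ Ioo c d, x ∈ openInterval lo hi := fun x hx =>
    ⟨hlo.trans_lt (EReal.coe_lt_coe_iff.2 hx.1), (EReal.coe_lt_coe_iff.2 hx.2).trans hd2⟩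
  have key : ∀ ε > 0, ∃ e, c < e ∧ e ≤ d ∧ ∀ t ∈ Ioo c e, u t ∈ Metric.closedBall ξ ε := by
    intro ε hε
    obtain ⟨e, he, hs⟩ := (mem_nhdsGT_iff_exists_Ioo_subset' hcd).1
      (h (Metric.closedBall_mem_nhds ξ hε))
    exact ⟨min e d, lt_min he hcd, min_le_right _ _, fun t ht =>
      hs ⟨ht.1, ht.2.trans_le (min_le_left _ _)⟩⟩
  constructor
  · refine Metric.nhds_basis_closedBall.tendsto_right_iff.2 fun ε hε => ?_
    obtain ⟨e, hce, hed, hs⟩ := key ε hε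
    filter_upwards [Ioo_mem_nhdsGT hce] with x hx
    refine Metric.isClosed_closedBall.mem_of_tendsto
      (locallyBV_tendsto hu (hm x ⟨hx.1, hx.2.trans_le hed⟩)).1 ?_
    filter_upwards [Ioo_mem_nhdsLT hx.1] with t ht
    exact hs t ⟨ht.1, ht.2.trans hx.2⟩
  · refine Metric.nhds_basis_closedBall.tendsto_right_iff.2 fun ε hε => ?_
    obtain ⟨e, hce, hed, hs⟩ := key ε hε
    filter_upwards [Ioo_mem_nhdsGT hce] with x hx
    refine Metric.isClosed_closedBall.mem_of_tendsto
      (locallyBV_tendsto hu (hm x ⟨hx.1, hx.2.trans_le hed⟩)).2 ?_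
    filter_upwards [Ioo_mem_nhdsGT hx.2] with t ht
    exact hs t ⟨hx.1.trans ht.1, ht.2⟩

/-! ### Regular points -/

lemma isUnit_of_mulVec_injective {A : Matrix (Fin n) (Fin n) ℂ}
    (h : ∀ z, A *ᵥ z = 0 → z = 0) : IsUnit A := by
  rw [← Matrix.mulVec_injective_iff_isUnit]
  intro x y hxy
  have := h (x - y) (by rw [Matrix.mulVec_sub, hxy, sub_self])
  exact sub_eq_zero.1 this

/-- The matrix X has norm at most 1/4, so 1 ± X are injective. Since small one-sided neighbourhoods
carry little mass, singular points cannot accumulate inside (a, b). -/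
lemma regular_of_measure_small {lam : ℂ} {x : ℝ}
    (hs : ∫ s in {x}, entrySum (S.coef lam s) ∂S.μ ≤ 1 / 2) : S.Regular lam x := by
  have e : ∫ s in {x}, entrySum (S.coef lam s) ∂S.μ = S.μ.real {x} * entrySum (S.coef lam x) := by
    rw [integral_singleton, smul_eq_mul]
  rw [e] at hs
  have key : ∀ z, ‖S.halfJump lam x *ᵥ z‖ ≤ 1 / 4 * ‖z‖ := fun z => by
    rw [halfJump, Matrix.smul_mulVec, norm_smul, Real.norm_of_nonneg (by positivity)]
    calc _ ≤ 2⁻¹ * S.μ.real {x} * (entrySum (S.coef lam x) * ‖z‖) := by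
          gcongr
          exact norm_mulVec_le _ _
      _ = 2⁻¹ * (S.μ.real {x} * entrySum (S.coef lam x)) * ‖z‖ := by ring
      _ ≤ 2⁻¹ * (1 / 2) * ‖z‖ := by gcongr
      _ = _ := by ring
  refine ⟨isUnit_of_mulVec_injective fun z hz => ?_, isUnit_of_mulVec_injective fun z hz => ?_⟩
  · rw [Matrix.sub_mulVec, Matrix.one_mulVec, sub_eq_zero] at hz
    have h1 := key z
    rw [← hz] at h1
    exact norm_le_zero_iff.1 (by linarith [norm_nonneg z])
  · rw [Matrix.add_mulVec, Matrix.one_mulVec, add_eq_zero_iff_eq_neg] at hz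
    have h1 := key z
    rw [← norm_neg, ← hz] at h1
    exact norm_le_zero_iff.1 (by linarith [norm_nonneg z])

lemma exists_regular_right {c : ℝ} (hc : c ∈ S.interval) (lam : ℂ) :
    ∃ d, c < d ∧ d ∈ S.interval ∧ ∀ x ∈ Ioc c d, S.Regular lam x := by
  obtain ⟨e, h1, h2⟩ := EReal.lt_iff_exists_real_btwn.1 hc.2
  have hce : c < e := EReal.coe_lt_coe_iff.1 h1
  have he : e ∈ S.interval := ⟨hc.1.trans h1, h2⟩
  have hint := integrableOn_entrySum fun j k => coef_integrableOn lam hc he le_rfl j k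
  obtain ⟨d, hcd, hde, hs⟩ := exists_small_right hce (hint.mono_set Ioc_subset_Icc_self)
  refine ⟨d, hcd, openInterval_Icc_subset hc he ⟨hcd.le, hde⟩, fun x hx => ?_⟩
  refine regular_of_measure_small (le_trans ?_ hs)
  exact setIntegral_mono_set (hint.mono_set (Ioc_subset_Icc_self.trans (Icc_subset_Icc_right hde)))
    (Eventually.of_forall fun _ => entrySum_nonneg _)
    (LE.le.eventuallyLE (singleton_subset_iff.2 hx))

/-- Among the singular points to the right of `c` there is a first one. -/
lemma exists_first_singular {c x : ℝ} (hc : c ∈ S.interval) (hcx : c < x) (hx : x ∈ S.interval)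
    {lam : ℂ} (hs : ¬ S.Regular lam x) :
    ∃ z ∈ Ioc c x, ¬ S.Regular lam z ∧ ∀ y ∈ Ioo c z, S.Regular lam y := by
  set A := {z | z ∈ Ioc c x ∧ ¬ S.Regular lam z} with hA
  have hne : A.Nonempty := ⟨x, ⟨hcx, le_rfl⟩, hs⟩
  have hbd : BddBelow A := ⟨c, fun z hz => hz.1.1.le⟩
  have hcs : c ≤ sInf A := le_csInf hne fun z hz => hz.1.1.le
  have hsx : sInf A ≤ x := csInf_le hbd ⟨⟨hcx, le_rfl⟩, hs⟩
  -- The infimum is attained, as just to the right of it all points are regular.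
  have hmem : sInf A ∈ A := by
    obtain ⟨d, hd, _, hreg⟩ := exists_regular_right
      (openInterval_Icc_subset hc hx ⟨hcs, hsx⟩) lam
    obtain ⟨z, hz, hzd⟩ := exists_lt_of_csInf_lt hne hd
    rcases (csInf_le hbd hz).eq_or_lt with e | hlt
    · rwa [e]
    · exact absurd (hreg z ⟨hlt, hzd.le⟩) hz.2
  refine ⟨sInf A, hmem.1, hmem.2, fun y hy => ?_⟩
  by_contra hn
  exact absurd (csInf_le hbd ⟨⟨hy.1, hy.2.le.trans hsx⟩, hn⟩) (not_le.2 hy.2)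

/-- Among the singular points to the left of `c` there is a last one. -/
lemma exists_last_singular {c x : ℝ} (hc : c ∈ S.interval) (hcx : x < c) (hx : x ∈ S.interval)
    {lam : ℂ} (hs : ¬ S.Regular lam x) :
    ∃ z ∈ Ico x c, ¬ S.Regular lam z ∧ ∀ y ∈ Ioo z c, S.Regular lam y := by
  obtain ⟨z, h1, h2, h3⟩ := exists_first_singular (S := S.reflect) (c := -c) (x := -x) (lam := lam)
    (mem_reflect_interval.2 (by rwa [neg_neg])) (by linarith)
    (mem_reflect_interval.2 (by rwa [neg_neg])) (by rwa [reflect_regular, neg_neg])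
  refine ⟨-z, ⟨by linarith [h1.2], by linarith [h1.1]⟩, by rwa [← reflect_regular], fun y hy => ?_⟩
  have := reflect_regular.1 (h3 (-y) ⟨by linarith [hy.2], by linarith [hy.1]⟩)
  rwa [neg_neg] at this

end General

section TwoByTwo

variable {S : FirstOrderSystem 2}

/-! ### The bilinear form of a real system of size two -/

lemma IsReal.J_eq (hS : S.IsReal) : S.J = !![0, S.J 0 1; -S.J 0 1, 0] := by
  have h : ∀ j k, star (S.J k j) = -S.J j k := fun j k => by
    have := congrFun (congrFun S.J_skewHermitian j) k
    simpa [Matrix.conjTranspose_apply] using this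
  have hr : ∀ j k, star (S.J j k) = S.J j k := fun j k => by
    rw [Complex.star_def]; exact Complex.conj_eq_iff_im.2 (hS.1 j k)
  ext j k
  fin_cases j <;> fin_cases k
  · have := (hr 0 0).symm.trans (h 0 0)
    simpa using self_eq_neg.1 this
  · rfl
  · have := (hr 0 1).symm.trans (h 1 0)
    simp [this]
  · have := (hr 1 1).symm.trans (h 1 1)
    simpa using self_eq_neg.1 this

lemma IsReal.J01_ne (hS : S.IsReal) : S.J 0 1 ≠ 0 := fun h => by
  have h1 := (Matrix.isUnit_iff_isUnit_det _).1 S.J_invertible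
  rw [hS.J_eq, h] at h1
  simp at h1

lemma IsReal.star_J01 (hS : S.IsReal) : star (S.J 0 1) = S.J 0 1 := by
  rw [Complex.star_def]; exact Complex.conj_eq_iff_im.2 (hS.1 0 1)

lemma IsReal.form_eq (hS : S.IsReal) (v u : Fin 2 → ℂ) :
    S.form v u = S.J 0 1 * (star (v 0) * u 1 - star (v 1) * u 0) := by
  rw [form_eq_sum]
  have e := hS.J_eq
  have e1 : S.J 0 0 = 0 := by rw [e]; rfl
  have e2 : S.J 1 0 = -S.J 0 1 := by rw [e]; simp
  have e3 : S.J 1 1 = 0 := by rw [e]; rfl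
  simp [Fin.sum_univ_two, e1, e2, e3]
  ring

/-- The alternating bilinear form `vᵀ J u`. -/
def bracket (S : FirstOrderSystem 2) (v u : Fin 2 → ℂ) : ℂ := S.form (star v) u

lemma IsReal.bracket_eq (hS : S.IsReal) (v u : Fin 2 → ℂ) :
    S.bracket v u = S.J 0 1 * (v 0 * u 1 - v 1 * u 0) := by
  rw [bracket, hS.form_eq]; simp

/-- Vectors with vanishing bracket are proportional. -/
lemma IsReal.exists_smul_of_bracket (hS : S.IsReal) {v u : Fin 2 → ℂ} (hv : v ≠ 0)
    (h : S.bracket v u = 0) : ∃ α : ℂ, u = α • v := by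
  rw [hS.bracket_eq, mul_eq_zero, or_iff_right hS.J01_ne, sub_eq_zero] at h
  by_cases h0 : v 0 = 0
  · have h1 : v 1 ≠ 0 := fun h1 => hv (by ext j; fin_cases j <;> simpa)
    refine ⟨u 1 / v 1, ?_⟩
    ext j
    fin_cases j
    · rw [h0, zero_mul] at h
      have : u 0 = 0 := by simpa [h1] using h.symm
      simp [h0, this]
    · simp [h1]
  · refine ⟨u 0 / v 0, ?_⟩
    ext j
    fin_cases j
    · simp [h0]
    · simp
      field_simp
      linear_combination h

/-- Vectors with nonvanishing bracket span the plane. -/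
lemma IsReal.bracket_smul (hS : S.IsReal) (v u z : Fin 2 → ℂ) :
    S.bracket v u • z = S.bracket z u • v + S.bracket v z • u := by
  simp only [hS.bracket_eq]
  ext j
  fin_cases j <;> simp <;> ring

/-- The Plücker relation of the alternating bilinear form for z, v and their conjugates. It ties the
energies of two solutions to their bracket, which is constant when both have the same parameter. -/
lemma IsReal.plucker (hS : S.IsReal) (z v : Fin 2 → ℂ) :
    (S.form z z).im * (S.form v v).im = ‖S.form z v‖ ^ 2 - ‖S.bracket z v‖ ^ 2 := by
  have h1 : ((‖S.form z v‖ ^ 2 - ‖S.bracket z v‖ ^ 2 : ℝ) : ℂ) =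
      -(S.form z z * S.form v v) := by
    push_cast
    rw [← Complex.mul_conj', ← Complex.mul_conj', ← Complex.star_def, star_form, hS.form_eq,
      hS.form_eq, hS.form_eq, hS.form_eq, hS.bracket_eq]
    simp only [star_mul', star_sub, hS.star_J01]
    ring
  rw [form_self z, form_self v] at h1
  have h2 : -(((S.form z z).im : ℂ) * Complex.I * (((S.form v v).im : ℂ) * Complex.I)) =
      (((S.form z z).im * (S.form v v).im : ℝ) : ℂ) := by
    push_cast
    linear_combination -((S.form z z).im : ℂ) * ((S.form v v).im : ℂ) * Complex.I_sq
  rw [h2] at h1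
  exact_mod_cast h1.symm

/-- There are vectors of positive energy. -/
lemma IsReal.exists_height_pos (hS : S.IsReal) {lam : ℂ} (hl : lam.im ≠ 0) :
    ∃ z, 0 < S.height lam z := by
  have hj : S.J 0 1 ≠ 0 := hS.J01_ne
  have hjr : ((S.J 0 1).re : ℂ) = S.J 0 1 := Complex.ext rfl (by simp [hS.1 0 1])
  have hj0 : (S.J 0 1).re ≠ 0 := fun h => hj (by rw [← hjr, h]; simp)
  have key : ∀ s : ℝ, S.height lam ![1, Complex.I * s] = (S.J 0 1).re * s / lam.im := fun s => by
    rw [height, hS.form_eq, ← hjr]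
    simp
    field_simp
    ring
  -- The energy of (1, is) is J₀₁ s / Im λ, and s = J₀₁ Im λ makes it J₀₁².
  refine ⟨![1, Complex.I * (((S.J 0 1).re * lam.im : ℝ) : ℂ)], ?_⟩
  rw [key]
  have : (S.J 0 1).re * ((S.J 0 1).re * lam.im) / lam.im = (S.J 0 1).re ^ 2 := by
    field_simp
  rw [this]
  positivity

/-- The Wronskian of two solutions is constant. -/
lemma Solves.bracket_eq (hS : S.IsReal) {lo hi : EReal} (hsub : openInterval lo hi ⊆ S.interval)
    {lam : ℂ} {u v : ℝ → Fin 2 → ℂ} (h : S.Solves lo hi u (lam • u))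
    (k : S.Solves lo hi v (lam • v)) {x y : ℝ} (hx : x ∈ openInterval lo hi)
    (hy : y ∈ openInterval lo hi) (hxy : x ≤ y) :
    S.bracket (Function.rightLim v y) (Function.rightLim u y)
      = S.bracket (Function.leftLim v x) (Function.leftLim u x) := by
  have st : Function.rightLim (fun x => star (v x)) y = star (Function.rightLim v y) ∧
      Function.leftLim (fun x => star (v x)) x = star (Function.leftLim v x) :=
    ⟨rightLim_eq_of_tendsto ((continuous_star.tendsto _).comp (locallyBV_tendsto k.balanced.1 hy).2),
      leftLim_eq_of_tendsto ((continuous_star.tendsto _).comp (locallyBV_tendsto k.balanced.1 hx).1)⟩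
  have := (Solves.green hsub h (k.conj hS hsub) hx hy hxy).2
  rw [st.1, st.2] at this
  rw [bracket, bracket, ← sub_eq_zero, this]
  rw [← integral_zero ℝ ℂ (μ := S.μ.restrict (Icc x y))]
  congr 1
  ext t
  simp only [density, Pi.smul_apply, star_smul, star_star, Matrix.mulVec_smul, dotProduct_smul,
    smul_dotProduct, sub_self]

/-! ### Singular points of a real system of size two -/

/-- A real Hermitian matrix is symmetric, and in size two J⁻¹ times a symmetric matrix has trace
zero. The treatment of singular points rests on this use of the reality of q and w. -/
lemma IsReal.halfJump_trace (hS : S.IsReal) {x : ℝ} (hx : x ∈ S.interval) (lam : ℂ) :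
    (S.halfJump lam x) 1 1 = -(S.halfJump lam x) 0 0 := by
  have sym : ∀ {M : Matrix (Fin 2) (Fin 2) ℂ}, M.IsHermitian → (∀ j k, (M j k).im = 0) →
      M 1 0 = M 0 1 := fun {M} hM hr => by
    have := congrFun (congrFun hM 1) 0
    rw [Matrix.conjTranspose_apply, Complex.star_def, Complex.conj_eq_iff_im.2 (hr 0 1)] at this
    exact this.symm
  set A := lam • S.W x - S.Q x with hA
  have hAs : A 1 0 = A 0 1 := by
    simp only [hA, Matrix.sub_apply, Matrix.smul_apply,
      sym (S.W_nonneg x hx).isHermitian fun j k => (hS.2 x hx j k).2,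
      sym (S.Q_hermitian x hx) fun j k => (hS.2 x hx j k).1]
  have hinv : S.J⁻¹ = !![0, -(S.J 0 1)⁻¹; (S.J 0 1)⁻¹, 0] := by
    apply Matrix.inv_eq_left_inv
    have := hS.J01_ne
    rw [hS.J_eq]
    ext j k
    fin_cases j <;> fin_cases k <;> simp [Matrix.mul_apply, Fin.sum_univ_two, this]
  simp only [halfJump, coef, ← hA, Matrix.smul_apply, Matrix.mul_apply, hinv, Fin.sum_univ_two,
    hAs]
  simp

lemma IsReal.halfJump_det (hS : S.IsReal) {x : ℝ} (hx : x ∈ S.interval) (lam : ℂ) :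
    (1 + S.halfJump lam x).det = 1 + (S.halfJump lam x).det ∧
      (1 - S.halfJump lam x).det = 1 + (S.halfJump lam x).det := by
  have htr := hS.halfJump_trace hx lam
  simp only [Matrix.det_fin_two]
  constructor <;> simp [htr] <;> ring

lemma IsReal.det_of_singular (hS : S.IsReal) {x : ℝ} (hx : x ∈ S.interval) {lam : ℂ}
    (hs : ¬ S.Regular lam x) : 1 + (S.halfJump lam x).det = 0 := by
  by_contra h
  refine hs ⟨?_, ?_⟩
  · rw [Matrix.isUnit_iff_isUnit_det, (hS.halfJump_det hx lam).2]
    exact isUnit_iff_ne_zero.2 h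
  · rw [Matrix.isUnit_iff_isUnit_det, (hS.halfJump_det hx lam).1]
    exact isUnit_iff_ne_zero.2 h

/-- At a singular point the half jump is an involution. -/
lemma IsReal.halfJump_sq (hS : S.IsReal) {x : ℝ} (hx : x ∈ S.interval) {lam : ℂ}
    (hs : ¬ S.Regular lam x) : S.halfJump lam x * S.halfJump lam x = 1 := by
  have htr := hS.halfJump_trace hx lam
  have hd := hS.det_of_singular hx hs
  generalize S.halfJump lam x = X at *
  -- The Cayley–Hamilton relation for trace 0 and determinant -1.
  rw [Matrix.det_fin_two, htr] at hd
  ext j k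
  fin_cases j <;> fin_cases k <;> simp [Matrix.mul_apply, Fin.sum_univ_two, htr]
  · linear_combination -hd
  · ring
  · ring
  · linear_combination -hd

lemma IsReal.exists_ker_add (hS : S.IsReal) {x : ℝ} (hx : x ∈ S.interval) {lam : ℂ}
    (hs : ¬ S.Regular lam x) : ∃ k, k ≠ 0 ∧ S.halfJump lam x *ᵥ k = -k := by
  obtain ⟨k, hk, e⟩ := Matrix.exists_mulVec_eq_zero_iff.2
    ((hS.halfJump_det hx lam).1.trans (hS.det_of_singular hx hs))
  refine ⟨k, hk, ?_⟩
  rw [Matrix.add_mulVec, Matrix.one_mulVec] at e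
  exact (neg_eq_of_add_eq_zero_right e).symm

lemma IsReal.exists_ker_sub (hS : S.IsReal) {x : ℝ} (hx : x ∈ S.interval) {lam : ℂ}
    (hs : ¬ S.Regular lam x) : ∃ k, k ≠ 0 ∧ S.halfJump lam x *ᵥ k = k := by
  obtain ⟨k, hk, e⟩ := Matrix.exists_mulVec_eq_zero_iff.2
    ((hS.halfJump_det hx lam).2.trans (hS.det_of_singular hx hs))
  refine ⟨k, hk, ?_⟩
  rw [Matrix.sub_mulVec, Matrix.one_mulVec, sub_eq_zero] at e
  exact e.symm

/-- One has u⁻ = (1 - X)u and X(1 - X) = -(1 - X), because X² = 1. So every solution arrives at a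
singular point in ker(1 + X), where nonzero vectors have negative energy, and leaves it in ker(1 -
X), where they have positive energy. -/
lemma IsReal.halfJump_left (hS : S.IsReal) {lo hi : EReal} {lam : ℂ} {u : ℝ → Fin 2 → ℂ}
    (hsub : openInterval lo hi ⊆ S.interval)
    (h : S.Solves lo hi u (lam • u)) {x : ℝ} (hx : x ∈ openInterval lo hi)
    (hs : ¬ S.Regular lam x) :
    S.halfJump lam x *ᵥ Function.leftLim u x = -Function.leftLim u x := by
  rw [h.leftLim_eq_sub hx, Matrix.mulVec_mulVec, mul_sub, hS.halfJump_sq (hsub hx) hs, mul_one,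
    ← Matrix.neg_mulVec, neg_sub]

lemma IsReal.halfJump_right (hS : S.IsReal) {lo hi : EReal} {lam : ℂ} {u : ℝ → Fin 2 → ℂ}
    (hsub : openInterval lo hi ⊆ S.interval)
    (h : S.Solves lo hi u (lam • u)) {x : ℝ} (hx : x ∈ openInterval lo hi)
    (hs : ¬ S.Regular lam x) :
    S.halfJump lam x *ᵥ Function.rightLim u x = Function.rightLim u x := by
  rw [h.rightLim_eq_add hx, Matrix.mulVec_mulVec, mul_add, hS.halfJump_sq (hsub hx) hs, mul_one,
    add_comm]

end TwoByTwo

end FirstOrderSystem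

/-! ### Exhausting an open interval by compact ones -/

section Exhaustion

lemma exists_exhaustion {lo hi : EReal} (h : lo < hi) : ∃ x y : ℕ → ℝ,
    (∀ n, x n ∈ openInterval lo hi) ∧ (∀ n, y n ∈ openInterval lo hi) ∧
    (∀ n, x n ≤ y n) ∧ ∀ t ∈ openInterval lo hi, ∀ᶠ n in atTop, t ∈ Icc (x n) (y n) := by
  obtain ⟨m, h1, h2⟩ := EReal.lt_iff_exists_real_btwn.1 h
  obtain ⟨v, -, v1, v2⟩ := exists_seq_strictMono_tendsto' h2
  obtain ⟨w, -, w1, w2⟩ := exists_seq_strictAnti_tendsto' h1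
  have hv : ∀ n, ((v n).toReal : EReal) = v n := fun n =>
    EReal.coe_toReal (ne_top_of_lt (v1 n).2) (ne_bot_of_gt (v1 n).1)
  have hw : ∀ n, ((w n).toReal : EReal) = w n := fun n =>
    EReal.coe_toReal (ne_top_of_lt (w1 n).2) (ne_bot_of_gt (w1 n).1)
  refine ⟨fun n => (w n).toReal, fun n => (v n).toReal, fun n => ?_, fun n => ?_, fun n => ?_,
    fun t ht => ?_⟩
  · exact ⟨by rw [hw]; exact (w1 n).1, by rw [hw]; exact (w1 n).2.trans h2⟩
  · exact ⟨by rw [hv]; exact h1.trans (v1 n).1, by rw [hv]; exact (v1 n).2⟩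
  · rw [← EReal.coe_le_coe_iff, hv, hw]
    exact ((w1 n).2.trans (v1 n).1).le
  · filter_upwards [v2.eventually (lt_mem_nhds ht.2), w2.eventually (gt_mem_nhds ht.1)] with n a b
    exact ⟨by rw [← EReal.coe_le_coe_iff, hw]; exact b.le,
      by rw [← EReal.coe_le_coe_iff, hv]; exact a.le⟩

lemma integrableOn_openInterval_of_bounded {μ : Measure ℝ} {lo hi : EReal} (h : lo < hi)
    {f : ℝ → ℝ} {M : ℝ}
    (hf : ∀ x ∈ openInterval lo hi, ∀ y ∈ openInterval lo hi, IntegrableOn f (Icc x y) μ)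
    (h0 : ∀ x ∈ openInterval lo hi, 0 ≤ f x)
    (hb : ∀ x ∈ openInterval lo hi, ∀ y ∈ openInterval lo hi, x ≤ y →
      ∫ t in Icc x y, f t ∂μ ≤ M) : IntegrableOn f (openInterval lo hi) μ := by
  obtain ⟨x, y, hx, hy, hxy, ht⟩ := exists_exhaustion h
  have hmeas := (isOpen_openInterval lo hi).measurableSet
  have hcov : AECover (μ.restrict (openInterval lo hi)) atTop fun n => Icc (x n) (y n) :=
    ⟨(ae_restrict_iff' hmeas).2 (Eventually.of_forall ht), fun n => measurableSet_Icc⟩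
  have hr : ∀ n, (μ.restrict (openInterval lo hi)).restrict (Icc (x n) (y n))
      = μ.restrict (Icc (x n) (y n)) := fun n => by
    rw [Measure.restrict_restrict measurableSet_Icc,
      inter_eq_self_of_subset_left (openInterval_Icc_subset (hx n) (hy n))]
  refine hcov.integrable_of_integral_bounded_of_nonneg_ae M (fun n => ?_)
    ((ae_restrict_iff' hmeas).2 (Eventually.of_forall h0)) (Eventually.of_forall fun n => ?_)
  · rw [IntegrableOn, hr]
    exact hf _ (hx n) _ (hy n)
  · rw [hr]
    exact hb _ (hx n) _ (hy n) (hxy n)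

lemma ae_openInterval_of_Icc {μ : Measure ℝ} {lo hi : EReal} (h : lo < hi) {p : ℝ → Prop}
    (hp : ∀ x ∈ openInterval lo hi, ∀ y ∈ openInterval lo hi, x ≤ y →
      ∀ᵐ t ∂μ.restrict (Icc x y), p t) : ∀ᵐ t ∂μ.restrict (openInterval lo hi), p t := by
  obtain ⟨x, y, hx, hy, hxy, ht⟩ := exists_exhaustion h
  rw [ae_restrict_iff' (isOpen_openInterval lo hi).measurableSet]
  have := ae_all_iff.2 fun n => (ae_restrict_iff' measurableSet_Icc).1
    (hp _ (hx n) _ (hy n) (hxy n))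
  filter_upwards [this] with t h1 h2
  obtain ⟨n, hn⟩ := (ht t h2).exists
  exact h1 n hn

end Exhaustion

/-! ### Restriction to subintervals; square-integrability as boundedness of the energy -/

namespace FirstOrderSystem

variable {n : ℕ} {S : FirstOrderSystem n}

lemma rightLim_congr_right {lo hi : EReal} {u v : ℝ → Fin n → ℂ} {c : ℝ}
    (h : ∀ x ∈ openInterval lo hi, v x = u x) (hlo : lo ≤ c) (hhi : (c : EReal) < hi)
    {ξ : Fin n → ℂ} (hu : Tendsto u (𝓝[>] c) (𝓝 ξ)) : Tendsto v (𝓝[>] c) (𝓝 ξ) := by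
  refine hu.congr' ?_
  obtain ⟨d, hd1, hd2⟩ := EReal.lt_iff_exists_real_btwn.1 hhi
  filter_upwards [Ioo_mem_nhdsGT (EReal.coe_lt_coe_iff.1 hd1)] with x hx
  exact (h x ⟨hlo.trans_lt (EReal.coe_lt_coe_iff.2 hx.1),
    (EReal.coe_lt_coe_iff.2 hx.2).trans hd2⟩).symm

lemma leftLim_congr_left {lo hi : EReal} {u v : ℝ → Fin n → ℂ} {c : ℝ}
    (h : ∀ x ∈ openInterval lo hi, v x = u x) (hlo : lo < c) (hhi : (c : EReal) ≤ hi)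
    {ξ : Fin n → ℂ} (hu : Tendsto u (𝓝[<] c) (𝓝 ξ)) : Tendsto v (𝓝[<] c) (𝓝 ξ) := by
  refine hu.congr' ?_
  obtain ⟨d, hd1, hd2⟩ := EReal.lt_iff_exists_real_btwn.1 hlo
  filter_upwards [Ioo_mem_nhdsLT (EReal.coe_lt_coe_iff.1 hd2)] with x hx
  exact (h x ⟨hd1.trans (EReal.coe_lt_coe_iff.2 hx.1),
    (EReal.coe_lt_coe_iff.2 hx.2).trans_le hhi⟩).symm

/-- One-sided limits at a point of an open interval depend only on the values there. -/
lemma sided_congr {lo hi : EReal} {u v : ℝ → Fin n → ℂ}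
    (hu : LocallyBoundedVariationOn u (openInterval lo hi))
    (h : ∀ x ∈ openInterval lo hi, v x = u x) {x : ℝ} (hx : x ∈ openInterval lo hi) :
    Function.leftLim v x = Function.leftLim u x ∧ Function.rightLim v x = Function.rightLim u x :=
  ⟨leftLim_eq_of_tendsto (leftLim_congr_left h hx.1 hx.2.le (locallyBV_tendsto hu hx).1),
    rightLim_eq_of_tendsto (rightLim_congr_right h hx.1.le hx.2 (locallyBV_tendsto hu hx).2)⟩

/-- The integral of `u* w u` over `(lo, hi)` is finite. -/
def SqOn (S : FirstOrderSystem n) (lo hi : EReal) (u : ℝ → Fin n → ℂ) : Prop :=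
  IntegrableOn (fun t => (S.density u u t).re) (openInterval lo hi) S.μ

/-- The extension by zero of the restriction of `u` to `(lo, hi)`. -/
def cut (lo hi : EReal) (u : ℝ → Fin n → ℂ) : ℝ → Fin n → ℂ := (openInterval lo hi).indicator u

lemma cut_of_mem {lo hi : EReal} (u : ℝ → Fin n → ℂ) {x : ℝ} (hx : x ∈ openInterval lo hi) :
    cut lo hi u x = u x := indicator_of_mem hx u

lemma cut_of_notMem {lo hi : EReal} (u : ℝ → Fin n → ℂ) {x : ℝ} (hx : x ∉ openInterval lo hi) :
    cut lo hi u x = 0 := indicator_of_notMem hx u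

lemma cut_add (lo hi : EReal) (u v : ℝ → Fin n → ℂ) :
    cut lo hi (u + v) = cut lo hi u + cut lo hi v := indicator_add _ _ _

lemma cut_smul (lo hi : EReal) (c : ℂ) (u : ℝ → Fin n → ℂ) :
    cut lo hi (c • u) = c • cut lo hi u :=
  indicator_const_smul (openInterval lo hi) c u

section

variable {lo hi : EReal} {lam : ℂ} {u v : ℝ → Fin n → ℂ}

lemma Solves.congr_lam (hsub : openInterval lo hi ⊆ S.interval) (h : S.Solves lo hi u (lam • u))
    (hv : ∀ x ∈ openInterval lo hi, v x = u x) : S.Solves lo hi v (lam • v) :=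
  h.congr hsub hv fun x hx => by rw [Pi.smul_apply, Pi.smul_apply, hv x hx]

lemma SqOn.congr (h : S.SqOn lo hi u) (hv : ∀ x ∈ openInterval lo hi, v x = u x) :
    S.SqOn lo hi v :=
  IntegrableOn.congr_fun h (fun x hx => by simp only [density, hv x hx])
    (isOpen_openInterval lo hi).measurableSet

lemma SqOn.mono (h : S.SqOn lo hi u) {lo' hi' : EReal}
    (hs : openInterval lo' hi' ⊆ openInterval lo hi) : S.SqOn lo' hi' u := h.mono_set hs

lemma density_cut_self (u : ℝ → Fin n → ℂ) :
    S.density (cut lo hi u) (cut lo hi u) = (openInterval lo hi).indicator (S.density u u) := by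
  ext x
  by_cases hx : x ∈ openInterval lo hi
  · rw [indicator_of_mem hx, density, cut_of_mem u hx, density]
  · rw [indicator_of_notMem hx, density, cut_of_notMem u hx]
    simp

lemma SqOn.integrable_density (hsub : openInterval lo hi ⊆ S.interval) (hs : S.SqOn lo hi u) :
    IntegrableOn (S.density u u) (openInterval lo hi) S.μ :=
  IntegrableOn.congr_fun (f := fun x => ((S.density u u x).re : ℂ)) (Integrable.ofReal hs)
    (fun _ hx => (density_self_re u (hsub hx)).symm) (isOpen_openInterval lo hi).measurableSet

lemma restrict_ν (hsub : openInterval lo hi ⊆ S.interval) :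
    S.ν.restrict (openInterval lo hi) = S.μ.restrict (openInterval lo hi) := by
  rw [ν, Measure.restrict_restrict (isOpen_openInterval lo hi).measurableSet,
    inter_eq_self_of_subset_left hsub]

lemma Solves.cut_mem (hsub : openInterval lo hi ⊆ S.interval) (h : S.Solves lo hi u (lam • u))
    (hs : S.SqOn lo hi u) : cut lo hi u ∈ S.sqSolutions lo hi lam := by
  have hm := (isOpen_openInterval lo hi).measurableSet
  refine ⟨fun x hx => cut_of_notMem u hx, h.congr_lam hsub fun x hx => cut_of_mem u hx, ?_, ?_⟩
  · rw [cut, aestronglyMeasurable_indicator_iff hm, restrict_ν hsub]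
    exact h.balanced.1.aestronglyMeasurable hm S.μ
  · rw [density_cut_self, integrable_indicator_iff hm, IntegrableOn, restrict_ν hsub]
    exact hs.integrable_density hsub

lemma sqOn_of_mem (hsub : openInterval lo hi ⊆ S.interval) (h : u ∈ S.sqSolutions lo hi lam) :
    S.SqOn lo hi u := by
  have := (Integrable.re h.2.2.2).restrict (s := openInterval lo hi)
  rw [restrict_ν hsub] at this
  exact this

lemma SqOn.add (hsub : openInterval lo hi ⊆ S.interval) (h : S.Solves lo hi u (lam • u))
    (hs : S.SqOn lo hi u) (k : S.Solves lo hi v (lam • v)) (ks : S.SqOn lo hi v) :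
    S.SqOn lo hi (u + v) := by
  have := sqOn_of_mem hsub (add_mem (h.cut_mem hsub hs) (k.cut_mem hsub ks))
  rw [← cut_add] at this
  exact this.congr fun x hx => (cut_of_mem _ hx).symm

lemma SqOn.smul (c : ℂ) (hs : S.SqOn lo hi u) : S.SqOn lo hi (c • u) := by
  have : (fun t => (S.density (c • u) (c • u) t).re)
      = fun t => ‖c‖ ^ 2 * (S.density u u t).re := by
    ext t
    rw [density_smul_right, density_smul_left, ← mul_assoc, Complex.star_def, Complex.mul_conj']
    norm_cast
    rw [Complex.re_ofReal_mul]
  rw [SqOn, this]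
  exact Integrable.const_mul hs _

lemma Solves.add_lam (h : S.Solves lo hi u (lam • u)) (k : S.Solves lo hi v (lam • v)) :
    S.Solves lo hi (u + v) (lam • (u + v)) := by
  rw [smul_add]; exact h.add k

lemma Solves.smul_lam (c : ℂ) (h : S.Solves lo hi u (lam • u)) :
    S.Solves lo hi (c • u) (lam • (c • u)) := by
  rw [smul_comm]; exact h.smul c

/-- A solution without energy growth solves the equation with `lam = 0`. -/
lemma Solves.ae_eq_zero (hlt : lo < hi) (hsub : openInterval lo hi ⊆ S.interval)
    (hl : lam.im ≠ 0) (h : S.Solves lo hi u (lam • u))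
    (hz : ∀ x ∈ openInterval lo hi, ∀ y ∈ openInterval lo hi, x ≤ y →
      S.height lam (Function.rightLim u y) ≤ S.height lam (Function.leftLim u x)) :
    (∀ᵐ x ∂S.μ.restrict (openInterval lo hi), S.W x *ᵥ u x = 0) ∧ S.Solves lo hi u 0 := by
  have key : ∀ᵐ x ∂S.μ.restrict (openInterval lo hi), S.W x *ᵥ u x = 0 := by
    refine ae_openInterval_of_Icc hlt fun x hx y hy hxy => ?_
    obtain ⟨hi', e⟩ := h.height_sub hsub hl hx hy hxy
    have hnn : 0 ≤ᵐ[S.μ.restrict (Icc x y)] fun t => (S.density u u t).re :=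
      (ae_restrict_iff' measurableSet_Icc).2 (Eventually.of_forall fun t ht =>
        density_self_re_nonneg u (hsub (openInterval_Icc_subset hx hy ht)))
    have e0 : ∫ t in Icc x y, (S.density u u t).re ∂S.μ = 0 :=
      le_antisymm (by linarith [hz x hx y hy hxy]) (integral_nonneg_of_ae hnn)
    have := (integral_eq_zero_iff_of_nonneg_ae hnn hi').1 e0
    filter_upwards [this, ae_restrict_mem measurableSet_Icc] with t h1 h2
    have ht := hsub (openInterval_Icc_subset hx hy h2)
    refine mulVec_eq_zero_of_density ht ?_
    rw [density_self_re u ht]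
    exact congrArg _ h1
  refine ⟨key, h.congr_ae ?_⟩
  filter_upwards [key] with x hx
  rw [Pi.smul_apply, Matrix.mulVec_smul, hx]
  simp

end

section RightEnd

variable {c : ℝ} {hi : EReal} {lam : ℂ} {u : ℝ → Fin n → ℂ}

lemma Solves.tendsto_sided_right (hc : c ∈ S.interval) (hchi : (c : EReal) < hi)
    (hhi : hi ≤ S.b) (h : S.Solves c hi u (lam • u)) :
    Tendsto (Function.leftLim u) (𝓝[>] c) (𝓝 (Function.rightLim u c)) ∧
    Tendsto (Function.rightLim u) (𝓝[>] c) (𝓝 (Function.rightLim u c)) :=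
  tendsto_sided_of_tendsto_right h.balanced.1 le_rfl hchi (h.tendsto_right hc hchi hhi)

lemma Ioo_mem_openInterval_right {x : ℝ} (hx : x ∈ openInterval (c : EReal) hi) {t : ℝ}
    (ht : t ∈ Ioo c x) : t ∈ openInterval (c : EReal) hi :=
  ⟨EReal.coe_lt_coe_iff.2 ht.1, (EReal.coe_lt_coe_iff.2 ht.2).trans hx.2⟩

lemma Solves.height_initial_le (hc : c ∈ S.interval) (hhi : hi ≤ S.b) (hl : lam.im ≠ 0)
    (h : S.Solves c hi u (lam • u)) {x : ℝ} (hx : x ∈ openInterval (c : EReal) hi) :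
    S.height lam (Function.rightLim u c) ≤ S.height lam (Function.leftLim u x) := by
  have hchi := hx.1.trans hx.2
  have hsub := openInterval_subset_right hc hhi
  refine le_of_tendsto (((continuous_height lam).tendsto _).comp
    (h.tendsto_sided_right hc hchi hhi).1) ?_
  filter_upwards [Ioo_mem_nhdsGT (EReal.coe_lt_coe_iff.1 hx.1)] with t ht
  exact h.height_left_mono hsub hl (Ioo_mem_openInterval_right hx ht) hx ht.2.le

/-- The integrals of u*wu over compact intervals are increments of an energy that starts at
h(u⁺(c)), so an upper bound for the energy bounds them all. The converse is
`Solves.bounded_of_sqOn`. -/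
lemma Solves.sqOn_of_bounded (hc : c ∈ S.interval) (hchi : (c : EReal) < hi) (hhi : hi ≤ S.b)
    (hl : lam.im ≠ 0) (h : S.Solves c hi u (lam • u)) {M : ℝ}
    (hM : ∀ y ∈ openInterval (c : EReal) hi, S.height lam (Function.rightLim u y) ≤ M) :
    S.SqOn c hi u := by
  have hsub := openInterval_subset_right hc hhi
  refine integrableOn_openInterval_of_bounded hchi
    (M := M - S.height lam (Function.rightLim u c)) (fun x hx y hy => ?_)
    (fun x hx => density_self_re_nonneg u (hsub hx)) fun x hx y hy hxy => ?_
  · rcases le_total x y with hxy | hxy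
    · exact (h.height_sub hsub hl hx hy hxy).1
    · exact (h.height_sub hsub hl hy hy le_rfl).1.mono_set (Icc_subset_Icc_left hxy)
  · rw [← (h.height_sub hsub hl hx hy hxy).2]
    linarith [hM y hy, h.height_initial_le hc hhi hl hx]

lemma Solves.bounded_of_sqOn (hc : c ∈ S.interval) (hhi : hi ≤ S.b)
    (hl : lam.im ≠ 0) (h : S.Solves c hi u (lam • u)) (hs : S.SqOn c hi u) {y : ℝ}
    (hy : y ∈ openInterval (c : EReal) hi) :
    S.height lam (Function.rightLim u y) ≤ S.height lam (Function.rightLim u c)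
      + ∫ t in openInterval c hi, (S.density u u t).re ∂S.μ := by
  have hchi := hy.1.trans hy.2
  have hsub := openInterval_subset_right hc hhi
  refine ge_of_tendsto ((((continuous_height lam).tendsto _).comp
    (h.tendsto_sided_right hc hchi hhi).1).add_const _) ?_
  filter_upwards [Ioo_mem_nhdsGT (EReal.coe_lt_coe_iff.1 hy.1)] with t ht
  have htm := Ioo_mem_openInterval_right hy ht
  have h1 := (h.height_sub hsub hl htm hy ht.2.le).2
  have h2 : ∫ s in Icc t y, (S.density u u s).re ∂S.μ
      ≤ ∫ s in openInterval c hi, (S.density u u s).re ∂S.μ :=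
    setIntegral_mono_set hs ((ae_restrict_iff' (isOpen_openInterval _ _).measurableSet).2
      (Eventually.of_forall fun s hs => density_self_re_nonneg u (hsub hs)))
      (LE.le.eventuallyLE (openInterval_Icc_subset htm hy))
  simp only [Function.comp]
  linarith

lemma Solves.eq_zero_of_rightLim (hc : c ∈ S.interval) (hhi : hi ≤ S.b)
    (hreg : ∀ x ∈ openInterval (c : EReal) hi, S.Regular lam x)
    (h : S.Solves c hi u (lam • u)) (h0 : Function.rightLim u c = 0) :
    ∀ x ∈ openInterval (c : EReal) hi, u x = 0 := fun x hx =>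
  h.eq_zero_right hc hhi hreg (h0 ▸ h.tendsto_right hc (hx.1.trans hx.2) hhi) x hx

/-- A solution with nonpositive energy and initial value zero vanishes. -/
lemma Solves.eq_zero_of_height_nonpos (hc : c ∈ S.interval) (hhi : hi ≤ S.b)
    (hl : lam.im ≠ 0) (h : S.Solves c hi u (lam • u)) (h0 : Function.rightLim u c = 0)
    (hn : ∀ y ∈ openInterval (c : EReal) hi, S.height lam (Function.rightLim u y) ≤ 0) :
    ∀ x ∈ openInterval (c : EReal) hi, u x = 0 := by
  intro x hx
  have hchi := hx.1.trans hx.2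
  have hsub := openInterval_subset_right hc hhi
  have h1 := (h.ae_eq_zero hchi hsub hl fun x hx y hy hxy => by
    have := h.height_initial_le hc hhi hl hx
    rw [h0, height_zero] at this
    exact (hn y hy).trans this).2
  -- The energy starts at 0 and cannot grow, so u also solves the equation with λ = 0, for which no
  -- singular points exist. This is why no regularity for λ is needed.
  have h2 : S.Solves c hi u ((0 : ℂ) • u) := by rwa [zero_smul]
  exact h2.eq_zero_of_rightLim hc hhi (fun x hx => regular_zero (hsub hx)) h0 x hx

end RightEnd

end FirstOrderSystem

/-! ### Continuation by zero at singular points; a solution of nonpositive energy near b -/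

namespace FirstOrderSystem

section Glue

variable {n : ℕ} {S : FirstOrderSystem n} {lam : ℂ}

/-- A solution ending at an atom in the kernel of `1 + X` may be continued by zero. -/
lemma Solves.glue_zero_right {lo hi : EReal} {x : ℝ} (hlo : S.a ≤ lo) (hlox : lo < (x : EReal))
    (hxhi : (x : EReal) < hi) (hhi : hi ≤ S.b) {u : ℝ → Fin n → ℂ}
    (h : S.Solves lo x u (lam • u))
    (hk : S.halfJump lam x *ᵥ Function.leftLim u x = -Function.leftLim u x) :
    S.Solves lo hi (glueFun u 0 x) (lam • glueFun u 0 x) := by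
  have := Solves.glue (lam := lam) (f := 0) hlo hlox hxhi hhi LocInt.zero (u := u) (v := 0)
    (by rwa [add_zero]) (by rw [smul_zero, add_zero]; exact Solves.zero) (by
      rw [rightLim_zero_fun, rhs, glueFun_self, rightLim_zero_fun]
      simp only [Pi.zero_apply, Matrix.mulVec_zero, add_zero]
      rw [halfJump, Matrix.smul_mulVec] at hk
      rw [Matrix.mulVec_smul]
      linear_combination (norm := module) -hk)
  rwa [add_zero] at this

/-- A solution starting at an atom in the kernel of `1 - X` may be preceded by zero. -/
lemma Solves.glue_zero_left {lo hi : EReal} {x : ℝ} (hlo : S.a ≤ lo) (hlox : lo < (x : EReal))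
    (hxhi : (x : EReal) < hi) (hhi : hi ≤ S.b) {u : ℝ → Fin n → ℂ}
    (h : S.Solves x hi u (lam • u))
    (hk : S.halfJump lam x *ᵥ Function.rightLim u x = Function.rightLim u x) :
    S.Solves lo hi (glueFun 0 u x) (lam • glueFun 0 u x) := by
  have := Solves.glue (lam := lam) (f := 0) hlo hlox hxhi hhi LocInt.zero (u := 0) (v := u)
    (by rw [smul_zero, add_zero]; exact Solves.zero) (by rwa [add_zero]) (by
      rw [leftLim_zero_fun, rhs, glueFun_self, leftLim_zero_fun]
      simp only [Pi.zero_apply, Matrix.mulVec_zero, add_zero, zero_add, sub_zero]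
      rw [halfJump, Matrix.smul_mulVec] at hk
      rw [Matrix.mulVec_smul]
      linear_combination (norm := module) -hk)
  rwa [add_zero] at this

lemma rightLim_comb {lo hi : EReal} {u v : ℝ → Fin n → ℂ} (hu : S.Solves lo hi u (lam • u))
    (hv : S.Solves lo hi v (lam • v)) (α β : ℂ) {x : ℝ} (hx : x ∈ openInterval lo hi) :
    Function.rightLim (α • u + β • v) x
      = α • Function.rightLim u x + β • Function.rightLim v x :=
  rightLim_eq_of_tendsto (((locallyBV_tendsto hu.balanced.1 hx).2.const_smul α).add
    ((locallyBV_tendsto hv.balanced.1 hx).2.const_smul β))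

lemma rightLim_comb_initial {c : ℝ} {hi : EReal} (hc : c ∈ S.interval) (hchi : (c : EReal) < hi)
    (hhi : hi ≤ S.b) {u v : ℝ → Fin n → ℂ} (hu : S.Solves c hi u (lam • u))
    (hv : S.Solves c hi v (lam • v)) (α β : ℂ) :
    Function.rightLim (α • u + β • v) c
      = α • Function.rightLim u c + β • Function.rightLim v c :=
  rightLim_eq_of_tendsto (((hu.tendsto_right hc hchi hhi).const_smul α).add
    ((hv.tendsto_right hc hchi hhi).const_smul β))

lemma Solves.comb {lo hi : EReal} {u v : ℝ → Fin n → ℂ} (hu : S.Solves lo hi u (lam • u))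
    (hv : S.Solves lo hi v (lam • v)) (α β : ℂ) :
    S.Solves lo hi (α • u + β • v) (lam • (α • u + β • v)) :=
  (hu.smul_lam α).add_lam (hv.smul_lam β)

lemma rightLim_eq_zero {lo hi : EReal} {u : ℝ → Fin n → ℂ} {x : ℝ} (hlo : lo ≤ x)
    (hhi : (x : EReal) < hi) (h : ∀ t ∈ openInterval lo hi, u t = 0) :
    Function.rightLim u x = 0 :=
  rightLim_eq_of_tendsto (rightLim_congr_right (u := 0) h hlo hhi tendsto_const_nhds)

lemma leftLim_eq_zero {lo hi : EReal} {u : ℝ → Fin n → ℂ} {x : ℝ} (hlo : lo < x)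
    (hhi : (x : EReal) ≤ hi) (h : ∀ t ∈ openInterval lo hi, u t = 0) :
    Function.leftLim u x = 0 :=
  leftLim_eq_of_tendsto (leftLim_congr_left (u := 0) h hlo hhi tendsto_const_nhds)

/-- A solution vanishing near the right end has nonpositive energy. -/
lemma Solves.height_nonpos_of_vanish {c z : ℝ} {hi : EReal} (hc : c ∈ S.interval) (hhi : hi ≤ S.b)
    (hl : lam.im ≠ 0) {u : ℝ → Fin n → ℂ} (h : S.Solves c hi u (lam • u))
    (hz : z ∈ openInterval (c : EReal) hi) (h0 : ∀ x ∈ openInterval (z : EReal) hi, u x = 0)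
    {y : ℝ} (hy : y ∈ openInterval (c : EReal) hi) :
    S.height lam (Function.rightLim u y) ≤ 0 := by
  have hsub := openInterval_subset_right hc hhi
  have h1 : ∀ y ∈ openInterval (c : EReal) hi, z ≤ y → Function.rightLim u y = 0 :=
    fun y hy hzy => rightLim_eq_zero (EReal.coe_le_coe_iff.2 hzy) hy.2 h0
  rcases le_total z y with hzy | hyz
  · rw [h1 y hy hzy, height_zero]
  · have := h.height_right_mono hsub hl hy hz hyz
    rwa [h1 z hz le_rfl, height_zero] at this

end Glue

variable {S : FirstOrderSystem 2} {lam : ℂ}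

lemma tendsto_bracket {α : Type*} {l : Filter α} {f g : α → Fin 2 → ℂ} {x y : Fin 2 → ℂ}
    (hf : Tendsto f l (𝓝 x)) (hg : Tendsto g l (𝓝 y)) :
    Tendsto (fun t => S.bracket (f t) (g t)) l (𝓝 (S.bracket x y)) := by
  have h1 : Tendsto (fun t => star (f t)) l (𝓝 (star x)) := (continuous_star.tendsto x).comp hf
  have h2 := h1.prodMk_nhds hg
  have h3 := (S.continuous_form.tendsto (star x, y)).comp h2
  exact h3

lemma Solves.bracket_initial (hS : S.IsReal) {c : ℝ} {hi : EReal} (hc : c ∈ S.interval)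
    (hhi : hi ≤ S.b) {u v : ℝ → Fin 2 → ℂ} (h : S.Solves c hi u (lam • u))
    (k : S.Solves c hi v (lam • v)) {y : ℝ} (hy : y ∈ openInterval (c : EReal) hi) :
    S.bracket (Function.rightLim v y) (Function.rightLim u y)
      = S.bracket (Function.rightLim v c) (Function.rightLim u c) := by
  have hchi := hy.1.trans hy.2
  have hsub := openInterval_subset_right hc hhi
  have h1 : Tendsto (fun x => S.bracket (Function.leftLim v x) (Function.leftLim u x)) (𝓝[>] c)
      (𝓝 (S.bracket (Function.rightLim v y) (Function.rightLim u y))) := by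
    refine tendsto_const_nhds.congr' ?_
    filter_upwards [Ioo_mem_nhdsGT (EReal.coe_lt_coe_iff.1 hy.1)] with t ht
    exact h.bracket_eq hS hsub k (Ioo_mem_openInterval_right hy ht) hy ht.2.le
  have h2 : Tendsto (fun x => S.bracket (Function.leftLim v x) (Function.leftLim u x)) (𝓝[>] c)
      (𝓝 (S.bracket (Function.rightLim v c) (Function.rightLim u c))) :=
    tendsto_bracket (k.tendsto_sided_right hc hchi hhi).1 (h.tendsto_sided_right hc hchi hhi).1
  exact tendsto_nhds_unique h1 h2

/-- Two independent solutions span all solutions. -/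
lemma IsReal.exists_comb (hS : S.IsReal) {c : ℝ} {hi : EReal} (hc : c ∈ S.interval)
    (hchi : (c : EReal) < hi) (hhi : hi ≤ S.b)
    (hreg : ∀ x ∈ openInterval (c : EReal) hi, S.Regular lam x) {u v z : ℝ → Fin 2 → ℂ}
    (hu : S.Solves c hi u (lam • u)) (hv : S.Solves c hi v (lam • v))
    (hz : S.Solves c hi z (lam • z))
    (h : S.bracket (Function.rightLim u c) (Function.rightLim v c) ≠ 0) :
    ∃ α β : ℂ, ∀ x ∈ openInterval (c : EReal) hi, z x = (α • u + β • v) x := by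
  -- Cramer's rule for the initial values; uniqueness carries the relation over to all of (c, hi).
  have e := hS.bracket_smul (Function.rightLim u c) (Function.rightLim v c) (Function.rightLim z c)
  set ω := S.bracket (Function.rightLim u c) (Function.rightLim v c)
  set p := S.bracket (Function.rightLim z c) (Function.rightLim v c)
  set q := S.bracket (Function.rightLim u c) (Function.rightLim z c)
  refine ⟨ω⁻¹ * p, ω⁻¹ * q, fun x hx => ?_⟩
  set w := (ω⁻¹ * p) • u + (ω⁻¹ * q) • v with hw
  have hws : S.Solves c hi w (lam • w) := hu.comb hv _ _
  have hd := hz.comb hws 1 (-1)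
  have h0 : Function.rightLim ((1 : ℂ) • z + (-1 : ℂ) • w) c = 0 := by
    rw [rightLim_comb_initial hc hchi hhi hz hws, hw, rightLim_comb_initial hc hchi hhi hu hv]
    have e' := congrArg (ω⁻¹ • ·) e
    simp only [smul_smul, inv_mul_cancel₀ h, one_smul, smul_add] at e'
    rw [e']
    module
  have := hd.eq_zero_of_rightLim hc hhi hreg h0 x hx
  simp only [Pi.add_apply, one_smul, neg_smul, Pi.neg_apply] at this
  exact add_neg_eq_zero.1 this

/-- If all combinations of two solutions have nonpositive energy, they are dependent. -/
lemma IsReal.exists_smul_of_nonpos (hS : S.IsReal) {c : ℝ} {hi : EReal} (hc : c ∈ S.interval)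
    (hchi : (c : EReal) < hi) (hhi : hi ≤ S.b) (hl : lam.im ≠ 0) {u v : ℝ → Fin 2 → ℂ}
    (hu : S.Solves c hi u (lam • u)) (hv : S.Solves c hi v (lam • v))
    (hv0 : Function.rightLim v c ≠ 0)
    (hn : ∀ α β : ℂ, ∀ y ∈ openInterval (c : EReal) hi,
      S.height lam (Function.rightLim (α • v + β • u) y) ≤ 0) :
    ∃ α : ℂ, ∀ x ∈ openInterval (c : EReal) hi, u x = α • v x := by
  have hsub := openInterval_subset_right hc hhi
  by_cases h : S.bracket (Function.rightLim v c) (Function.rightLim u c) = 0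
  · obtain ⟨α, hα⟩ := hS.exists_smul_of_bracket hv0 h
    refine ⟨α, fun x hx => ?_⟩
    have := (hv.comb hu (-α) 1).eq_zero_of_height_nonpos hc hhi hl
      (by rw [rightLim_comb_initial hc hchi hhi hv hu, hα]; module) (hn (-α) 1) x hx
    simp only [Pi.add_apply, one_smul, neg_smul, Pi.neg_apply] at this
    exact (neg_add_eq_zero.1 this).symm
  · exfalso
    -- If the initial values were independent, some combination would start at a multiple of a
    -- vector of positive energy, and the energy does not decrease afterwards.
    obtain ⟨ζ, hζ⟩ := hS.exists_height_pos hl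
    have e := hS.bracket_smul (Function.rightLim v c) (Function.rightLim u c) ζ
    set ω := S.bracket (Function.rightLim v c) (Function.rightLim u c)
    set p := S.bracket ζ (Function.rightLim u c)
    set q := S.bracket (Function.rightLim v c) ζ
    obtain ⟨d, hd1, hd2⟩ := EReal.lt_iff_exists_real_btwn.1 hchi
    have h1 := hv.comb hu p q
    have h2 := h1.height_initial_le hc hhi hl ⟨hd1, hd2⟩
    have h3 := h1.height_left_le_right hsub hl (x := d) (y := d) ⟨hd1, hd2⟩ ⟨hd1, hd2⟩ le_rfl
    rw [rightLim_comb_initial hc hchi hhi hv hu, ← e, height_smul] at h2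
    have h4 := hn p q d ⟨hd1, hd2⟩
    have : 0 < ‖ω‖ ^ 2 * S.height lam ζ := by positivity
    linarith

/-- Near the right endpoint there is a nontrivial solution of nonpositive energy. -/
lemma IsReal.exists_nonpos_solution (hS : S.IsReal) {c : ℝ} {hi : EReal} (hc : c ∈ S.interval)
    (hchi : (c : EReal) < hi) (hhi : hi ≤ S.b) (hl : lam.im ≠ 0) :
    ∃ u, S.Solves c hi u (lam • u) ∧ Function.rightLim u c ≠ 0 ∧
      (∀ y ∈ openInterval (c : EReal) hi, S.height lam (Function.rightLim u y) ≤ 0) ∧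
      ∀ z ∈ openInterval (c : EReal) hi, ¬ S.Regular lam z →
        ∀ x ∈ openInterval (z : EReal) hi, u x = 0 := by
  have hsub := openInterval_subset_right hc hhi
  by_cases hreg : ∀ x ∈ openInterval (c : EReal) hi, S.Regular lam x
  · have hj := hS.J01_ne
    obtain ⟨u₁, h₁, i₁⟩ := exists_hom_right hc hchi hhi hreg ![1, 0]
    obtain ⟨u₂, h₂, i₂⟩ := exists_hom_right hc hchi hhi hreg ![0, 1]
    have hω : ∀ y ∈ openInterval (c : EReal) hi,
        S.bracket (Function.rightLim u₁ y) (Function.rightLim u₂ y) = S.J 0 1 := fun y hy => by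
      rw [h₂.bracket_initial hS hc hhi h₁ hy, i₁, i₂, hS.bracket_eq]; simp
    have hV : ∀ y ∈ openInterval (c : EReal) hi, ∀ ξ : Fin 2 → ℂ,
        Function.rightLim (ξ 0 • u₁ + ξ 1 • u₂) y
          = ξ 0 • Function.rightLim u₁ y + ξ 1 • Function.rightLim u₂ y :=
      fun y hy ξ => rightLim_comb h₁ h₂ _ _ hy
    -- Weyl's nested sets: normalised initial values whose solution has energy at most 0 at y. As
    -- the energy increases, these compact sets shrink with y, so they have a common point.
    let A : openInterval (c : EReal) hi → Set (Fin 2 → ℂ) := fun y =>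
      Metric.sphere 0 1 ∩ {ξ | S.height lam (Function.rightLim (ξ 0 • u₁ + ξ 1 • u₂) y) ≤ 0}
    have hcl : ∀ y, IsClosed (A y) := fun y => by
      refine Metric.isClosed_sphere.inter ?_
      simp only [hV y y.2]
      refine isClosed_le ((continuous_height lam).comp ?_) continuous_const
      fun_prop
    have hne : ∀ y, (A y).Nonempty := fun y => by
      have hω' := hω y y.2
      set r₁ := Function.rightLim u₁ y
      set r₂ := Function.rightLim u₂ y
      -- Real vectors have energy 0. A combination of u₁ and u₂ that equals a multiple of (1, 0) at
      -- y therefore gives, once normalised, a point of the set.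
      have e := hS.bracket_smul r₁ r₂ ![1, 0]
      rw [hω'] at e
      set p := S.bracket ![1, 0] r₂
      set q := S.bracket r₁ ![1, 0]
      have hξ : (![p, q] : Fin 2 → ℂ) ≠ 0 := fun h0 => by
        have hp : p = 0 := congrFun h0 0
        have hq : q = 0 := congrFun h0 1
        rw [hp, hq, zero_smul, zero_smul, add_zero] at e
        have := congrFun e 0
        simp [hj] at this
      set s : ℂ := ((‖(![p, q] : Fin 2 → ℂ)‖⁻¹ : ℝ) : ℂ)
      refine ⟨s • ![p, q], ?_, ?_⟩
      · rw [mem_sphere_zero_iff_norm, norm_smul, Complex.norm_real, norm_inv, norm_norm,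
          inv_mul_cancel₀ (norm_ne_zero_iff.2 hξ)]
      · rw [mem_ofPred_eq, hV y y.2]
        have : (s • (![p, q] : Fin 2 → ℂ)) 0 • r₁ + (s • (![p, q] : Fin 2 → ℂ)) 1 • r₂
            = (s * S.J 0 1) • ![1, 0] := by
          rw [mul_smul, e]
          simp only [Pi.smul_apply, Matrix.cons_val_zero, Matrix.cons_val_one, smul_eq_mul]
          module
        rw [this, height_smul, height, hS.form_eq]
        simp
    have hdir : Directed (· ⊇ ·) A := by
      intro y y'
      refine ⟨max y y', ?_, ?_⟩
      · rintro ξ ⟨h1, h2⟩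
        exact ⟨h1, ((h₁.comb h₂ _ _).height_right_mono hsub hl y.2 (max y y').2
          (le_max_left y y')).trans h2⟩
      · rintro ξ ⟨h1, h2⟩
        exact ⟨h1, ((h₁.comb h₂ _ _).height_right_mono hsub hl y'.2 (max y y').2
          (le_max_right y y')).trans h2⟩
    obtain ⟨d, hd1, hd2⟩ := EReal.lt_iff_exists_real_btwn.1 hchi
    have : Nonempty (openInterval (c : EReal) hi) := ⟨⟨d, hd1, hd2⟩⟩
    obtain ⟨ξ, hξ⟩ := IsCompact.nonempty_iInter_of_directed_nonempty_isCompact_isClosed A hdir hne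
      (fun y => (isCompact_sphere _ _).inter_right (by
        have := hcl y
        simp only [hV y y.2]
        refine isClosed_le ((continuous_height lam).comp ?_) continuous_const
        fun_prop)) hcl
    rw [mem_iInter] at hξ
    refine ⟨ξ 0 • u₁ + ξ 1 • u₂, h₁.comb h₂ _ _, ?_, fun y hy => (hξ ⟨y, hy⟩).2,
      fun z hz hzs => absurd (hreg z hz) hzs⟩
    rw [rightLim_comb_initial hc hchi hhi h₁ h₂, i₁, i₂]
    have e : ξ 0 • ![(1 : ℂ), 0] + ξ 1 • ![0, 1] = ξ := by
      ext j; fin_cases j <;> simp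
    rw [e]
    intro h0
    have := (hξ ⟨d, hd1, hd2⟩).1
    rw [h0] at this
    simp at this
  -- If there are singular points, a solution is ended at the first one: it is solved backwards from
  -- a vector of ker(1 + X) there and continued by zero to the right. Being zero beyond the first
  -- singular point, it is zero beyond all of them.
  · push Not at hreg
    obtain ⟨x, hx, hxs⟩ := hreg
    obtain ⟨x₁, hx₁, hs₁, hreg⟩ := exists_first_singular hc (EReal.coe_lt_coe_iff.1 hx.1)
      (hsub hx) hxs
    have hm₁ : x₁ ∈ openInterval (c : EReal) hi := ⟨EReal.coe_lt_coe_iff.2 hx₁.1,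
      (EReal.coe_le_coe_iff.2 hx₁.2).trans_lt hx.2⟩
    have hregE : ∀ y ∈ openInterval (c : EReal) (x₁ : EReal), S.Regular lam y := fun y hy =>
      hreg y (openInterval_coe c x₁ ▸ hy)
    obtain ⟨k, hk0, hk⟩ := hS.exists_ker_add (hsub hm₁) hs₁
    obtain ⟨w, hw, lw⟩ := exists_hom_left (hsub hm₁) hm₁.1 hc.1.le hregE k
    have hu := Solves.glue_zero_right hc.1.le hm₁.1 hm₁.2 hhi hw (by rw [lw, hk])
    have hv : ∀ x ∈ openInterval (x₁ : EReal) hi, glueFun w 0 x₁ x = 0 := fun x hx =>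
      glueFun_of_gt w 0 (EReal.coe_lt_coe_iff.1 hx.1)
    refine ⟨_, hu, fun h0 => hk0 ?_, fun y hy => hu.height_nonpos_of_vanish hc hhi hl hm₁ hv hy,
      fun z hz hzs x hx => hv x ⟨?_, hx.2⟩⟩
    · have hu' := hu.mono (openInterval_mono le_rfl hm₁.2.le : openInterval c x₁ ⊆ _)
      have := hu'.eq_zero_of_rightLim hc (hsub hm₁).2.le hregE h0
      rw [← lw]
      refine leftLim_eq_zero hm₁.1 le_rfl fun t ht => ?_
      rw [← this t ht]
      exact (glueFun_of_lt w 0 (EReal.coe_lt_coe_iff.1 ht.2)).symm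
    · refine lt_of_le_of_lt (EReal.coe_le_coe_iff.2 ?_) hx.1
      by_contra hlt
      exact hzs (hreg z ⟨EReal.coe_lt_coe_iff.1 hz.1, not_le.1 hlt⟩)

end FirstOrderSystem

/-! ### Comparison of solutions for two parameters; consequences of the failure of `CircleB` -/

lemma exists_tail_small {μ : Measure ℝ} {lo hi : EReal} (h : lo < hi) {f : ℝ → ℝ}
    (hf : IntegrableOn f (openInterval lo hi) μ) (h0 : ∀ x ∈ openInterval lo hi, 0 ≤ f x)
    {ε : ℝ} (hε : 0 < ε) : ∃ d ∈ openInterval lo hi,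
      ∀ x : ℝ, d < x → ∀ y : ℝ, (y : EReal) < hi → ∫ t in Icc x y, f t ∂μ ≤ ε := by
  obtain ⟨x, y, hx, hy, hxy, ht⟩ := exists_exhaustion h
  have hmeas := (isOpen_openInterval lo hi).measurableSet
  have hcov : AECover (μ.restrict (openInterval lo hi)) atTop fun n => Icc (x n) (y n) :=
    ⟨(ae_restrict_iff' hmeas).2 (Eventually.of_forall ht), fun n => measurableSet_Icc⟩
  have hr : ∀ n, (μ.restrict (openInterval lo hi)).restrict (Icc (x n) (y n))
      = μ.restrict (Icc (x n) (y n)) := fun n => by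
    rw [Measure.restrict_restrict measurableSet_Icc,
      inter_eq_self_of_subset_left (openInterval_Icc_subset (hx n) (hy n))]
  have lim := hcov.integral_tendsto_of_countably_generated hf
  simp only [hr] at lim
  obtain ⟨n, hn⟩ := (lim.eventually (lt_mem_nhds (sub_lt_self _ hε))).exists
  refine ⟨y n, hy n, fun p hp q hq => ?_⟩
  rcases le_or_gt p q with hpq | hpq
  · have hsub : Icc p q ⊆ openInterval lo hi := fun t ht =>
      ⟨(hy n).1.trans (EReal.coe_lt_coe_iff.2 (hp.trans_le ht.1)),
        (EReal.coe_le_coe_iff.2 ht.2).trans_lt hq⟩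
    have hsub' := openInterval_Icc_subset (hx n) (hy n)
    have hd : Disjoint (Icc (x n) (y n)) (Icc p q) := by
      rw [Set.disjoint_left]
      intro t h1 h2
      exact absurd (h1.2.trans_lt hp) (not_lt.2 h2.1)
    have e := setIntegral_union hd measurableSet_Icc (hf.mono_set hsub') (hf.mono_set hsub)
    have : ∫ t in Icc (x n) (y n) ∪ Icc p q, f t ∂μ ≤ ∫ t in openInterval lo hi, f t ∂μ :=
      setIntegral_mono_set hf ((ae_restrict_iff' hmeas).2 (Eventually.of_forall h0))
        (LE.le.eventuallyLE (union_subset hsub' hsub))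
    linarith
  · rw [Icc_eq_empty (not_le.2 hpq)]
    simpa using hε.le

namespace FirstOrderSystem

section General

variable {n : ℕ} {S : FirstOrderSystem n}

/-- This is `norm_form_le` for √s v and u/√s. The free weight s is what later yields a product of
integrals instead of a sum. -/
lemma norm_density_le (v u : ℝ → Fin n → ℂ) {x : ℝ} (hx : x ∈ S.interval) {s : ℝ} (hs : 0 < s) :
    ‖S.density v u x‖ ≤ s * (S.density v v x).re + s⁻¹ * (S.density u u x).re := by
  have h := norm_form_le (S.W_nonneg x hx) (((√s : ℝ) : ℂ) • v x) (((√s⁻¹ : ℝ) : ℂ) • u x)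
  simp only [Matrix.mulVec_smul, star_smul, smul_dotProduct, dotProduct_smul, smul_eq_mul,
    Complex.star_def, Complex.conj_ofReal, norm_mul, Complex.norm_real,
    Real.norm_of_nonneg (Real.sqrt_nonneg _), ← mul_assoc] at h
  rw [Real.mul_self_sqrt hs.le, Real.mul_self_sqrt (inv_nonneg.2 hs.le),
    ← Real.sqrt_mul (inv_nonneg.2 hs.le), inv_mul_cancel₀ hs.ne', Real.sqrt_one, one_mul] at h
  change ‖S.density v u x‖ ≤ s * ‖S.density v v x‖ + s⁻¹ * ‖S.density u u x‖ at h
  have e : ∀ w : ℝ → Fin n → ℂ, ‖S.density w w x‖ = (S.density w w x).re := fun w => by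
    conv_lhs => rw [density_self_re w hx]
    rw [Complex.norm_real, Real.norm_of_nonneg (density_self_re_nonneg w hx)]
  rwa [e, e] at h

/-- A Cauchy-Schwarz inequality (with a constant that is not optimal). -/
lemma norm_integral_density_sq_le {v u : ℝ → Fin n → ℂ} {K : Set ℝ} (hK : MeasurableSet K)
    (hKs : K ⊆ S.interval) (hv : IntegrableOn (fun t => (S.density v v t).re) K S.μ)
    (hu : IntegrableOn (fun t => (S.density u u t).re) K S.μ) :
    ‖∫ t in K, S.density v u t ∂S.μ‖ ^ 2
      ≤ 4 * (∫ t in K, (S.density v v t).re ∂S.μ) * ∫ t in K, (S.density u u t).re ∂S.μ := by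
  set A := ∫ t in K, (S.density v v t).re ∂S.μ with hA
  set C := ∫ t in K, (S.density u u t).re ∂S.μ with hC
  set B := ‖∫ t in K, S.density v u t ∂S.μ‖ with hB
  have hA0 : 0 ≤ A := setIntegral_nonneg hK fun t ht => density_self_re_nonneg v (hKs ht)
  have hC0 : 0 ≤ C := setIntegral_nonneg hK fun t ht => density_self_re_nonneg u (hKs ht)
  have h1 : ∀ s : ℝ, 0 < s → B ≤ s * A + s⁻¹ * C := fun s hs => by
    refine (norm_integral_le_integral_norm _).trans ?_
    rw [hA, hC, ← integral_const_mul, ← integral_const_mul,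
      ← integral_add (hv.const_mul s) (hu.const_mul s⁻¹)]
    refine integral_mono_of_nonneg (Eventually.of_forall fun t => norm_nonneg _)
      ((hv.const_mul s).add (hu.const_mul s⁻¹)) ?_
    exact (ae_restrict_iff' hK).2 (Eventually.of_forall fun t ht => norm_density_le v u (hKs ht) hs)
  -- A quadratic that is nonnegative everywhere has nonpositive discriminant; for s ≤ 0 each term is
  -- nonnegative by itself.
  have h2 : ∀ s : ℝ, 0 ≤ A * (s * s) + (-B) * s + C := fun s => by
    rcases le_or_gt s 0 with hs | hs
    · have : 0 ≤ B * -s := mul_nonneg (norm_nonneg _) (by linarith)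
      nlinarith [mul_nonneg hA0 (mul_self_nonneg s)]
    · have := mul_le_mul_of_nonneg_left (h1 s hs) hs.le
      have e : s * (s * A + s⁻¹ * C) = A * (s * s) + C := by field_simp
      linarith
  have := discrim_le_zero h2
  rw [discrim] at this
  linarith

end General

variable {S : FirstOrderSystem 2} {lam : ℂ}

lemma IsReal.density_star (hS : S.IsReal) (u : ℝ → Fin 2 → ℂ) {x : ℝ} (hx : x ∈ S.interval) :
    (S.density (fun t => star (u t)) (fun t => star (u t)) x).re = (S.density u u x).re := by
  have : S.density (fun t => star (u t)) (fun t => star (u t)) x = star (S.density u u x) := by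
    rw [density, density, ← hS.star_W hx, Matrix.star_dotProduct, star_star, dotProduct_comm]
  rw [this]; simp

/-- The bracket of two solutions with different parameters. -/
lemma IsReal.norm_bracket_sub_le (hS : S.IsReal) {lo hi : EReal}
    (hsub : openInterval lo hi ⊆ S.interval) {lam₀ : ℂ} (hl : lam.im ≠ 0) (hl₀ : lam₀.im ≠ 0)
    {U u : ℝ → Fin 2 → ℂ} (hU : S.Solves lo hi U (lam₀ • U)) (hu : S.Solves lo hi u (lam • u))
    {x y : ℝ} (hx : x ∈ openInterval lo hi) (hy : y ∈ openInterval lo hi) (hxy : x ≤ y) :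
    ‖S.bracket (Function.rightLim U y) (Function.rightLim u y)
      - S.bracket (Function.leftLim U x) (Function.leftLim u x)‖ ^ 2
      ≤ 4 * ‖lam - lam₀‖ ^ 2 * (∫ t in Icc x y, (S.density U U t).re ∂S.μ)
        * ∫ t in Icc x y, (S.density u u t).re ∂S.μ := by
  have st : Function.rightLim (fun x => star (U x)) y = star (Function.rightLim U y) ∧
      Function.leftLim (fun x => star (U x)) x = star (Function.leftLim U x) :=
    ⟨rightLim_eq_of_tendsto ((continuous_star.tendsto _).comp (locallyBV_tendsto hU.balanced.1 hy).2),
      leftLim_eq_of_tendsto ((continuous_star.tendsto _).comp (locallyBV_tendsto hU.balanced.1 hx).1)⟩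
  have g := (Solves.green hsub hu (hU.conj hS hsub) hx hy hxy).2
  rw [st.1, st.2] at g
  have hm := openInterval_Icc_subset hx hy |>.trans hsub
  -- The bracket is the form with the conjugate of U, which solves the equation with the conjugate
  -- of λ₀. Green's integrand reduces to (λ - λ₀) Uᵀwu.
  have e : ∀ t, S.density (fun x => star (U x)) (lam • u) t
      - S.density (fun x => star ((lam₀ • U) x)) u t
      = (lam - lam₀) * S.density (fun x => star (U x)) u t := fun t => by
    simp only [density, Pi.smul_apply, star_smul, star_star, Matrix.mulVec_smul, dotProduct_smul,
      smul_dotProduct, smul_eq_mul]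
    ring
  simp only [e] at g
  rw [integral_const_mul] at g
  rw [bracket, bracket, g, norm_mul, mul_pow]
  have hUi := (hU.height_sub hsub hl₀ hx hy hxy).1
  have e2 := fun t ht => hS.density_star U (hm ht) (x := t)
  have := norm_integral_density_sq_le measurableSet_Icc hm
    (IntegrableOn.congr_fun hUi (fun t ht => (e2 t ht).symm) measurableSet_Icc)
    (hu.height_sub hsub hl hx hy hxy).1
  rw [setIntegral_congr_fun measurableSet_Icc e2] at this
  calc _ ≤ ‖lam - lam₀‖ ^ 2 * _ := mul_le_mul_of_nonneg_left this (sq_nonneg _)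
    _ = _ := by ring

/-- By Cramer's rule z is expanded in U and V with brackets as coefficients. Two solutions with
bounded form values thus control the energy of any vector by its brackets with them. -/
lemma IsReal.norm_form_self_le (hS : S.IsReal) {U V z : Fin 2 → ℂ} {M : ℝ}
    (h11 : ‖S.form U U‖ ≤ M) (h12 : ‖S.form U V‖ ≤ M) (h22 : ‖S.form V V‖ ≤ M) :
    ‖S.bracket U V‖ ^ 2 * ‖S.form z z‖
      ≤ 2 * M * (‖S.bracket U z‖ ^ 2 + ‖S.bracket V z‖ ^ 2) := by
  have h21 : ‖S.form V U‖ ≤ M := by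
    rw [← norm_neg, ← star_form, norm_star]; exact h12
  have hM : 0 ≤ M := (norm_nonneg _).trans h11
  have e := hS.bracket_smul U V z
  have hp : ‖S.bracket z V‖ = ‖S.bracket V z‖ := by
    rw [hS.bracket_eq, hS.bracket_eq, ← norm_neg]; congr 1; ring
  set p := S.bracket z V
  set q := S.bracket U z
  set ω := S.bracket U V
  have h1 : ‖ω‖ ^ 2 * ‖S.form z z‖ = ‖S.form (ω • z) (ω • z)‖ := by
    rw [form_smul_left, form_smul_right, norm_mul, norm_mul, norm_star]; ring
  rw [h1, e, form_add_left, form_add_right, form_add_right]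
  simp only [form_smul_left, form_smul_right]
  have h2 : ‖p * (star p * S.form U U) + q * (star p * S.form U V)
      + (p * (star q * S.form V U) + q * (star q * S.form V V))‖
      ≤ ‖p‖ * (‖p‖ * M) + ‖q‖ * (‖p‖ * M) + (‖p‖ * (‖q‖ * M) + ‖q‖ * (‖q‖ * M)) := by
    refine (norm_add_le _ _).trans (add_le_add ((norm_add_le _ _).trans (add_le_add ?_ ?_))
      ((norm_add_le _ _).trans (add_le_add ?_ ?_))) <;>
    · rw [norm_mul, norm_mul, norm_star]
      gcongr
  refine h2.trans ?_
  rw [← hp]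
  nlinarith [mul_nonneg hM (sq_nonneg (‖p‖ - ‖q‖))]

/-- Near `b` all solutions for some nonreal parameter are square-integrable. -/
def CircleB (S : FirstOrderSystem 2) : Prop :=
  ∃ lam : ℂ, lam.im ≠ 0 ∧ ∃ c ∈ S.interval,
    (∀ x ∈ openInterval (c : EReal) S.b, S.Regular lam x) ∧
      ∀ u, S.Solves c S.b u (lam • u) → S.SqOn c S.b u

/-- If not all solutions near `b` are square-integrable, then the square-integrable ones have
nonpositive energy. -/
lemma IsReal.height_nonpos (hS : S.IsReal) (hC : ¬ S.CircleB) {c : ℝ} (hc : c ∈ S.interval)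
    (hl : lam.im ≠ 0) {u : ℝ → Fin 2 → ℂ} (hu : S.Solves c S.b u (lam • u))
    (hs : S.SqOn c S.b u) {y : ℝ} (hy : y ∈ openInterval (c : EReal) S.b) :
    S.height lam (Function.rightLim u y) ≤ 0 := by
  by_contra! hpos
  have hsubc := openInterval_subset_right hc le_rfl
  have hyI := hsubc hy
  have hsuby : openInterval (y : EReal) S.b ⊆ openInterval (c : EReal) S.b :=
    openInterval_mono hy.1.le le_rfl
  have hsub := openInterval_subset_right hyI le_rfl
  have huy := hu.mono hsuby
  -- At a singular point u⁻ has energy at most 0, whereas to the right of y it is at least h(u⁺(y))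
  -- > 0.
  have hreg : ∀ x ∈ openInterval (y : EReal) S.b, S.Regular lam x := by
    intro x hx
    by_contra hsing
    have h1 := huy.height_initial_le hyI le_rfl hl hx
    have hk := hS.halfJump_left hsub huy hx hsing
    by_cases h0 : Function.leftLim u x = 0
    · rw [h0, height_zero] at h1; linarith
    · have := height_neg_of_halfJump (hsub hx) hl hk h0
      linarith
  obtain ⟨v, hv, hv0, hvn, -⟩ := hS.exists_nonpos_solution hyI hyI.2 le_rfl hl
  have hvs := hv.sqOn_of_bounded hyI hyI.2 le_rfl hl hvn
  have hb : S.bracket (Function.rightLim v y) (Function.rightLim u y) ≠ 0 := by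
    intro h0
    obtain ⟨α, hα⟩ := hS.exists_smul_of_bracket hv0 h0
    obtain ⟨d, hd1, hd2⟩ := EReal.lt_iff_exists_real_btwn.1 hyI.2
    have h1 := hv.height_initial_le hyI le_rfl hl ⟨hd1, hd2⟩
    have h2 := hv.height_left_le_right hsub hl ⟨hd1, hd2⟩ ⟨hd1, hd2⟩ le_rfl
    have h3 := hvn d ⟨hd1, hd2⟩
    rw [hα, height_smul] at hpos
    nlinarith [sq_nonneg ‖α‖]
  -- Both u and the solution v of nonpositive energy are square-integrable, and they are
  -- independent; so all solutions to the right of y are square-integrable, which is the excluded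
  -- case.
  refine hC ⟨lam, hl, y, hyI, hreg, fun z hz => ?_⟩
  obtain ⟨α, β, e⟩ := hS.exists_comb hyI hyI.2 le_rfl hreg hv huy hz hb
  exact (SqOn.add hsub (hv.smul_lam α) (hvs.smul α) (huy.smul_lam β)
    ((hs.mono hsuby).smul β)).congr e

/-- If not all solutions near `b` are square-integrable, then the energy of the square-integrable
ones tends to `0`. -/
lemma IsReal.exists_height_gt (hS : S.IsReal) (hC : ¬ S.CircleB) {c : ℝ} (hc : c ∈ S.interval)
    (hl : lam.im ≠ 0) {u : ℝ → Fin 2 → ℂ} (hu : S.Solves c S.b u (lam • u))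
    {κ : ℝ} (hκ : κ < 0) :
    ∃ y ∈ openInterval (c : EReal) S.b, κ < S.height lam (Function.rightLim u y) := by
  by_contra! hle
  have hsub := openInterval_subset_right hc le_rfl
  -- The right-hand limit at a singular point has energy at least 0, but here it would be at most κ
  -- < 0.
  have hreg : ∀ x ∈ openInterval (c : EReal) S.b, S.Regular lam x := by
    intro x hx
    by_contra hsing
    have h1 := hle x hx
    have hk := hS.halfJump_right hsub hu hx hsing
    by_cases h0 : Function.rightLim u x = 0
    · rw [h0, height_zero] at h1; linarith
    · have := height_pos_of_halfJump (hsub hx) hl hk h0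
      linarith
  refine hC ⟨lam, hl, c, hc, hreg, fun z hz => ?_⟩
  set w := ‖S.bracket (Function.rightLim z c) (Function.rightLim u c)‖ ^ 2 with hw
  set m := (2 * lam.im) ^ 2 with hm
  have hm0 : 0 < m := by positivity
  refine hz.sqOn_of_bounded hc hc.2 le_rfl hl (M := w / (m * -κ)) fun y hy => ?_
  -- Up to a positive factor the Plücker relation bounds h(z)h(u) from below by minus the square of
  -- a constant bracket. As h(u) ≤ κ < 0, this bounds h(z) from above.
  have h1 := hS.plucker (Function.rightLim z y) (Function.rightLim u y)
  rw [hu.bracket_initial hS hc le_rfl hz hy, ← hw] at h1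
  have h2 : m * (S.height lam (Function.rightLim z y) * S.height lam (Function.rightLim u y))
      ≥ -w := by
    have : m * (S.height lam (Function.rightLim z y) * S.height lam (Function.rightLim u y))
        = (S.form (Function.rightLim z y) (Function.rightLim z y)).im
          * (S.form (Function.rightLim u y) (Function.rightLim u y)).im := by
      rw [height, height, hm]
      field_simp
    rw [this, h1]
    nlinarith [sq_nonneg ‖S.form (Function.rightLim z y) (Function.rightLim u y)‖]
  have h3 := hle y hy
  have hk0 : 0 < m * -κ := mul_pos hm0 (by linarith)
  rw [le_div_iff₀ hk0]
  set a := S.height lam (Function.rightLim z y)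
  set b := S.height lam (Function.rightLim u y)
  rcases le_or_gt a 0 with ha | ha
  · have : 0 ≤ w := sq_nonneg _
    nlinarith
  · have : a * b ≤ a * κ := mul_le_mul_of_nonneg_left h3 ha.le
    nlinarith

end FirstOrderSystem

/-! ### Subspaces of dimension one and two -/

section Rank

variable {V : Type*} [AddCommGroup V] [Module ℂ V]

lemma rank_eq_one_of_generator {p : Submodule ℂ V} {v : V} (hv : v ∈ p) (h0 : v ≠ 0)
    (h : ∀ u ∈ p, ∃ α : ℂ, u = α • v) : Module.rank ℂ p = 1 := by
  have e : p = Submodule.span ℂ {v} := by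
    refine le_antisymm (fun u hu => ?_) ((Submodule.span_singleton_le_iff_mem _ _).2 hv)
    obtain ⟨α, rfl⟩ := h u hu
    exact Submodule.smul_mem _ _ (Submodule.mem_span_singleton_self v)
  rw [e, ← Module.finrank_eq_rank, finrank_span_singleton h0, Nat.cast_one]

lemma rank_eq_two_of_generators {p : Submodule ℂ V} {v w : V} (hv : v ∈ p) (hw : w ∈ p)
    (h0 : ∀ α β : ℂ, α • v + β • w = 0 → α = 0 ∧ β = 0)
    (h : ∀ u ∈ p, ∃ α β : ℂ, u = α • v + β • w) : Module.rank ℂ p = 2 := by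
  have e : p = Submodule.span ℂ (Set.range ![v, w]) := by
    have hr : Set.range ![v, w] = {v, w} := by
      simp [Matrix.range_cons, Set.pair_comm]
    rw [hr]
    refine le_antisymm (fun u hu => ?_) (Submodule.span_le.2 ?_)
    · obtain ⟨α, β, rfl⟩ := h u hu
      exact Submodule.mem_span_pair.2 ⟨α, β, rfl⟩
    · rintro x (rfl | rfl) <;> assumption
  have hli : LinearIndependent ℂ ![v, w] := LinearIndependent.pair_iff.2 h0
  have := FiniteDimensional.span_of_finite ℂ (Set.finite_range ![v, w])
  rw [e, ← Module.finrank_eq_rank, finrank_span_eq_card hli]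
  simp

end Rank

/-! ### Independence of the parameter and the dimension of the square-integrable solutions near b -/

namespace FirstOrderSystem

variable {S : FirstOrderSystem 2} {lam : ℂ}

/-- The energy increases, so its bound near b is also a bound further to the left, whether or not
there are singular points in between. -/
lemma Solves.sqOn_extend {c e : ℝ} (hc : c ∈ S.interval) (he : e ∈ S.interval) (hce : c ≤ e)
    (hl : lam.im ≠ 0) {u : ℝ → Fin 2 → ℂ} (hu : S.Solves c S.b u (lam • u))
    (hs : S.SqOn e S.b u) : S.SqOn c S.b u := by
  have hsub := openInterval_subset_right hc le_rfl
  have hsube : openInterval (e : EReal) S.b ⊆ openInterval (c : EReal) S.b :=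
    openInterval_mono (EReal.coe_le_coe_iff.2 hce) le_rfl
  have hue := hu.mono hsube
  refine hu.sqOn_of_bounded hc hc.2 le_rfl hl (M := S.height lam (Function.rightLim u e)
    + ∫ t in openInterval e S.b, (S.density u u t).re ∂S.μ) fun y hy => ?_
  obtain ⟨f, hf1, hf2⟩ := EReal.lt_iff_exists_real_btwn.1 he.2
  have hmax : max y f ∈ openInterval (e : EReal) S.b :=
    ⟨hf1.trans_le (EReal.coe_le_coe_iff.2 (le_max_right y f)), by
      rcases max_choice y f with h | h <;> rw [h]
      exacts [hy.2, hf2]⟩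
  exact (hu.height_right_mono hsub hl hy (hsube hmax) (le_max_left y f)).trans
    (hue.bounded_of_sqOn he le_rfl hl hs hmax)

/-- Two square-integrable reference solutions near `b`, whose brackets control the energy. -/
lemma IsReal.exists_reference (hS : S.IsReal) (hC : S.CircleB) (hl : lam.im ≠ 0) :
    ∃ lam₀ : ℂ, lam₀.im ≠ 0 ∧ ∃ c₀ ∈ S.interval, ∃ U V : ℝ → Fin 2 → ℂ,
      S.Solves c₀ S.b U (lam₀ • U) ∧ S.Solves c₀ S.b V (lam₀ • V) ∧
      S.SqOn c₀ S.b U ∧ S.SqOn c₀ S.b V ∧ ∃ K : ℝ, 0 < K ∧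
      ∀ y ∈ openInterval (c₀ : EReal) S.b,
        S.bracket (Function.leftLim U y) (Function.leftLim V y) = S.J 0 1 ∧
        ∀ ζ, |S.height lam ζ| ≤ K * (‖S.bracket (Function.rightLim U y) ζ‖ ^ 2
            + ‖S.bracket (Function.rightLim V y) ζ‖ ^ 2) ∧
          |S.height lam ζ| ≤ K * (‖S.bracket (Function.leftLim U y) ζ‖ ^ 2
            + ‖S.bracket (Function.leftLim V y) ζ‖ ^ 2) := by
  obtain ⟨lam₀, hl₀, c₀, hc₀, hreg, hall⟩ := hC
  have hsub₀ := openInterval_subset_right hc₀ le_rfl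
  have hj := hS.J01_ne
  obtain ⟨U, hU, iU⟩ := exists_hom_right hc₀ hc₀.2 le_rfl hreg ![1, 0]
  obtain ⟨V, hV, iV⟩ := exists_hom_right hc₀ hc₀.2 le_rfl hreg ![0, 1]
  have hωr : ∀ y ∈ openInterval (c₀ : EReal) S.b,
      S.bracket (Function.rightLim U y) (Function.rightLim V y) = S.J 0 1 := fun y hy => by
    rw [hV.bracket_initial hS hc₀ le_rfl hU hy, iU, iV, hS.bracket_eq]; simp
  have hωl : ∀ y ∈ openInterval (c₀ : EReal) S.b,
      S.bracket (Function.leftLim U y) (Function.leftLim V y) = S.J 0 1 := fun y hy => by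
    rw [← hV.bracket_eq hS hsub₀ hU hy hy le_rfl, hωr y hy]
  have hUs := hall U hU
  have hVs := hall V hV
  have bound : ∀ {u : ℝ → Fin 2 → ℂ}, S.Solves c₀ S.b u (lam₀ • u) → S.SqOn c₀ S.b u →
      ∃ B : ℝ, ∀ y ∈ openInterval (c₀ : EReal) S.b,
        |(S.form (Function.rightLim u y) (Function.rightLim u y)).im| ≤ B ∧
        |(S.form (Function.leftLim u y) (Function.leftLim u y)).im| ≤ B := by
    intro u hu hs
    set p := S.height lam₀ (Function.rightLim u c₀)
    set I := ∫ t in openInterval c₀ S.b, (S.density u u t).re ∂S.μ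
    have e : ∀ z, |(S.form z z).im| = |2 * lam₀.im| * |S.height lam₀ z| := fun z => by
      rw [← abs_mul, height, mul_div_cancel₀ _ (by simpa using hl₀)]
    refine ⟨|2 * lam₀.im| * max |p| |p + I|, fun y hy => ?_⟩
    have h1 := hu.height_initial_le hc₀ le_rfl hl₀ hy
    have h2 := hu.height_left_le_right hsub₀ hl₀ hy hy le_rfl
    have h3 := hu.bounded_of_sqOn hc₀ le_rfl hl₀ hs hy
    rw [e, e]
    exact ⟨mul_le_mul_of_nonneg_left (abs_le_max_abs_abs (h1.trans h2) h3) (abs_nonneg _),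
      mul_le_mul_of_nonneg_left (abs_le_max_abs_abs h1 (h2.trans h3)) (abs_nonneg _)⟩
  obtain ⟨B₁, hB₁⟩ := bound hU hUs
  obtain ⟨B₂, hB₂⟩ := bound hV hVs
  have normf : ∀ z, ‖S.form z z‖ = |(S.form z z).im| := fun z => by
    conv_lhs => rw [form_self z]
    simp
  set M := B₁ + B₂ + (B₁ * B₂ + ‖S.J 0 1‖ ^ 2 + 1) with hM
  have hB₀ : 0 ≤ B₁ ∧ 0 ≤ B₂ := by
    obtain ⟨d, hd1, hd2⟩ := EReal.lt_iff_exists_real_btwn.1 hc₀.2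
    exact ⟨(abs_nonneg _).trans (hB₁ d ⟨hd1, hd2⟩).1, (abs_nonneg _).trans (hB₂ d ⟨hd1, hd2⟩).1⟩
  have hBB := mul_nonneg hB₀.1 hB₀.2
  -- The diagonal values of the form are bounded through the energies, the mixed one by the Plücker
  -- relation with the bracket J₀₁.
  have cross : ∀ {z v : Fin 2 → ℂ}, |(S.form z z).im| ≤ B₁ → |(S.form v v).im| ≤ B₂ →
      S.bracket z v = S.J 0 1 →
      ‖S.form z z‖ ≤ M ∧ ‖S.form z v‖ ≤ M ∧ ‖S.form v v‖ ≤ M := by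
    intro z v h1 h2 h3
    have hp := hS.plucker z v
    rw [h3] at hp
    have hn := sq_nonneg ‖S.J 0 1‖
    refine ⟨by rw [normf]; linarith, ?_, by rw [normf]; linarith⟩
    have h4 : (S.form z z).im * (S.form v v).im ≤ B₁ * B₂ := by
      refine (le_abs_self _).trans ?_
      rw [abs_mul]
      exact mul_le_mul h1 h2 (abs_nonneg _) hB₀.1
    nlinarith [sq_nonneg (‖S.form z v‖ - 1), hB₀.1, hB₀.2]
  have hMpos : 0 < M := by nlinarith [sq_nonneg ‖S.J 0 1‖, hB₀.1, hB₀.2]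
  set K := 2 * M / (‖S.J 0 1‖ ^ 2 * |2 * lam.im|) with hK
  have hJ2 : 0 < ‖S.J 0 1‖ ^ 2 := by positivity
  have hl2 : 0 < |2 * lam.im| := by positivity
  have hKpos : 0 < K := by positivity
  have energy : ∀ {z v ζ : Fin 2 → ℂ}, |(S.form z z).im| ≤ B₁ → |(S.form v v).im| ≤ B₂ →
      S.bracket z v = S.J 0 1 →
      |S.height lam ζ| ≤ K * (‖S.bracket z ζ‖ ^ 2 + ‖S.bracket v ζ‖ ^ 2) := by
    intro z v ζ h1 h2 h3
    obtain ⟨c1, c2, c3⟩ := cross h1 h2 h3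
    have := hS.norm_form_self_le (z := ζ) c1 c2 c3
    rw [h3, normf] at this
    rw [height, abs_div, hK, div_mul_eq_mul_div, div_le_div_iff₀ hl2 (by positivity)]
    calc _ = (‖S.J 0 1‖ ^ 2 * |(S.form ζ ζ).im|) * |2 * lam.im| := by ring
      _ ≤ _ := mul_le_mul_of_nonneg_right this hl2.le
  exact ⟨lam₀, hl₀, c₀, hc₀, U, V, hU, hV, hUs, hVs, K, hKpos, fun y hy => ⟨hωl y hy, fun ζ =>
    ⟨energy (hB₁ y hy).1 (hB₂ y hy).1 (hωr y hy), energy (hB₁ y hy).2 (hB₂ y hy).2 (hωl y hy)⟩⟩⟩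

/-- In the application m and p are the energies of a solution at the two ends of an interval, b and
a its brackets with two reference solutions there. Let A and B be the sums of the squared norms of a
and of b, and I = p - m. Then I ≤ K(A + B) and A ≤ 2B + 16ηI, and as 16Kη ≤ 1/2 the terms with I are
absorbed, leaving I ≤ 6KB. The bound in terms of A is symmetric. -/
lemma energy_estimate {a₁ a₂ b₁ b₂ : ℂ} {p m K η : ℝ} (hK : 0 < K) (hI : 0 ≤ p - m)
    (hp : |p| ≤ K * (‖a₁‖ ^ 2 + ‖a₂‖ ^ 2)) (hm : |m| ≤ K * (‖b₁‖ ^ 2 + ‖b₂‖ ^ 2))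
    (h₁ : ‖a₁ - b₁‖ ^ 2 ≤ 4 * η * (p - m)) (h₂ : ‖a₂ - b₂‖ ^ 2 ≤ 4 * η * (p - m))
    (hη : 16 * K * η ≤ 1 / 2) :
    p - m ≤ 6 * K * (‖b₁‖ ^ 2 + ‖b₂‖ ^ 2) ∧ p - m ≤ 6 * K * (‖a₁‖ ^ 2 + ‖a₂‖ ^ 2) ∧
      ‖b₁‖ ^ 2 + ‖b₂‖ ^ 2 ≤ 2 * (‖a₁‖ ^ 2 + ‖a₂‖ ^ 2) + 16 * η * (p - m) := by
  have two : ∀ a b : ℂ, ‖a‖ ^ 2 ≤ 2 * ‖b‖ ^ 2 + 2 * ‖a - b‖ ^ 2 := fun a b => by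
    have h1 : ‖a‖ ≤ ‖b‖ + ‖a - b‖ := by
      calc ‖a‖ = ‖b + (a - b)‖ := by congr 1; ring
        _ ≤ _ := norm_add_le _ _
    nlinarith [norm_nonneg a, sq_nonneg (‖b‖ - ‖a - b‖)]
  have t1 := two a₁ b₁
  have t2 := two a₂ b₂
  have t3 := two b₁ a₁
  have t4 := two b₂ a₂
  rw [norm_sub_rev] at t3 t4
  have hp' := (abs_le.1 hp).2
  have hm' := (abs_le.1 hm).1
  set A := ‖a₁‖ ^ 2 + ‖a₂‖ ^ 2
  set B := ‖b₁‖ ^ 2 + ‖b₂‖ ^ 2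
  set I := p - m with hIdef
  have hA : A ≤ 2 * B + 16 * η * I := by linarith
  have hB : B ≤ 2 * A + 16 * η * I := by linarith
  have hIK : I ≤ K * A + K * B := by linarith
  have e : K * (16 * η * I) ≤ 1 / 2 * I := by
    calc K * (16 * η * I) = 16 * K * η * I := by ring
      _ ≤ _ := mul_le_mul_of_nonneg_right hη hI
  have hA' := mul_le_mul_of_nonneg_left hA hK.le
  have hB' := mul_le_mul_of_nonneg_left hB hK.le
  refine ⟨?_, ?_, hB⟩ <;> nlinarith

/-- Square-integrability of all solutions near `b` does not depend on the parameter. -/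
lemma IsReal.circle_all (hS : S.IsReal) (hC : S.CircleB) (hl : lam.im ≠ 0) :
    ∃ d ∈ S.interval, ∀ c ∈ S.interval, d ≤ c →
      (∀ x ∈ openInterval (c : EReal) S.b, S.Regular lam x) ∧
        ∀ u, S.Solves c S.b u (lam • u) → S.SqOn c S.b u := by
  have hj := hS.J01_ne
  obtain ⟨lam₀, hl₀, c₀, hc₀, U, V, hU, hV, hUs, hVs, K, hK, hKy⟩ := hS.exists_reference hC hl
  have hsub₀ := openInterval_subset_right hc₀ le_rfl
  set δ := ‖lam - lam₀‖ ^ 2 with hδ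
  have hδ0 : 0 ≤ δ := sq_nonneg _
  -- Chosen to make 16K|λ - λ₀|²ε ≤ 1/2, the smallness that `energy_estimate` asks for; ε bounds the
  -- tails of the reference solutions.
  set ε := 1 / (32 * K * (δ + 1)) with hε
  have hε0 : 0 < ε := by positivity
  obtain ⟨d₁, hd₁, ht₁⟩ := exists_tail_small hc₀.2 hUs
    (fun x hx => density_self_re_nonneg U (hsub₀ hx)) hε0
  obtain ⟨d₂, hd₂, ht₂⟩ := exists_tail_small hc₀.2 hVs
    (fun x hx => density_self_re_nonneg V (hsub₀ hx)) hε0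
  have hεδ : 16 * K * (δ * ε) ≤ 1 / 2 := by
    rw [hε, mul_one_div, mul_div_assoc', div_le_div_iff₀ (by positivity) (by norm_num)]
    nlinarith
  have hdm : max d₁ d₂ ∈ S.interval := by
    rcases max_choice d₁ d₂ with h | h <;> rw [h]
    exacts [hsub₀ hd₁, hsub₀ hd₂]
  refine ⟨max d₁ d₂, hdm, fun c hc hdc => ?_⟩
  have hsub := openInterval_subset_right hc le_rfl
  have hcc₀ : openInterval (c : EReal) S.b ⊆ openInterval (c₀ : EReal) S.b :=
    openInterval_mono (hd₁.1.le.trans (EReal.coe_le_coe_iff.2 ((le_max_left _ _).trans hdc))) le_rfl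
  have main : ∀ u : ℝ → Fin 2 → ℂ, S.Solves c S.b u (lam • u) →
      ∀ x ∈ openInterval (c : EReal) S.b, ∀ y ∈ openInterval (c : EReal) S.b, x ≤ y →
      0 ≤ S.height lam (Function.rightLim u y) - S.height lam (Function.leftLim u x) ∧ _ :=
    fun u hu x hx y hy hxy => by
    have hcx : c < x := EReal.coe_lt_coe_iff.1 hx.1
    obtain ⟨-, hI⟩ := hu.height_sub hsub hl hx hy hxy
    have hI0 := integral_density_nonneg (u := u) (hsub hx) (hsub hy)
    have e1 := hS.norm_bracket_sub_le hsub hl hl₀ (hU.mono hcc₀) hu hx hy hxy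
    have e2 := hS.norm_bracket_sub_le hsub hl hl₀ (hV.mono hcc₀) hu hx hy hxy
    have q1 := ht₁ x (((le_max_left _ _).trans hdc).trans_lt hcx) y hy.2
    have q2 := ht₂ x (((le_max_right _ _).trans hdc).trans_lt hcx) y hy.2
    rw [← hI] at hI0 e1 e2
    refine ⟨hI0, energy_estimate (η := δ * ε) hK hI0 ((hKy y (hcc₀ hy)).2 _).1
      ((hKy x (hcc₀ hx)).2 _).2 ?_ ?_ hεδ⟩
    · refine e1.trans (mul_le_mul_of_nonneg_right ?_ hI0)
      rw [← mul_assoc]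
      exact mul_le_mul_of_nonneg_left q1 (by positivity)
    · refine e2.trans (mul_le_mul_of_nonneg_right ?_ hI0)
      rw [← mul_assoc]
      exact mul_le_mul_of_nonneg_left q2 (by positivity)
  refine ⟨fun z hz => ?_, fun u hu => ?_⟩
  · by_contra hsing
    -- The solution χ vanishes to the right of a singular point z. Read backwards from a point where
    -- χ is 0, the estimate makes the brackets of χ⁻ with U and V vanish, hence χ⁻ itself everywhere
    -- on (c, b), which contradicts χ⁺(c) ≠ 0.
    obtain ⟨χ, hχ, hχ0, -, hv⟩ := hS.exists_nonpos_solution hc hc.2 le_rfl hl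
    obtain ⟨y₀, hy1, hy2⟩ := EReal.lt_iff_exists_real_btwn.1 hz.2
    have hzy₀ : z < y₀ := EReal.coe_lt_coe_iff.1 hy1
    have hleft : ∀ x ∈ openInterval (c : EReal) S.b, Function.leftLim χ x = 0 := by
      intro x hx
      have hmax : max x y₀ ∈ openInterval (c : EReal) S.b := by
        rcases max_choice x y₀ with h | h <;> rw [h]
        exacts [hx, ⟨hz.1.trans hy1, hy2⟩]
      obtain ⟨hI0, -, hIp, hMP⟩ := main χ hχ x hx _ hmax (le_max_left x y₀)
      have h0 : Function.rightLim χ (max x y₀) = 0 := rightLim_eq_zero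
        (EReal.coe_le_coe_iff.2 (hzy₀.le.trans (le_max_right x y₀))) hmax.2 (hv z hz hsing)
      have hb0 : ∀ w, S.bracket w 0 = 0 := fun w => form_zero_right _
      rw [h0, hb0, hb0, norm_zero] at hIp hMP
      rw [h0] at hI0
      have hI : S.height lam 0 - S.height lam (Function.leftLim χ x) = 0 :=
        le_antisymm (by simpa using hIp) hI0
      rw [hI] at hMP
      have b1 : S.bracket (Function.leftLim U x) (Function.leftLim χ x) = 0 := by
        rw [← norm_eq_zero, ← sq_eq_zero_iff]
        nlinarith [sq_nonneg ‖S.bracket (Function.leftLim U x) (Function.leftLim χ x)‖,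
          sq_nonneg ‖S.bracket (Function.leftLim V x) (Function.leftLim χ x)‖]
      have b2 : S.bracket (Function.leftLim V x) (Function.leftLim χ x) = 0 := by
        rw [← norm_eq_zero, ← sq_eq_zero_iff]
        nlinarith [sq_nonneg ‖S.bracket (Function.leftLim U x) (Function.leftLim χ x)‖,
          sq_nonneg ‖S.bracket (Function.leftLim V x) (Function.leftLim χ x)‖]
      have b3 : S.bracket (Function.leftLim χ x) (Function.leftLim V x) = 0 := by
        rw [hS.bracket_eq] at b2 ⊢
        linear_combination -b2
      have := hS.bracket_smul (Function.leftLim U x) (Function.leftLim V x) (Function.leftLim χ x)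
      rw [b1, b3, zero_smul, zero_smul, add_zero, (hKy x (hcc₀ hx)).1] at this
      exact (smul_eq_zero.1 this).resolve_left hj
    refine hχ0 (tendsto_nhds_unique (hχ.tendsto_sided_right hc hc.2 le_rfl).1 ?_)
    refine tendsto_const_nhds.congr' ?_
    filter_upwards [Ioo_mem_nhdsGT (EReal.coe_lt_coe_iff.1 hz.1)] with t ht
    exact (hleft t (Ioo_mem_openInterval_right hz ht)).symm
  · obtain ⟨x, hx1, hx2⟩ := EReal.lt_iff_exists_real_btwn.1 hc.2
    have hx : x ∈ openInterval (c : EReal) S.b := ⟨hx1, hx2⟩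
    refine hu.sqOn_of_bounded hc hc.2 le_rfl hl (M := S.height lam (Function.leftLim u x) + 6 * K *
      (‖S.bracket (Function.leftLim U x) (Function.leftLim u x)‖ ^ 2
        + ‖S.bracket (Function.leftLim V x) (Function.leftLim u x)‖ ^ 2)) fun y hy => ?_
    rcases le_total x y with hxy | hyx
    · linarith [(main u hu x hx y hy hxy).2.1]
    · have h1 := hu.height_right_mono hsub hl hy hx hyx
      linarith [(main u hu x hx x hx le_rfl).2.1]

lemma cut_ne_zero {c : ℝ} {hi : EReal} (hchi : (c : EReal) < hi) {u : ℝ → Fin 2 → ℂ}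
    (h : Function.rightLim u c ≠ 0) : cut c hi u ≠ 0 := fun h0 =>
  h (rightLim_eq_zero le_rfl hchi fun x hx => by rw [← cut_of_mem u hx, h0]; rfl)

/-- The limit-point case: the square-integrable solutions near `b` form a line. -/
lemma IsReal.limitPointAtB (hS : S.IsReal) (hC : ¬ S.CircleB) : S.LimitPointAtB := by
  intro c hc lam hl
  have hsub := openInterval_subset_right hc le_rfl
  obtain ⟨v, hv, hv0, hvn, -⟩ := hS.exists_nonpos_solution hc hc.2 le_rfl hl
  have hvs := hv.sqOn_of_bounded hc hc.2 le_rfl hl hvn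
  refine rank_eq_one_of_generator (hv.cut_mem hsub hvs) (cut_ne_zero hc.2 hv0) fun u hu => ?_
  have hus := sqOn_of_mem hsub hu
  obtain ⟨α, hα⟩ := hS.exists_smul_of_nonpos hc hc.2 le_rfl hl hu.2.1 hv hv0
    fun α β y hy => hS.height_nonpos hC hc hl (hv.comb hu.2.1 α β)
      (SqOn.add hsub (hv.smul_lam α) (hvs.smul α) (hu.2.1.smul_lam β) (hus.smul β)) hy
  refine ⟨α, funext fun x => ?_⟩
  by_cases hx : x ∈ openInterval (c : EReal) S.b
  · rw [Pi.smul_apply, cut_of_mem v hx, hα x hx]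
  · rw [Pi.smul_apply, cut_of_notMem v hx, hu.1 x hx, smul_zero]

/-- A traceless X is skew with respect to the bracket. The bracket of two vectors fixed by X
therefore equals its own negative, and ker(1 - X) is a line. -/
lemma IsReal.exists_smul_of_halfJump (hS : S.IsReal) {x : ℝ} (hx : x ∈ S.interval)
    {k z : Fin 2 → ℂ} (hk0 : k ≠ 0) (hk : S.halfJump lam x *ᵥ k = k)
    (hz : S.halfJump lam x *ᵥ z = z) : ∃ α : ℂ, z = α • k := by
  refine hS.exists_smul_of_bracket hk0 ?_
  have htr := hS.halfJump_trace hx lam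
  have e : S.bracket (S.halfJump lam x *ᵥ k) z = -S.bracket k (S.halfJump lam x *ᵥ z) := by
    rw [hS.bracket_eq, hS.bracket_eq]
    simp only [Matrix.mulVec, dotProduct, Fin.sum_univ_two, htr]
    ring
  rw [hk, hz] at e
  exact self_eq_neg.1 e

/-- The limit-circle case: the square-integrable solutions near `b` form a plane. -/
lemma IsReal.limitCircleAtB (hS : S.IsReal) (hC : S.CircleB) : S.LimitCircleAtB := by
  intro c hc lam hl
  obtain ⟨d, hd, hdC⟩ := hS.circle_all hC hl
  have hsub := openInterval_subset_right hc le_rfl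
  have hmax : ∀ x y, x ∈ S.interval → y ∈ S.interval → max x y ∈ S.interval := fun x y hx hy => by
    rcases max_choice x y with h | h <;> rw [h] <;> assumption
  have hall : ∀ u, S.Solves c S.b u (lam • u) → S.SqOn c S.b u := fun u hu =>
    hu.sqOn_extend hc (hmax c d hc hd) (le_max_left c d) hl
      ((hdC _ (hmax c d hc hd) (le_max_right c d)).2 u
        (hu.mono (openInterval_mono (EReal.coe_le_coe_iff.2 (le_max_left c d)) le_rfl)))
  by_cases hreg : ∀ x ∈ openInterval (c : EReal) S.b, S.Regular lam x
  · obtain ⟨u₁, h₁, i₁⟩ := exists_hom_right hc hc.2 le_rfl hreg ![1, 0]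
    obtain ⟨u₂, h₂, i₂⟩ := exists_hom_right hc hc.2 le_rfl hreg ![0, 1]
    refine rank_eq_two_of_generators (h₁.cut_mem hsub (hall u₁ h₁)) (h₂.cut_mem hsub (hall u₂ h₂))
      (fun α β h => ?_) fun u hu => ?_
    · rw [← cut_smul, ← cut_smul, ← cut_add] at h
      have h0 : Function.rightLim (α • u₁ + β • u₂) c = 0 := by
        by_contra hne
        exact cut_ne_zero hc.2 hne h
      rw [rightLim_comb_initial hc hc.2 le_rfl h₁ h₂, i₁, i₂] at h0
      exact ⟨by simpa using congrFun h0 0, by simpa using congrFun h0 1⟩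
    · obtain ⟨α, β, e⟩ := hS.exists_comb hc hc.2 le_rfl hreg h₁ h₂ hu.2.1
        (by rw [i₁, i₂, hS.bracket_eq]; simpa using hS.J01_ne)
      refine ⟨α, β, funext fun x => ?_⟩
      rw [← cut_smul, ← cut_smul, ← cut_add]
      by_cases hx : x ∈ openInterval (c : EReal) S.b
      · rw [cut_of_mem _ hx, e x hx]
      · rw [cut_of_notMem _ hx, hu.1 x hx]
  -- Beyond d all points are regular, so there is a last singular point z. The basis consists of v₁,
  -- which is zero up to z and starts there in ker(1 - X), and of v₂, which vanishes to the right of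
  -- z.
  · push Not at hreg
    obtain ⟨z₀, hz₀, hs₀⟩ := hreg
    obtain ⟨e, he1, he2⟩ := EReal.lt_iff_exists_real_btwn.1 (hmax z₀ d (hsub hz₀) hd).2
    rw [EReal.coe_lt_coe_iff, max_lt_iff] at he1
    have heI : e ∈ S.interval := ⟨hd.1.trans (EReal.coe_lt_coe_iff.2 he1.2), he2⟩
    obtain ⟨z, hz, hs, hzr⟩ := exists_last_singular heI he1.1 (hsub hz₀) hs₀
    have hzm : z ∈ openInterval (c : EReal) S.b :=
      ⟨hz₀.1.trans_le (EReal.coe_le_coe_iff.2 hz.1), (EReal.coe_lt_coe_iff.2 hz.2).trans he2⟩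
    have hzI := hsub hzm
    have hregz : ∀ x ∈ openInterval (z : EReal) S.b, S.Regular lam x := fun x hx => by
      rcases lt_or_ge x e with hxe | hxe
      · exact hzr x ⟨EReal.coe_lt_coe_iff.1 hx.1, hxe⟩
      · exact (hdC d hd le_rfl).1 x ⟨EReal.coe_lt_coe_iff.2 (he1.2.trans_le hxe), hx.2⟩
    obtain ⟨k, hk0, hk⟩ := hS.exists_ker_sub hzI hs
    obtain ⟨w, hw, iw⟩ := exists_hom_right hzI hzI.2 le_rfl hregz k
    have hv₁ := Solves.glue_zero_left hc.1.le hzm.1 hzm.2 le_rfl hw (by rw [iw, hk])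
    set v₁ := glueFun 0 w z with hv₁d
    have v₁l : ∀ x ∈ openInterval (c : EReal) (z : EReal), v₁ x = 0 := fun x hx =>
      glueFun_of_lt 0 w (EReal.coe_lt_coe_iff.1 hx.2)
    have v₁r : ∀ x ∈ openInterval (z : EReal) S.b, v₁ x = w x := fun x hx =>
      glueFun_of_gt 0 w (EReal.coe_lt_coe_iff.1 hx.1)
    have v₁z : Function.rightLim v₁ z = k := by
      rw [← iw]
      exact rightLim_eq_of_tendsto (rightLim_congr_right v₁r le_rfl hzI.2
        (hw.tendsto_right hzI hzI.2 le_rfl))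
    have v₁c : Function.rightLim v₁ c = 0 := rightLim_eq_zero le_rfl hzm.1 v₁l
    obtain ⟨v₂, hv₂, hv₂0, -, hv₂v⟩ := hS.exists_nonpos_solution hc hc.2 le_rfl hl
    have hv₂z := hv₂v z hzm hs
    refine rank_eq_two_of_generators (hv₁.cut_mem hsub (hall v₁ hv₁))
      (hv₂.cut_mem hsub (hall v₂ hv₂)) (fun α β h => ?_) fun u hu => ?_
    · rw [← cut_smul, ← cut_smul, ← cut_add] at h
      have h0 : Function.rightLim (α • v₁ + β • v₂) c = 0 := by
        by_contra hne
        exact cut_ne_zero hc.2 hne h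
      rw [rightLim_comb_initial hc hc.2 le_rfl hv₁ hv₂, v₁c, smul_zero, zero_add] at h0
      have hβ : β = 0 := (smul_eq_zero.1 h0).resolve_right hv₂0
      have h1 : Function.rightLim (α • v₁ + β • v₂) z = 0 := by
        refine rightLim_eq_zero le_rfl hzI.2 fun x hx => ?_
        rw [← cut_of_mem (α • v₁ + β • v₂) (openInterval_mono hzm.1.le le_rfl hx), h]
        rfl
      rw [rightLim_comb hv₁ hv₂ α β hzm, v₁z, hβ, zero_smul, add_zero] at h1
      exact ⟨(smul_eq_zero.1 h1).resolve_right hk0, hβ⟩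
    -- As u⁺(z) lies in the line ker(1 - X), subtracting a multiple of v₁ removes u to the right of
    -- z. What remains has nonpositive energy and is a multiple of v₂.
    · have hk' := hS.halfJump_right hsub hu.2.1 hzm hs
      obtain ⟨α, hα⟩ := hS.exists_smul_of_halfJump hzI hk0 hk hk'
      have hd := hu.2.1.comb hv₁ 1 (-α)
      have hd0 : ∀ x ∈ openInterval (z : EReal) S.b, ((1 : ℂ) • u + (-α) • v₁) x = 0 :=
        (hd.mono (openInterval_mono hzm.1.le le_rfl)).eq_zero_of_rightLim hzI le_rfl hregz (by
          rw [rightLim_comb hu.2.1 hv₁ _ _ hzm, v₁z, hα]; module)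
      obtain ⟨β, hβ⟩ := hS.exists_smul_of_nonpos hc hc.2 le_rfl hl hd hv₂ hv₂0
        fun p q y hy => (hv₂.comb hd p q).height_nonpos_of_vanish hc le_rfl hl hzm
          (fun x hx => by
            rw [Pi.add_apply, Pi.smul_apply, Pi.smul_apply, hd0 x hx, hv₂z x hx]; simp) hy
      refine ⟨α, β, funext fun x => ?_⟩
      rw [← cut_smul, ← cut_smul, ← cut_add]
      by_cases hx : x ∈ openInterval (c : EReal) S.b
      · rw [cut_of_mem _ hx]
        have := hβ x hx
        simp only [Pi.add_apply, Pi.smul_apply] at this ⊢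
        rw [← this]
        module
      · rw [cut_of_notMem _ hx, hu.1 x hx]

lemma exists_mem_interval {n : ℕ} (S : FirstOrderSystem n) : ∃ c, c ∈ S.interval := by
  obtain ⟨c, h1, h2⟩ := EReal.lt_iff_exists_real_btwn.1 S.a_lt_b
  exact ⟨c, h1, h2⟩

lemma limitPointAtB_not_limitCircleAtB (h : S.LimitPointAtB) : ¬ S.LimitCircleAtB := fun k => by
  obtain ⟨c, hc⟩ := S.exists_mem_interval
  have := (h c hc Complex.I (by simp)).symm.trans (k c hc Complex.I (by simp))
  norm_num at this

lemma IsReal.limitPointAtB_iff (hS : S.IsReal) : S.LimitPointAtB ↔ ¬ S.CircleB :=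
  ⟨fun h k => limitPointAtB_not_limitCircleAtB h (hS.limitCircleAtB k), hS.limitPointAtB⟩

lemma IsReal.limitPoint_or_limitCircleAtB (hS : S.IsReal) :
    S.LimitPointAtB ∨ S.LimitCircleAtB := by
  by_cases h : S.CircleB
  exacts [Or.inr (hS.limitCircleAtB h), Or.inl (hS.limitPointAtB h)]

end FirstOrderSystem

/-! ### The endpoint a by reflection; gluing at an interior point and the dimension formula -/

namespace FirstOrderSystem

section Reflection

variable {n : ℕ} {S : FirstOrderSystem n} {lam : ℂ}

lemma reflect_form (v u : Fin n → ℂ) : S.reflect.form v u = -S.form v u := by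
  simp [form, reflect, Matrix.neg_mulVec]

lemma reflect_height (z : Fin n → ℂ) : S.reflect.height lam z = -S.height lam z := by
  simp [height, reflect_form, neg_div]

lemma reflect_density (u v : ℝ → Fin n → ℂ) (x : ℝ) :
    S.reflect.density (fun t => u (-t)) (fun t => v (-t)) x = S.density u v (-x) := rfl

lemma mem_sqIntegrable_reflect {u : ℝ → Fin n → ℂ} :
    (fun x => u (-x)) ∈ S.reflect.sqIntegrable ↔ u ∈ S.sqIntegrable := by
  change AEStronglyMeasurable (fun x => u (-x)) S.reflect.ν ∧
    Integrable (S.reflect.density (fun x => u (-x)) (fun x => u (-x))) S.reflect.ν ↔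
    AEStronglyMeasurable u S.ν ∧ Integrable (S.density u u) S.ν
  have e : S.reflect.density (fun x => u (-x)) (fun x => u (-x)) = fun x => S.density u u (-x) :=
    rfl
  rw [reflect_ν, measurableEmbedding_neg_real.aestronglyMeasurable_map_iff, e,
    measurableEmbedding_neg_real.integrable_map_iff]
  simp [Function.comp_def]

lemma mem_sqSolutions_reflect {lo hi : EReal} (hsub : openInterval lo hi ⊆ S.interval)
    {u : ℝ → Fin n → ℂ} :
    (fun x => u (-x)) ∈ S.reflect.sqSolutions (-hi) (-lo) lam ↔ u ∈ S.sqSolutions lo hi lam := by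
  change ((∀ x, x ∉ openInterval (-hi) (-lo) → u (-x) = 0) ∧
    S.reflect.Solves (-hi) (-lo) (fun x => u (-x)) (lam • fun x => u (-x)) ∧
    (fun x => u (-x)) ∈ S.reflect.sqIntegrable) ↔
    ((∀ x, x ∉ openInterval lo hi → u x = 0) ∧ S.Solves lo hi u (lam • u) ∧ u ∈ S.sqIntegrable)
  rw [mem_sqIntegrable_reflect]
  refine and_congr ⟨fun h x hx => ?_, fun h x hx => ?_⟩ (and_congr ?_ Iff.rfl)
  · have := h (-x) (by rwa [mem_openInterval_neg, neg_neg])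
    rwa [neg_neg] at this
  · exact h _ (by rwa [mem_openInterval_neg] at hx)
  · exact solves_reflect_iff (f := lam • u) hsub

lemma rank_sqSolutions_reflect {lo hi : EReal} (hsub : openInterval lo hi ⊆ S.interval) :
    Module.rank ℂ (S.reflect.sqSolutions (-hi) (-lo) lam)
      = Module.rank ℂ (S.sqSolutions lo hi lam) := by
  let e := LinearEquiv.funCongrLeft ℂ (Fin n → ℂ) (Equiv.neg ℝ)
  have h : S.sqSolutions lo hi lam = (S.reflect.sqSolutions (-hi) (-lo) lam).map
      (e : (ℝ → Fin n → ℂ) →ₗ[ℂ] (ℝ → Fin n → ℂ)) := by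
    ext u
    rw [Submodule.mem_map_equiv, ← mem_sqSolutions_reflect hsub]
    rfl
  rw [h]
  exact (e.submoduleMap (S.reflect.sqSolutions (-hi) (-lo) lam)).rank_eq

lemma limitAtA_iff_reflect (k : Cardinal) :
    (∀ c : ℝ, c ∈ S.interval → ∀ lam : ℂ, lam.im ≠ 0 →
      Module.rank ℂ (S.sqSolutions S.a c lam) = k) ↔
    ∀ c : ℝ, c ∈ S.reflect.interval → ∀ lam : ℂ, lam.im ≠ 0 →
      Module.rank ℂ (S.reflect.sqSolutions c S.reflect.b lam) = k := by
  constructor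
  · intro h c hc lam hl
    have hc' := mem_reflect_interval.1 hc
    have := h (-c) hc' lam hl
    rw [← rank_sqSolutions_reflect (openInterval_subset_left hc' le_rfl), EReal.coe_neg, neg_neg]
      at this
    exact this
  · intro h c hc lam hl
    have := h (-c) (mem_reflect_interval.2 (by rwa [neg_neg])) lam hl
    rw [← rank_sqSolutions_reflect (openInterval_subset_left hc le_rfl), ← EReal.coe_neg]
    exact this

lemma limitPointAtA_iff_reflect : S.LimitPointAtA ↔ S.reflect.LimitPointAtB :=
  limitAtA_iff_reflect 1

lemma limitCircleAtA_iff_reflect : S.LimitCircleAtA ↔ S.reflect.LimitCircleAtB :=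
  limitAtA_iff_reflect 2

lemma leftLim_comp_neg {w : ℝ → Fin n → ℂ} {x : ℝ} {ξ : Fin n → ℂ}
    (h : Tendsto w (𝓝[>] (-x)) (𝓝 ξ)) : Function.leftLim (fun t => w (-t)) x = ξ :=
  leftLim_eq_of_tendsto (tendsto_comp_neg_left.2 h)

lemma rightLim_comp_neg {w : ℝ → Fin n → ℂ} {x : ℝ} {ξ : Fin n → ℂ}
    (h : Tendsto w (𝓝[<] (-x)) (𝓝 ξ)) : Function.rightLim (fun t => w (-t)) x = ξ :=
  rightLim_eq_of_tendsto (tendsto_comp_neg_right.2 h)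

end Reflection

variable {S : FirstOrderSystem 2} {lam : ℂ}

lemma IsReal.limitPoint_or_limitCircleAtA (hS : S.IsReal) :
    S.LimitPointAtA ∨ S.LimitCircleAtA := by
  rw [limitPointAtA_iff_reflect, limitCircleAtA_iff_reflect]
  exact hS.reflect.limitPoint_or_limitCircleAtB

lemma limitPointAtA_not_limitCircleAtA (h : S.LimitPointAtA) : ¬ S.LimitCircleAtA := by
  rw [limitPointAtA_iff_reflect] at h
  rw [limitCircleAtA_iff_reflect]
  exact limitPointAtB_not_limitCircleAtB h

/-- Near the left endpoint there is a nontrivial solution of nonnegative energy. -/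
lemma IsReal.exists_nonneg_solution (hS : S.IsReal) {c : ℝ} (hc : c ∈ S.interval)
    (hl : lam.im ≠ 0) :
    ∃ u, u ∈ S.sqSolutions S.a c lam ∧ Function.leftLim u c ≠ 0 ∧
      ∀ y ∈ openInterval S.a (c : EReal), 0 ≤ S.height lam (Function.leftLim u y) := by
  have hsub := openInterval_subset_left hc le_rfl
  have hc' : -c ∈ S.reflect.interval := mem_reflect_interval.2 (by rwa [neg_neg])
  have hsub' := openInterval_subset_right hc' le_rfl
  -- Reflection changes the sign of J and hence of the energy, so nonpositive energy near the right
  -- end turns into nonnegative energy near a.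
  obtain ⟨w, hw, hw0, hwn, -⟩ := hS.reflect.exists_nonpos_solution hc' hc'.2 le_rfl hl
  have hws := hw.sqOn_of_bounded hc' hc'.2 le_rfl hl hwn
  have hv := hw.cut_mem hsub' hws
  have hva : ∀ x ∈ openInterval ((-c : ℝ) : EReal) S.reflect.b,
    cut (-c : ℝ) S.reflect.b w x = w x := fun x hx => cut_of_mem w hx
  set v := cut (-c : ℝ) S.reflect.b w with hvdef
  refine ⟨fun x => v (-x), ?_, ?_, fun y hy => ?_⟩
  · rw [← mem_sqSolutions_reflect hsub]
    simp only [neg_neg]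
    rw [← EReal.coe_neg]
    exact hv
  · rw [leftLim_comp_neg (rightLim_congr_right hva le_rfl hc'.2
      (hw.tendsto_right hc' hc'.2 le_rfl))]
    exact hw0
  · have hy' : -y ∈ openInterval ((-c : ℝ) : EReal) S.reflect.b := by
      rw [EReal.coe_neg]
      exact mem_openInterval_neg.2 (by rwa [neg_neg])
    rw [leftLim_comp_neg (rightLim_congr_right hva hy'.1.le hy'.2
      (locallyBV_tendsto hw.balanced.1 hy').2)]
    have := hwn (-y) hy'
    rw [reflect_height] at this
    linarith

lemma IsReal.exists_nonpos_sqSolution (hS : S.IsReal) {c : ℝ} (hc : c ∈ S.interval)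
    (hl : lam.im ≠ 0) :
    ∃ u, u ∈ S.sqSolutions c S.b lam ∧ Function.rightLim u c ≠ 0 ∧
      ∀ y ∈ openInterval (c : EReal) S.b, S.height lam (Function.rightLim u y) ≤ 0 := by
  have hsub := openInterval_subset_right hc le_rfl
  obtain ⟨w, hw, hw0, hwn, -⟩ := hS.exists_nonpos_solution hc hc.2 le_rfl hl
  have hva : ∀ x ∈ openInterval (c : EReal) S.b, cut c S.b w x = w x := fun x hx => cut_of_mem w hx
  refine ⟨cut c S.b w, hw.cut_mem hsub (hw.sqOn_of_bounded hc hc.2 le_rfl hl hwn), ?_,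
    fun y hy => ?_⟩
  · rw [rightLim_eq_of_tendsto (rightLim_congr_right hva le_rfl hc.2
      (hw.tendsto_right hc hc.2 le_rfl))]
    exact hw0
  · rw [(sided_congr hw.balanced.1 hva hy).2]
    exact hwn y hy

section Decomposition

variable {n : ℕ} {S : FirstOrderSystem n}

lemma sqOn_glue {c : ℝ} (hc : c ∈ S.interval) {u v : ℝ → Fin n → ℂ} (hu : S.SqOn S.a c u)
    (hv : S.SqOn c S.b v) : S.SqOn S.a S.b (glueFun u v c) := by
  have h1 := SqOn.congr (v := glueFun u v c) hu
    fun x hx => glueFun_of_lt u v (EReal.coe_lt_coe_iff.1 hx.2)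
  have h2 := SqOn.congr (v := glueFun u v c) hv
    fun x hx => glueFun_of_gt u v (EReal.coe_lt_coe_iff.1 hx.1)
  have h3 : IntegrableOn (fun t => (S.density (glueFun u v c) (glueFun u v c) t).re) {c} S.μ :=
    integrableOn_singleton (hx := (measure_lt_top hc hc
      (singleton_subset_iff.2 (left_mem_Icc.2 le_rfl))))
  refine ((h1.union h2).union h3).mono_set fun x hx => ?_
  rcases lt_trichotomy x c with h | h | h
  · exact Or.inl (Or.inl ⟨hx.1, EReal.coe_lt_coe_iff.2 h⟩)
  · exact Or.inr h
  · exact Or.inl (Or.inr ⟨EReal.coe_lt_coe_iff.2 h, hx.2⟩)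

/-- Solutions to the left and to the right of `c` with matching limits give a solution. -/
lemma Solves.glue_lam {c : ℝ} (hc : c ∈ S.interval) {lam : ℂ} {u v : ℝ → Fin n → ℂ}
    (h : S.Solves S.a c u (lam • u)) (k : S.Solves c S.b v (lam • v))
    (hj : (1 - S.halfJump lam c) *ᵥ Function.rightLim v c
      = (1 + S.halfJump lam c) *ᵥ Function.leftLim u c) :
    S.Solves S.a S.b (glueFun u v c) (lam • glueFun u v c) := by
  have := Solves.glue (f := 0) (lam := lam) (u := u) (v := v) le_rfl hc.1 hc.2 le_rfl
    LocInt.zero (by rwa [add_zero]) (by rwa [add_zero]) (by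
      rw [rhs, glueFun_self]
      simp only [Pi.zero_apply, Matrix.mulVec_zero, add_zero]
      rw [Matrix.mulVec_smul, Matrix.mulVec_add]
      rw [Matrix.sub_mulVec, Matrix.add_mulVec, Matrix.one_mulVec, Matrix.one_mulVec, halfJump,
        Matrix.smul_mulVec, Matrix.smul_mulVec] at hj
      linear_combination (norm := module) hj)
  rwa [add_zero] at this

/-- Both sides are (1 - X)(1 + X)u(c). Written as a condition on the one-sided limits it makes sense
at singular points too, and by `Solves.glue_lam` it is sufficient for gluing. -/
lemma glue_condition {c : ℝ} (hc : c ∈ S.interval) {lam : ℂ} {u : ℝ → Fin n → ℂ}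
    (h : S.Solves S.a S.b u (lam • u)) :
    (1 - S.halfJump lam c) *ᵥ Function.rightLim u c
      = (1 + S.halfJump lam c) *ᵥ Function.leftLim u c := by
  rw [h.leftLim_eq_sub hc, h.rightLim_eq_add hc, Matrix.mulVec_mulVec, Matrix.mulVec_mulVec]
  congr 1
  noncomm_ring

/-- The defect of a pair of solutions to be the restrictions of a single solution. -/
def gluingDefect (S : FirstOrderSystem n) {c : ℝ} (hc : c ∈ S.interval) (lam : ℂ) :
    S.sqSolutions S.a c lam × S.sqSolutions c S.b lam →ₗ[ℂ] (Fin n → ℂ) where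
  toFun p := (1 - S.halfJump lam c) *ᵥ Function.rightLim p.2.1 c
    - (1 + S.halfJump lam c) *ᵥ Function.leftLim p.1.1 c
  map_add' p q := by
    have e1 : Function.rightLim (p.2.1 + q.2.1) c
        = Function.rightLim p.2.1 c + Function.rightLim q.2.1 c :=
      rightLim_eq_of_tendsto ((p.2.2.2.1.tendsto_right hc hc.2 le_rfl).add
        (q.2.2.2.1.tendsto_right hc hc.2 le_rfl))
    have e2 : Function.leftLim (p.1.1 + q.1.1) c
        = Function.leftLim p.1.1 c + Function.leftLim q.1.1 c :=
      leftLim_eq_of_tendsto ((p.1.2.2.1.tendsto_left hc hc.1 le_rfl).add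
        (q.1.2.2.1.tendsto_left hc hc.1 le_rfl))
    simp only [Prod.fst_add, Prod.snd_add, Submodule.coe_add]
    rw [e1, e2, Matrix.mulVec_add, Matrix.mulVec_add]
    abel
  map_smul' α p := by
    have e1 : Function.rightLim (α • p.2.1) c = α • Function.rightLim p.2.1 c :=
      rightLim_eq_of_tendsto ((p.2.2.2.1.tendsto_right hc hc.2 le_rfl).const_smul α)
    have e2 : Function.leftLim (α • p.1.1) c = α • Function.leftLim p.1.1 c :=
      leftLim_eq_of_tendsto ((p.1.2.2.1.tendsto_left hc hc.1 le_rfl).const_smul α)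
    simp only [Prod.smul_fst, Prod.smul_snd, Submodule.coe_smul, RingHom.id_apply]
    rw [e1, e2, Matrix.mulVec_smul, Matrix.mulVec_smul, smul_sub]

/-- The restrictions of a solution to both sides of `c`. -/
def restrictions (S : FirstOrderSystem n) {c : ℝ} (hc : c ∈ S.interval) (lam : ℂ) :
    S.sqSolutions S.a S.b lam →ₗ[ℂ] S.sqSolutions S.a c lam × S.sqSolutions c S.b lam where
  toFun u := (⟨cut S.a c u.1, Solves.cut_mem (openInterval_subset_left hc le_rfl)
      (u.2.2.1.mono (openInterval_subset_left hc le_rfl))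
      ((sqOn_of_mem le_rfl u.2).mono (openInterval_subset_left hc le_rfl))⟩,
    ⟨cut c S.b u.1, Solves.cut_mem (openInterval_subset_right hc le_rfl)
      (u.2.2.1.mono (openInterval_subset_right hc le_rfl))
      ((sqOn_of_mem le_rfl u.2).mono (openInterval_subset_right hc le_rfl))⟩)
  map_add' _ _ := Prod.ext (Subtype.ext (cut_add _ _ _ _)) (Subtype.ext (cut_add _ _ _ _))
  map_smul' _ _ := Prod.ext (Subtype.ext (cut_smul _ _ _ _)) (Subtype.ext (cut_smul _ _ _ _))

lemma restrictions_injective {c : ℝ} (hc : c ∈ S.interval) (lam : ℂ) :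
    Function.Injective (S.restrictions hc lam) := by
  rw [← LinearMap.ker_eq_bot, LinearMap.ker_eq_bot']
  intro u hu
  have h1 : cut S.a c u.1 = 0 := congrArg (fun p => p.1.1) hu
  have h2 : cut c S.b u.1 = 0 := congrArg (fun p => p.2.1) hu
  have l : ∀ x ∈ openInterval S.a (c : EReal), u.1 x = 0 := fun x hx => by
    rw [← cut_of_mem u.1 hx, h1]; rfl
  have r : ∀ x ∈ openInterval (c : EReal) S.b, u.1 x = 0 := fun x hx => by
    rw [← cut_of_mem u.1 hx, h2]; rfl
  refine Subtype.ext (funext fun x => ?_)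
  by_cases hx : x ∈ S.interval
  · rcases lt_trichotomy x c with h | h | h
    · exact l x ⟨hx.1, EReal.coe_lt_coe_iff.2 h⟩
    · subst h
      rw [u.2.2.1.balanced.2 x hc, leftLim_eq_zero hc.1 le_rfl l, rightLim_eq_zero le_rfl hc.2 r]
      simp
    · exact r x ⟨EReal.coe_lt_coe_iff.2 h, hx.2⟩
  · exact u.2.1 x hx

lemma range_restrictions {c : ℝ} (hc : c ∈ S.interval) (lam : ℂ) :
    LinearMap.range (S.restrictions hc lam) = LinearMap.ker (S.gluingDefect hc lam) := by
  ext p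
  rw [LinearMap.mem_range, LinearMap.mem_ker]
  constructor
  · rintro ⟨u, rfl⟩
    change (1 - S.halfJump lam c) *ᵥ Function.rightLim (cut c S.b u.1) c
      - (1 + S.halfJump lam c) *ᵥ Function.leftLim (cut S.a c u.1) c = 0
    have hb := locallyBV_tendsto u.2.2.1.balanced.1 hc
    rw [rightLim_eq_of_tendsto (rightLim_congr_right (fun x hx => cut_of_mem u.1 hx) le_rfl hc.2 hb.2),
      leftLim_eq_of_tendsto (leftLim_congr_left (fun x hx => cut_of_mem u.1 hx) hc.1 le_rfl hb.1),
      glue_condition hc u.2.2.1, sub_self]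
  · intro hp
    have hg := Solves.glue_lam hc p.1.2.2.1 p.2.2.2.1 (sub_eq_zero.1 hp)
    have hs := sqOn_glue hc (sqOn_of_mem (openInterval_subset_left hc le_rfl) p.1.2)
      (sqOn_of_mem (openInterval_subset_right hc le_rfl) p.2.2)
    refine ⟨⟨_, hg.cut_mem le_rfl hs⟩, Prod.ext (Subtype.ext (funext fun x => ?_))
      (Subtype.ext (funext fun x => ?_))⟩
    · change cut S.a c (cut S.a S.b (glueFun p.1.1 p.2.1 c)) x = p.1.1 x
      by_cases hx : x ∈ openInterval S.a (c : EReal)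
      · rw [cut_of_mem _ hx, cut_of_mem _ (openInterval_subset_left hc le_rfl hx),
          glueFun_of_lt _ _ (EReal.coe_lt_coe_iff.1 hx.2)]
      · rw [cut_of_notMem _ hx, p.1.2.1 x hx]
    · change cut c S.b (cut S.a S.b (glueFun p.1.1 p.2.1 c)) x = p.2.1 x
      by_cases hx : x ∈ openInterval (c : EReal) S.b
      · rw [cut_of_mem _ hx, cut_of_mem _ (openInterval_subset_right hc le_rfl hx),
          glueFun_of_gt _ _ (EReal.coe_lt_coe_iff.1 hx.1)]
      · rw [cut_of_notMem _ hx, p.2.2.1 x hx]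

end Decomposition

lemma exists_right_gt {x c : ℝ} (hx : x ∈ S.interval) (hc : c ∈ S.interval) :
    ∃ y ∈ S.interval, x ≤ y ∧ c < y := by
  obtain ⟨d, hd1, hd2⟩ := EReal.lt_iff_exists_real_btwn.1 hc.2
  rcases max_choice x d with h | h
  · exact ⟨x, hx, le_rfl, (EReal.coe_lt_coe_iff.1 hd1).trans_le (max_eq_left_iff.1 h)⟩
  · exact ⟨d, ⟨hc.1.trans hd1, hd2⟩, max_eq_right_iff.1 h, EReal.coe_lt_coe_iff.1 hd1⟩

lemma exists_left_lt {x c : ℝ} (hx : x ∈ S.interval) (hc : c ∈ S.interval) :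
    ∃ y ∈ S.interval, y ≤ x ∧ y < c := by
  obtain ⟨d, hd1, hd2⟩ := EReal.lt_iff_exists_real_btwn.1 hc.1
  rcases min_choice x d with h | h
  · exact ⟨x, hx, le_rfl, (min_eq_left_iff.1 h).trans_lt (EReal.coe_lt_coe_iff.1 hd2)⟩
  · exact ⟨d, ⟨hd1, hd2.trans hc.2⟩, min_eq_right_iff.1 h, EReal.coe_lt_coe_iff.1 hd2⟩

/-- Take u near a of nonnegative and v near b of nonpositive energy. If their contributions were
dependent, multiples of u and v would glue to a solution on (a, b) whose increasing energy is at
least 0 near a and at most 0 near b. Then w annihilates it and definiteness makes it zero. Two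
independent vectors span ℂ². -/
lemma IsReal.gluingDefect_surjective (hS : S.IsReal) (hdef : S.Definite) {c : ℝ}
    (hc : c ∈ S.interval) (hl : lam.im ≠ 0) :
    Function.Surjective (S.gluingDefect hc lam) := by
  obtain ⟨u, hu, hu0, hun⟩ := hS.exists_nonneg_solution hc hl
  obtain ⟨v, hv, hv0, hvn⟩ := hS.exists_nonpos_sqSolution hc hl
  have hsubl := openInterval_subset_left hc (le_refl S.a)
  have hsubr := openInterval_subset_right hc (le_refl S.b)
  have key : ∀ α β : ℂ, (1 - S.halfJump lam c) *ᵥ (α • Function.rightLim v c)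
      = (1 + S.halfJump lam c) *ᵥ (β • Function.leftLim u c) → α = 0 ∧ β = 0 := by
    intro α β h
    have hu' := hu.2.1.smul_lam β
    have hv' := hv.2.1.smul_lam α
    have tu := (hu.2.1.tendsto_left hc hc.1 le_rfl).const_smul β
    have tv := (hv.2.1.tendsto_right hc hc.2 le_rfl).const_smul α
    have lu : Function.leftLim (β • u) c = β • Function.leftLim u c := leftLim_eq_of_tendsto tu
    have rv : Function.rightLim (α • v) c = α • Function.rightLim v c := rightLim_eq_of_tendsto tv
    have hg := Solves.glue_lam hc hu' hv' (by rw [lu, rv, h])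
    set χ := glueFun (β • u) (α • v) c with hχ
    have χl : ∀ x ∈ openInterval S.a (c : EReal), χ x = (β • u) x := fun x hx =>
      glueFun_of_lt _ _ (EReal.coe_lt_coe_iff.1 hx.2)
    have χr : ∀ x ∈ openInterval (c : EReal) S.b, χ x = (α • v) x := fun x hx =>
      glueFun_of_gt _ _ (EReal.coe_lt_coe_iff.1 hx.1)
    have hz := hg.ae_eq_zero S.a_lt_b le_rfl hl fun x hx y hy hxy => by
      -- The points are moved away to the two sides of c, where the glued function is a multiple of
      -- u and of v and the signs of the energies are known.
      obtain ⟨x', hx', hxx, hxc⟩ := exists_left_lt hx hc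
      obtain ⟨y', hy', hyy, hcy⟩ := exists_right_gt hy hc
      have hx'm : x' ∈ openInterval S.a (c : EReal) := ⟨hx'.1, EReal.coe_lt_coe_iff.2 hxc⟩
      have hy'm : y' ∈ openInterval (c : EReal) S.b := ⟨EReal.coe_lt_coe_iff.2 hcy, hy'.2⟩
      have h1 := hg.height_right_mono le_rfl hl hy hy' hyy
      have h2 := hg.height_left_mono le_rfl hl hx' hx hxx
      rw [(sided_congr hv'.balanced.1 χr hy'm).2, rightLim_smul_of_BV α hv.2.1.balanced.1 hy'm,
        height_smul] at h1
      rw [(sided_congr hu'.balanced.1 χl hx'm).1, leftLim_smul_of_BV β hu.2.1.balanced.1 hx'm,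
        height_smul] at h2
      have h3 := mul_nonneg (sq_nonneg ‖β‖) (hun x' hx'm)
      have h4 := mul_nonpos_of_nonneg_of_nonpos (sq_nonneg ‖α‖) (hvn y' hy'm)
      linarith
    have hχ0 := hdef χ hz.2 hz.1
    constructor
    · have : Function.rightLim (α • v) c = 0 :=
        rightLim_eq_zero le_rfl hc.2 fun x hx => by rw [← χr x hx, hχ0 x (hsubr hx)]
      rw [rv] at this
      exact (smul_eq_zero.1 this).resolve_right hv0
    · have : Function.leftLim (β • u) c = 0 :=
        leftLim_eq_zero hc.1 le_rfl fun x hx => by rw [← χl x hx, hχ0 x (hsubl hx)]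
      rw [lu] at this
      exact (smul_eq_zero.1 this).resolve_right hu0
  set p := (1 - S.halfJump lam c) *ᵥ Function.rightLim v c with hp
  set q := (1 + S.halfJump lam c) *ᵥ Function.leftLim u c with hq
  simp only [Matrix.mulVec_smul, ← hp, ← hq] at key
  have hp0 : p ≠ 0 := fun h0 => one_ne_zero (key 1 0 (by rw [h0]; simp)).1
  have hb : S.bracket p q ≠ 0 := fun h0 => by
    obtain ⟨γ, hγ⟩ := hS.exists_smul_of_bracket hp0 h0
    exact one_ne_zero (key γ 1 (by rw [hγ, one_smul])).2
  intro z
  have e := hS.bracket_smul p q z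
  refine ⟨((-((S.bracket p q)⁻¹ * S.bracket p z)) • ⟨u, hu⟩,
    ((S.bracket p q)⁻¹ * S.bracket z q) • ⟨v, hv⟩), ?_⟩
  have e1 : S.gluingDefect hc lam (⟨u, hu⟩, 0) = -q := by
    change (1 - S.halfJump lam c) *ᵥ Function.rightLim (0 : ℝ → Fin 2 → ℂ) c - q = -q
    rw [rightLim_zero_fun, Matrix.mulVec_zero, zero_sub]
  have e2 : S.gluingDefect hc lam (0, ⟨v, hv⟩) = p := by
    change p - (1 + S.halfJump lam c) *ᵥ Function.leftLim (0 : ℝ → Fin 2 → ℂ) c = p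
    rw [leftLim_zero_fun, Matrix.mulVec_zero, sub_zero]
  have e3 : ∀ (α β : ℂ) (x : S.sqSolutions S.a c lam) (y : S.sqSolutions c S.b lam),
      (α • x, β • y) = α • (x, (0 : S.sqSolutions c S.b lam))
        + β • ((0 : S.sqSolutions S.a c lam), y) := fun α β x y => by
    simp
  rw [e3, map_add, map_smul, map_smul, e1, e2]
  have e' := congrArg ((S.bracket p q)⁻¹ • ·) e
  simp only [smul_smul, inv_mul_cancel₀ hb, one_smul, smul_add] at e'
  linear_combination (norm := module) -e'

/-- The dimension formula for the square-integrable solutions on the whole interval. -/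
lemma IsReal.rank_add_two (hS : S.IsReal) (hdef : S.Definite) {c : ℝ}
    (hc : c ∈ S.interval) (hl : lam.im ≠ 0) :
    2 + Module.rank ℂ (S.sqSolutions S.a S.b lam)
      = Module.rank ℂ (S.sqSolutions S.a c lam) + Module.rank ℂ (S.sqSolutions c S.b lam) := by
  have h1 := (S.gluingDefect hc lam).rank_range_add_rank_ker
  rw [rank_prod', LinearMap.range_eq_top.2 (hS.gluingDefect_surjective hdef hc hl), rank_top,
    ← range_restrictions, rank_range_of_injective _ (restrictions_injective hc lam)] at h1
  rw [← h1]
  simp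

end FirstOrderSystem

/-! ### Deficiency spaces as spaces of square-integrable solutions -/

namespace FirstOrderSystem

section Classes

variable {n : ℕ} {S : FirstOrderSystem n}

/-- The element of `𝓛²(w)` with a given underlying function. -/
def PreL2.of (u : ℝ → Fin n → ℂ) (hu : u ∈ S.sqIntegrable) : S.PreL2 := ⟨u, hu⟩

lemma PreL2.norm_eq_zero_iff (f : S.PreL2) : ‖f‖ = 0 ↔ ∀ᵐ x ∂S.ν, S.W x *ᵥ f.fn x = 0 := by
  have h1 : ‖f‖ ^ 2 = ∫ x, (S.density f.fn f.fn x).re ∂S.ν := by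
    rw [← inner_self_eq_norm_sq (𝕜 := ℂ)]
    exact (integral_re f.2.2).symm
  have hnn : 0 ≤ᵐ[S.ν] fun x => (S.density f.fn f.fn x).re := by
    filter_upwards [S.ae_mem] with x hx using density_self_re_nonneg _ hx
  rw [← sq_eq_zero_iff, h1, integral_eq_zero_iff_of_nonneg_ae hnn (Integrable.re f.2.2)]
  constructor
  · intro h
    filter_upwards [h, S.ae_mem] with x h1 h2
    refine mulVec_eq_zero_of_density h2 ?_
    rw [density_self_re _ h2]
    exact congrArg _ h1
  · intro h
    filter_upwards [h] with x h1
    simp [density, h1]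

lemma PreL2.mk_eq_mk_iff (f g : S.PreL2) :
    (SeparationQuotient.mk f : S.L2) = SeparationQuotient.mk g ↔
      ∀ᵐ x ∂S.ν, S.W x *ᵥ f.fn x = S.W x *ᵥ g.fn x := by
  rw [SeparationQuotient.mk_eq_mk, Metric.inseparable_iff, dist_eq_norm, PreL2.norm_eq_zero_iff]
  refine eventually_congr (Eventually.of_forall fun x => ?_)
  change S.W x *ᵥ (f.fn x - g.fn x) = 0 ↔ _
  rw [Matrix.mulVec_sub, sub_eq_zero]

lemma PreL2.mk_eq_zero_iff (f : S.PreL2) :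
    (SeparationQuotient.mk f : S.L2) = 0 ↔ ∀ᵐ x ∂S.ν, S.W x *ᵥ f.fn x = 0 := by
  have := PreL2.mk_eq_mk_iff f 0
  have e : (0 : S.PreL2).fn = 0 := rfl
  simpa only [SeparationQuotient.mk_zero, e, Pi.zero_apply, Matrix.mulVec_zero] using this

lemma mem_Tmax_iff {x : S.L2 × S.L2} : x ∈ S.Tmax ↔
    ∃ u f : S.PreL2, S.Solves S.a S.b u.fn f.fn ∧
      x = (SeparationQuotient.mk u, SeparationQuotient.mk f) := by
  constructor
  · rintro ⟨⟨u, f⟩, h, rfl⟩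
    exact ⟨u, f, h, rfl⟩
  · rintro ⟨u, f, h, rfl⟩
    exact ⟨(u, f), h, rfl⟩

lemma mem_deficiencySpace {lam : ℂ} {x : S.L2 × S.L2} :
    x ∈ S.deficiencySpace lam ↔ x ∈ S.Tmax ∧ x.2 = lam • x.1 := Iff.rfl

/-- The map `u ↦ ([u], lam [u])`. -/
def toDeficiency (S : FirstOrderSystem n) (lam : ℂ) :
    S.sqSolutions S.a S.b lam →ₗ[ℂ] S.L2 × S.L2 where
  toFun u := (SeparationQuotient.mk (PreL2.of u.1 u.2.2.2),
    lam • SeparationQuotient.mk (PreL2.of u.1 u.2.2.2))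
  map_add' u v := by
    rw [Prod.mk_add_mk, ← smul_add]
    rfl
  map_smul' c u := by
    rw [RingHom.id_apply, Prod.smul_mk, smul_comm c lam]
    rfl

/-- If the class of u is zero then wu = 0 almost everywhere, so the right-hand side λwu vanishes as
well and the definiteness condition applies. -/
lemma toDeficiency_injective (hdef : S.Definite) (lam : ℂ) :
    Function.Injective (S.toDeficiency lam) := by
  rw [← LinearMap.ker_eq_bot, LinearMap.ker_eq_bot']
  intro u hu
  have h1 := (PreL2.mk_eq_zero_iff _).1 (congrArg Prod.fst hu)
  change ∀ᵐ x ∂S.ν, S.W x *ᵥ u.1 x = 0 at h1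
  have h2 : S.Solves S.a S.b u.1 0 := u.2.2.1.congr_ae (by
    filter_upwards [h1] with x hx
    rw [Pi.smul_apply, Matrix.mulVec_smul, hx]
    simp)
  refine Subtype.ext (funext fun x => ?_)
  by_cases hx : x ∈ S.interval
  · exact hdef _ h2 h1 x hx
  · exact u.2.1 x hx

/-- From [f] = λ[u] one has wf = λwu almost everywhere, so the representative u solves the equation
with right-hand side λwu. Cutting off outside (a, b) does not change its class. -/
lemma range_toDeficiency (lam : ℂ) :
    LinearMap.range (S.toDeficiency lam) = S.deficiencySpace lam := by
  ext x
  rw [LinearMap.mem_range, mem_deficiencySpace]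
  constructor
  · rintro ⟨u, rfl⟩
    refine ⟨mem_Tmax_iff.2 ⟨PreL2.of u.1 u.2.2.2, lam • PreL2.of u.1 u.2.2.2, u.2.2.1, rfl⟩, rfl⟩
  · rintro ⟨hx, h2⟩
    obtain ⟨u, f, hs, rfl⟩ := mem_Tmax_iff.1 hx
    have h3 : ∀ᵐ x ∂S.ν, S.W x *ᵥ f.fn x = S.W x *ᵥ (lam • u.fn) x :=
      (PreL2.mk_eq_mk_iff f (lam • u)).1 h2
    have hu : S.Solves S.a S.b u.fn (lam • u.fn) := hs.congr_ae (by
      filter_upwards [h3] with x hx using hx.symm)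
    have hsq : S.SqOn S.a S.b u.fn := Integrable.re u.2.2
    have hm := hu.cut_mem le_rfl hsq
    have hmi : cut S.a S.b u.fn ∈ S.sqIntegrable := hm.2.2
    have e : (SeparationQuotient.mk (PreL2.of (cut S.a S.b u.fn) hmi) : S.L2)
        = SeparationQuotient.mk u := by
      rw [PreL2.mk_eq_mk_iff]
      filter_upwards [S.ae_mem] with x hx
      congr 1
      exact cut_of_mem u.fn hx
    refine ⟨⟨_, hm⟩, Prod.ext e ?_⟩
    change lam • SeparationQuotient.mk (PreL2.of (cut S.a S.b u.fn) hmi) = _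
    rw [e]
    exact h2.symm

lemma rank_deficiencySpace (hdef : S.Definite) (lam : ℂ) :
    Module.rank ℂ (S.deficiencySpace lam) = Module.rank ℂ (S.sqSolutions S.a S.b lam) := by
  rw [← range_toDeficiency, rank_range_of_injective _ (toDeficiency_injective hdef lam)]

end Classes

section Indices

variable {S : FirstOrderSystem 2} {lam : ℂ}

lemma IsReal.two_add_rank (hS : S.IsReal) (hdef : S.Definite) (hl : lam.im ≠ 0) {k l : Cardinal}
    (ha : ∀ c : ℝ, c ∈ S.interval → ∀ lam : ℂ, lam.im ≠ 0 →
      Module.rank ℂ (S.sqSolutions S.a c lam) = k)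
    (hb : ∀ c : ℝ, c ∈ S.interval → ∀ lam : ℂ, lam.im ≠ 0 →
      Module.rank ℂ (S.sqSolutions c S.b lam) = l) :
    2 + Module.rank ℂ (S.deficiencySpace lam) = k + l := by
  obtain ⟨c, hc⟩ := S.exists_mem_interval
  rw [rank_deficiencySpace hdef, hS.rank_add_two hdef hc hl, ha c hc lam hl, hb c hc lam hl]

lemma IsReal.rank_point_point (hS : S.IsReal) (hdef : S.Definite) (hl : lam.im ≠ 0)
    (ha : S.LimitPointAtA) (hb : S.LimitPointAtB) :
    Module.rank ℂ (S.deficiencySpace lam) = 0 := by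
  have h := hS.two_add_rank hdef hl ha hb
  rw [one_add_one_eq_two] at h
  exact Cardinal.eq_of_add_eq_add_left (a := 2) (by rw [h, add_zero])
    Cardinal.natCast_lt_aleph0

lemma IsReal.rank_circle_point (hS : S.IsReal) (hdef : S.Definite) (hl : lam.im ≠ 0)
    (h : (S.LimitCircleAtA ∧ S.LimitPointAtB) ∨ (S.LimitPointAtA ∧ S.LimitCircleAtB)) :
    Module.rank ℂ (S.deficiencySpace lam) = 1 := by
  refine Cardinal.eq_of_add_eq_add_left (a := 2) ?_ Cardinal.natCast_lt_aleph0
  rcases h with ⟨ha, hb⟩ | ⟨ha, hb⟩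
  · exact hS.two_add_rank hdef hl ha hb
  · rw [hS.two_add_rank hdef hl ha hb, add_comm]

lemma IsReal.rank_circle_circle (hS : S.IsReal) (hdef : S.Definite) (hl : lam.im ≠ 0)
    (ha : S.LimitCircleAtA) (hb : S.LimitCircleAtB) :
    Module.rank ℂ (S.deficiencySpace lam) = 2 :=
  Cardinal.eq_of_add_eq_add_left (a := 2) (hS.two_add_rank hdef hl ha hb)
    Cardinal.natCast_lt_aleph0

/-- The deficiency indices in terms of the classification of the endpoints. -/
lemma IsReal.indices (hS : S.IsReal) (hdef : S.Definite) :
    ((S.nPlus = 0 ∧ S.nMinus = 0) ↔ (S.LimitPointAtA ∧ S.LimitPointAtB)) ∧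
    ((S.nPlus = 1 ∧ S.nMinus = 1) ↔
      ((S.LimitCircleAtA ∧ S.LimitPointAtB) ∨ (S.LimitPointAtA ∧ S.LimitCircleAtB))) ∧
    ((S.nPlus = 2 ∧ S.nMinus = 2) ↔ (S.LimitCircleAtA ∧ S.LimitCircleAtB)) := by
  have hi : (Complex.I).im ≠ 0 := by simp
  have hi' : (-Complex.I).im ≠ 0 := by simp
  have na : S.LimitPointAtA → ¬ S.LimitCircleAtA := limitPointAtA_not_limitCircleAtA
  have nb : S.LimitPointAtB → ¬ S.LimitCircleAtB := limitPointAtB_not_limitCircleAtB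
  have e0 : S.LimitPointAtA ∧ S.LimitPointAtB → S.nPlus = 0 ∧ S.nMinus = 0 := fun h =>
    ⟨hS.rank_point_point hdef hi h.1 h.2, hS.rank_point_point hdef hi' h.1 h.2⟩
  have e1 : (S.LimitCircleAtA ∧ S.LimitPointAtB) ∨ (S.LimitPointAtA ∧ S.LimitCircleAtB) →
      S.nPlus = 1 ∧ S.nMinus = 1 := fun h =>
    ⟨hS.rank_circle_point hdef hi h, hS.rank_circle_point hdef hi' h⟩
  have e2 : S.LimitCircleAtA ∧ S.LimitCircleAtB → S.nPlus = 2 ∧ S.nMinus = 2 := fun h =>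
    ⟨hS.rank_circle_circle hdef hi h.1 h.2, hS.rank_circle_circle hdef hi' h.1 h.2⟩
  have c01 : (0 : Cardinal) ≠ 1 := by norm_num
  have c02 : (0 : Cardinal) ≠ 2 := by norm_num
  have c12 : (1 : Cardinal) ≠ 2 := by norm_num
  have ab := hS.limitPoint_or_limitCircleAtA
  have bb := hS.limitPoint_or_limitCircleAtB
  refine ⟨⟨fun h => ?_, e0⟩, ⟨fun h => ?_, e1⟩, ⟨fun h => ?_, e2⟩⟩ <;>
    rcases ab with ha | ha <;> rcases bb with hb | hb
  · exact ⟨ha, hb⟩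
  · exact absurd (h.1.symm.trans (e1 (Or.inr ⟨ha, hb⟩)).1) c01
  · exact absurd (h.1.symm.trans (e1 (Or.inl ⟨ha, hb⟩)).1) c01
  · exact absurd (h.1.symm.trans (e2 ⟨ha, hb⟩).1) c02
  · exact absurd ((e0 ⟨ha, hb⟩).1.symm.trans h.1) c01
  · exact Or.inr ⟨ha, hb⟩
  · exact Or.inl ⟨ha, hb⟩
  · exact absurd (h.1.symm.trans (e2 ⟨ha, hb⟩).1) c12
  · exact absurd ((e0 ⟨ha, hb⟩).1.symm.trans h.1) c02
  · exact absurd ((e1 (Or.inr ⟨ha, hb⟩)).1.symm.trans h.1) c12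
  · exact absurd ((e1 (Or.inl ⟨ha, hb⟩)).1.symm.trans h.1) c12
  · exact ⟨ha, hb⟩

end Indices

end FirstOrderSystem

/-! ### Completeness of the space of square-integrable functions -/

/-- The upper triangular Cholesky factor of a non-negative matrix of size two. -/
def choleskyFactor (M : Matrix (Fin 2) (Fin 2) ℂ) : Matrix (Fin 2) (Fin 2) ℂ :=
  -- In a non-negative matrix a vanishing corner entry forces the neighbouring entry to vanish, and
  -- x / 0 = 0 then gives the right factor. The explicit formula makes measurability in M evident.
  !![(√(M 0 0).re : ℂ), M 0 1 / (√(M 0 0).re : ℂ);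
    0, (√((M 1 1).re - ‖M 0 1‖ ^ 2 / (M 0 0).re) : ℂ)]

/-- A generalised inverse of the Cholesky factor. -/
def choleskyInverse (M : Matrix (Fin 2) (Fin 2) ℂ) : Matrix (Fin 2) (Fin 2) ℂ :=
  !![(choleskyFactor M 0 0)⁻¹,
      -(choleskyFactor M 0 0)⁻¹ * choleskyFactor M 0 1 * (choleskyFactor M 1 1)⁻¹;
    0, (choleskyFactor M 1 1)⁻¹]

/-- With 0⁻¹ = 0 the product of factor and inverse is diagonal with entries 1 or 0, and an entry is
0 only where the corresponding row of the factor is 0. -/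
lemma choleskyFactor_mul_inverse_mul (M : Matrix (Fin 2) (Fin 2) ℂ) :
    choleskyFactor M * choleskyInverse M * choleskyFactor M = choleskyFactor M := by
  have h0 : choleskyFactor M 0 0 = 0 → choleskyFactor M 0 1 = 0 := by
    intro h
    have h' : (√(M 0 0).re : ℂ) = 0 := h
    change M 0 1 / (√(M 0 0).re : ℂ) = 0
    rw [h', div_zero]
  have h10 : choleskyFactor M 1 0 = 0 := rfl
  rw [choleskyInverse]
  set R := choleskyFactor M
  have e : R * !![(R 0 0)⁻¹, -(R 0 0)⁻¹ * R 0 1 * (R 1 1)⁻¹; 0, (R 1 1)⁻¹] =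
      !![R 0 0 * (R 0 0)⁻¹, 0; 0, R 1 1 * (R 1 1)⁻¹] := by
    ext i j
    fin_cases i <;> fin_cases j <;> simp [Matrix.mul_apply, Fin.sum_univ_two, h10]
    by_cases h : R 0 0 = 0
    · simp [h0 h]
    · field_simp
      ring
  rw [e]
  ext i j
  fin_cases i <;> fin_cases j <;> simp [Matrix.mul_apply, Fin.sum_univ_two, h10]
  by_cases h : R 0 0 = 0
  · simp [h0 h]
  · simp [h]

/-- The number under the second root is nonnegative because the determinant is. The determinant also
forces M₀₁ = 0 when M₀₀ = 0, the case in which the quotients degenerate. -/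
lemma Matrix.PosSemidef.choleskyFactor {M : Matrix (Fin 2) (Fin 2) ℂ} (hM : M.PosSemidef) :
    (choleskyFactor M)ᴴ * _root_.choleskyFactor M = M := by
  have h00 : 0 ≤ M 0 0 := hM.diag_nonneg
  have h11 : 0 ≤ M 1 1 := hM.diag_nonneg
  have h10 : M 1 0 = star (M 0 1) := (hM.isHermitian.apply 1 0).symm
  have e00 : M 0 0 = ((M 0 0).re : ℂ) := Complex.eq_re_of_ofReal_le h00
  have e11 : M 1 1 = ((M 1 1).re : ℂ) := Complex.eq_re_of_ofReal_le h11
  have r00 : 0 ≤ (M 0 0).re := (Complex.le_def.1 h00).1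
  have hd : ‖M 0 1‖ ^ 2 ≤ (M 0 0).re * (M 1 1).re := by
    have h := hM.det_nonneg
    rw [Matrix.det_fin_two, h10, Complex.star_def, Complex.mul_conj, e00, e11,
      Complex.normSq_eq_norm_sq] at h
    have h' := (Complex.le_def.1 h).1
    simp only [← Complex.ofReal_mul, ← Complex.ofReal_sub, Complex.ofReal_re,
      Complex.zero_re] at h'
    linarith
  have hs : 0 ≤ (M 1 1).re - ‖M 0 1‖ ^ 2 / (M 0 0).re := by
    rcases r00.eq_or_lt with h | h
    · rw [← h, div_zero, sub_zero]
      exact (Complex.le_def.1 h11).1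
    · rw [sub_nonneg, div_le_iff₀ h]
      linarith
  have hz : (M 0 0).re = 0 → M 0 1 = 0 := fun h => by
    rw [h, zero_mul] at hd
    exact norm_eq_zero.1 (pow_eq_zero_iff two_ne_zero |>.1 (le_antisymm hd (sq_nonneg _)))
  have sq0 : (√(M 0 0).re : ℂ) * (√(M 0 0).re : ℂ) = ((M 0 0).re : ℂ) := by
    rw [← Complex.ofReal_mul, Real.mul_self_sqrt r00]
  have sq1 : (√((M 1 1).re - ‖M 0 1‖ ^ 2 / (M 0 0).re) : ℂ)
      * (√((M 1 1).re - ‖M 0 1‖ ^ 2 / (M 0 0).re) : ℂ)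
      = (M 1 1).re - (‖M 0 1‖ : ℂ) ^ 2 / (M 0 0).re := by
    rw [← Complex.ofReal_mul, Real.mul_self_sqrt hs]
    push_cast
    rfl
  have hr : (M 0 0).re ≠ 0 → (√(M 0 0).re : ℂ) ≠ 0 := fun h =>
    Complex.ofReal_ne_zero.2 (Real.sqrt_ne_zero'.2 (lt_of_le_of_ne r00 (Ne.symm h)))
  have hn : star (M 0 1) * M 0 1 = (‖M 0 1‖ : ℂ) ^ 2 := by
    rw [mul_comm, Complex.star_def, Complex.mul_conj, Complex.normSq_eq_norm_sq]
    push_cast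
    rfl
  ext i j
  fin_cases i <;> fin_cases j <;>
    simp only [_root_.choleskyFactor, Matrix.mul_apply, Fin.sum_univ_two, Matrix.conjTranspose_apply,
      Fin.zero_eta, Fin.mk_one, Fin.isValue, Matrix.of_apply, Matrix.cons_val', Matrix.cons_val_zero,
      Matrix.cons_val_one, Matrix.cons_val_fin_one, zero_mul, mul_zero, add_zero,
      Complex.star_def, map_zero, map_div₀, Complex.conj_ofReal]
  · rw [sq0, ← e00]
  · by_cases h : (M 0 0).re = 0
    · simp [hz h]
    · exact mul_div_cancel₀ _ (hr h)
  · rw [h10]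
    by_cases h : (M 0 0).re = 0
    · simp [hz h]
    · exact div_mul_cancel₀ _ (hr h)
  · rw [sq1, div_mul_div_comm, sq0, ← Complex.star_def, hn, e11]
    simp

namespace FirstOrderSystem

variable {S : FirstOrderSystem 2}

/-- The function `R f` for the Cholesky factor `R` of `W`. -/
def whiten (S : FirstOrderSystem 2) (f : ℝ → Fin 2 → ℂ) (x : ℝ) : EuclideanSpace ℂ (Fin 2) :=
  WithLp.toLp 2 (choleskyFactor (S.W x) *ᵥ f x)

lemma inner_whiten (f g : ℝ → Fin 2 → ℂ) {x : ℝ} (hx : x ∈ S.interval) :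
    inner ℂ (S.whiten f x) (S.whiten g x) = S.density f g x := by
  rw [whiten, whiten, EuclideanSpace.inner_toLp_toLp, density]
  conv_rhs => rw [← (S.W_nonneg x hx).choleskyFactor]
  rw [← Matrix.mulVec_mulVec, Matrix.dotProduct_mulVec, ← Matrix.star_mulVec, dotProduct_comm]

lemma aestronglyMeasurable_W (S : FirstOrderSystem 2) (j k : Fin 2) :
    AEStronglyMeasurable (fun x => S.W x j k) S.ν :=
  (S.W_locallyIntegrable j k).aestronglyMeasurable

lemma aestronglyMeasurable_choleskyFactor (S : FirstOrderSystem 2) (j k : Fin 2) :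
    AEStronglyMeasurable (fun x => choleskyFactor (S.W x) j k) S.ν := by
  have hre : ∀ j k, AEMeasurable (fun x => (S.W x j k).re) S.ν := fun j k =>
    Complex.measurable_re.comp_aemeasurable (S.aestronglyMeasurable_W j k).aemeasurable
  have hs : AEMeasurable (fun x => (√(S.W x 0 0).re : ℂ)) S.ν :=
    Complex.measurable_ofReal.comp_aemeasurable
      (Real.continuous_sqrt.measurable.comp_aemeasurable (hre 0 0))
  refine AEMeasurable.aestronglyMeasurable ?_
  fin_cases j <;> fin_cases k
  · exact hs
  · exact (S.aestronglyMeasurable_W 0 1).aemeasurable.div hs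
  · exact aemeasurable_const
  · exact Complex.measurable_ofReal.comp_aemeasurable
      (Real.continuous_sqrt.measurable.comp_aemeasurable
        ((hre 1 1).sub (((S.aestronglyMeasurable_W 0 1).norm.aemeasurable.pow_const 2).div (hre 0 0))))

lemma aestronglyMeasurable_choleskyInverse (S : FirstOrderSystem 2) (j k : Fin 2) :
    AEStronglyMeasurable (fun x => choleskyInverse (S.W x) j k) S.ν := by
  have h := fun j k => (S.aestronglyMeasurable_choleskyFactor j k).aemeasurable
  refine AEMeasurable.aestronglyMeasurable ?_
  fin_cases j <;> fin_cases k
  · exact (h 0 0).inv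
  · exact ((h 0 0).inv.neg.mul (h 0 1)).mul (h 1 1).inv
  · exact aemeasurable_const
  · exact (h 1 1).inv

lemma aestronglyMeasurable_whiten {f : ℝ → Fin 2 → ℂ} (hf : AEStronglyMeasurable f S.ν) :
    AEStronglyMeasurable (S.whiten f) S.ν :=
  (PiLp.continuous_toLp 2 _).comp_aestronglyMeasurable
    (aestronglyMeasurable_mulVec S.aestronglyMeasurable_choleskyFactor hf)

lemma norm_whiten_sq (f : ℝ → Fin 2 → ℂ) {x : ℝ} (hx : x ∈ S.interval) :
    ‖S.whiten f x‖ ^ 2 = (S.density f f x).re := by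
  rw [← inner_whiten f f hx, inner_self_eq_norm_sq_to_K]
  norm_cast

lemma memLp_whiten_iff {f : ℝ → Fin 2 → ℂ} (hf : AEStronglyMeasurable f S.ν) :
    MemLp (S.whiten f) 2 S.ν ↔ Integrable (S.density f f) S.ν := by
  rw [memLp_two_iff_integrable_sq_norm (aestronglyMeasurable_whiten hf)]
  have e : (fun x => ‖S.whiten f x‖ ^ 2) =ᵐ[S.ν] fun x => (S.density f f x).re := by
    filter_upwards [S.ae_mem] with x hx using norm_whiten_sq f hx
  rw [integrable_congr e]
  refine ⟨fun h => ?_, fun h => h.re⟩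
  refine (h.ofReal (𝕜 := ℂ)).congr ?_
  filter_upwards [S.ae_mem] with x hx
  exact (density_self_re _ hx).symm

/-- The isometry `f ↦ R f` into an ordinary `L²` space. -/
def whitenLp (S : FirstOrderSystem 2) :
    S.PreL2 →ₗ[ℂ] Lp (EuclideanSpace ℂ (Fin 2)) 2 S.ν where
  toFun f := ((memLp_whiten_iff f.2.1).2 f.2.2).toLp
  map_add' f g := by
    rw [← MemLp.toLp_add]
    refine MemLp.toLp_congr _ _ (Eventually.of_forall fun x => ?_)
    change WithLp.toLp 2 (choleskyFactor (S.W x) *ᵥ (f.fn x + g.fn x)) = _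
    rw [Matrix.mulVec_add]
    rfl
  map_smul' c f := by
    rw [RingHom.id_apply, ← MemLp.toLp_const_smul]
    refine MemLp.toLp_congr _ _ (Eventually.of_forall fun x => ?_)
    change WithLp.toLp 2 (choleskyFactor (S.W x) *ᵥ (c • f.fn x)) = _
    rw [Matrix.mulVec_smul]
    rfl

lemma coeFn_whitenLp (f : S.PreL2) : S.whitenLp f =ᵐ[S.ν] S.whiten f.fn :=
  MemLp.coeFn_toLp ((memLp_whiten_iff f.2.1).2 f.2.2)

lemma norm_whitenLp (f : S.PreL2) : ‖S.whitenLp f‖ = ‖f‖ := by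
  rw [← sq_eq_sq₀ (norm_nonneg _) (norm_nonneg _), ← inner_self_eq_norm_sq (𝕜 := ℂ),
    ← inner_self_eq_norm_sq (𝕜 := ℂ), L2.inner_def, PreL2.inner_def]
  congr 1
  refine integral_congr_ae ?_
  filter_upwards [S.ae_mem, coeFn_whitenLp f] with x hx h
  rw [h, inner_whiten _ _ hx]
  rfl

lemma isometry_whitenLp (S : FirstOrderSystem 2) : Isometry S.whitenLp :=
  AddMonoidHomClass.isometry_of_norm _ norm_whitenLp

/-- It suffices that the isometry f ↦ Rf into an ordinary L² space has closed range. Along a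
subsequence a limit Φ is almost everywhere a pointwise limit of vectors in the range of R(x). With
R' = `choleskyInverse` the matrix RR' is the identity on that range, so Φ = R(R'Φ). -/
instance : CompleteSpace S.PreL2 := by
  rw [completeSpace_iff_isComplete_range S.isometry_whitenLp.isUniformInducing]
  refine IsClosed.isComplete (IsSeqClosed.isClosed ?_)
  intro φ Φ hφ hlim
  choose f hf using hφ
  obtain ⟨ns, -, hns⟩ := (tendstoInMeasure_of_tendsto_Lp hlim).exists_seq_tendsto_ae
  have hfae : ∀ᵐ x ∂S.ν, ∀ i, φ i x = S.whiten (f i).fn x := by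
    rw [ae_all_iff]
    intro i
    rw [← hf i]
    exact coeFn_whitenLp (f i)
  set g : ℝ → Fin 2 → ℂ := fun x => choleskyInverse (S.W x) *ᵥ (Φ x).ofLp with hg
  have hgm : AEStronglyMeasurable g S.ν :=
    aestronglyMeasurable_mulVec S.aestronglyMeasurable_choleskyInverse
      ((PiLp.continuous_ofLp 2 _).comp_aestronglyMeasurable (Lp.aestronglyMeasurable Φ))
  have hgΦ : S.whiten g =ᵐ[S.ν] Φ := by
    filter_upwards [hns, hfae] with x h1 h2
    set P := choleskyFactor (S.W x) * choleskyInverse (S.W x)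
    have hc : Continuous fun z : EuclideanSpace ℂ (Fin 2) =>
        (WithLp.toLp 2 (P *ᵥ z.ofLp) : EuclideanSpace ℂ (Fin 2)) :=
      (PiLp.continuous_toLp 2 _).comp
        (continuous_const.matrix_mulVec (PiLp.continuous_ofLp 2 _))
    have h3 := (hc.tendsto (Φ x)).comp h1
    have h4 : (fun z : EuclideanSpace ℂ (Fin 2) =>
        (WithLp.toLp 2 (P *ᵥ z.ofLp) : EuclideanSpace ℂ (Fin 2))) ∘ (fun i => φ (ns i) x)
        = fun i => φ (ns i) x := by
      ext1 i
      simp only [Function.comp_apply]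
      rw [h2 (ns i), whiten, Matrix.mulVec_mulVec, choleskyFactor_mul_inverse_mul]
    rw [h4] at h3
    have h5 := tendsto_nhds_unique h3 h1
    rw [whiten, hg]
    simp only
    rw [Matrix.mulVec_mulVec]
    exact h5
  have hmem : MemLp (S.whiten g) 2 S.ν := (Lp.memLp Φ).ae_eq hgΦ.symm
  refine ⟨PreL2.of g ⟨hgm, (memLp_whiten_iff hgm).1 hmem⟩, Lp.ext ?_⟩
  exact (coeFn_whitenLp _).trans hgΦ

end FirstOrderSystem

/-! ### Inhomogeneous equations and solutions of compact support -/

namespace FirstOrderSystem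

section Inhomogeneous

variable {n : ℕ} {S : FirstOrderSystem n}

/-- The initial value problem on the whole interval. -/
lemma exists_solution {c : ℝ} (hc : c ∈ S.interval) {f : ℝ → Fin n → ℂ} (hf : S.LocInt f)
    (ξ : Fin n → ℂ) : ∃ u, S.Solves S.a S.b u f ∧ Function.rightLim u c = ξ := by
  have hR := fun (lo hi : EReal) (hsub : openInterval lo hi ⊆ S.interval) x
    (hx : x ∈ openInterval lo hi) => S.regular_zero (hsub hx)
  obtain ⟨v, hv, lv⟩ := exists_solution_right hc hc.2 le_rfl (lam := 0) hf
    (hR _ _ (openInterval_subset_right hc le_rfl)) ξ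
  -- The left-hand limit that makes the two halves fit: the jump condition at c solved for u⁻,
  -- possible since 1 + X is invertible for λ = 0.
  set η : Fin n → ℂ := (1 + S.halfJump 0 c)⁻¹ *ᵥ
    ((1 - S.halfJump 0 c) *ᵥ ξ - S.μ.real {c} • (S.J⁻¹ *ᵥ (S.W c *ᵥ f c))) with hη
  obtain ⟨u, hu, lu⟩ := exists_solution_left hc hc.1 le_rfl (lam := 0) hf
    (hR _ _ (openInterval_subset_left hc le_rfl)) η
  have rv : Function.rightLim v c = ξ := rightLim_eq_of_tendsto lv
  have ru : Function.leftLim u c = η := leftLim_eq_of_tendsto lu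
  have hj : (1 + S.halfJump 0 c) *ᵥ η
      = (1 - S.halfJump 0 c) *ᵥ ξ - S.μ.real {c} • (S.J⁻¹ *ᵥ (S.W c *ᵥ f c)) := by
    rw [hη, Matrix.mulVec_mulVec,
      Matrix.mul_nonsing_inv _ ((Matrix.isUnit_iff_isUnit_det _).1 (S.regular_zero hc).2),
      Matrix.one_mulVec]
  have h := Solves.glue (lam := 0) le_rfl hc.1 hc.2 le_rfl hf hu hv (by
    rw [rhs, glueFun_self, ru, rv, Matrix.mulVec_smul, Matrix.mulVec_add]
    rw [Matrix.sub_mulVec, Matrix.add_mulVec, Matrix.one_mulVec, Matrix.one_mulVec, halfJump,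
      Matrix.smul_mulVec, Matrix.smul_mulVec] at hj
    linear_combination (norm := module) -hj)
  rw [zero_smul, zero_add] at h
  refine ⟨_, h, rightLim_eq_of_tendsto (lv.congr' ?_)⟩
  filter_upwards [self_mem_nhdsWithin] with x hx
  exact (glueFun_of_gt u v hx).symm

lemma integrableOn_density {K : Set ℝ} (hK : MeasurableSet K) {v f : ℝ → Fin n → ℂ} {C : ℝ}
    (hf : IntegrableOn (fun t => S.W t *ᵥ f t) K S.μ)
    (hv : AEStronglyMeasurable v (S.μ.restrict K)) (hC : ∀ x ∈ K, ‖v x‖ ≤ C) :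
    IntegrableOn (S.density v f) K S.μ := by
  have e : S.density v f = fun t => ∑ j, star (v t j) * (S.W t *ᵥ f t) j := rfl
  rw [e]
  refine integrable_finsetSum _ fun j _ => ?_
  refine Integrable.bdd_mul (c := C) (Integrable.eval hf j)
    (continuous_star.comp_aestronglyMeasurable
      ((continuous_apply j).comp_aestronglyMeasurable hv)) ?_
  refine (ae_restrict_iff' hK).2 (Eventually.of_forall fun x hx => ?_)
  rw [norm_star]
  exact (norm_le_pi_norm _ _).trans (hC x hx)

lemma restrict_ν_Icc {x y : ℝ} (hx : x ∈ S.interval) (hy : y ∈ S.interval) :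
    S.ν.restrict (Icc x y) = S.μ.restrict (Icc x y) := by
  rw [ν, Measure.restrict_restrict measurableSet_Icc,
    inter_eq_self_of_subset_left (t := S.interval) (openInterval_Icc_subset hx hy)]

lemma ae_of_ae_Icc {p : ℝ → Prop}
    (h : ∀ x ∈ S.interval, ∀ y ∈ S.interval, x ≤ y → ∀ᵐ t ∂S.ν.restrict (Icc x y), p t) :
    ∀ᵐ t ∂S.ν, p t :=
  ae_openInterval_of_Icc S.a_lt_b fun x hx y hy hxy => by
    rw [← restrict_ν_Icc hx hy]
    exact h x hx y hy hxy

/-- The j-th entry of Wf is the form of f with a constant unit vector, and `norm_form_le` bounds it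
by two integrable diagonal values. Hence square-integrable functions are admissible right-hand
sides. -/
lemma integrableOn_mulVec_of_mem {f : ℝ → Fin n → ℂ} (hf : f ∈ S.sqIntegrable) {x y : ℝ}
    (hx : x ∈ S.interval) (hy : y ∈ S.interval) :
    IntegrableOn (fun t => S.W t *ᵥ f t) (Icc x y) S.μ := by
  have hW := fun j k => S.W_integrableOn (K := Icc x y) hx hy Subset.rfl j k
  have hff : IntegrableOn (S.density f f) (Icc x y) S.μ := by
    rw [IntegrableOn, ← restrict_ν_Icc hx hy]
    exact hf.2.restrict
  have hm : AEStronglyMeasurable f (S.μ.restrict (Icc x y)) := by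
    rw [← restrict_ν_Icc hx hy]
    exact hf.1.restrict
  refine Integrable.of_eval fun j => ?_
  have he : ∀ t, S.density (fun _ => Pi.single j 1) f t = (S.W t *ᵥ f t) j := fun t => by
    rw [density, ← Pi.single_star, star_one, single_one_dotProduct]
  have hee : IntegrableOn (S.density (fun _ => Pi.single j 1) fun _ => Pi.single j 1)
      (Icc x y) S.μ :=
    integrableOn_density measurableSet_Icc (integrableOn_mulVec measurableSet_Icc hW
      aestronglyMeasurable_const fun _ _ => le_rfl) aestronglyMeasurable_const fun _ _ => le_rfl
  refine (hee.norm.add hff.norm).mono'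
    ((continuous_apply j).comp_aestronglyMeasurable
      (aestronglyMeasurable_mulVec (fun j k => (hW j k).1) hm)) ?_
  refine (ae_restrict_iff' measurableSet_Icc).2 (Eventually.of_forall fun t ht => ?_)
  change ‖(S.W t *ᵥ f t) j‖ ≤ _
  rw [← he]
  exact norm_form_le (S.W_nonneg t (openInterval_Icc_subset hx hy ht)) _ _

lemma locInt_of_mem {f : ℝ → Fin n → ℂ} (hf : f ∈ S.sqIntegrable) : S.LocInt f :=
  fun _ hx _ hy => integrableOn_mulVec_of_mem hf hx hy

lemma density_indicator_self (K : Set ℝ) (f : ℝ → Fin n → ℂ) :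
    S.density (K.indicator f) (K.indicator f) = K.indicator (S.density f f) := by
  ext x
  by_cases hx : x ∈ K <;> simp [density, hx]

lemma indicator_mem_of_mem {f : ℝ → Fin n → ℂ} (hf : f ∈ S.sqIntegrable) (x y : ℝ) :
    (Icc x y).indicator f ∈ S.sqIntegrable := by
  refine ⟨hf.1.indicator measurableSet_Icc, ?_⟩
  rw [density_indicator_self]
  exact hf.2.indicator measurableSet_Icc

/-- A solution, restricted to a compact interval, is square-integrable. -/
lemma Solves.indicator_mem {u f : ℝ → Fin n → ℂ} (hu : S.Solves S.a S.b u f) {x y : ℝ}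
    (hx : x ∈ S.interval) (hy : y ∈ S.interval) :
    (Icc x y).indicator u ∈ S.sqIntegrable := by
  obtain ⟨C, hC⟩ := hu.balanced.exists_bound hx hy
  have hm : AEStronglyMeasurable u (S.μ.restrict (Icc x y)) :=
    (hu.balanced.1.aestronglyMeasurable S.measurableSet_interval S.μ).mono_measure
      (Measure.restrict_mono (openInterval_Icc_subset hx hy) le_rfl)
  constructor
  · rw [aestronglyMeasurable_indicator_iff measurableSet_Icc, restrict_ν_Icc hx hy]
    exact hm
  · rw [density_indicator_self, integrable_indicator_iff measurableSet_Icc, IntegrableOn,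
      restrict_ν_Icc hx hy]
    exact integrableOn_density measurableSet_Icc (integrableOn_mulVec measurableSet_Icc
      (fun j k => S.W_integrableOn hx hy Subset.rfl j k) hm hC) hm hC

lemma inner_eq_setIntegral {f g : S.PreL2} {x y : ℝ} (hx : x ∈ S.interval) (hy : y ∈ S.interval)
    (h : ∀ t ∉ Icc x y, S.density f.fn g.fn t = 0) :
    inner ℂ f g = ∫ t in Icc x y, S.density f.fn g.fn t ∂S.μ := by
  rw [← restrict_ν_Icc hx hy, setIntegral_eq_integral_of_forall_compl_eq_zero h]
  rfl

lemma exists_lt_mem {x : ℝ} (hx : x ∈ S.interval) : ∃ c ∈ S.interval, c < x := by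
  obtain ⟨d, hd1, hd2⟩ := EReal.lt_iff_exists_real_btwn.1 hx.1
  exact ⟨d, ⟨hd1, hd2.trans hx.2⟩, EReal.coe_lt_coe_iff.1 hd2⟩

/-- If the right-hand side vanishes to the left of `x`, then some solution does. -/
lemma exists_solution_vanishing_left {r : ℝ → Fin n → ℂ} (hr : S.LocInt r) {x : ℝ}
    (hx : x ∈ S.interval) (hr0 : ∀ t < x, r t = 0) :
    ∃ u, S.Solves S.a S.b u r ∧ ∀ t < x, u t = 0 := by
  obtain ⟨c, hc, hcx⟩ := exists_lt_mem hx
  obtain ⟨v, hv, lv⟩ := exists_solution_right hc hc.2 le_rfl (lam := 0) hr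
    (fun t ht => S.regular_zero (openInterval_subset_right hc le_rfl ht)) 0
  have hz : S.Solves S.a c (0 : ℝ → Fin n → ℂ) ((0 : ℂ) • (0 : ℝ → Fin n → ℂ) + r) := by
    refine Solves.congr (openInterval_subset_left hc le_rfl) Solves.zero (fun _ _ => rfl) ?_
    intro t ht
    rw [Pi.add_apply, hr0 t ((mem_openInterval_coe_right.1 ht).2.trans hcx)]
    simp
  have rv : Function.rightLim v c = 0 := rightLim_eq_of_tendsto lv
  have h := Solves.glue (lam := 0) le_rfl hc.1 hc.2 le_rfl hr hz hv (by
    rw [rhs, glueFun_self, leftLim_zero_fun, rv, hr0 c hcx]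
    simp)
  rw [zero_smul, zero_add] at h
  refine ⟨_, h, fun t ht => ?_⟩
  rcases lt_trichotomy t c with h1 | h1 | h1
  · rw [glueFun_of_lt _ _ h1]; rfl
  · rw [h1, glueFun_self, leftLim_zero_fun, rv]; simp
  · rw [glueFun_of_gt _ _ h1]
    have hsub : openInterval (c : EReal) (x : EReal) ⊆ openInterval (c : EReal) S.b :=
      openInterval_mono le_rfl hx.2.le
    have hv' : S.Solves c x v ((0 : ℂ) • v) :=
      Solves.congr (hsub.trans (openInterval_subset_right hc le_rfl)) (hv.mono hsub)
        (fun _ _ => rfl) fun s hs => by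
          rw [Pi.add_apply, hr0 s (mem_openInterval_coe_right.1 hs).2, add_zero]
    exact hv'.eq_zero_right hc hx.2.le
      (fun s hs => S.regular_zero (openInterval_subset_right hc le_rfl (hsub hs))) lv t
      (by rw [openInterval_coe]; exact ⟨h1, ht⟩)

lemma eq_zero_of_form {z : Fin n → ℂ} (h : ∀ ξ, S.form ξ z = 0) : z = 0 := by
  have h1 : S.J *ᵥ z = 0 := dotProduct_star_self_eq_zero.1 (h (S.J *ᵥ z))
  rw [← S.inv_mulVec_J z, h1, Matrix.mulVec_zero]

lemma leftLim_eq_zero_of_lt {u : ℝ → Fin n → ℂ} {c x : ℝ} (hcx : c < x) (h : ∀ t < x, u t = 0) :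
    Function.leftLim u c = 0 := by
  refine leftLim_eq_of_tendsto (tendsto_const_nhds.congr' ?_)
  filter_upwards [self_mem_nhdsWithin] with t ht
  exact (h t (lt_trans ht hcx)).symm

lemma rightLim_eq_zero_of_gt {u : ℝ → Fin n → ℂ} {d y : ℝ} (hyd : y < d) (h : ∀ t > y, u t = 0) :
    Function.rightLim u d = 0 := by
  refine rightLim_eq_of_tendsto (tendsto_const_nhds.congr' ?_)
  filter_upwards [self_mem_nhdsWithin] with t ht
  exact (h t (lt_trans hyd ht)).symm

lemma exists_gt_mem {x : ℝ} (hx : x ∈ S.interval) : ∃ c ∈ S.interval, x < c := by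
  obtain ⟨d, hd1, hd2⟩ := EReal.lt_iff_exists_real_btwn.1 hx.2
  exact ⟨d, ⟨hx.1.trans hd1, hd2⟩, EReal.coe_lt_coe_iff.1 hd1⟩

/-- Green's formula for a solution which vanishes to the left of `x`. -/
lemma form_eq_setIntegral {u r v g : ℝ → Fin n → ℂ} (hu : S.Solves S.a S.b u r)
    (hv : S.Solves S.a S.b v g) {x y d : ℝ} (hx : x ∈ S.interval) (hd : d ∈ S.interval)
    (hxd : x ≤ d) (hyd : y ≤ d) (h0 : ∀ t < x, u t = 0) (hr : ∀ t ∉ Icc x y, r t = 0)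
    (hg : ∀ t ∉ Icc x y, S.density g u t = 0) :
    S.form (Function.rightLim v d) (Function.rightLim u d)
      = ∫ t in Icc x y, S.density v r t - S.density g u t ∂S.μ := by
  obtain ⟨c, hc, hcx⟩ := exists_lt_mem hx
  have h := (hu.green Subset.rfl hv hc hd (hcx.le.trans hxd)).2
  rw [leftLim_eq_zero_of_lt hcx h0, form_zero_right, sub_zero] at h
  rw [h]
  refine setIntegral_eq_of_subset_of_forall_sdiff_eq_zero measurableSet_Icc
    (Icc_subset_Icc hcx.le hyd) fun t ht => ?_
  rw [hg t ht.2, sub_zero, density, hr t ht.2, Matrix.mulVec_zero, dotProduct_zero]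

/-- If a right-hand side supported on `[x, y]` is orthogonal to the solutions of the homogeneous
equation, then the inhomogeneous equation has a solution supported on `[x, y]`. -/
lemma exists_compact_solution {r : ℝ → Fin n → ℂ} (hr : S.LocInt r) {x y : ℝ}
    (hx : x ∈ S.interval) (hy : y ∈ S.interval) (hxy : x ≤ y) (hsupp : ∀ t ∉ Icc x y, r t = 0)
    (horth : ∀ k, S.Solves S.a S.b k 0 → ∫ t in Icc x y, S.density k r t ∂S.μ = 0) :
    ∃ u, S.Solves S.a S.b u r ∧ ∀ t ∈ S.interval, t ∉ Icc x y → u t = 0 := by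
  obtain ⟨u, hu, h0⟩ := exists_solution_vanishing_left hr hx
    fun t ht => hsupp t fun h => absurd h.1 (not_le.2 ht)
  refine ⟨u, hu, fun t ht htn => ?_⟩
  rcases lt_or_ge t x with h1 | h1
  · exact h0 t h1
  have hyt : y < t := not_le.1 fun h => htn ⟨h1, h⟩
  obtain ⟨d, hyd, hdt⟩ := exists_between hyt
  have hd : d ∈ S.interval := openInterval_Icc_subset hy ht ⟨hyd.le, hdt.le⟩
  -- Green's formula pairs u⁺(d) with the value at d of an arbitrary homogeneous solution.
  -- Orthogonality makes every such pairing 0, so u⁺(d) = 0 and uniqueness applies beyond d.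
  have hz : Function.rightLim u d = 0 := by
    refine eq_zero_of_form (S := S) fun ξ => ?_
    obtain ⟨k, hk, rfl⟩ := exists_solution hd LocInt.zero ξ
    have hden : ∀ t, S.density 0 u t = 0 := fun t => by simp [density]
    rw [form_eq_setIntegral hu hk hx hd (hxy.trans hyd.le) hyd.le h0 hsupp fun t _ => hden t]
    simp only [hden, sub_zero]
    exact horth k hk
  have hsub : openInterval (d : EReal) S.b ⊆ S.interval := openInterval_subset_right hd le_rfl
  have hu' : S.Solves d S.b u ((0 : ℂ) • u) :=
    Solves.congr hsub (hu.mono hsub) (fun _ _ => rfl) fun s hs => by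
      rw [hsupp s fun h => absurd h.2 (not_le.2 (hyd.trans (mem_openInterval_coe_left.1 hs).1))]
      simp
  have lim := hu'.tendsto_right hd hd.2 le_rfl
  rw [hz] at lim
  exact hu'.eq_zero_right hd le_rfl (fun s hs => S.regular_zero (hsub hs)) lim t
    (mem_openInterval_coe_left.2 ⟨hdt, ht.2⟩)

end Inhomogeneous

end FirstOrderSystem

/-! ### Homogeneous solutions; pairs orthogonal to the compactly supported elements of T_max -/

namespace FirstOrderSystem

variable {n : ℕ} {S : FirstOrderSystem n}

/-- The solutions of `J k' + q k = 0` on `(a, b)`. -/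
def homSolutions (S : FirstOrderSystem n) : Submodule ℂ (ℝ → Fin n → ℂ) where
  carrier := {k | (∀ x, x ∉ S.interval → k x = 0) ∧ S.Solves S.a S.b k 0}
  add_mem' := by
    rintro u v ⟨h1, h2⟩ ⟨k1, k2⟩
    refine ⟨fun x hx => by simp [h1 x hx, k1 x hx], ?_⟩
    simpa using h2.add k2
  zero_mem' := ⟨fun _ _ => rfl, Solves.zero⟩
  smul_mem' := by
    rintro c u ⟨h1, h2⟩
    refine ⟨fun x hx => by simp [h1 x hx], ?_⟩
    simpa using h2.smul c

lemma homSolutions_eq_zero {k : ℝ → Fin n → ℂ} (hk : k ∈ S.homSolutions) {c : ℝ}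
    (hc : c ∈ S.interval) (h0 : k c = 0) : k = 0 := by
  have h : S.Solves S.a S.b k ((0 : ℂ) • k) := by rw [zero_smul]; exact hk.2
  have hl := h.leftLim_eq_sub hc
  have hr := h.rightLim_eq_add hc
  have ht := locallyBV_tendsto h.balanced.1 hc
  rw [hl, hr, h0, Matrix.mulVec_zero, Matrix.mulVec_zero] at ht
  have s1 : openInterval S.a c ⊆ S.interval := openInterval_subset_left hc le_rfl
  have s2 : openInterval c S.b ⊆ S.interval := openInterval_subset_right hc le_rfl
  ext1 x
  by_cases hx : x ∈ S.interval
  · rcases lt_trichotomy x c with h1 | h1 | h1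
    · exact (h.mono s1).eq_zero_left hc le_rfl (fun t ht => S.regular_zero (s1 ht)) ht.1 x
        (mem_openInterval_coe_right.2 ⟨hx.1, h1⟩)
    · rw [h1, h0]; rfl
    · exact (h.mono s2).eq_zero_right hc le_rfl (fun t ht => S.regular_zero (s2 ht)) ht.2 x
        (mem_openInterval_coe_left.2 ⟨h1, hx.2⟩)
  · exact hk.1 x hx

/-- Evaluation at one point is injective by uniqueness for λ = 0. -/
instance : FiniteDimensional ℂ S.homSolutions := by
  obtain ⟨c, hc⟩ := S.exists_mem_interval
  refine FiniteDimensional.of_injective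
    ((LinearMap.proj c : (ℝ → Fin n → ℂ) →ₗ[ℂ] (Fin n → ℂ)).comp S.homSolutions.subtype) ?_
  rw [← LinearMap.ker_eq_bot, LinearMap.ker_eq_bot']
  exact fun k hk => Subtype.ext (homSolutions_eq_zero k.2 hc hk)

lemma Solves.cut_mem_hom {k : ℝ → Fin n → ℂ} (hk : S.Solves S.a S.b k 0) :
    cut S.a S.b k ∈ S.homSolutions :=
  ⟨fun _ hx => cut_of_notMem k hx, hk.congr Subset.rfl (fun _ hx => cut_of_mem k hx) fun _ _ => rfl⟩

/-- A solution of the homogeneous equation, restricted to a compact interval, as an element of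
`L²(w)`. -/
def compress (S : FirstOrderSystem n) {x y : ℝ} (hx : x ∈ S.interval) (hy : y ∈ S.interval) :
    S.homSolutions →ₗ[ℂ] S.L2 where
  toFun k := SeparationQuotient.mk
    (PreL2.of ((Icc x y).indicator k.1) (k.2.2.indicator_mem hx hy))
  map_add' k l := by
    rw [← SeparationQuotient.mk_add]
    exact congrArg _ (Subtype.ext (indicator_add _ _ _))
  map_smul' c k := by
    rw [RingHom.id_apply, ← SeparationQuotient.mk_smul]
    exact congrArg _ (Subtype.ext (indicator_const_smul (Icc x y) c k.1))

/-- The homogeneous solutions with `w k = 0` on `[x, y]`. -/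
def nullSolutions (S : FirstOrderSystem n) (x y : ℝ) : Submodule ℂ S.homSolutions where
  carrier := {k | ∀ᵐ t ∂S.ν.restrict (Icc x y), S.W t *ᵥ k.1 t = 0}
  add_mem' := by
    intro k l (hk : ∀ᵐ t ∂_, _) (hl : ∀ᵐ t ∂_, _)
    change ∀ᵐ t ∂_, _
    filter_upwards [hk, hl] with t h1 h2
    change S.W t *ᵥ (k.1 t + l.1 t) = 0
    rw [Matrix.mulVec_add, h1, h2, add_zero]
  zero_mem' := by
    change ∀ᵐ t ∂S.ν.restrict (Icc x y), S.W t *ᵥ (0 : ℝ → Fin n → ℂ) t = 0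
    exact Eventually.of_forall fun t => Matrix.mulVec_zero _
  smul_mem' := by
    intro c k (hk : ∀ᵐ t ∂_, _)
    change ∀ᵐ t ∂_, _
    filter_upwards [hk] with t h1
    change S.W t *ᵥ (c • k.1 t) = 0
    rw [Matrix.mulVec_smul, h1, smul_zero]

lemma nullSolutions_mono {x y x' y' : ℝ} (hx : x' ≤ x) (hy : y ≤ y') :
    S.nullSolutions x' y' ≤ S.nullSolutions x y := fun _ hk =>
  ae_mono (Measure.restrict_mono (Icc_subset_Icc hx hy) le_rfl) hk

lemma Definite.eq_zero (hdef : S.Definite) {k : ℝ → Fin n → ℂ} (hk : k ∈ S.homSolutions)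
    (h : ∀ᵐ t ∂S.ν, S.W t *ᵥ k t = 0) : k = 0 := by
  ext1 x
  by_cases hx : x ∈ S.interval
  · exact hdef k hk.2 h x hx
  · exact hk.1 x hx

/-- The definiteness condition holds on some compact interval. -/
lemma Definite.exists_compact (hdef : S.Definite) : ∃ x ∈ S.interval, ∃ y ∈ S.interval,
    x ≤ y ∧ S.nullSolutions x y = ⊥ := by
  obtain ⟨c, hc⟩ := S.exists_mem_interval
  let ι := {p : ℝ × ℝ // p.1 ∈ S.interval ∧ p.2 ∈ S.interval ∧ p.1 ≤ p.2}
  have : Nonempty ι := ⟨⟨(c, c), hc, hc, le_rfl⟩⟩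
  let d : ι → ℕ := fun p => Module.finrank ℂ (S.nullSolutions p.1.1 p.1.2)
  -- On an interval for which the dimension of the null solutions is minimal, enlarging the interval
  -- loses none of them. They are thus annihilated by w on all of (a, b) and vanish by definiteness.
  obtain ⟨⟨⟨x, y⟩, hx, hy, hxy⟩, hp⟩ : ∃ p : ι, ∀ q, d p ≤ d q :=
    ⟨Function.argmin d, fun q => not_lt.1 (Function.not_lt_argmin d q)⟩
  refine ⟨x, hx, y, hy, hxy, (Submodule.eq_bot_iff _).2 fun k hk => Subtype.ext ?_⟩
  refine hdef.eq_zero k.2 (ae_of_ae_Icc fun x' hx' y' hy' hxy' => ?_)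
  have hm : min x x' ∈ S.interval := by rcases min_choice x x' with h | h <;> rw [h] <;> assumption
  have hM : max y y' ∈ S.interval := by rcases max_choice y y' with h | h <;> rw [h] <;> assumption
  have hle : min x x' ≤ max y y' := (min_le_left _ _).trans (hxy.trans (le_max_left _ _))
  have e := Submodule.eq_of_le_of_finrank_le
    (nullSolutions_mono (S := S) (min_le_left x x') (le_max_left y y'))
    (hp ⟨(min x x', max y y'), hm, hM, hle⟩)
  have hk' : k ∈ S.nullSolutions x' y' :=
    nullSolutions_mono (min_le_right x x') (le_max_right y y') (e ▸ hk)
  exact hk'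

/-- The pair `p` vanishes outside of a compact subinterval of `(a, b)`. -/
def CompactlySupported (p : S.PreL2 × S.PreL2) : Prop :=
  ∃ x ∈ S.interval, ∃ y ∈ S.interval, x ≤ y ∧ ∀ t ∉ Icc x y, p.1.fn t = 0 ∧ p.2.fn t = 0

lemma inner_conj (f g : S.PreL2) : star (inner ℂ f g) = inner ℂ g f := inner_conj_symm g f

/-- On [x, y] the difference v - v₁ is projected onto the homogeneous solutions; let k be the
projection and r the remainder. Being orthogonal to them, r is the right-hand side of a solution U
supported in [x, y] (`exists_compact_solution`). The hypothesis for the pair (U, r) and Green's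
formula for U and v₁ + k together give ⟨r, r⟩ = 0. -/
lemma exists_hom_eq_on_Icc {v g : S.PreL2}
    (h : ∀ p ∈ S.maxPairs, CompactlySupported p → inner ℂ p.1 g = inner ℂ p.2 v)
    {v₁ : ℝ → Fin n → ℂ} (hv₁ : S.Solves S.a S.b v₁ g.fn) {x y : ℝ} (hx : x ∈ S.interval)
    (hy : y ∈ S.interval) (hxy : x ≤ y) : ∃ k : S.homSolutions,
      ∀ᵐ t ∂S.ν.restrict (Icc x y), S.W t *ᵥ (v.fn t - v₁ t - k.1 t) = 0 := by
  have on {f : ℝ → Fin n → ℂ} {t : ℝ} (ht : t ∈ Icc x y) : (Icc x y).indicator f t = f t :=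
    indicator_of_mem ht f
  have off {f : ℝ → Fin n → ℂ} {t : ℝ} (ht : t ∉ Icc x y) : (Icc x y).indicator f t = 0 :=
    indicator_of_notMem ht f
  let V : S.PreL2 := PreL2.of ((Icc x y).indicator v.fn) (indicator_mem_of_mem v.2 x y)
  let V₁ : S.PreL2 := PreL2.of ((Icc x y).indicator v₁) (hv₁.indicator_mem hx hy)
  let M := LinearMap.range (S.compress hx hy)
  have : FiniteDimensional ℂ M := inferInstance
  obtain ⟨k, hk⟩ : M.starProjection (SeparationQuotient.mk (V - V₁)) ∈ M :=
    Submodule.starProjection_apply_mem _ _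
  have horth := M.sub_starProjection_mem_orthogonal (SeparationQuotient.mk (V - V₁))
  rw [← hk] at horth
  let K : S.PreL2 := PreL2.of ((Icc x y).indicator k.1) (k.2.2.indicator_mem hx hy)
  let r : S.PreL2 := V - V₁ - K
  have hr0 : ∀ t ∉ Icc x y, r.fn t = 0 := fun t ht => by
    change (Icc x y).indicator v.fn t - (Icc x y).indicator v₁ t - (Icc x y).indicator k.1 t = 0
    rw [off ht, off ht, off ht, sub_zero, sub_zero]
  have hr1 : ∀ t ∈ Icc x y, r.fn t = v.fn t - v₁ t - k.1 t := fun t ht => by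
    change (Icc x y).indicator v.fn t - (Icc x y).indicator v₁ t - (Icc x y).indicator k.1 t = _
    rw [on ht, on ht, on ht]
  have dr : ∀ f : ℝ → Fin n → ℂ, ∀ t ∉ Icc x y, S.density f r.fn t = 0 := fun f t ht => by
    rw [density, hr0 t ht, Matrix.mulVec_zero, dotProduct_zero]
  have hperp : ∀ l, S.Solves S.a S.b l 0 → ∫ t in Icc x y, S.density l r.fn t ∂S.μ = 0 := by
    intro l hl
    have h1 : inner ℂ (S.compress hx hy ⟨_, hl.cut_mem_hom⟩)
      (SeparationQuotient.mk (V - V₁) - S.compress hx hy k) = 0 :=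
      horth _ (LinearMap.mem_range_self _ _)
    have h2 : inner ℂ (PreL2.of ((Icc x y).indicator (cut S.a S.b l))
      (hl.cut_mem_hom.2.indicator_mem hx hy)) r = 0 := h1
    rw [inner_eq_setIntegral hx hy (dr _)] at h2
    rw [← h2]
    refine setIntegral_congr_fun measurableSet_Icc fun t ht => ?_
    change star (l t) ⬝ᵥ _ = star ((Icc x y).indicator (cut S.a S.b l) t) ⬝ᵥ _
    rw [on ht, cut_of_mem l (openInterval_Icc_subset hx hy ht)]
  obtain ⟨u, hu, hu0⟩ := exists_compact_solution (locInt_of_mem r.2) hx hy hxy hr0 hperp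
  let U : S.PreL2 := PreL2.of ((Icc x y).indicator u) (hu.indicator_mem hx hy)
  have hU : S.Solves S.a S.b U.fn r.fn := by
    refine hu.congr Subset.rfl (fun t ht => ?_) fun _ _ => rfl
    change (Icc x y).indicator u t = u t
    by_cases ht' : t ∈ Icc x y
    · exact on ht'
    · rw [off ht', hu0 t ht ht']
  have hU0 : ∀ t ∉ Icc x y, U.fn t = 0 := fun t ht => off ht
  have e1 := h (U, r) hU ⟨x, hx, y, hy, hxy, fun t ht => ⟨hU0 t ht, hr0 t ht⟩⟩
  have hz : S.Solves S.a S.b (v₁ + k.1) g.fn := by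
    have := hv₁.add k.2.2
    rwa [add_zero] at this
  let Z : S.PreL2 := V₁ + K
  have hZ : ∀ t ∈ Icc x y, Z.fn t = (v₁ + k.1) t := fun t ht => by
    change (Icc x y).indicator v₁ t + (Icc x y).indicator k.1 t = _
    rw [on ht, on ht]; rfl
  have dg : ∀ t ∉ Icc x y, S.density g.fn U.fn t = 0 := fun t ht => by
    rw [density, hU0 t ht, Matrix.mulVec_zero, dotProduct_zero]
  obtain ⟨d, hd, hyd⟩ := exists_gt_mem hy
  have e2 := form_eq_setIntegral hU hz hx hd (hxy.trans hyd.le) hyd.le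
    (fun t ht => hU0 t fun h => absurd h.1 (not_le.2 ht)) hr0 dg
  rw [rightLim_eq_zero_of_gt hyd fun t ht => hU0 t fun h => absurd h.2 (not_le.2 ht),
    form_zero_right] at e2
  have i1 : IntegrableOn (S.density Z.fn r.fn) (Icc x y) S.μ := by
    rw [IntegrableOn, ← restrict_ν_Icc hx hy]
    exact (S.density_integrable Z.2.1 r.2.1 Z.2.2 r.2.2).restrict
  have i2 : IntegrableOn (S.density g.fn U.fn) (Icc x y) S.μ := by
    rw [IntegrableOn, ← restrict_ν_Icc hx hy]
    exact (S.density_integrable g.2.1 U.2.1 g.2.2 U.2.2).restrict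
  have e3 : inner ℂ Z r = inner ℂ g U := by
    rw [inner_eq_setIntegral hx hy (dr _), inner_eq_setIntegral hx hy dg, ← sub_eq_zero,
      ← integral_sub i1 i2, e2]
    refine setIntegral_congr_fun measurableSet_Icc fun t ht => ?_
    simp only [density, hZ t ht]
  have e4 : inner ℂ V r = inner ℂ v r := by
    rw [inner_eq_setIntegral hx hy (dr _), inner_eq_setIntegral hx hy (dr _)]
    refine setIntegral_congr_fun measurableSet_Icc fun t ht => ?_
    change star ((Icc x y).indicator v.fn t) ⬝ᵥ _ = star (v.fn t) ⬝ᵥ _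
    rw [on ht]
  have e5 : inner ℂ r r = 0 := by
    have hrVZ : r = V - Z := sub_sub _ _ _
    conv_lhs => rw [hrVZ, inner_sub_left, ← hrVZ]
    rw [e3, e4, ← inner_conj U g, ← inner_conj r v, e1, sub_self]
  have e6 : ‖r‖ = 0 := by
    rw [← sq_eq_zero_iff, ← inner_self_eq_norm_sq (𝕜 := ℂ), e5]
    rfl
  refine ⟨k, ?_⟩
  have e7 := (PreL2.norm_eq_zero_iff r).1 e6
  filter_upwards [ae_restrict_of_ae e7, ae_restrict_mem measurableSet_Icc] with t h1 h2
  rw [← hr1 t h2]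
  exact h1

/-- As W is Hermitian, u*Wu is determined by Wu. -/
lemma mem_sqIntegrable_of_ae {u : ℝ → Fin n → ℂ} (hu : AEStronglyMeasurable u S.ν) (v : S.PreL2)
    (h : ∀ᵐ t ∂S.ν, S.W t *ᵥ u t = S.W t *ᵥ v.fn t) : u ∈ S.sqIntegrable := by
  refine ⟨hu, Integrable.congr v.2.2 ?_⟩
  filter_upwards [h, S.ae_mem] with t h1 h2
  have hH : (S.W t)ᴴ = S.W t := (S.W_nonneg t h2).isHermitian
  have e : ∀ z : Fin n → ℂ, star z ⬝ᵥ (S.W t *ᵥ v.fn t) = star (S.W t *ᵥ z) ⬝ᵥ v.fn t := fun z => by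
    rw [Matrix.star_mulVec, hH, Matrix.dotProduct_mulVec]
  change star (v.fn t) ⬝ᵥ (S.W t *ᵥ v.fn t) = star (u t) ⬝ᵥ (S.W t *ᵥ u t)
  rw [h1, e, e, h1]

/-- The adjoint of the restriction of `T_max` to compactly supported functions is contained in
`T_max`. -/
lemma Definite.exists_solution_of_orthogonal (hdef : S.Definite) {v g : S.PreL2}
    (h : ∀ p ∈ S.maxPairs, CompactlySupported p → inner ℂ p.1 g = inner ℂ p.2 v) :
    ((SeparationQuotient.mk v, SeparationQuotient.mk g) : S.L2 × S.L2) ∈ S.Tmax := by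
  obtain ⟨c, hc⟩ := S.exists_mem_interval
  obtain ⟨v₁, hv₁, -⟩ := exists_solution hc (locInt_of_mem g.2) 0
  obtain ⟨x, hx, y, hy, hxy, hnull⟩ := hdef.exists_compact
  obtain ⟨k, hk⟩ := exists_hom_eq_on_Icc h hv₁ hx hy hxy
  have hae : ∀ᵐ t ∂S.ν, S.W t *ᵥ (v.fn t - v₁ t - k.1 t) = 0 := by
    refine ae_of_ae_Icc fun x' hx' y' hy' hxy' => ?_
    have hm : min x x' ∈ S.interval := by
      rcases min_choice x x' with h | h <;> rw [h] <;> assumption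
    have hM : max y y' ∈ S.interval := by
      rcases max_choice y y' with h | h <;> rw [h] <;> assumption
    have hle : min x x' ≤ max y y' := (min_le_left _ _).trans (hxy.trans (le_max_left _ _))
    -- A larger interval leads to the same homogeneous solution, because k - l is null on [x, y],
    -- where the system is already definite. So one k serves for all of (a, b).
    obtain ⟨l, hl⟩ := exists_hom_eq_on_Icc h hv₁ hm hM hle
    have hkl : k - l ∈ S.nullSolutions x y := by
      have hl' := ae_mono (Measure.restrict_mono (μ := S.ν)
        (Icc_subset_Icc (min_le_left x x') (le_max_left y y')) le_rfl) hl
      change ∀ᵐ t ∂S.ν.restrict (Icc x y), S.W t *ᵥ (k.1 t - l.1 t) = 0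
      filter_upwards [hk, hl'] with t h1 h2
      rw [show k.1 t - l.1 t = (v.fn t - v₁ t - l.1 t) - (v.fn t - v₁ t - k.1 t) by abel,
        Matrix.mulVec_sub, h1, h2, sub_zero]
    have e : k = l := sub_eq_zero.1 ((Submodule.mem_bot ℂ).1 (hnull ▸ hkl))
    subst e
    exact ae_mono (Measure.restrict_mono (μ := S.ν)
      (Icc_subset_Icc (min_le_right x x') (le_max_right y y')) le_rfl) hl
  have hz : S.Solves S.a S.b (v₁ + k.1) g.fn := by
    have := hv₁.add k.2.2
    rwa [add_zero] at this
  have hae' : ∀ᵐ t ∂S.ν, S.W t *ᵥ (v₁ + k.1) t = S.W t *ᵥ v.fn t := by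
    filter_upwards [hae] with t ht
    rw [sub_sub, Matrix.mulVec_sub, sub_eq_zero] at ht
    exact ht.symm
  have hmem : v₁ + k.1 ∈ S.sqIntegrable :=
    mem_sqIntegrable_of_ae (hz.balanced.1.aestronglyMeasurable S.measurableSet_interval S.μ) v hae'
  have e : (SeparationQuotient.mk (PreL2.of (v₁ + k.1) hmem) : S.L2) = SeparationQuotient.mk v :=
    (PreL2.mk_eq_mk_iff (PreL2.of (v₁ + k.1) hmem) v).2 hae'
  rw [← e]
  exact mem_Tmax_iff.2 ⟨PreL2.of (v₁ + k.1) hmem, g, hz, rfl⟩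

end FirstOrderSystem

/-! ### Linear relations in a Hilbert space -/

namespace LinearRelation

variable {H : Type*} [NormedAddCommGroup H] [InnerProductSpace ℂ H] {T : Submodule ℂ (H × H)}

/-- The elements `(u, lam u)` of `T`. -/
def eigen (T : Submodule ℂ (H × H)) (lam : ℂ) : Submodule ℂ (H × H) :=
  T ⊓ LinearMap.graph (lam • (LinearMap.id : H →ₗ[ℂ] H))

/-- The sum of the deficiency spaces at `i` and `-i`. -/
def deficiency (T : Submodule ℂ (H × H)) : Submodule ℂ (H × H) :=
  eigen T Complex.I ⊔ eigen T (-Complex.I)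

/-- The elements `(u, f)` of `T` with `⟨v, u⟩ + ⟨g, f⟩ = 0`. -/
def restriction (T : Submodule ℂ (H × H)) (v g : H) : Submodule ℂ (H × H) where
  carrier := {x | x ∈ T ∧ inner ℂ v x.1 + inner ℂ g x.2 = 0}
  add_mem' := by
    rintro x y ⟨h1, h2⟩ ⟨k1, k2⟩
    refine ⟨add_mem h1 k1, ?_⟩
    rw [Prod.fst_add, Prod.snd_add, inner_add_right, inner_add_right]
    linear_combination h2 + k2
  zero_mem' := ⟨zero_mem _, by simp⟩
  smul_mem' := by
    rintro c x ⟨h1, h2⟩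
    refine ⟨T.smul_mem c h1, ?_⟩
    rw [Prod.smul_fst, Prod.smul_snd, inner_smul_right, inner_smul_right]
    linear_combination c * h2

lemma mem_eigen {lam : ℂ} {x : H × H} : x ∈ eigen T lam ↔ x ∈ T ∧ x.2 = lam • x.1 := Iff.rfl

lemma deficiency_le : deficiency T ≤ T := sup_le inf_le_left inf_le_left

lemma adjoint_anti {T' : Submodule ℂ (H × H)} (h : T' ≤ T) : T.adjoint ≤ T'.adjoint := fun x hx => by
  rw [Submodule.mem_adjoint_iff] at hx ⊢
  exact fun a b hab => hx a b (h hab)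

lemma le_adjoint_adjoint : T ≤ T.adjoint.adjoint := fun x hx => by
  rw [Submodule.mem_adjoint_iff]
  intro a b hab
  have h := (Submodule.mem_adjoint_iff _ _).1 hab x.1 x.2 hx
  have h' := congrArg (starRingEnd ℂ) h
  rw [map_sub, inner_conj_symm, inner_conj_symm, map_zero] at h'
  linear_combination -h'

/-- The deficiency space is invariant under `(u, f) ↦ (f, -u)`. -/
lemma rotate_mem {x : H × H} (hx : x ∈ deficiency T) : (x.2, -x.1) ∈ deficiency T := by
  obtain ⟨p, hp, m, hm, rfl⟩ := Submodule.mem_sup.1 hx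
  have e : ((p + m).2, -(p + m).1) = Complex.I • p + (-Complex.I) • m := by
    ext1
    · simp [(mem_eigen.1 hp).2, (mem_eigen.1 hm).2]
    · simp only [Prod.fst_add, Prod.snd_add, Prod.smul_snd, (mem_eigen.1 hp).2, (mem_eigen.1 hm).2,
        smul_smul]
      simp
      abel
  rw [e]
  exact add_mem (Submodule.mem_sup_left (Submodule.smul_mem _ _ hp))
    (Submodule.mem_sup_right (Submodule.smul_mem _ _ hm))

/-- Membership in the adjoint is orthogonality to the rotated elements (f, -u) of T, and the
deficiency space is invariant under the rotation. -/
lemma adjoint_orthogonal {x t : H × H} (ht : t ∈ T.adjoint) (hx : x ∈ deficiency T) :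
    inner ℂ x.1 t.1 + inner ℂ x.2 t.2 = 0 := by
  have h := (Submodule.mem_adjoint_iff _ _).1 ht _ _ (deficiency_le (rotate_mem hx))
  rw [inner_neg_left] at h
  linear_combination -h

lemma eq_zero_of_inner {x : H × H} (h : inner ℂ x.1 x.1 + inner ℂ x.2 x.2 = 0) : x = 0 := by
  rw [inner_self_eq_norm_sq_to_K, inner_self_eq_norm_sq_to_K] at h
  have h' : ‖x.1‖ ^ 2 + ‖x.2‖ ^ 2 = 0 := Complex.ofReal_eq_zero.1 (by
    push_cast
    exact h)
  have h1 : ‖x.1‖ = 0 := by nlinarith [sq_nonneg ‖x.1‖, sq_nonneg ‖x.2‖]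
  have h2 : ‖x.2‖ = 0 := by nlinarith [sq_nonneg ‖x.1‖, sq_nonneg ‖x.2‖]
  exact Prod.ext (norm_eq_zero.1 h1) (norm_eq_zero.1 h2)

/-- Von Neumann's decomposition of a relation that is the adjoint of a closed symmetric one. -/
lemma exists_decomposition [CompleteSpace H] (h1 : T.adjoint ≤ T) (h2 : T.adjoint.adjoint ≤ T)
    {x : H × H} (hx : x ∈ T) : ∃ t ∈ T.adjoint, ∃ p ∈ eigen T Complex.I,
      ∃ m ∈ eigen T (-Complex.I), x = t + (p + m) := by
  -- The adjoint is the orthogonal complement of a rotated copy of T, hence closed, and it admits an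
  -- orthogonal projection. The inner product on pairs lives on `WithLp 2`.
  obtain ⟨A, _, hA⟩ : ∃ A : Submodule ℂ (WithLp 2 (H × H)), A.HasOrthogonalProjection ∧
      ∀ z : WithLp 2 (H × H), z ∈ A ↔ z.ofLp ∈ T.adjoint := by
    refine ⟨(T.map ((LinearEquiv.skewSwap ℂ H H).symm.trans
      (WithLp.linearEquiv 2 ℂ (H × H)).symm).toLinearMap)ᗮ, ?_, fun z => ?_⟩
    · have := Submodule.instOrthogonalCompleteSpace (T.map ((LinearEquiv.skewSwap ℂ H H).symm.trans
        (WithLp.linearEquiv 2 ℂ (H × H)).symm).toLinearMap)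
      exact Submodule.HasOrthogonalProjection.ofCompleteSpace _
    rw [Submodule.adjoint, Submodule.mem_map]
    constructor
    · exact fun h => ⟨z, h, rfl⟩
    · rintro ⟨w, hw, he⟩
      have : w = z := (WithLp.linearEquiv 2 ℂ (H × H)).injective he
      exact this ▸ hw
  obtain ⟨t, ht, y, hy, hxy⟩ := A.exists_add_mem_mem_orthogonal (WithLp.toLp 2 x)
  have ht' : t.ofLp ∈ T.adjoint := (hA t).1 ht
  have hx' : x = t.ofLp + y.ofLp := congrArg WithLp.ofLp hxy
  have hyT : y.ofLp ∈ T := by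
    rw [show y.ofLp = x - t.ofLp by rw [hx']; abel]
    exact sub_mem hx (h1 ht')
  -- As y is orthogonal to T*, its rotation belongs to T**, which is contained in T.
  have hrot : ((y.ofLp.2, -y.ofLp.1) : H × H) ∈ T := by
    refine h2 ((Submodule.mem_adjoint_iff _ _).2 fun a b hab => ?_)
    have h := hy (WithLp.toLp 2 (a, b)) ((hA _).2 hab)
    rw [WithLp.prod_inner_apply] at h
    simp only [inner_neg_right] at h ⊢
    linear_combination h
  -- For the rotation ρ one has ρ² = -1, so y splits into (y - iρy)/2 and (y + iρy)/2, on which the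
  -- second entry is i and -i times the first.
  refine ⟨t.ofLp, ht', (2⁻¹ : ℂ) • (y.ofLp - Complex.I • (y.ofLp.2, -y.ofLp.1)), ?_,
    (2⁻¹ : ℂ) • (y.ofLp + Complex.I • (y.ofLp.2, -y.ofLp.1)), ?_, ?_⟩
  · refine Submodule.smul_mem _ _ (mem_eigen.2 ⟨sub_mem hyT (T.smul_mem _ hrot), ?_⟩)
    simp only [Prod.fst_sub, Prod.snd_sub, Prod.smul_fst, Prod.smul_snd, smul_sub, smul_smul,
      Complex.I_mul_I]
    module
  · refine Submodule.smul_mem _ _ (mem_eigen.2 ⟨add_mem hyT (T.smul_mem _ hrot), ?_⟩)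
    simp only [Prod.fst_add, Prod.snd_add, Prod.smul_fst, Prod.smul_snd, smul_add, smul_smul,
      neg_mul, Complex.I_mul_I]
    module
  · rw [hx']
    module

lemma exists_decomposition' [CompleteSpace H] (h1 : T.adjoint ≤ T) (h2 : T.adjoint.adjoint ≤ T)
    {x : H × H} (hx : x ∈ T) : ∃ t ∈ T.adjoint, ∃ d ∈ deficiency T, x = t + d := by
  obtain ⟨t, ht, p, hp, m, hm, h⟩ := exists_decomposition h1 h2 hx
  exact ⟨t, ht, _, Submodule.add_mem_sup hp hm, h⟩

lemma adjoint_eq_of_deficiency_eq_bot [CompleteSpace H] (h1 : T.adjoint ≤ T)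
    (h2 : T.adjoint.adjoint ≤ T) (h : deficiency T = ⊥) : T.adjoint = T := by
  refine le_antisymm h1 fun x hx => ?_
  obtain ⟨t, ht, d, hd, rfl⟩ := exists_decomposition' h1 h2 hx
  rw [h, Submodule.mem_bot] at hd
  rwa [hd, add_zero]

/-- A boundary condition given by an element of the deficiency space on which the boundary form
vanishes defines a self-adjoint relation. -/
lemma adjoint_restriction [CompleteSpace H] (h1 : T.adjoint ≤ T) (h2 : T.adjoint.adjoint ≤ T)
    [FiniteDimensional ℂ (deficiency T)] (hd : Module.finrank ℂ (deficiency T) ≤ 2) {v g : H}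
    (hvg : (v, g) ∈ deficiency T) (h0 : (v, g) ≠ 0) (hs : inner ℂ v g = inner ℂ g v) :
    (restriction T v g).adjoint = restriction T v g := by
  have he : (g, -v) ∈ deficiency T := rotate_mem hvg
  have he0 : ((g, -v) : H × H) ≠ 0 := fun h => h0 (by
    rw [Prod.mk_eq_zero, neg_eq_zero] at h
    exact Prod.mk_eq_zero.2 h.symm)
  have hq : inner ℂ v v + inner ℂ g g ≠ 0 := fun h => h0 (eq_zero_of_inner (x := (v, g)) h)
  have hle : T.adjoint ≤ restriction T v g := fun t ht => ⟨h1 ht, adjoint_orthogonal ht hvg⟩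
  -- The equality ⟨v, g⟩ = ⟨g, v⟩ says that (g, -v) satisfies the boundary condition given by (v,
  -- g).
  have her : (g, -v) ∈ restriction T v g := ⟨deficiency_le he, by
    rw [inner_neg_right, hs]; ring⟩
  -- The same equality makes (v, g) and (g, -v) orthogonal, hence independent, and they span a space
  -- of dimension at most 2.
  have hspan : deficiency T ≤ Submodule.span ℂ (Set.range ![(v, g), (g, -v)]) := by
    have hli : LinearIndependent ℂ ![((v, g) : H × H), (g, -v)] := by
      rw [LinearIndependent.pair_iff]
      intro s r hsr
      have e1 : s • v + r • g = 0 := congrArg Prod.fst hsr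
      have e2 : s • g + r • -v = 0 := congrArg Prod.snd hsr
      have hs0 : s * (inner ℂ v v + inner ℂ g g) = 0 := by
        have i1 := congrArg (inner ℂ v) e1
        have i2 := congrArg (inner ℂ g) e2
        rw [inner_add_right, inner_smul_right, inner_smul_right, inner_zero_right] at i1 i2
        rw [inner_neg_right] at i2
        linear_combination i1 + i2 - r * hs
      have hs' : s = 0 := (mul_eq_zero.1 hs0).resolve_right hq
      rw [hs', zero_smul, zero_add] at hsr
      exact ⟨hs', (smul_eq_zero.1 hsr).resolve_right he0⟩
    have hsub : Submodule.span ℂ (Set.range ![(v, g), (g, -v)]) ≤ deficiency T := by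
      rw [Submodule.span_le]
      rintro _ ⟨i, rfl⟩
      fin_cases i
      · exact hvg
      · exact he
    refine (Submodule.eq_of_le_of_finrank_le hsub ?_).ge
    rw [finrank_span_eq_card hli, Fintype.card_fin]
    exact hd
  -- The condition removes the component along (v, g), so the restriction is T* enlarged by the
  -- single vector (g, -v).
  have hdec : ∀ x ∈ restriction T v g, ∃ t ∈ T.adjoint, ∃ β : ℂ, x = t + β • (g, -v) := by
    intro x hx
    obtain ⟨t, ht, d, hd, rfl⟩ := exists_decomposition' h1 h2 hx.1
    have hds := hspan hd
    rw [Matrix.range_cons, Matrix.range_cons, Matrix.range_empty, union_empty, singleton_union,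
      Submodule.mem_span_pair] at hds
    obtain ⟨α, β, rfl⟩ := hds
    refine ⟨t, ht, β, ?_⟩
    have e1 := ((restriction T v g).sub_mem hx (hle ht)).2
    have e2 := her.2
    simp only [add_sub_cancel_left, Prod.fst_add, Prod.snd_add, Prod.smul_mk, inner_add_right,
      inner_smul_right] at e1 e2
    have hα : α * (inner ℂ v v + inner ℂ g g) = 0 := by linear_combination e1 - β * e2
    rw [(mul_eq_zero.1 hα).resolve_right hq, zero_smul, zero_add]
  refine le_antisymm (fun x hx => ?_) fun x hx => ?_
  · refine ⟨h2 (adjoint_anti hle hx), ?_⟩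
    have h := (Submodule.mem_adjoint_iff _ _).1 hx _ _ her
    rw [inner_neg_left] at h
    linear_combination -h
  · rw [Submodule.mem_adjoint_iff]
    intro a b hab
    obtain ⟨t, ht, β, hx'⟩ := hdec _ hab
    have ha : a = t.1 + β • g := congrArg Prod.fst hx'
    have hb : b = t.2 + β • -v := congrArg Prod.snd hx'
    have h3 := (Submodule.mem_adjoint_iff _ _).1 (le_adjoint_adjoint hx.1) t.1 t.2 ht
    have h4 := hx.2
    rw [ha, hb, inner_add_left, inner_add_left, inner_smul_left, inner_smul_left, inner_neg_left]
    linear_combination h3 - (starRingEnd ℂ) β * h4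

/-- Every self-adjoint restriction is given by such a boundary condition. -/
lemma exists_restriction_eq [CompleteSpace H] (h1 : T.adjoint ≤ T) (h2 : T.adjoint.adjoint ≤ T)
    [FiniteDimensional ℂ (deficiency T)] (hd : Module.finrank ℂ (deficiency T) ≤ 2)
    (hne : deficiency T ≠ ⊥) {T' : Submodule ℂ (H × H)} (hT' : T' ≤ T) (hsa : T'.adjoint = T') :
    ∃ v g : H, (v, g) ∈ deficiency T ∧ (v, g) ≠ 0 ∧ inner ℂ v g = inner ℂ g v ∧
      T' = restriction T v g := by
  have hle : T.adjoint ≤ T' := hsa ▸ adjoint_anti hT'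
  -- If T' met the deficiency space only in 0, it would lie in T*; then T ⊆ T'* = T' ⊆ T*, and the
  -- deficiency space would be trivial.
  obtain ⟨e, he, heT, he0⟩ : ∃ e ∈ deficiency T, e ∈ T' ∧ e ≠ 0 := by
    by_contra! hcon
    have hT1 : T' ≤ T.adjoint := fun x hx => by
      obtain ⟨t, ht, d, hd, rfl⟩ := exists_decomposition' h1 h2 (hT' hx)
      have hd' : d ∈ T' := by
        have := sub_mem hx (hle ht)
        rwa [add_sub_cancel_left] at this
      rwa [hcon d hd hd', add_zero]
    have hT2 : T ≤ T.adjoint :=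
      (le_adjoint_adjoint.trans (adjoint_anti hT1)).trans (hsa.le.trans hT1)
    refine hne ((Submodule.eq_bot_iff _).2 fun d hd => ?_)
    exact eq_zero_of_inner (adjoint_orthogonal (hT2 (deficiency_le hd)) hd)
  have hself : ∀ x ∈ T', inner ℂ e.2 x.1 - inner ℂ e.1 x.2 = 0 := fun x hx => by
    rw [← hsa] at hx
    exact (Submodule.mem_adjoint_iff _ _).1 hx _ _ heT
  -- By symmetry the elements of T' are orthogonal to the rotation of e. So T' is contained in the
  -- restriction defined by that rotation, and of two nested self-adjoint relations neither is
  -- proper in the other.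
  have hvg : (-e.2, e.1) ∈ deficiency T := by
    have := Submodule.neg_mem _ (rotate_mem he)
    rwa [Prod.neg_mk, neg_neg] at this
  have hvg0 : (-e.2, e.1) ≠ 0 := fun h => he0 (by
    rw [Prod.mk_eq_zero, neg_eq_zero] at h
    exact Prod.ext h.2 h.1)
  have hs : inner ℂ (-e.2) e.1 = inner ℂ e.1 (-e.2) := by
    rw [inner_neg_left, inner_neg_right]
    linear_combination -hself e heT
  have hTr : T' ≤ restriction T (-e.2) e.1 := fun x hx => ⟨hT' hx, by
    rw [inner_neg_left]
    linear_combination -hself x hx⟩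
  refine ⟨-e.2, e.1, hvg, hvg0, hs, le_antisymm hTr ?_⟩
  rw [← adjoint_restriction h1 h2 hd hvg hvg0 hs, ← hsa]
  exact adjoint_anti hTr

end LinearRelation

/-! ### The first and second adjoint of T_max -/

namespace FirstOrderSystem

variable {n : ℕ} {S : FirstOrderSystem n}

/-- Green's formula for a compactly supported pair. -/
lemma inner_eq_of_compactlySupported {p q : S.PreL2 × S.PreL2} (hp : p ∈ S.maxPairs)
    (hc : CompactlySupported p) (hq : q ∈ S.maxPairs) : inner ℂ q.2 p.1 = inner ℂ q.1 p.2 := by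
  obtain ⟨x, hx, y, hy, hxy, h0⟩ := hc
  have d1 : ∀ t ∉ Icc x y, S.density q.2.fn p.1.fn t = 0 := fun t ht => by
    rw [density, (h0 t ht).1, Matrix.mulVec_zero, dotProduct_zero]
  have d2 : ∀ t ∉ Icc x y, S.density q.1.fn p.2.fn t = 0 := fun t ht => by
    rw [density, (h0 t ht).2, Matrix.mulVec_zero, dotProduct_zero]
  obtain ⟨d, hd, hyd⟩ := exists_gt_mem hy
  have e2 := form_eq_setIntegral hp hq hx hd (hxy.trans hyd.le) hyd.le
    (fun t ht => (h0 t fun h => absurd h.1 (not_le.2 ht)).1) (fun t ht => (h0 t ht).2) d1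
  rw [rightLim_eq_zero_of_gt hyd fun t ht => (h0 t fun h => absurd h.2 (not_le.2 ht)).1,
    form_zero_right, integral_sub] at e2
  · rw [inner_eq_setIntegral hx hy d1, inner_eq_setIntegral hx hy d2]
    linear_combination e2
  · rw [← restrict_ν_Icc hx hy]
    exact (S.density_integrable q.1.2.1 p.2.2.1 q.1.2.2 p.2.2.2).restrict
  · rw [← restrict_ν_Icc hx hy]
    exact (S.density_integrable q.2.2.1 p.1.2.1 q.2.2.2 p.1.2.2).restrict

lemma Definite.adjoint_le (hdef : S.Definite) : S.Tmax.adjoint ≤ S.Tmax := by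
  rintro ⟨x, y⟩ h
  obtain ⟨v, rfl⟩ := SeparationQuotient.surjective_mk x
  obtain ⟨g, rfl⟩ := SeparationQuotient.surjective_mk y
  refine hdef.exists_solution_of_orthogonal fun p hp _ => ?_
  exact (sub_eq_zero.1 ((Submodule.mem_adjoint_iff _ _).1 h _ _ ⟨p, hp, rfl⟩)).symm

/-- Compactly supported pairs of T_max belong to T_max*, Green's formula having no boundary terms
for them. An element of the second adjoint is thus orthogonal to them, which already puts it into
T_max. -/
lemma Definite.adjoint_adjoint_le (hdef : S.Definite) : S.Tmax.adjoint.adjoint ≤ S.Tmax := by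
  rintro ⟨x, y⟩ h
  obtain ⟨v, rfl⟩ := SeparationQuotient.surjective_mk x
  obtain ⟨g, rfl⟩ := SeparationQuotient.surjective_mk y
  refine hdef.exists_solution_of_orthogonal fun p hp hc => ?_
  refine (sub_eq_zero.1 ((Submodule.mem_adjoint_iff _ _).1 h (SeparationQuotient.mk p.1)
    (SeparationQuotient.mk p.2) ?_)).symm
  rw [Submodule.mem_adjoint_iff]
  rintro a b ⟨q, hq, he⟩
  rw [← show SeparationQuotient.mk q.1 = a from congrArg Prod.fst he,
    ← show SeparationQuotient.mk q.2 = b from congrArg Prod.snd he]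
  exact sub_eq_zero.2 (inner_eq_of_compactlySupported hp hc hq)

end FirstOrderSystem

namespace FirstOrderSystem

variable {n : ℕ} {S : FirstOrderSystem n} {u f v g : ℝ → Fin n → ℂ}

/-! ### Boundary values of the form -/

lemma hasBasis_towardsB (S : FirstOrderSystem n) :
    S.towardsB.HasBasis (fun c : ℝ => c ∈ S.interval) fun c => openInterval c S.b := by
  have h := (nhdsLT_basis_of_exists_lt ⟨S.a, S.a_lt_b⟩).comap (fun x : ℝ => (x : EReal))
  refine h.to_hasBasis (fun l hl => ?_) fun c hc => ⟨c, hc.2, Subset.rfl⟩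
  obtain ⟨c, h1, h2⟩ := EReal.lt_iff_exists_real_btwn.1 (max_lt hl S.a_lt_b)
  exact ⟨c, ⟨(le_max_right _ _).trans_lt h1, h2⟩, fun x hx =>
    ⟨((le_max_left _ _).trans_lt h1).trans hx.1, hx.2⟩⟩

lemma hasBasis_towardsA (S : FirstOrderSystem n) :
    S.towardsA.HasBasis (fun c : ℝ => c ∈ S.interval) fun c => openInterval S.a c := by
  have h := (nhdsGT_basis_of_exists_gt ⟨S.b, S.a_lt_b⟩).comap (fun x : ℝ => (x : EReal))
  refine h.to_hasBasis (fun l hl => ?_) fun c hc => ⟨c, hc.1, Subset.rfl⟩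
  obtain ⟨c, h1, h2⟩ := EReal.lt_iff_exists_real_btwn.1 (lt_min hl S.a_lt_b)
  exact ⟨c, ⟨h1, h2.trans_le (min_le_right _ _)⟩, fun x hx =>
    ⟨hx.1, hx.2.trans (h2.trans_le (min_le_left _ _))⟩⟩

instance : S.towardsB.NeBot := S.hasBasis_towardsB.neBot_iff.2 fun {_} hc => by
  obtain ⟨d, hd, hcd⟩ := exists_gt_mem hc
  exact ⟨d, mem_openInterval_coe_left.2 ⟨hcd, hd.2⟩⟩

instance : S.towardsA.NeBot := S.hasBasis_towardsA.neBot_iff.2 fun {_} hc => by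
  obtain ⟨d, hd, hcd⟩ := exists_lt_mem hc
  exact ⟨d, mem_openInterval_coe_right.2 ⟨hd.1, hcd⟩⟩

instance : S.towardsA.IsCountablyGenerated := by
  unfold towardsA; infer_instance

instance : S.towardsB.IsCountablyGenerated := by
  unfold towardsB; infer_instance

lemma eventually_towardsB {c : ℝ} (hc : c ∈ S.interval) :
    ∀ᶠ x in S.towardsB, x ∈ S.interval ∧ c < x := by
  filter_upwards [S.hasBasis_towardsB.mem_of_mem hc] with x hx
  exact ⟨openInterval_subset_right hc le_rfl hx, (mem_openInterval_coe_left.1 hx).1⟩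

lemma eventually_towardsA {c : ℝ} (hc : c ∈ S.interval) :
    ∀ᶠ x in S.towardsA, x ∈ S.interval ∧ x < c := by
  filter_upwards [S.hasBasis_towardsA.mem_of_mem hc] with x hx
  exact ⟨openInterval_subset_left hc le_rfl hx, (mem_openInterval_coe_right.1 hx).2⟩

lemma tendsto_neg_towardsB (S : FirstOrderSystem n) :
    Tendsto (Neg.neg : ℝ → ℝ) S.towardsB S.reflect.towardsA := by
  refine tendsto_comap_iff.2 (tendsto_nhdsWithin_iff.2 ⟨?_, ?_⟩)
  · have h : Tendsto (fun x : ℝ => (x : EReal)) S.towardsB (𝓝 S.b) :=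
      tendsto_comap.mono_right nhdsWithin_le_nhds
    have h' := (continuous_neg.tendsto S.b).comp h
    exact h'.congr fun x => (EReal.coe_neg x).symm
  · obtain ⟨c, hc⟩ := S.exists_mem_interval
    filter_upwards [eventually_towardsB hc] with x hx
    change -S.b < ((-x : ℝ) : EReal)
    rw [EReal.coe_neg]
    exact EReal.neg_lt_neg_iff.2 hx.1.2

/-- The integrand in Green's formula is integrable. -/
lemma integrable_green (hu : u ∈ S.sqIntegrable) (hf : f ∈ S.sqIntegrable)
    (hv : v ∈ S.sqIntegrable) (hg : g ∈ S.sqIntegrable) :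
    Integrable (fun t => S.density v f t - S.density g u t) S.ν :=
  (S.density_integrable hv.1 hf.1 hv.2 hf.2).sub (S.density_integrable hg.1 hu.1 hg.2 hu.2)

lemma Solves.form_sub_form (h : S.Solves S.a S.b u f) (k : S.Solves S.a S.b v g) {x y : ℝ}
    (hx : x ∈ S.interval) (hy : y ∈ S.interval) (hxy : x ≤ y) :
    S.form (Function.rightLim v y) (Function.rightLim u y)
      - S.form (Function.rightLim v x) (Function.rightLim u x)
      = ∫ t in Ioc x y, S.density v f t - S.density g u t ∂S.ν := by
  obtain ⟨i1, e1⟩ := h.green Subset.rfl k hx hy hxy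
  obtain ⟨i2, e2⟩ := h.green Subset.rfl k hx hx le_rfl
  have hI : Icc x x ∪ Ioc x y = Icc x y := by
    rw [Icc_self, singleton_union, Ioc_insert_left hxy]
  have hd : Disjoint (Icc x x) (Ioc x y) := by
    rw [Icc_self, disjoint_singleton_left]
    exact fun h => lt_irrefl _ h.1
  have e3 := setIntegral_union hd measurableSet_Ioc i2 (i1.mono_set (hI ▸ subset_union_right))
  rw [hI] at e3
  have e4 : S.ν.restrict (Ioc x y) = S.μ.restrict (Ioc x y) := by
    rw [ν, Measure.restrict_restrict measurableSet_Ioc, inter_eq_self_of_subset_left (t := S.interval)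
      (Ioc_subset_Icc_self.trans (openInterval_Icc_subset hx hy))]
  rw [e4]
  linear_combination e1 - e2 + e3

/-- Green's formula on (c, y], whose integrand is integrable up to b for square-integrable data;
this is why boundary values at b exist. -/
lemma Solves.tendsto_form_towardsB (h : S.Solves S.a S.b u f) (k : S.Solves S.a S.b v g)
    (hu : u ∈ S.sqIntegrable) (hf : f ∈ S.sqIntegrable) (hv : v ∈ S.sqIntegrable)
    (hg : g ∈ S.sqIntegrable) {c : ℝ} (hc : c ∈ S.interval) :
    Tendsto (fun y => S.form (Function.rightLim v y) (Function.rightLim u y)) S.towardsB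
      (𝓝 (S.form (Function.rightLim v c) (Function.rightLim u c)
        + ∫ t in Ioi c, S.density v f t - S.density g u t ∂S.ν)) := by
  have hcov : AECover (S.ν.restrict (Ioi c)) S.towardsB (fun y : ℝ => Iic y) := by
    refine ⟨?_, fun _ => measurableSet_Iic⟩
    filter_upwards [ae_restrict_of_ae S.ae_mem] with t ht
    filter_upwards [eventually_towardsB ht] with y hy using hy.2.le
  have hlim := hcov.integral_tendsto_of_countably_generated (integrable_green hu hf hv hg).restrict
  refine (hlim.const_add _).congr' ?_
  filter_upwards [eventually_towardsB hc] with y hy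
  rw [Measure.restrict_restrict measurableSet_Iic, inter_comm, Ioi_inter_Iic,
    ← h.form_sub_form k hc hy.1 hy.2.le]
  ring

/-- As the form vanishes at b, its value at y is minus Green's integral over (y, b), and y tends to
a. -/
lemma Solves.tendsto_form_towardsA (h : S.Solves S.a S.b u f) (k : S.Solves S.a S.b v g)
    (hu : u ∈ S.sqIntegrable) (hf : f ∈ S.sqIntegrable) (hv : v ∈ S.sqIntegrable)
    (hg : g ∈ S.sqIntegrable)
    (h0 : Tendsto (fun y => S.form (Function.rightLim v y) (Function.rightLim u y))
      S.towardsB (𝓝 0)) :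
    Tendsto (fun y => S.form (Function.rightLim v y) (Function.rightLim u y)) S.towardsA
      (𝓝 (-∫ t, S.density v f t - S.density g u t ∂S.ν)) := by
  have hcov : AECover S.ν S.towardsA (fun y : ℝ => Ioi y) := by
    refine ⟨?_, fun _ => measurableSet_Ioi⟩
    filter_upwards [S.ae_mem] with t ht
    filter_upwards [eventually_towardsA ht] with y hy using hy.2
  have hlim := hcov.integral_tendsto_of_countably_generated (integrable_green hu hf hv hg)
  obtain ⟨c, hc⟩ := S.exists_mem_interval
  refine hlim.neg.congr' ?_
  filter_upwards [eventually_towardsA hc] with y hy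
  have := tendsto_nhds_unique h0 (h.tendsto_form_towardsB k hu hf hv hg hy.1)
  linear_combination this

/-! ### Patching -/

lemma Solves.eqOn_right (h : S.Solves S.a S.b u f) (k : S.Solves S.a S.b v g) {d : ℝ}
    (hd : d ∈ S.interval) (hr : Function.rightLim u d = Function.rightLim v d)
    (hfg : ∀ t > d, f t = g t) : ∀ t ∈ S.interval, d < t → u t = v t := by
  have hsub : openInterval (d : EReal) S.b ⊆ S.interval := openInterval_subset_right hd le_rfl
  have hs : S.Solves S.a S.b (u + (-1 : ℂ) • v) (f + (-1 : ℂ) • g) := h.add (k.smul (-1))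
  have hu' : S.Solves d S.b (u + (-1 : ℂ) • v) ((0 : ℂ) • (u + (-1 : ℂ) • v)) :=
    Solves.congr hsub (hs.mono hsub) (fun _ _ => rfl) fun s hs => by
      have := hfg s (mem_openInterval_coe_left.1 hs).1
      congr 1
      simp [this]
  have lim := hu'.tendsto_right hd hd.2 le_rfl
  rw [rightLim_add_of_BV h.balanced.1 (k.smul (-1)).balanced.1 hd,
    rightLim_smul_of_BV _ k.balanced.1 hd, hr,
    show Function.rightLim v d + (-1 : ℂ) • Function.rightLim v d = 0 by module] at lim
  intro t ht hdt
  have := hu'.eq_zero_right hd le_rfl (fun s hs => S.regular_zero (hsub hs)) lim t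
    (mem_openInterval_coe_left.2 ⟨hdt, ht.2⟩)
  rw [Pi.add_apply, Pi.smul_apply, neg_one_smul, ← sub_eq_add_neg] at this
  exact sub_eq_zero.1 this

/-- On an interval where the system is definite, every antilinear functional of the value of the
homogeneous solutions at a point is represented by a homogeneous solution. -/
lemma exists_gram {x y : ℝ} (hx : x ∈ S.interval) (hy : y ∈ S.interval)
    (hnull : S.nullSolutions x y = ⊥) (ζ : Fin n → ℂ) : ∃ k : S.homSolutions,
      ∀ l : S.homSolutions, ∫ t in Icc x y, S.density l.1 k.1 t ∂S.μ
        = S.form (Function.rightLim l.1 y) ζ := by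
  have hinj : Function.Injective (S.compress hx hy) := by
    rw [← LinearMap.ker_eq_bot, LinearMap.ker_eq_bot']
    intro k hk
    have h1 := (PreL2.mk_eq_zero_iff (PreL2.of ((Icc x y).indicator k.1)
      (k.2.2.indicator_mem hx hy))).1 hk
    have h2 : k ∈ S.nullSolutions x y := by
      change ∀ᵐ t ∂S.ν.restrict (Icc x y), S.W t *ᵥ k.1 t = 0
      filter_upwards [ae_restrict_of_ae h1, ae_restrict_mem measurableSet_Icc] with t h3 h4
      rw [← indicator_of_mem h4 k.1]
      exact h3
    rw [hnull] at h2
    exact (Submodule.mem_bot ℂ).1 h2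
  -- No nonzero homogeneous solution is null on [x, y], so their compressions form an isomorphic
  -- finite-dimensional inner product space, to which the Riesz representation theorem applies.
  let M := LinearMap.range (S.compress hx hy)
  let e : S.homSolutions ≃ₗ[ℂ] M := LinearEquiv.ofInjective _ hinj
  let φ : S.homSolutions →ₗ[ℂ] ℂ :=
    { toFun := fun l => -S.form ζ (Function.rightLim l.1 y)
      map_add' := fun l m => by
        change -S.form ζ (Function.rightLim (l.1 + m.1) y) = _
        rw [rightLim_add_of_BV l.2.2.balanced.1 m.2.2.balanced.1 hy, form_add_right]
        ring
      map_smul' := fun c l => by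
        change -S.form ζ (Function.rightLim (c • l.1) y) = _
        rw [rightLim_smul_of_BV c l.2.2.balanced.1 hy, form_smul_right, RingHom.id_apply,
          smul_eq_mul]
        ring }
  obtain ⟨m, hm⟩ := (InnerProductSpace.toDual ℂ M).surjective
    (LinearMap.toContinuousLinearMap (φ.comp e.symm.toLinearMap))
  obtain ⟨k, rfl⟩ := e.surjective m
  refine ⟨k, fun l => ?_⟩
  have h1 : inner ℂ (e k) (e l) = -S.form ζ (Function.rightLim l.1 y) := by
    have h2 := DFunLike.congr_fun hm (e l)
    rw [InnerProductSpace.toDual_apply_apply] at h2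
    rw [h2]
    change φ (e.symm (e l)) = _
    rw [e.symm_apply_apply]
    rfl
  have h3 : inner ℂ (e l) (e k) = S.form (Function.rightLim l.1 y) ζ := by
    rw [← inner_conj_symm (e l) (e k), h1, map_neg]
    have := S.star_form ζ (Function.rightLim l.1 y)
    rw [Complex.star_def] at this
    rw [this, neg_neg]
  rw [← h3]
  change _ = inner ℂ (PreL2.of ((Icc x y).indicator l.1) (l.2.2.indicator_mem hx hy))
    (PreL2.of ((Icc x y).indicator k.1) (k.2.2.indicator_mem hx hy))
  rw [inner_eq_setIntegral hx hy]
  · refine setIntegral_congr_fun measurableSet_Icc fun t ht => ?_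
    change _ = star ((Icc x y).indicator l.1 t) ⬝ᵥ (S.W t *ᵥ (Icc x y).indicator k.1 t)
    rw [indicator_of_mem ht, indicator_of_mem ht]
    rfl
  · intro t ht
    change star ((Icc x y).indicator l.1 t) ⬝ᵥ (S.W t *ᵥ (Icc x y).indicator k.1 t) = 0
    rw [indicator_of_notMem ht, star_zero, zero_dotProduct]

lemma sqIntegrable_indicator {K : Set ℝ} (hK : MeasurableSet K) (hu : u ∈ S.sqIntegrable) :
    K.indicator u ∈ S.sqIntegrable := by
  refine ⟨hu.1.indicator hK, ?_⟩
  rw [density_indicator_self]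
  exact hu.2.indicator hK

/-- Every element of `T_max` agrees near `b` with one that vanishes near `a`. -/
lemma Definite.exists_patch (hdef : S.Definite) (h : S.Solves S.a S.b v g)
    (hv : v ∈ S.sqIntegrable) (hg : g ∈ S.sqIntegrable) :
    ∃ v' g', S.Solves S.a S.b v' g' ∧ v' ∈ S.sqIntegrable ∧ g' ∈ S.sqIntegrable ∧
      (∃ x ∈ S.interval, ∀ t < x, v' t = 0 ∧ g' t = 0) ∧
      ∃ y ∈ S.interval, ∀ t ∈ S.interval, y < t → v' t = v t := by
  obtain ⟨x, hx, y, hy, hxy, hnull⟩ := hdef.exists_compact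
  -- The right-hand side k on [x, y] steers the solution that is 0 to the left of x to the value
  -- v⁺(y), from where it continues as v.
  obtain ⟨k, hk⟩ := exists_gram hx hy hnull (Function.rightLim v y)
  set g' := (Icc x y).indicator k.1 + (Ioi y).indicator g with hg'
  have hg'm : g' ∈ S.sqIntegrable :=
    add_mem (k.2.2.indicator_mem hx hy) (sqIntegrable_indicator measurableSet_Ioi hg)
  have hg0 : ∀ t < x, g' t = 0 := fun t ht => by
    rw [hg', Pi.add_apply, indicator_of_notMem (fun h => absurd h.1 (not_le.2 ht)),
      indicator_of_notMem (fun h : t ∈ Ioi y => absurd h (not_lt.2 (ht.le.trans hxy))), add_zero]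
  have hg1 : ∀ t ∈ Icc x y, g' t = k.1 t := fun t ht => by
    rw [hg', Pi.add_apply, indicator_of_mem ht,
      indicator_of_notMem (fun h : t ∈ Ioi y => absurd h (not_lt.2 ht.2)), add_zero]
  have hg2 : ∀ t > y, g' t = g t := fun t ht => by
    rw [hg', Pi.add_apply, indicator_of_notMem (fun h => absurd h.2 (not_le.2 ht)),
      indicator_of_mem (show t ∈ Ioi y from ht), zero_add]
  obtain ⟨v', hv', h0⟩ := exists_solution_vanishing_left (locInt_of_mem hg'm) hx hg0
  obtain ⟨c, hc, hcx⟩ := exists_lt_mem hx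
  have hr : Function.rightLim v' y = Function.rightLim v y := by
    rw [← sub_eq_zero]
    refine eq_zero_of_form (S := S) fun ξ => ?_
    obtain ⟨l, hl, rfl⟩ := exists_solution hy LocInt.zero ξ
    have e1 := (hv'.green Subset.rfl hl hc hy (hcx.le.trans hxy)).2
    rw [leftLim_eq_zero_of_lt hcx h0, form_zero_right, sub_zero] at e1
    have e2 := hk ⟨_, hl.cut_mem_hom⟩
    have e3 : Function.rightLim (cut S.a S.b l) y = Function.rightLim l y :=
      (sided_congr hl.balanced.1 (fun t ht => cut_of_mem l ht) hy).2
    simp only [e3] at e2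
    have e4 : ∫ t in Icc c y, S.density l g' t - S.density 0 v' t ∂S.μ
        = ∫ t in Icc x y, S.density (cut S.a S.b l) k.1 t ∂S.μ := by
      rw [setIntegral_eq_of_subset_of_forall_sdiff_eq_zero measurableSet_Icc
        (Icc_subset_Icc_left hcx.le)]
      · refine setIntegral_congr_fun measurableSet_Icc fun t ht => ?_
        simp only [density, hg1 t ht, cut_of_mem l (openInterval_Icc_subset hx hy ht)]
        simp
      · intro t ht
        have : t < x := not_le.1 fun h => ht.2 ⟨h, ht.1.2⟩
        simp [density, hg0 t this]
    rw [e4, e2] at e1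
    rw [sub_eq_add_neg, ← neg_one_smul ℂ, form_add_right, form_smul_right, e1]
    ring
  have heq := hv'.eqOn_right h hy hr hg2
  have hvm : (Icc x y).indicator v' + (Ioi y).indicator v ∈ S.sqIntegrable :=
    add_mem (hv'.indicator_mem hx hy) (sqIntegrable_indicator measurableSet_Ioi hv)
  refine ⟨_, g', hv'.congr Subset.rfl (fun t ht => ?_) fun _ _ => rfl, hvm, hg'm,
    ⟨x, hx, fun t ht => ⟨?_, hg0 t ht⟩⟩, y, hy, fun t _ ht => ?_⟩
  · rw [Pi.add_apply]
    rcases lt_or_ge t x with h1 | h1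
    · rw [indicator_of_notMem (fun h => absurd h.1 (not_le.2 h1)), h0 t h1,
        indicator_of_notMem (fun h : t ∈ Ioi y => absurd h (not_lt.2 (h1.le.trans hxy))), add_zero]
    · rcases le_or_gt t y with h2 | h2
      · rw [indicator_of_mem (show t ∈ Icc x y from ⟨h1, h2⟩),
          indicator_of_notMem (fun h : t ∈ Ioi y => absurd h (not_lt.2 h2)), add_zero]
      · rw [indicator_of_notMem (fun h => absurd h.2 (not_le.2 h2)),
          indicator_of_mem (show t ∈ Ioi y from h2), zero_add, heq t ht h2]
  · rw [Pi.add_apply, indicator_of_notMem (fun h => absurd h.1 (not_le.2 ht)),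
      indicator_of_notMem (fun h : t ∈ Ioi y => absurd h (not_lt.2 (ht.le.trans hxy))), add_zero]
  · rw [Pi.add_apply, indicator_of_notMem (fun h => absurd h.2 (not_le.2 ht)),
      indicator_of_mem (show t ∈ Ioi y from ht), zero_add]

end FirstOrderSystem

/-! ### The boundary form vanishes at a limit-point endpoint -/

namespace FirstOrderSystem

section Vanishing

variable {n : ℕ} {S : FirstOrderSystem n} {p p' q : S.PreL2 × S.PreL2}

/-- The form of `q` and `p` vanishes at the endpoint `b`. -/
def VanishAtB (q p : S.PreL2 × S.PreL2) : Prop :=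
  Tendsto (fun y => S.form (Function.rightLim q.1.fn y) (Function.rightLim p.1.fn y)) S.towardsB
    (𝓝 0)

lemma VanishAtB.symm (h : VanishAtB q p) : VanishAtB p q := by
  have h' := (continuous_star.tendsto (0 : ℂ)).comp h
  rw [star_zero] at h'
  have h'' := h'.neg
  rw [neg_zero] at h''
  refine h''.congr fun y => ?_
  rw [Function.comp_apply, star_form, neg_neg]

lemma VanishAtB.add (h : VanishAtB q p) (h' : VanishAtB q p') (hp : p ∈ S.maxPairs)
    (hp' : p' ∈ S.maxPairs) : VanishAtB q (p + p') := by
  have hs := Tendsto.add h h'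
  rw [add_zero] at hs
  obtain ⟨c, hc⟩ := S.exists_mem_interval
  refine hs.congr' ?_
  filter_upwards [eventually_towardsB hc] with y hy
  rw [← form_add_right, ← rightLim_add_of_BV (Solves.balanced hp).1 (Solves.balanced hp').1 hy.1]
  rfl

/-- The balanced representative of an element of `T_max` is unique. -/
lemma Definite.eqOn_of_classes_eq (hdef : S.Definite) (hp : p ∈ S.maxPairs) (hq : q ∈ S.maxPairs)
    (h : S.classes p = S.classes q) : ∀ x ∈ S.interval, p.1.fn x = q.1.fn x := by
  have h1 := (PreL2.mk_eq_mk_iff p.1 q.1).1 (congrArg Prod.fst h)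
  have h2 := (PreL2.mk_eq_mk_iff p.2 q.2).1 (congrArg Prod.snd h)
  have hs : S.Solves S.a S.b (p - q).1.fn (p - q).2.fn := sub_mem hp hq
  have hs0 : S.Solves S.a S.b (p - q).1.fn 0 := hs.congr_ae (by
    filter_upwards [h2] with x hx
    change S.W x *ᵥ 0 = S.W x *ᵥ (p.2.fn x - q.2.fn x)
    rw [Matrix.mulVec_sub, hx, sub_self, Matrix.mulVec_zero])
  intro x hx
  refine sub_eq_zero.1 (hdef _ hs0 ?_ x hx)
  filter_upwards [h1] with t ht
  change S.W t *ᵥ (p.1.fn t - q.1.fn t) = 0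
  rw [Matrix.mulVec_sub, ht, sub_self]

lemma VanishAtB.congr_right (h : VanishAtB q p) (hp : p ∈ S.maxPairs) {c : ℝ}
    (hc : c ∈ S.interval) (he : ∀ x ∈ S.interval, c < x → p'.1.fn x = p.1.fn x) :
    VanishAtB q p' := by
  refine Tendsto.congr' ?_ h
  have hsub : openInterval (c : EReal) S.b ⊆ S.interval := openInterval_subset_right hc le_rfl
  filter_upwards [eventually_towardsB hc] with y hy
  rw [(sided_congr (Solves.mono hp hsub).balanced.1
    (fun x hx => he x (hsub hx) (mem_openInterval_coe_left.1 hx).1)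
    (mem_openInterval_coe_left.2 ⟨hy.2, hy.1.2⟩)).2]

/-- The form vanishes at `b` if one of the entries belongs to the minimal relation. -/
lemma Definite.vanishAtB_of_mem_adjoint (hdef : S.Definite) (hp : p ∈ S.maxPairs)
    (hpa : S.classes p ∈ S.Tmax.adjoint) (hq : q ∈ S.maxPairs) : VanishAtB p q := by
  -- Only the behaviour of q near b matters, so q may be replaced by an element that vanishes near
  -- a. For it the boundary value at b is the full Green integral, which is 0 since p belongs to the
  -- adjoint.
  obtain ⟨v, g, hs, hv, hg, ⟨x, hx, h0⟩, y, hy, he⟩ := hdef.exists_patch hq q.1.2 q.2.2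
  let q' : S.PreL2 × S.PreL2 := (PreL2.of v hv, PreL2.of g hg)
  have hq' : q' ∈ S.maxPairs := hs
  refine VanishAtB.congr_right (p := q') ?_ hq' hy fun t ht hyt => (he t ht hyt).symm
  refine VanishAtB.symm ?_
  obtain ⟨c, hc, hcx⟩ := exists_lt_mem hx
  have h := Solves.tendsto_form_towardsB hp hs p.1.2 p.2.2 hv hg hc
  have e0 : Function.rightLim v c = 0 := by
    refine rightLim_eq_of_tendsto (tendsto_const_nhds.congr' ?_)
    filter_upwards [Ioo_mem_nhdsGT hcx] with t ht
    exact (h0 t ht.2).1.symm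
  have e1 : inner ℂ q'.2 p.1 - inner ℂ q'.1 p.2 = 0 :=
    (Submodule.mem_adjoint_iff _ _).1 hpa _ _ ⟨q', hq', rfl⟩
  have e2 : ∫ t, S.density v p.2.fn t - S.density g p.1.fn t ∂S.ν = 0 := by
    have i1 : Integrable (S.density v p.2.fn) S.ν :=
      S.density_integrable hv.1 p.2.2.1 hv.2 p.2.2.2
    have i2 : Integrable (S.density g p.1.fn) S.ν :=
      S.density_integrable hg.1 p.1.2.1 hg.2 p.1.2.2
    rw [integral_sub i1 i2]
    have e3 : (∫ t, S.density g p.1.fn t ∂S.ν) - ∫ t, S.density v p.2.fn t ∂S.ν = 0 := e1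
    linear_combination -e3
  rw [setIntegral_eq_integral_of_forall_compl_eq_zero, e0, form_zero_left, zero_add, e2] at h
  · exact h
  · intro t ht
    obtain ⟨hv0, hg0⟩ := h0 t ((not_lt.1 ht).trans_lt hcx)
    simp [density, hv0, hg0]

lemma exists_eigen_rep {lam : ℂ} {x : S.L2 × S.L2} (hx : x ∈ LinearRelation.eigen S.Tmax lam) :
    ∃ z : S.PreL2, S.Solves S.a S.b z.fn (lam • z.fn) ∧ S.classes (z, lam • z) = x := by
  have hx' : x ∈ LinearMap.range (S.toDeficiency lam) := by
    rw [range_toDeficiency]; exact hx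
  obtain ⟨w, rfl⟩ := hx'
  exact ⟨PreL2.of w.1 w.2.2.2, w.2.2.1, rfl⟩

end Vanishing

variable {S : FirstOrderSystem 2} {lam : ℂ}

lemma LimitPointAtB.exists_generator (h : S.LimitPointAtB) {c : ℝ} (hc : c ∈ S.interval)
    (hl : lam.im ≠ 0) : ∃ z ∈ S.sqSolutions c S.b lam, ∀ w ∈ S.sqSolutions c S.b lam,
      ∃ α : ℂ, w = α • z := by
  have hr := h c hc lam hl
  have hf : Module.finrank ℂ (S.sqSolutions c S.b lam) = 1 := by
    rw [Module.finrank, hr, map_one]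
  obtain ⟨z, -, hz⟩ := finrank_eq_one_iff'.1 hf
  refine ⟨z.1, z.2, fun w hw => ?_⟩
  obtain ⟨α, hα⟩ := hz ⟨w, hw⟩
  exact ⟨α, (congrArg Subtype.val hα).symm⟩

/-- The energy increases, is at most 0 by `IsReal.height_nonpos`, and exceeds any negative number
somewhere by `IsReal.exists_height_gt`. -/
lemma IsReal.tendsto_height (hS : S.IsReal) (h : S.LimitPointAtB) {c : ℝ} (hc : c ∈ S.interval)
    (hl : lam.im ≠ 0) {z : ℝ → Fin 2 → ℂ} (hz : z ∈ S.sqSolutions c S.b lam) :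
    Tendsto (fun y => S.height lam (Function.rightLim z y)) S.towardsB (𝓝 0) := by
  have hC := hS.limitPointAtB_iff.1 h
  have hsub : openInterval (c : EReal) S.b ⊆ S.interval := openInterval_subset_right hc le_rfl
  refine tendsto_order.2 ⟨fun κ hκ => ?_, fun κ hκ => ?_⟩
  · obtain ⟨y₀, hy₀, h0⟩ := hS.exists_height_gt hC hc hl hz.2.1 hκ
    filter_upwards [eventually_towardsB (hsub hy₀)] with y hy
    have hyc : c < y := (mem_openInterval_coe_left.1 hy₀).1.trans hy.2
    exact h0.trans_le (hz.2.1.height_right_mono hsub hl hy₀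
      (mem_openInterval_coe_left.2 ⟨hyc, hy.1.2⟩) hy.2.le)
  · filter_upwards [eventually_towardsB hc] with y hy
    exact (hS.height_nonpos hC hc hl hz.2.1 (sqOn_of_mem hsub hz)
      (mem_openInterval_coe_left.2 ⟨hy.2, hy.1.2⟩)).trans_lt hκ

lemma exists_smul_rightLim {c : ℝ} (hc : c ∈ S.interval) {z u : ℝ → Fin 2 → ℂ}
    (hz : z ∈ S.sqSolutions c S.b lam)
    (hgen : ∀ w ∈ S.sqSolutions c S.b lam, ∃ α : ℂ, w = α • z)
    (hu : S.Solves S.a S.b u (lam • u)) (hs : u ∈ S.sqIntegrable) :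
    ∃ α : ℂ, ∀ y ∈ openInterval (c : EReal) S.b,
      Function.rightLim u y = α • Function.rightLim z y := by
  have hsub : openInterval (c : EReal) S.b ⊆ S.interval := openInterval_subset_right hc le_rfl
  have hsq : S.SqOn S.a S.b u := Integrable.re hs.2
  obtain ⟨α, hα⟩ := hgen _ ((hu.mono hsub).cut_mem hsub (hsq.mono hsub))
  refine ⟨α, fun y hy => ?_⟩
  rw [← rightLim_smul_of_BV α hz.2.1.balanced.1 hy, ← hα]
  exact ((sided_congr (hu.mono hsub).balanced.1 (fun x hx => cut_of_mem u hx) hy).2).symm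

/-- In the limit-point case the form of two eigenfunctions for the same parameter vanishes. -/
lemma IsReal.tendsto_form_eigen (hS : S.IsReal) (h : S.LimitPointAtB) (hl : lam.im ≠ 0)
    {u v : ℝ → Fin 2 → ℂ} (hu : S.Solves S.a S.b u (lam • u)) (hus : u ∈ S.sqIntegrable)
    (hv : S.Solves S.a S.b v (lam • v)) (hvs : v ∈ S.sqIntegrable) :
    Tendsto (fun y => S.form (Function.rightLim v y) (Function.rightLim u y)) S.towardsB
      (𝓝 0) := by
  obtain ⟨c, hc⟩ := S.exists_mem_interval
  obtain ⟨z, hz, hgen⟩ := h.exists_generator hc hl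
  obtain ⟨α, hα⟩ := exists_smul_rightLim hc hz hgen hu hus
  obtain ⟨β, hβ⟩ := exists_smul_rightLim hc hz hgen hv hvs
  have h1 := hS.tendsto_height h hc hl hz
  have h2 : Tendsto (fun y => star β * (α * (((2 * lam.im * S.height lam (Function.rightLim z y) :
      ℝ) : ℂ) * Complex.I))) S.towardsB (𝓝 0) := by
    have h3 := ((Complex.continuous_ofReal.tendsto _).comp
      (h1.const_mul (2 * lam.im))).mul_const Complex.I
    have h4 := (h3.const_mul α).const_mul (star β)
    simpa using h4
  refine h2.congr' ?_
  filter_upwards [eventually_towardsB hc] with y hy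
  have hy' := mem_openInterval_coe_left.2 ⟨hy.2, hy.1.2⟩
  rw [hα y hy', hβ y hy', form_smul_left, form_smul_right, form_self_eq_height hl]

/-- In the limit-point case the form of two eigenfunctions for conjugate parameters vanishes. -/
lemma IsReal.tendsto_form_conj (hS : S.IsReal) (h : S.LimitPointAtB) (hl : lam.im ≠ 0)
    {u v : ℝ → Fin 2 → ℂ} (hu : S.Solves S.a S.b u (lam • u)) (hus : u ∈ S.sqIntegrable)
    (hv : S.Solves S.a S.b v (star lam • v)) (hvs : v ∈ S.sqIntegrable) :
    Tendsto (fun y => S.form (Function.rightLim v y) (Function.rightLim u y)) S.towardsB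
      (𝓝 0) := by
  obtain ⟨c, hc⟩ := S.exists_mem_interval
  obtain ⟨z, hz, hgen⟩ := h.exists_generator hc hl
  -- The conjugate of v solves the equation for λ, so near b it is a multiple of the same z as u.
  -- The form of v and u becomes the bracket of two multiples of z, which is 0.
  have hw : S.Solves S.a S.b (fun x => star (v x)) (lam • fun x => star (v x)) := by
    have := hv.conj hS Subset.rfl
    refine this.congr Subset.rfl (fun _ _ => rfl) fun x _ => ?_
    simp
  have hws : (fun x => star (v x)) ∈ S.sqIntegrable := by
    refine ⟨continuous_star.comp_aestronglyMeasurable hvs.1, ?_⟩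
    refine ((Integrable.re hvs.2).ofReal (𝕜 := ℂ)).congr ?_
    filter_upwards [S.ae_mem] with x hx
    rw [density_self_re (fun x => star (v x)) hx, hS.density_star v hx]
    rfl
  obtain ⟨α, hα⟩ := exists_smul_rightLim hc hz hgen hu hus
  obtain ⟨β, hβ⟩ := exists_smul_rightLim hc hz hgen hw hws
  refine tendsto_const_nhds.congr' ?_
  filter_upwards [eventually_towardsB hc] with y hy
  have hy' := mem_openInterval_coe_left.2 ⟨hy.2, hy.1.2⟩
  have e : Function.rightLim v y = star (β • Function.rightLim z y) := by
    rw [← hβ y hy']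
    have : Tendsto (fun x => star (v x)) (𝓝[>] y) (𝓝 (star (Function.rightLim v y))) :=
      (continuous_star.tendsto _).comp (locallyBV_tendsto hv.balanced.1 hy.1).2
    rw [rightLim_eq_of_tendsto this, star_star]
  rw [hα y hy', e]
  change (0 : ℂ) = S.bracket (β • Function.rightLim z y) (α • Function.rightLim z y)
  rw [hS.bracket_eq]
  simp only [Pi.smul_apply, smul_eq_mul]
  ring

/-- By von Neumann's decomposition only two kinds of pairings remain. Elements of T_max* are covered
by `Definite.vanishAtB_of_mem_adjoint`. For eigenfunctions to ±i the form is a multiple of an energy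
tending to 0 when the parameters are equal, and a bracket of proportional vectors when they are
conjugate. -/
lemma IsReal.vanishAtB (hS : S.IsReal) (hdef : S.Definite) (h : S.LimitPointAtB)
    {p q : S.PreL2 × S.PreL2} (hp : p ∈ S.maxPairs) (hq : q ∈ S.maxPairs) : VanishAtB q p := by
  have hI : (Complex.I).im ≠ 0 := by simp
  have hI' : (-Complex.I).im ≠ 0 := by simp
  have sI : star Complex.I = -Complex.I := Complex.conj_I
  have sI' : star (-Complex.I) = Complex.I := by rw [star_neg, sI, neg_neg]
  obtain ⟨c, hc⟩ := S.exists_mem_interval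
  have dec : ∀ p ∈ S.maxPairs, ∃ t ∈ S.maxPairs, S.classes t ∈ S.Tmax.adjoint ∧
      ∃ z w : S.PreL2, S.Solves S.a S.b z.fn (Complex.I • z.fn) ∧
        S.Solves S.a S.b w.fn (-Complex.I • w.fn) ∧
        ∀ x ∈ S.interval, p.1.fn x = (t + ((z, Complex.I • z) + (w, -Complex.I • w))).1.fn x := by
    intro p hp
    obtain ⟨t, ht, d, hd, e, he, hpe⟩ := LinearRelation.exists_decomposition hdef.adjoint_le
      hdef.adjoint_adjoint_le (x := S.classes p) ⟨p, hp, rfl⟩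
    obtain ⟨t', ht', rfl⟩ := hdef.adjoint_le ht
    obtain ⟨z, hz, rfl⟩ := exists_eigen_rep hd
    obtain ⟨w, hw, rfl⟩ := exists_eigen_rep he
    refine ⟨t', ht', ht, z, w, hz, hw, hdef.eqOn_of_classes_eq hp ?_ ?_⟩
    · exact add_mem ht' (add_mem hz hw)
    · rw [hpe, map_add, map_add]
  have key : ∀ (lam : ℂ), (lam = Complex.I ∨ lam = -Complex.I) → ∀ z : S.PreL2,
      S.Solves S.a S.b z.fn (lam • z.fn) → ∀ q ∈ S.maxPairs, VanishAtB q (z, lam • z) := by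
    intro lam hlam z hz q hq
    obtain ⟨t, ht, hta, y, w, hy, hw, he⟩ := dec q hq
    have hzm : (z, lam • z) ∈ S.maxPairs := hz
    refine VanishAtB.symm (VanishAtB.congr_right ?_ (add_mem ht (add_mem hy hw)) hc
      fun x hx _ => he x hx)
    refine VanishAtB.add (hdef.vanishAtB_of_mem_adjoint ht hta hzm).symm
      (VanishAtB.add ?_ ?_ hy hw) ht (add_mem hy hw)
    · rcases hlam with rfl | rfl
      · exact hS.tendsto_form_eigen h hI hy y.2 hz z.2
      · exact hS.tendsto_form_conj h hI hy y.2 (by rw [sI]; exact hz) z.2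
    · rcases hlam with rfl | rfl
      · exact hS.tendsto_form_conj h hI' hw w.2 (by rw [sI']; exact hz) z.2
      · exact hS.tendsto_form_eigen h hI' hw w.2 hz z.2
  obtain ⟨t, ht, hta, z, w, hz, hw, he⟩ := dec p hp
  refine VanishAtB.congr_right ?_ (add_mem ht (add_mem hz hw)) hc fun x hx _ => he x hx
  exact VanishAtB.add (hdef.vanishAtB_of_mem_adjoint ht hta hq).symm
    (VanishAtB.add (key _ (Or.inl rfl) z hz q hq) (key _ (Or.inr rfl) w hw q hq) hz hw) ht
    (add_mem hz hw)

/-- In the limit-point case at `b`, the boundary form at `a` is given by the integrals in Green's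
formula. -/
lemma IsReal.tendsto_form_towardsA (hS : S.IsReal) (hdef : S.Definite) (h : S.LimitPointAtB)
    {u f v g : ℝ → Fin 2 → ℂ} (hu : S.Solves S.a S.b u f) (hv : S.Solves S.a S.b v g)
    (hus : u ∈ S.sqIntegrable) (hfs : f ∈ S.sqIntegrable) (hvs : v ∈ S.sqIntegrable)
    (hgs : g ∈ S.sqIntegrable) :
    Tendsto (fun y => S.form (Function.rightLim v y) (Function.rightLim u y)) S.towardsA
      (𝓝 (-∫ t, S.density v f t - S.density g u t ∂S.ν)) :=
  hu.tendsto_form_towardsA hv hus hfs hvs hgs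
    (hS.vanishAtB hdef h (p := (PreL2.of u hus, PreL2.of f hfs))
      (q := (PreL2.of v hvs, PreL2.of g hgs)) hu hv)

end FirstOrderSystem

/-! ### Boundary conditions at the limit-circle endpoint -/

namespace FirstOrderSystem

section Reflection

variable {n : ℕ} {S : FirstOrderSystem n}

lemma Definite.reflect (hdef : S.Definite) : S.reflect.Definite := by
  intro u hu hz x hx
  have h1 : S.Solves S.a S.b (fun x => u (-x)) fun _ => 0 := by
    refine (solves_reflect_iff Subset.rfl).1 ?_
    simp only [neg_neg]
    exact hu
  rw [reflect_ν, measurableEmbedding_neg_real.ae_map_iff] at hz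
  have h2 : ∀ᵐ x ∂S.ν, S.W x *ᵥ u (-x) = 0 := by
    filter_upwards [hz] with t ht
    have : S.W (- -t) *ᵥ u (-t) = 0 := ht
    rwa [neg_neg] at this
  have h3 := hdef _ h1 h2 (-x) (mem_reflect_interval.1 hx)
  rwa [neg_neg] at h3

end Reflection

variable {S : FirstOrderSystem 2}

/-- In the limit-point case at `a`, the boundary form at `b` is given by the integrals in Green's
formula. -/
lemma IsReal.tendsto_form_leftLim_towardsB (hS : S.IsReal) (hdef : S.Definite)
    (h : S.LimitPointAtA) {u f v g : ℝ → Fin 2 → ℂ} (hu : S.Solves S.a S.b u f)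
    (hv : S.Solves S.a S.b v g) (hus : u ∈ S.sqIntegrable) (hfs : f ∈ S.sqIntegrable)
    (hvs : v ∈ S.sqIntegrable) (hgs : g ∈ S.sqIntegrable) :
    Tendsto (fun y => S.form (Function.leftLim v y) (Function.leftLim u y)) S.towardsB
      (𝓝 (∫ t, S.density v f t - S.density g u t ∂S.ν)) := by
  have h1 := hS.reflect.tendsto_form_towardsA hdef.reflect (limitPointAtA_iff_reflect.1 h)
    (hu.reflect Subset.rfl) (hv.reflect Subset.rfl) (mem_sqIntegrable_reflect.2 hus)
    (mem_sqIntegrable_reflect.2 hfs) (mem_sqIntegrable_reflect.2 hvs)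
    (mem_sqIntegrable_reflect.2 hgs)
  simp only [reflect_density, reflect_form] at h1
  rw [reflect_ν, measurableEmbedding_neg_real.integral_map] at h1
  simp only [neg_neg] at h1
  have h2 := (h1.comp S.tendsto_neg_towardsB).neg
  rw [neg_neg] at h2
  refine h2.congr' ?_
  obtain ⟨c, hc⟩ := S.exists_mem_interval
  filter_upwards [eventually_towardsB hc] with y hy
  have e : ∀ w : ℝ → Fin 2 → ℂ, IsBalancedBV S.a S.b w →
      Function.rightLim (fun t => w (-t)) (-y) = Function.leftLim w y := fun w hw =>
    rightLim_comp_neg (by rw [neg_neg]; exact (locallyBV_tendsto hw.1 hy.1).1)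
  rw [Function.comp_apply, e u hu.balanced, e v hv.balanced, neg_neg]

/-- A relation given by a boundary condition in terms of representatives. -/
lemma restriction_eq_image (P : S.PreL2 × S.PreL2 → Prop) (v g : S.PreL2)
    (h : ∀ p ∈ S.maxPairs, P p ↔ inner ℂ v p.1 + inner ℂ g p.2 = 0) :
    (LinearRelation.restriction S.Tmax (SeparationQuotient.mk v) (SeparationQuotient.mk g) :
      Set (S.L2 × S.L2)) = S.classes '' {p | p ∈ S.maxPairs ∧ P p} := by
  ext x
  constructor
  · rintro ⟨⟨p, hp, rfl⟩, hx⟩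
    exact ⟨p, ⟨hp, (h p hp).2 hx⟩, rfl⟩
  · rintro ⟨p, ⟨hp, hP⟩, rfl⟩
    exact ⟨⟨p, hp, rfl⟩, (h p hp).1 hP⟩

lemma integral_green (p q : S.PreL2 × S.PreL2) :
    ∫ t, S.density q.1.fn p.2.fn t - S.density q.2.fn p.1.fn t ∂S.ν
      = inner ℂ q.1 p.2 - inner ℂ q.2 p.1 :=
  integral_sub (S.density_integrable q.1.2.1 p.2.2.1 q.1.2.2 p.2.2.2)
    (S.density_integrable q.2.2.1 p.1.2.1 q.2.2.2 p.1.2.2)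

/-- The form vanishes at b, so Green's identity with (g, -v) gives (g*Ju)⁺(a) = -(⟨v, u⟩ + ⟨g, f⟩):
the boundary condition is orthogonality to (v, g). -/
lemma IsReal.restriction_eq_restrictionAtA (hS : S.IsReal) (hdef : S.Definite)
    (h : S.LimitPointAtB) {v g : S.PreL2} (hg : (g, -v) ∈ S.maxPairs) :
    (LinearRelation.restriction S.Tmax (SeparationQuotient.mk v) (SeparationQuotient.mk g) :
      Set (S.L2 × S.L2)) = S.restrictionAtA g := by
  refine restriction_eq_image _ v g fun p hp => ?_
  have h1 := hS.tendsto_form_towardsA hdef h hp hg p.1.2 p.2.2 g.2 (-v).2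
  have h2 := integral_green p (g, -v)
  have h3 : inner ℂ (-v) p.1 = -inner ℂ v p.1 := inner_neg_left v p.1
  simp only [h3] at h2
  constructor
  · intro h0
    have e := tendsto_nhds_unique h0 h1
    have e' : (0 : ℂ) = -(inner ℂ g p.2 - -inner ℂ v p.1) := e.trans (congrArg _ h2)
    linear_combination e'
  · intro h0
    have e : -∫ t, S.density g.fn p.2.fn t - S.density (-v).fn p.1.fn t ∂S.ν = 0 := by
      refine (congrArg _ h2).trans ?_
      linear_combination -h0
    exact e ▸ h1

lemma IsReal.restriction_eq_restrictionAtB (hS : S.IsReal) (hdef : S.Definite)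
    (h : S.LimitPointAtA) {v g : S.PreL2} (hg : (g, -v) ∈ S.maxPairs) :
    (LinearRelation.restriction S.Tmax (SeparationQuotient.mk v) (SeparationQuotient.mk g) :
      Set (S.L2 × S.L2)) = S.restrictionAtB g := by
  refine restriction_eq_image _ v g fun p hp => ?_
  have h1 := hS.tendsto_form_leftLim_towardsB hdef h hp hg p.1.2 p.2.2 g.2 (-v).2
  have h2 := integral_green p (g, -v)
  have h3 : inner ℂ (-v) p.1 = -inner ℂ v p.1 := inner_neg_left v p.1
  simp only [h3] at h2
  constructor
  · intro h0
    have e := tendsto_nhds_unique h0 h1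
    have e' : (0 : ℂ) = inner ℂ g p.2 - -inner ℂ v p.1 := e.trans h2
    linear_combination -e'
  · intro h0
    have e : ∫ t, S.density g.fn p.2.fn t - S.density (-v).fn p.1.fn t ∂S.ν = 0 := by
      refine h2.trans ?_
      linear_combination h0
    exact e ▸ h1

/-- The self-adjoint restrictions in the case of deficiency indices one, for a boundary condition
`R g` that expresses the orthogonality to `(v, g)`. -/
lemma Definite.selfAdjoint_restrictions (hdef : S.Definite) (hp : S.nPlus = 1) (hm : S.nMinus = 1)
    {R : S.PreL2 → Set (S.L2 × S.L2)}
    (hR : ∀ v g : S.PreL2, (g, -v) ∈ S.maxPairs →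
      (LinearRelation.restriction S.Tmax (SeparationQuotient.mk v) (SeparationQuotient.mk g) :
        Set (S.L2 × S.L2)) = R g) :
    (∀ T : Submodule ℂ (S.L2 × S.L2), S.IsSelfAdjointRestriction T →
      ∃ v g : S.PreL2, S.IsBoundaryElement v g ∧ (T : Set (S.L2 × S.L2)) = R g) ∧
    (∀ v g : S.PreL2, S.IsBoundaryElement v g →
      ∃ T : Submodule ℂ (S.L2 × S.L2), S.IsSelfAdjointRestriction T ∧
        (T : Set (S.L2 × S.L2)) = R g) := by
  have f1 : Module.finrank ℂ (S.deficiencySpace Complex.I) = 1 := by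
    rw [Module.finrank, show Module.rank ℂ (S.deficiencySpace Complex.I) = 1 from hp, map_one]
  have f2 : Module.finrank ℂ (S.deficiencySpace (-Complex.I)) = 1 := by
    rw [Module.finrank, show Module.rank ℂ (S.deficiencySpace (-Complex.I)) = 1 from hm, map_one]
  have i1 : FiniteDimensional ℂ (S.deficiencySpace Complex.I) :=
    FiniteDimensional.of_finrank_eq_succ f1
  have i2 : FiniteDimensional ℂ (S.deficiencySpace (-Complex.I)) :=
    FiniteDimensional.of_finrank_eq_succ f2
  have hD : LinearRelation.deficiency S.Tmax
      = S.deficiencySpace Complex.I ⊔ S.deficiencySpace (-Complex.I) := rfl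
  have i3 : FiniteDimensional ℂ (LinearRelation.deficiency S.Tmax) := by
    rw [hD]; infer_instance
  have hd : Module.finrank ℂ (LinearRelation.deficiency S.Tmax) ≤ 2 := by
    rw [hD]
    have := Submodule.finrank_add_le_finrank_add_finrank (S.deficiencySpace Complex.I)
      (S.deficiencySpace (-Complex.I))
    rwa [f1, f2] at this
  have hne : LinearRelation.deficiency S.Tmax ≠ ⊥ := fun h => by
    have : S.deficiencySpace Complex.I = ⊥ := le_bot_iff.1 (h ▸ hD ▸ le_sup_left)
    rw [this, finrank_bot] at f1
    exact zero_ne_one f1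
  refine ⟨fun T hT => ?_, fun v g h => ?_⟩
  · obtain ⟨x, y, hxy, h0, hs, rfl⟩ := LinearRelation.exists_restriction_eq hdef.adjoint_le
      hdef.adjoint_adjoint_le hd hne hT.1 hT.2
    -- The rotated pair (y, -x) lies in T_max as well, which provides the balanced representative g
    -- of y; its right-hand side k represents -x, whence v = -k.
    obtain ⟨⟨g, k⟩, hgk, he⟩ := LinearRelation.deficiency_le (LinearRelation.rotate_mem hxy)
    have hg : SeparationQuotient.mk g = y := congrArg Prod.fst he
    have hk : SeparationQuotient.mk k = -x := congrArg Prod.snd he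
    have hv : SeparationQuotient.mk (-k) = x := by
      rw [SeparationQuotient.mk_neg, hk, neg_neg]
    have hgk' : (g, - -k) ∈ S.maxPairs := by rwa [neg_neg]
    subst hg hv
    refine ⟨-k, g, ⟨hxy, h0, ?_, hgk'⟩, hR _ _ hgk'⟩
    rw [inner_neg_right]
    exact add_neg_eq_zero.2 hs
  · obtain ⟨h1, h2, h3, h4⟩ := h
    rw [inner_neg_right, add_neg_eq_zero] at h3
    exact ⟨LinearRelation.restriction S.Tmax (SeparationQuotient.mk v) (SeparationQuotient.mk g),
      ⟨fun _ hx => hx.1, LinearRelation.adjoint_restriction hdef.adjoint_le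
        hdef.adjoint_adjoint_le hd h1 h2 h3⟩, hR v g h4⟩

lemma Definite.adjoint_eq (hdef : S.Definite) (hp : S.nPlus = 0) (hm : S.nMinus = 0) :
    S.Tmax.adjoint = S.Tmax := by
  refine LinearRelation.adjoint_eq_of_deficiency_eq_bot hdef.adjoint_le hdef.adjoint_adjoint_le ?_
  have h1 : S.deficiencySpace Complex.I = ⊥ := Submodule.rank_eq_zero.1 hp
  have h2 : S.deficiencySpace (-Complex.I) = ⊥ := Submodule.rank_eq_zero.1 hm
  change S.deficiencySpace Complex.I ⊔ S.deficiencySpace (-Complex.I) = ⊥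
  rw [h1, h2, bot_sup_eq]

end FirstOrderSystem

end

/-! ### The classification of the endpoints and the self-adjoint restrictions -/

theorem theoremT (S : FirstOrderSystem 2) (hreal : S.IsReal) (hdef : S.Definite) :
    -- at each endpoint we have the limit-point case or the limit-circle case
    ((S.LimitPointAtA ∨ S.LimitCircleAtA) ∧ (S.LimitPointAtB ∨ S.LimitCircleAtB)) ∧
    -- (1)
    ((S.nPlus = 0 ∧ S.nMinus = 0) ↔ (S.LimitPointAtA ∧ S.LimitPointAtB)) ∧
    (S.LimitPointAtA ∧ S.LimitPointAtB → S.Tmax.adjoint = S.Tmax) ∧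
    -- (2)
    ((S.nPlus = 1 ∧ S.nMinus = 1) ↔
      ((S.LimitCircleAtA ∧ S.LimitPointAtB) ∨ (S.LimitPointAtA ∧ S.LimitCircleAtB))) ∧
    (S.LimitCircleAtA ∧ S.LimitPointAtB →
      (∀ T : Submodule ℂ (S.L2 × S.L2), S.IsSelfAdjointRestriction T →
        ∃ v g : S.PreL2, S.IsBoundaryElement v g ∧
          (T : Set (S.L2 × S.L2)) = S.restrictionAtA g) ∧
      (∀ v g : S.PreL2, S.IsBoundaryElement v g →
        ∃ T : Submodule ℂ (S.L2 × S.L2), S.IsSelfAdjointRestriction T ∧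
          (T : Set (S.L2 × S.L2)) = S.restrictionAtA g)) ∧
    (S.LimitPointAtA ∧ S.LimitCircleAtB →
      (∀ T : Submodule ℂ (S.L2 × S.L2), S.IsSelfAdjointRestriction T →
        ∃ v g : S.PreL2, S.IsBoundaryElement v g ∧
          (T : Set (S.L2 × S.L2)) = S.restrictionAtB g) ∧
      (∀ v g : S.PreL2, S.IsBoundaryElement v g →
        ∃ T : Submodule ℂ (S.L2 × S.L2), S.IsSelfAdjointRestriction T ∧
          (T : Set (S.L2 × S.L2)) = S.restrictionAtB g)) ∧
    -- (3)
    ((S.nPlus = 2 ∧ S.nMinus = 2) ↔ (S.LimitCircleAtA ∧ S.LimitCircleAtB)) := by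
  obtain ⟨i0, i1, i2⟩ := hreal.indices hdef
  refine ⟨⟨hreal.limitPoint_or_limitCircleAtA, hreal.limitPoint_or_limitCircleAtB⟩, i0, fun h => ?_,
    i1, fun h => ?_, fun h => ?_, i2⟩
  · exact hdef.adjoint_eq (i0.2 h).1 (i0.2 h).2
  · obtain ⟨hp, hm⟩ := i1.2 (Or.inl h)
    exact hdef.selfAdjoint_restrictions hp hm fun v g hg =>
      hreal.restriction_eq_restrictionAtA hdef h.2 hg
  · obtain ⟨hp, hm⟩ := i1.2 (Or.inr h)
    exact hdef.selfAdjoint_restrictions hp hm fun v g hg =>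
      hreal.restriction_eq_restrictionAtB hdef h.1 hg
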